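/- Let $r\ge 0$ be an integer, $F_r$ the free group of rank $r$, $\det\colon Out(F_r)\to GL(r,\mathbb Z)\to\{\pm1\}$ the determinant of the induced action on the abelianization, $SOut_r=\ker(\det)$, and let $\tilde{\mathbb R}$ be $\mathbb R$ with $Out(F_r)$ acting through $\det$. All homology is with real coefficients. A marked graph of rank $r$ is a finite connected graph $X$ with all vertices of valence at least $3$, together with a homotopy equivalence between the rose $R_r$ and $X$, up to homotopy and graph isomorphism. Let $\mathcal{CX}_r$ be the simplicial closure of Outer space: there is one closed simplex for each marked graph $X$, with vertex set the edge set $E(X)$, and for every forest $\Phi\subset X$ the closed simplex of $X/\Phi$ is identified with the face of the closed simplex of $X$ spanned by the edges not in $\Phi$. Let $A_r\subset\mathcal{CX}_r$ be the subcomplex of the faces $S\subset E(X)$ for which $E(X)\setminus S$ contains a cycle. The group $Out(F_r)$ acts on $(\mathcal{CX}_r,A_r)$ by changing the marking. Let $H_*^{Out(F_r)}(\mathcal{CX}_r,A_r;\tilde{\mathbb R})$ denote equivariant homology, i.e. the homology of the Borel construction with coefficients $\tilde{\mathbb R}$. Let $P\overline X{}^{(r)}$ be the commutative graph complex of rank $r$: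 its degree $k$ part is spanned by the connected oriented graphs with $k$ vertices, all of valence at least $3$, and Euler characteristic $1-r$ (an orientation is an ordering of the vertices together with a direction of every edge, up to an even number of transpositions of vertices and reversals of edges), modulo isomorphism and $(X,-or)=-(X,or)$. The boundary is $\partial_E X=\sum_e X_e$, where $X_e=0$ if $e$ is a loop, and otherwise $X_e$ is $X$ with $e$ collapsed; if $e$ goes from the first to the second vertex, then in $X_e$ the merged vertex comes first and the other vertices keep their order. Then: (1) There is a long exact sequence $$\cdots\to H_p^{Out(F_r)}(\mathcal{CX}_r,A_r;\tilde{\mathbb R})\to H_p(\mathcal{CX}_r/SOut_r,A_r/SOut_r)\to H_p(\mathcal{CX}_r/Out(F_r),A_r/Out(F_r))\to H_{p-1}^{Out(F_r)}(\mathcal{CX}_r,A_r;\tilde{\mathbb R})\to\cdots$$ ending in $\to H_0(\mathcal{CX}_r/Out(F_r),A_r/Out(F_r))\to 0$, in which the second map is induced by the projection $\mathcal{CX}_r/SOut_r\to\mathcal{CX}_r/Out(F_r)$. (2) For every $p\ge 0$ there is an isomorphism $H_p^{Out(F_r)}(\mathcal{CX}_r,A_r;\tilde{\mathbb R})\cong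 H_{p+2-r}(P\overline X{}^{(r)})$ (the right side being $0$ if $p+2-r<0$); under these isomorphisms the sequence in (1) becomes a long exact sequence $$\cdots\to H_{p+2-r}(P\overline X{}^{(r)})\to H_p(\mathcal{CX}_r/SOut_r,A_r/SOut_r)\to H_p(\mathcal{CX}_r/Out(F_r),A_r/Out(F_r))\to H_{p+1-r}(P\overline X{}^{(r)})\to\cdots .$$ -/

import Mathlib

noncomputable section

open CategoryTheory

namespace OuterSpace

/-! ### The commutative graph complex -/

/-- An oriented graph with `k` vertices: the vertices are ordered (they are `0, …, k - 1`) and every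
edge is directed; the edges form a multiset of ordered pairs (tail, head), so that loops and
multiple edges are allowed. -/
abbrev OGraph (k : ℕ) : Type := Multiset (Fin k × Fin k)

namespace OGraph

/-- Renaming (and possibly identifying) vertices. -/
def relabel {k l : ℕ} (f : Fin k → Fin l) (s : OGraph k) : OGraph l := Multiset.map (Prod.map f f) s

/-- The graph is nonempty and connected. -/
def Connected {k : ℕ} (s : OGraph k) : Prop :=
  0 < k ∧ ∀ u v : Fin k, Relation.EqvGen (fun i j => (i, j) ∈ s) u v

/-- The number of half-edges at `v` (a loop counts twice). -/
def valence {k : ℕ} (s : OGraph k) (v : Fin k) : ℕ :=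
  s.countP (fun e => e.1 = v) + s.countP (fun e => e.2 = v)

/-- The generators of the rank `r` part of the reduced primitive graph complex: connected graphs all
of whose vertices have valence at least three, with Euler characteristic `1 - r`. -/
structure Admissible (r : ℕ) {k : ℕ} (s : OGraph k) : Prop where
  connected : s.Connected
  three_le_valence : ∀ v, 3 ≤ s.valence v
  euler : (k : ℤ) - (Multiset.card s : ℤ) = 1 - (r : ℤ)

/-- The orientation relations `(X, -or) = -(X, or)`: permuting the vertex ordering (and renaming
the vertices accordingly) multiplies by the sign of the permutation, reversing an edge multiplies
by `-1`. -/
inductive IsRelator {k : ℕ} : (OGraph k →₀ ℝ) → Prop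
  | perm (s : OGraph k) (σ : Equiv.Perm (Fin k)) :
      IsRelator (Finsupp.single (s.relabel σ) 1 - ((Equiv.Perm.sign σ : ℤ) : ℝ) • Finsupp.single s 1)
  | flip (s : OGraph k) (i j : Fin k) :
      IsRelator (Finsupp.single ((j, i) ::ₘ s) 1 + Finsupp.single ((i, j) ::ₘ s) 1)

/-- Oriented graphs with `k` vertices modulo isomorphism and the orientation relations. -/
abbrev Chain (k : ℕ) : Type :=
  (OGraph k →₀ ℝ) ⧸ Submodule.span ℝ {x : OGraph k →₀ ℝ | IsRelator x}

/-- The class of an oriented graph. -/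
def cls {k : ℕ} (s : OGraph k) : Chain k := Submodule.Quotient.mk (Finsupp.single s 1)

theorem cls_perm {k : ℕ} (s : OGraph k) (σ : Equiv.Perm (Fin k)) :
    cls (s.relabel σ) = ((Equiv.Perm.sign σ : ℤ) : ℝ) • cls s := by
  unfold cls
  rw [← Submodule.Quotient.mk_smul, Submodule.Quotient.eq]
  exact Submodule.subset_span (IsRelator.perm s σ)

theorem cls_flip {k : ℕ} (s : OGraph k) (i j : Fin k) :
    cls ((j, i) ::ₘ s) = - cls ((i, j) ::ₘ s) := by
  unfold cls
  rw [← Submodule.Quotient.mk_neg, Submodule.Quotient.eq, sub_neg_eq_add]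
  exact Submodule.subset_span (IsRelator.flip s i j)

/-- The effect on vertices of collapsing an edge from `i` to `j`: the vertex `j` is identified with
`i`, and the vertices other than `j` are renumbered by `0, …, k - 1` in their old order. -/
def contract {k : ℕ} (i j : Fin (k + 1)) (h : i ≠ j) (v : Fin (k + 1)) : Fin k :=
  if hv : v = j then (finSuccAboveEquiv j).symm ⟨i, h⟩ else (finSuccAboveEquiv j).symm ⟨v, hv⟩

theorem succAbove_contract {k : ℕ} (i j : Fin (k + 1)) (h : i ≠ j) (v : Fin (k + 1)) :
    j.succAbove (contract i j h v) = if v = j then i else v := by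
  have key : ∀ x : {x : Fin (k + 1) // x ≠ j},
      j.succAbove ((finSuccAboveEquiv j).symm x) = x := fun x => by
    exact congrArg Subtype.val ((finSuccAboveEquiv j).apply_symm_apply x)
  unfold contract
  split_ifs <;> exact key _

theorem val_succAbove {n : ℕ} (p : Fin (n + 1)) (x : Fin n) :
    (p.succAbove x : ℕ) = if (x : ℕ) < p then (x : ℕ) else x + 1 := by
  unfold Fin.succAbove
  simp only [Fin.lt_def, Fin.val_castSucc]
  split_ifs <;> simp

/-- The result of collapsing an edge `e`, where `s` is the multiset of the other edges. It is zero
for a loop. If `e` goes from the first vertex `0` to the second vertex `1`, then the merged vertex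
comes first, the others keep their order, and the sign is `+1`; in general, moving the tail and the
head of `e` to the first two places, collapsing, and moving the merged vertex back to the place of
the tail produces the sign `(-1) ^ (head + 1)` (compare `collapse_perm`). -/
def collapse {k : ℕ} (s : OGraph (k + 1)) (e : Fin (k + 1) × Fin (k + 1)) : Chain k :=
  if h : e.1 ≠ e.2 then
    (-1 : ℝ) ^ ((e.2 : ℕ) + 1) • cls (s.relabel (contract e.1 e.2 h))
  else 0

/-- The sum over all edges `e` of the graph with `e` collapsed. -/
def boundaryTerm {k : ℕ} (s : OGraph (k + 1)) : Chain k :=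
  (Multiset.map (fun e => collapse (s.erase e) e) s).sum

theorem exists_perm_contract {k : ℕ} (σ : Equiv.Perm (Fin (k + 1))) (i j : Fin (k + 1))
    (h : i ≠ j) (h' : σ i ≠ σ j) : ∃ σ' : Equiv.Perm (Fin k),
      (∀ v, contract (σ i) (σ j) h' (σ v) = σ' (contract i j h v)) ∧
      ((Equiv.Perm.sign σ' : ℤ) : ℝ) * (-1) ^ (σ j : ℕ) =
        ((Equiv.Perm.sign σ : ℤ) : ℝ) * (-1) ^ (j : ℕ) := by
  have hex : ∀ x : Fin k, σ (j.succAbove x) ≠ σ j := fun x hx =>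
    Fin.succAbove_ne j x (σ.injective hx)
  let τ : Equiv.Perm (Fin (k + 1)) := j.cycleRange.symm.trans (σ.trans (σ j).cycleRange)
  obtain ⟨⟨q, σ'⟩, hq⟩ : ∃ q, Equiv.Perm.decomposeFin.symm q = τ :=
    ⟨_, Equiv.symm_apply_apply _ _⟩
  have hτ0 : τ 0 = 0 := by simp [τ]
  have hq0 : q = 0 := by
    rw [← hq] at hτ0; simpa using hτ0
  subst hq0
  have hσ' : ∀ x, σ (j.succAbove x) = (σ j).succAbove (σ' x) := by
    intro x
    have h1 : τ x.succ = (σ' x).succ := by rw [← hq]; simp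
    have h2 : (σ j).cycleRange (σ (j.succAbove x)) = (σ' x).succ := by
      rw [← h1]; simp [τ]
    rw [← Fin.cycleRange_symm_succ (σ j), ← h2, Equiv.symm_apply_apply]
  refine ⟨σ', fun v => ?_, ?_⟩
  · apply Fin.succAbove_right_injective (p := σ j)
    rw [succAbove_contract, ← hσ', succAbove_contract]
    by_cases hv : v = j
    · simp [hv]
    · simp [hv, σ.injective.eq_iff]
  · have hs : Equiv.Perm.sign σ' = Equiv.Perm.sign τ := by
      rw [← hq]; simp
    have hs2 : Equiv.Perm.sign τ = (-1) ^ (σ j : ℕ) * Equiv.Perm.sign σ * (-1) ^ (j : ℕ) := by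
      simp only [τ]
      rw [Equiv.Perm.sign_trans, Equiv.Perm.sign_trans, Equiv.Perm.sign_symm,
        Fin.sign_cycleRange, Fin.sign_cycleRange]
    rw [hs, hs2]
    push_cast
    have : ((-1 : ℝ) ^ (σ j : ℕ)) * (-1) ^ (σ j : ℕ) = 1 := by
      rw [← mul_pow]; simp
    linear_combination ((Equiv.Perm.sign σ : ℤ) : ℝ) * (-1) ^ (j : ℕ) * this

theorem relabel_relabel {k l m : ℕ} (f : Fin k → Fin l) (g : Fin l → Fin m) (s : OGraph k) :
    (s.relabel f).relabel g = s.relabel (g ∘ f) := by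
  simp [OGraph.relabel, Multiset.map_map, Prod.map]

theorem collapse_perm {k : ℕ} (s : OGraph (k + 1)) (σ : Equiv.Perm (Fin (k + 1)))
    (e : Fin (k + 1) × Fin (k + 1)) :
    collapse (s.relabel σ) (Prod.map σ σ e) = ((Equiv.Perm.sign σ : ℤ) : ℝ) • collapse s e := by
  obtain ⟨i, j⟩ := e
  by_cases h : i = j
  · simp [collapse, h]
  · have h' : σ i ≠ σ j := fun hh => h (σ.injective hh)
    obtain ⟨σ', h1, h2⟩ := exists_perm_contract σ i j h h'
    have : (s.relabel σ).relabel (contract (σ i) (σ j) h') = (s.relabel (contract i j h)).relabel σ' := by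
      rw [relabel_relabel, relabel_relabel]; congr 1; funext v; exact h1 v
    simp only [collapse, Prod.map, ne_eq, h, h', not_false_eq_true, dite_true]
    rw [this, cls_perm, smul_smul, smul_smul]
    congr 1
    linear_combination -h2

theorem contract_comm {k : ℕ} (i j : Fin (k + 1)) (h : i ≠ j) : ∃ σ' : Equiv.Perm (Fin k),
      (∀ v, contract j i h.symm v = σ' (contract i j h v)) ∧
      ((Equiv.Perm.sign σ' : ℤ) : ℝ) * (-1) ^ (i : ℕ) = - (-1) ^ (j : ℕ) := by
  have h' : Equiv.swap i j i ≠ Equiv.swap i j j := by simpa using h.symm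
  obtain ⟨σ', h1, h2⟩ := exists_perm_contract (Equiv.swap i j) i j h h'
  refine ⟨σ', fun v => ?_, ?_⟩
  · rw [← h1]
    apply Fin.succAbove_right_injective (p := i)
    have e1 := succAbove_contract j i h.symm v
    have e2 := succAbove_contract (Equiv.swap i j i) (Equiv.swap i j j) h' (Equiv.swap i j v)
    simp only [Equiv.swap_apply_left, Equiv.swap_apply_right] at e2 ⊢
    rw [e1, e2]
    by_cases hi : v = i
    · subst hi; simp [h.symm]
    · by_cases hj : v = j
      · subst hj; simp [hi]
      · rw [Equiv.swap_apply_of_ne_of_ne hi hj]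
  · simpa [Equiv.Perm.sign_swap h] using h2

theorem collapse_swap {k : ℕ} (s : OGraph (k + 1)) (i j : Fin (k + 1)) :
    collapse s (j, i) = - collapse s (i, j) := by
  by_cases h : i = j
  · subst h; simp [collapse]
  · obtain ⟨σ', h1, h2⟩ := contract_comm i j h
    have : s.relabel (contract j i (Ne.symm h)) = (s.relabel (contract i j h)).relabel σ' := by
      rw [relabel_relabel]; congr 1; funext v; exact h1 v
    simp only [collapse, ne_eq, h, Ne.symm h, not_false_eq_true, dite_true]
    rw [this, cls_perm, smul_smul, ← neg_smul]
    congr 1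
    linear_combination -h2

theorem collapse_cons_flip {k : ℕ} (s : OGraph (k + 1)) (i j : Fin (k + 1))
    (e : Fin (k + 1) × Fin (k + 1)) :
    collapse ((j, i) ::ₘ s) e = - collapse ((i, j) ::ₘ s) e := by
  unfold collapse
  split_ifs with h
  · rw [OGraph.relabel, Multiset.map_cons, Prod.map_apply, cls_flip, smul_neg, OGraph.relabel,
      Multiset.map_cons, Prod.map_apply]
  · simp

theorem erase_cons_of_mem {α : Type} [DecidableEq α] (a b : α) (s : Multiset α) (h : b ∈ s) :
    (a ::ₘ s).erase b = a ::ₘ s.erase b := by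
  by_cases hab : b = a
  · subst hab; rw [Multiset.erase_cons_head, Multiset.cons_erase h]
  · exact Multiset.erase_cons_tail _ (by simpa using Ne.symm hab)

theorem boundaryTerm_cons {k : ℕ} (a : Fin (k + 1) × Fin (k + 1)) (s : OGraph (k + 1)) :
    boundaryTerm (a ::ₘ s) =
      collapse s a + (Multiset.map (fun e => collapse (a ::ₘ s.erase e) e) s).sum := by
  unfold boundaryTerm
  rw [Multiset.map_cons, Multiset.sum_cons, Multiset.erase_cons_head]
  congr 2
  exact Multiset.map_congr rfl fun e he => by rw [erase_cons_of_mem a e s he]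

theorem boundaryTerm_perm {k : ℕ} (s : OGraph (k + 1)) (σ : Equiv.Perm (Fin (k + 1))) :
    boundaryTerm (s.relabel σ) = ((Equiv.Perm.sign σ : ℤ) : ℝ) • boundaryTerm s := by
  have hinj : Function.Injective (Prod.map σ σ) := σ.injective.prodMap σ.injective
  have key : ∀ e : Fin (k + 1) × Fin (k + 1),
      collapse ((s.relabel σ).erase (Prod.map σ σ e)) (Prod.map σ σ e) =
        ((Equiv.Perm.sign σ : ℤ) : ℝ) • collapse (s.erase e) e := fun e => by
    rw [← collapse_perm]
    unfold OGraph.relabel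
    rw [Multiset.map_erase _ hinj]
  unfold boundaryTerm
  conv_lhs => rw [OGraph.relabel, Multiset.map_map]
  rw [Multiset.smul_sum, Multiset.map_map]
  congr 1
  exact Multiset.map_congr rfl fun e _ => key e

theorem boundaryTerm_flip {k : ℕ} (s : OGraph (k + 1)) (i j : Fin (k + 1)) :
    boundaryTerm ((j, i) ::ₘ s) = - boundaryTerm ((i, j) ::ₘ s) := by
  rw [boundaryTerm_cons, boundaryTerm_cons, collapse_swap, neg_add]
  congr 1
  rw [← Multiset.sum_map_neg', Multiset.map_map]
  exact congrArg _ (Multiset.map_congr rfl fun e _ => collapse_cons_flip (s.erase e) i j e)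

/-- The boundary operator `∂_E`. -/
def boundary (k : ℕ) : Chain (k + 1) →ₗ[ℝ] Chain k :=
  Submodule.liftQ _ (Finsupp.lift (Chain k) ℝ (OGraph (k + 1)) boundaryTerm) (by
    rw [Submodule.span_le]
    rintro x (⟨s, σ⟩ | ⟨s, i, j⟩)
    · rw [SetLike.mem_coe, LinearMap.mem_ker, map_sub, map_smul]
      simp [boundaryTerm_perm]
    · rw [SetLike.mem_coe, LinearMap.mem_ker, map_add]
      simp [boundaryTerm_flip s i j])

theorem boundary_cls {k : ℕ} (s : OGraph (k + 1)) : boundary k (cls s) = boundaryTerm s := by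
  simp [boundary, cls]

theorem sum_pairs_symm {α M : Type} [DecidableEq α] [AddCommGroup M] (s : Multiset α) :
    ∀ g : α → α → Multiset α → M,
    (s.map fun e => ((s.erase e).map fun f => g e f ((s.erase e).erase f)).sum).sum =
    (s.map fun e => ((s.erase e).map fun f => g f e ((s.erase e).erase f)).sum).sum := by
  induction s using Multiset.induction_on with
  | empty => intro g; simp
  | cons a t ih =>
    have key : ∀ g : α → α → Multiset α → M,
        ((a ::ₘ t).map fun e => (((a ::ₘ t).erase e).map fun f =>
          g e f (((a ::ₘ t).erase e).erase f)).sum).sum =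
        (t.map fun f => g a f (t.erase f)).sum + (t.map fun e => g e a (t.erase e)).sum +
        (t.map fun e => ((t.erase e).map fun f => g e f (a ::ₘ (t.erase e).erase f)).sum).sum := by
      intro g
      rw [Multiset.map_cons, Multiset.sum_cons, Multiset.erase_cons_head, add_assoc]
      rw [← Multiset.sum_map_add (f := fun e => g e a (t.erase e))]
      refine congrArg₂ _ rfl (congrArg _ ?_)
      refine Multiset.map_congr rfl fun e he => ?_
      rw [erase_cons_of_mem a e t he, Multiset.map_cons, Multiset.sum_cons,
        Multiset.erase_cons_head]
      congr 2
      exact Multiset.map_congr rfl fun f hf => by rw [erase_cons_of_mem a f _ hf]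
    intro g
    rw [key g, key fun e f => g f e]
    rw [ih fun e f u => g e f (a ::ₘ u)]
    abel

/-- Collapsing first `e` and then `f`, where `s` is the multiset of the other edges. -/
def collapse₂ {k : ℕ} (s : OGraph (k + 2)) (e f : Fin (k + 2) × Fin (k + 2)) : Chain k :=
  if h : e.1 ≠ e.2 then
    (-1 : ℝ) ^ ((e.2 : ℕ) + 1) •
      collapse (s.relabel (contract e.1 e.2 h)) (Prod.map (contract e.1 e.2 h) (contract e.1 e.2 h) f)
  else 0

theorem collapse₂_swap_right {k : ℕ} (s : OGraph (k + 2)) (e : Fin (k + 2) × Fin (k + 2))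
    (i j : Fin (k + 2)) : collapse₂ s e (j, i) = - collapse₂ s e (i, j) := by
  unfold collapse₂
  split_ifs with h
  · rw [Prod.map_apply, collapse_swap, smul_neg, Prod.map_apply]
  · simp

theorem collapse₂_swap_left {k : ℕ} (s : OGraph (k + 2)) (e : Fin (k + 2) × Fin (k + 2))
    (i j : Fin (k + 2)) : collapse₂ s (j, i) e = - collapse₂ s (i, j) e := by
  by_cases h : i = j
  · subst h; simp [collapse₂]
  · obtain ⟨σ', h1, h2⟩ := contract_comm i j h
    have hs : s.relabel (contract j i (Ne.symm h)) = (s.relabel (contract i j h)).relabel σ' := by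
      rw [relabel_relabel]; congr 1; funext v; exact h1 v
    have he : Prod.map (contract j i (Ne.symm h)) (contract j i (Ne.symm h)) e =
        Prod.map σ' σ' (Prod.map (contract i j h) (contract i j h) e) := by
      simp [Prod.map, h1]
    simp only [collapse₂, ne_eq, h, Ne.symm h, not_false_eq_true, dite_true]
    rw [hs, he, collapse_perm, smul_smul, ← neg_smul]
    congr 1
    linear_combination -h2

theorem collapse₂_anti_of_ne {k : ℕ} (s : OGraph (k + 2)) (a b c d : Fin (k + 2)) (hbd : b ≠ d) :
    collapse₂ s (a, b) (c, d) = - collapse₂ s (c, d) (a, b) := by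
  by_cases hab : a = b
  · subst hab; simp [collapse₂, collapse]
  by_cases hcd : c = d
  · subst hcd; simp [collapse₂, collapse]
  have hd := succAbove_contract a b hab d
  have hc := succAbove_contract a b hab c
  have hb := succAbove_contract c d hcd b
  have ha := succAbove_contract c d hcd a
  rw [if_neg (Ne.symm hbd)] at hd
  rw [if_neg hbd] at hb
  have hinjb := Fin.succAbove_right_injective (p := b)
  have hinjd := Fin.succAbove_right_injective (p := d)
  by_cases hpar : c = b ∧ d = a
  · obtain ⟨rfl, rfl⟩ := hpar
    have h1 : contract d c hab c = contract d c hab d := by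
      apply hinjb; rw [hc, hd]; simp
    have h2 : contract c d hcd d = contract c d hcd c := by
      apply hinjd; rw [ha, hb]; simp
    simp [collapse₂, collapse, h1, h2]
  have n1 : contract a b hab c ≠ contract a b hab d := by
    intro h; apply_fun b.succAbove at h; rw [hc, hd] at h
    split_ifs at h with h'
    · exact hpar ⟨h', h.symm⟩
    · exact hcd h
  have n2 : contract c d hcd a ≠ contract c d hcd b := by
    intro h; apply_fun d.succAbove at h; rw [ha, hb] at h
    split_ifs at h with h'
    · exact hpar ⟨h, h'.symm⟩
    · exact hab h
  set b' := contract c d hcd b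
  set d' := contract a b hab d
  have hcases : ((d' : ℕ) + 1 = d ∧ (b' : ℕ) = b ∧ (b : ℕ) < d) ∨
      ((d' : ℕ) = d ∧ (b' : ℕ) + 1 = b ∧ (d : ℕ) < b) := by
    have e1 := val_succAbove b d'
    have e2 := val_succAbove d b'
    rw [hd] at e1
    rw [hb] at e2
    have e3 : (b : ℕ) ≠ d := fun h => hbd (Fin.ext h)
    split_ifs at e1 e2 <;> omega
  have hcomm : ∀ x : Fin k, b.succAbove (d'.succAbove x) = d.succAbove (b'.succAbove x) := by
    intro x
    apply Fin.ext
    simp only [val_succAbove]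
    split_ifs <;> omega
  have hmap : ∀ v, contract (contract a b hab c) d' n1 (contract a b hab v) =
      contract (contract c d hcd a) b' n2 (contract c d hcd v) := by
    intro v
    apply Fin.succAbove_right_injective (p := d')
    apply hinjb
    rw [hcomm (contract (contract c d hcd a) b' n2 _), succAbove_contract, succAbove_contract]
    have q1 : contract a b hab v = d' ↔ (if v = b then a else v) = d := by
      rw [← hinjb.eq_iff, succAbove_contract, hd]
    have q2 : contract c d hcd v = b' ↔ (if v = d then c else v) = b := by
      rw [← hinjd.eq_iff, succAbove_contract, hb]
    rw [apply_ite b.succAbove, apply_ite d.succAbove, hc, ha, succAbove_contract,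
      succAbove_contract]
    simp only [q1, q2]
    grind
  have hsign : ((-1 : ℝ) ^ ((b : ℕ) + 1)) * (-1) ^ ((d' : ℕ) + 1) =
      - ((-1) ^ ((d : ℕ) + 1) * (-1) ^ ((b' : ℕ) + 1)) := by
    rcases hcases with ⟨h1, h2, -⟩ | ⟨h1, h2, -⟩
    · rw [← h1, h2]; ring
    · rw [← h2, h1]; ring
  have hs : (s.relabel (contract a b hab)).relabel (contract (contract a b hab c) d' n1) =
      (s.relabel (contract c d hcd)).relabel (contract (contract c d hcd a) b' n2) := by
    rw [relabel_relabel, relabel_relabel]; congr 1; funext v; exact hmap v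
  simp only [collapse₂, collapse, Prod.map, ne_eq, hab, hcd, not_false_eq_true, dite_true, n1, n2,
    d', b']
  rw [hs, smul_smul, smul_smul, hsign, neg_smul]

theorem collapse₂_anti {k : ℕ} (s : OGraph (k + 2)) (e f : Fin (k + 2) × Fin (k + 2)) :
    collapse₂ s e f = - collapse₂ s f e := by
  obtain ⟨a, b⟩ := e
  obtain ⟨c, d⟩ := f
  by_cases hbd : b = d
  · subst hbd
    by_cases hcb : c = b
    · subst hcb; simp [collapse₂, collapse]
    · rw [collapse₂_swap_right, collapse₂_swap_left s (a, b) b c,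
        collapse₂_anti_of_ne s a b b c (Ne.symm hcb)]
  · exact collapse₂_anti_of_ne s a b c d hbd

theorem boundary_collapse {k : ℕ} (s : OGraph (k + 2)) (e : Fin (k + 2) × Fin (k + 2)) :
    boundary k (collapse s e) =
      (Multiset.map (fun f => collapse₂ (s.erase f) e f) s).sum := by
  by_cases h : e.1 = e.2
  · simp [collapse, collapse₂, h]
  · rw [collapse, dif_pos h, map_smul, boundary_cls, boundaryTerm, OGraph.relabel,
      Multiset.map_map, Multiset.smul_sum, Multiset.map_map]
    refine congrArg _ (Multiset.map_congr rfl fun f hf => ?_)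
    rw [collapse₂, dif_pos h, Function.comp_apply, Function.comp_apply, OGraph.relabel,
      Multiset.map_erase_of_mem _ _ hf]

theorem boundary_boundary (k : ℕ) (x : Chain (k + 2)) :
    boundary k (boundary (k + 1) x) = 0 := by
  suffices h : boundary k ∘ₗ boundary (k + 1) = 0 from congrArg (fun f => f x) h
  apply Submodule.linearMap_qext
  apply Finsupp.lhom_ext'
  intro s
  apply LinearMap.ext_ring
  change boundary k (boundary (k + 1) (cls s)) = 0
  have h1 : boundary k (boundary (k + 1) (cls s)) =
      (Multiset.map (fun e => (Multiset.map (fun f =>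
        collapse₂ ((s.erase e).erase f) e f) (s.erase e)).sum) s).sum := by
    rw [boundary_cls, boundaryTerm, map_multiset_sum, Multiset.map_map]
    exact congrArg _ (Multiset.map_congr rfl fun e _ => boundary_collapse _ _)
  have h2 := sum_pairs_symm s (fun e f u => collapse₂ u e f)
  have h3 : (Multiset.map (fun e => (Multiset.map (fun f =>
        collapse₂ ((s.erase e).erase f) f e) (s.erase e)).sum) s).sum =
      - (Multiset.map (fun e => (Multiset.map (fun f =>
        collapse₂ ((s.erase e).erase f) e f) (s.erase e)).sum) s).sum := by
    rw [← Multiset.sum_map_neg', Multiset.map_map]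
    refine congrArg _ (Multiset.map_congr rfl fun e _ => ?_)
    rw [Function.comp_apply, ← Multiset.sum_map_neg', Multiset.map_map]
    exact congrArg _ (Multiset.map_congr rfl fun f _ => collapse₂_anti _ _ _)
  rw [h3] at h2
  rw [h1]
  have h4 := add_eq_zero_iff_eq_neg.mpr h2
  rw [← two_smul ℝ] at h4
  exact (smul_eq_zero.mp h4).resolve_left two_ne_zero

theorem countP_add_le {α : Type} (p q t : α → Prop) [DecidablePred p] [DecidablePred q]
    [DecidablePred t] (hp : ∀ a, p a → t a) (hq : ∀ a, q a → t a) (hpq : ∀ a, p a → ¬ q a)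
    (s : Multiset α) : s.countP p + s.countP q ≤ s.countP t := by
  induction s using Multiset.induction_on with
  | empty => simp
  | cons a s ih =>
    simp only [Multiset.countP_cons]
    have h1 := hp a
    have h2 := hq a
    have h3 := hpq a
    split_ifs <;> first | omega | tauto

theorem relabel_contract_admissible {r k : ℕ} {s : OGraph (k + 1)} (hs : s.Admissible r)
    {e : Fin (k + 1) × Fin (k + 1)} (he : e ∈ s) (h : e.1 ≠ e.2) :
    (relabel (contract e.1 e.2 h) (s.erase e)).Admissible r := by
  obtain ⟨i, j⟩ := e
  simp only at h
  have hcs : ∀ u : Fin k, contract i j h (j.succAbove u) = u := fun u => by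
    apply Fin.succAbove_right_injective (p := j)
    rw [succAbove_contract, if_neg (Fin.succAbove_ne j u)]
  have hij : contract i j h i = contract i j h j := by
    apply Fin.succAbove_right_injective (p := j)
    simp [succAbove_contract]
  have hse : s = (i, j) ::ₘ s.erase (i, j) := (Multiset.cons_erase he).symm
  refine ⟨⟨?_, ?_⟩, ?_, ?_⟩
  · have := (contract i j h i).pos
    exact this
  · have key : ∀ a b : Fin (k + 1), Relation.EqvGen (fun x y => (x, y) ∈ s) a b →
        Relation.EqvGen (fun x y => (x, y) ∈ relabel (contract i j h) (s.erase (i, j)))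
          (contract i j h a) (contract i j h b) := by
      intro a b hab
      induction hab with
      | rel x y hxy =>
        rw [hse, Multiset.mem_cons] at hxy
        rcases hxy with hxy | hxy
        · obtain ⟨rfl, rfl⟩ := Prod.mk.inj hxy
          rw [hij]
          exact Relation.EqvGen.refl _
        · exact Relation.EqvGen.rel _ _ (Multiset.mem_map.mpr ⟨(x, y), hxy, rfl⟩)
      | refl x => exact Relation.EqvGen.refl _
      | symm x y _ ih => exact Relation.EqvGen.symm _ _ ih
      | trans x y z _ _ ih1 ih2 => exact Relation.EqvGen.trans _ _ _ ih1 ih2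
    intro u v
    rw [← hcs u, ← hcs v]
    exact key _ _ (hs.connected.2 _ _)
  · intro u
    have hval : ∀ v, s.valence v = (s.erase (i, j)).countP (fun e => e.1 = v) +
        (s.erase (i, j)).countP (fun e => e.2 = v) +
        ((if i = v then 1 else 0) + (if j = v then 1 else 0)) := by
      intro v
      conv_lhs => rw [hse]
      unfold valence
      rw [Multiset.countP_cons, Multiset.countP_cons]
      ring
    have hv : (relabel (contract i j h) (s.erase (i, j))).valence u =
        (s.erase (i, j)).countP (fun e => contract i j h e.1 = u) +
        (s.erase (i, j)).countP (fun e => contract i j h e.2 = u) := by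
      simp [valence, relabel, Multiset.countP_eq_card_filter, Multiset.filter_map]
    rw [hv]
    by_cases hu : j.succAbove u = i
    · have hci : contract i j h i = u := (congrArg _ hu).symm.trans (hcs u)
      have hcj : contract i j h j = u := by rw [← hij, hci]
      have aux : ∀ g : Fin (k + 1) × Fin (k + 1) → Fin (k + 1),
          (s.erase (i, j)).countP (fun e => g e = i) + (s.erase (i, j)).countP (fun e => g e = j) ≤
          (s.erase (i, j)).countP (fun e => contract i j h (g e) = u) := by
        intro g
        exact countP_add_le _ _ _ (fun e he => by rw [he, hci]) (fun e he => by rw [he, hcj])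
          (fun e h1 h2 => h (h1.symm.trans h2)) _
      have h1 := aux Prod.fst
      have h2 := aux Prod.snd
      have h3 := hs.three_le_valence i
      have h4 := hs.three_le_valence j
      rw [hval] at h3 h4
      simp only [h, h.symm, if_true, if_false] at h3 h4
      omega
    · have hj : j.succAbove u ≠ j := Fin.succAbove_ne j u
      have aux : ∀ g : Fin (k + 1) × Fin (k + 1) → Fin (k + 1),
          (s.erase (i, j)).countP (fun e => g e = j.succAbove u) ≤
          (s.erase (i, j)).countP (fun e => contract i j h (g e) = u) := by
        intro g
        rw [Multiset.countP_eq_card_filter, Multiset.countP_eq_card_filter]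
        refine Multiset.card_le_card (Multiset.monotone_filter_right _ fun e he => ?_)
        rw [he, hcs]
      have h1 := aux Prod.fst
      have h2 := aux Prod.snd
      have h3 := hs.three_le_valence (j.succAbove u)
      rw [hval] at h3
      simp only [Ne.symm hu, Ne.symm hj, if_false] at h3
      omega
  · have h1 := hs.euler
    have h2 : Multiset.card s = Multiset.card (s.erase (i, j)) + 1 := by
      conv_lhs => rw [hse]
      simp
    rw [h2] at h1
    simp only [relabel, Multiset.card_map]
    push_cast at h1 ⊢
    linarith

/-- The span of the connected graphs of rank `r` without vertices of valence less than three. -/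
def reduced (r k : ℕ) : Submodule ℝ (Chain k) :=
  Submodule.span ℝ {x | ∃ s : OGraph k, s.Admissible r ∧ x = cls s}

theorem boundary_mem_reduced (r k : ℕ) (x : Chain (k + 1)) (hx : x ∈ reduced r (k + 1)) :
    boundary k x ∈ reduced r k := by
  induction hx using Submodule.span_induction with
  | mem x hx =>
    obtain ⟨s, hs, rfl⟩ := hx
    rw [boundary_cls]
    refine Multiset.sum_induction (· ∈ reduced r k) _ (fun _ _ => add_mem) (zero_mem _) ?_
    intro y hy
    obtain ⟨e, he, rfl⟩ := Multiset.mem_map.mp hy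
    unfold collapse
    split_ifs with h
    · exact Submodule.smul_mem _ _ (Submodule.subset_span
        ⟨_, relabel_contract_admissible hs he h, rfl⟩)
    · exact zero_mem _
  | zero => simp
  | add x y _ _ hx hy => rw [map_add]; exact add_mem hx hy
  | smul a x _ hx => rw [map_smul]; exact Submodule.smul_mem _ _ hx

end OGraph

/-- The rank `r` part of the reduced primitive graph complex of the commutative operad, graded by
the number of vertices. -/
def graphComplex (r : ℕ) : ChainComplex (ModuleCat ℝ) ℕ :=
  ChainComplex.of (fun k => ModuleCat.of ℝ (OGraph.reduced r k))
    (fun k => ModuleCat.ofHom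
      ((OGraph.boundary k).restrict (OGraph.boundary_mem_reduced r k)))
    (fun k => by
      ext x
      exact OGraph.boundary_boundary k x.1)

/-! ### The groups `Out(F_r)` and `SOut_r` -/

/-- The inner automorphisms of the free group of rank `r`. -/
abbrev Inn (r : ℕ) : Subgroup (MulAut (FreeGroup (Fin r))) :=
  (MulAut.conj : FreeGroup (Fin r) →* MulAut (FreeGroup (Fin r))).range

instance (r : ℕ) : (Inn r).Normal where
  conj_mem := by
    rintro _ ⟨c, rfl⟩ α
    refine ⟨α c, ?_⟩
    ext x
    simp

/-- `Out(F_r)`. -/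
abbrev Out (r : ℕ) : Type := MulAut (FreeGroup (Fin r)) ⧸ Inn r

/-- The determinant of the automorphism of the abelianization `ℤ^r` induced by an automorphism. -/
def autDet (r : ℕ) : MulAut (FreeGroup (Fin r)) →* ℤˣ where
  toFun α := LinearEquiv.det
    (MulEquiv.toAdditive (MulEquiv.abelianizationCongr α)).toIntLinearEquiv
  map_one' := by
    rw [← map_one (LinearEquiv.det (R := ℤ) (M := Additive (Abelianization (FreeGroup (Fin r)))))]
    congr 1
    ext x
    obtain ⟨x, rfl⟩ := Additive.ofMul.surjective x
    obtain ⟨x, rfl⟩ := QuotientGroup.mk_surjective x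
    rfl
  map_mul' α β := by
    rw [← map_mul]
    congr 1
    ext x
    obtain ⟨x, rfl⟩ := Additive.ofMul.surjective x
    obtain ⟨x, rfl⟩ := QuotientGroup.mk_surjective x
    rfl

/-- `Out(F_r) → GL(r, ℤ) → {±1}`. -/
def outDet (r : ℕ) : Out r →* ℤˣ :=
  QuotientGroup.lift (Inn r) (autDet r) (by
    rintro _ ⟨c, rfl⟩
    rw [MonoidHom.mem_ker, ← map_one (autDet r)]
    have h : MulEquiv.abelianizationCongr (MulAut.conj c) =
        MulEquiv.abelianizationCongr (1 : MulAut (FreeGroup (Fin r))) := by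
      ext x
      obtain ⟨x, rfl⟩ := QuotientGroup.mk_surjective x
      change Abelianization.of (c * x * c⁻¹) = Abelianization.of x
      rw [map_mul, map_mul, map_inv, mul_comm, inv_mul_cancel_left]
    simp only [autDet, MonoidHom.coe_mk, OneHom.coe_mk, h])

/-- The preimage of `SL(r, ℤ)` in `Out(F_r)`. -/
def SOut (r : ℕ) : Subgroup (Out r) := (outDet r).ker

/-! ### Marked graphs -/

/-- `p` is an edge path from `u` to `v`: the letter `(e, true)` runs along the edge `e` from its tail
to its head, the letter `(e, false)` runs backwards. Such a path is also a word in the edges, and it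
is reduced (without backtracking) if it is reduced as a word. -/
def IsWalk {nV nE : ℕ} (ends : Fin nE → Fin nV × Fin nV) :
    Fin nV → List (Fin nE × Bool) → Fin nV → Prop
  | u, [], v => u = v
  | u, (e, true) :: p, v => (ends e).1 = u ∧ IsWalk ends (ends e).2 p v
  | u, (e, false) :: p, v => (ends e).2 = u ∧ IsWalk ends (ends e).1 p v

/-- A marked graph of rank `r`: a finite connected graph with all vertices at least trivalent,
identified with the rose `R_r` up to homotopy. Edges are directed in order to write down paths and
labels; the directions can be changed by `Collapse`. The marking is recorded by a homotopy
equivalence from the graph to the rose (a homotopy inverse of the map from the rose to the graph):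
vertices go to the vertex of the rose, and `lab e` is the element of `F_r = π₁(R_r)` given by the
image of the edge `e`. Homotopies are accounted for by `Collapse.gauge`. It is a homotopy equivalence
if and only if it induces an isomorphism on fundamental groups, that is, every element of `F_r` is
the label of exactly one reduced closed path at any vertex. -/
structure MarkedGraph (r : ℕ) where
  nV : ℕ
  nE : ℕ
  ends : Fin nE → Fin nV × Fin nV
  lab : Fin nE → FreeGroup (Fin r)
  connected : OGraph.Connected (Finset.univ.val.map ends)
  three_le_valence : ∀ v, 3 ≤ OGraph.valence (Finset.univ.val.map ends) v
  marking : ∀ (v : Fin nV) (w : FreeGroup (Fin r)), ∃! p : List (Fin nE × Bool),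
    FreeGroup.IsReduced p ∧ IsWalk ends v p v ∧ FreeGroup.lift lab (FreeGroup.mk p) = w

namespace MarkedGraph
variable {r : ℕ}

/-- The subgraph with edge set `T` contains a cycle. -/
def HasCycle (Γ : MarkedGraph r) (T : Set (Fin Γ.nE)) : Prop :=
  ∃ (v : Fin Γ.nV) (p : List (Fin Γ.nE × Bool)), p ≠ [] ∧ FreeGroup.IsReduced p ∧
    IsWalk Γ.ends v p v ∧ ∀ d ∈ p, d.1 ∈ T

/-- An identification of the marked graph `Γ'` with the result of collapsing each component of a
forest in `Γ` to a point (an isomorphism of marked graphs if the forest has no edges). The edges of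
`Γ'` are the edges of `Γ` outside of the forest, with direction reversed if `flip` is true. The
marking of `Γ` is the composition of the collapse with the marking of `Γ'`, up to a homotopy which
moves the image of the vertex `v` along the loop `gauge v`. -/
structure Collapse (Γ Γ' : MarkedGraph r) where
  onV : Fin Γ.nV → Fin Γ'.nV
  onE : Fin Γ'.nE ↪ Fin Γ.nE
  flip : Fin Γ'.nE → Bool
  onV_surjective : Function.Surjective onV
  forest : ¬ Γ.HasCycle (Set.range onE)ᶜ
  onV_eq_iff : ∀ u v, onV u = onV v ↔
    Relation.EqvGen (fun x y => ∃ e, e ∉ Set.range onE ∧ Γ.ends e = (x, y)) u v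
  ends_onE : ∀ e, Prod.map onV onV (Γ.ends (onE e)) =
    if flip e then (Γ'.ends e).swap else Γ'.ends e
  gauge : Fin Γ.nV → FreeGroup (Fin r)
  lab_onE : ∀ e, Γ.lab (onE e) = gauge (Γ.ends (onE e)).1 *
    (if flip e then (Γ'.lab e)⁻¹ else Γ'.lab e) * (gauge (Γ.ends (onE e)).2)⁻¹
  lab_collapsed : ∀ e, e ∉ Set.range onE →
    Γ.lab e = gauge (Γ.ends e).1 * (gauge (Γ.ends e).2)⁻¹

/-- Changing the marking by an automorphism of `F_r`. -/
def twist (α : MulAut (FreeGroup (Fin r))) (Γ : MarkedGraph r) : MarkedGraph r where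
  nV := Γ.nV
  nE := Γ.nE
  ends := Γ.ends
  lab e := α (Γ.lab e)
  connected := Γ.connected
  three_le_valence := Γ.three_le_valence
  marking v w := by
    have h : ∀ x, FreeGroup.lift (fun e => α (Γ.lab e)) x = α (FreeGroup.lift Γ.lab x) := by
      intro x
      have : FreeGroup.lift (fun e => α (Γ.lab e)) =
          (α : FreeGroup (Fin r) →* FreeGroup (Fin r)).comp (FreeGroup.lift Γ.lab) := by
        ext; simp
      rw [this]; rfl
    have := Γ.marking v (α.symm w)
    simpa only [h, MulEquiv.eq_symm_apply] using this

/-- Collapses are compatible with a change of the marking. -/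
def Collapse.twist (α : MulAut (FreeGroup (Fin r))) {Γ Γ' : MarkedGraph r} (c : Collapse Γ Γ') :
    Collapse (Γ.twist α) (Γ'.twist α) where
  onV := c.onV
  onE := c.onE
  flip := c.flip
  onV_surjective := c.onV_surjective
  forest := c.forest
  onV_eq_iff := c.onV_eq_iff
  ends_onE := c.ends_onE
  gauge v := α (c.gauge v)
  lab_onE e := by
    change α (Γ.lab (c.onE e)) = _
    rw [c.lab_onE e]
    by_cases h : c.flip e <;> simp [h, MarkedGraph.twist] <;> rfl
  lab_collapsed e he := by
    change α (Γ.lab e) = _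
    rw [c.lab_collapsed e he]
    simp [MarkedGraph.twist]

/-- An inner automorphism does not change the marking up to homotopy. -/
def Collapse.conj (c : FreeGroup (Fin r)) (Γ : MarkedGraph r) :
    Collapse (Γ.twist (MulAut.conj c)) Γ where
  onV := id
  onE := Function.Embedding.refl _
  flip _ := false
  onV_surjective := Function.surjective_id
  forest := by
    rintro ⟨v, p, hp, -, -, h⟩
    obtain ⟨d, l, rfl⟩ := List.exists_cons_of_ne_nil hp
    exact h d (by simp) ⟨d.1, rfl⟩
  onV_eq_iff u v := by
    constructor
    · rintro rfl; exact Relation.EqvGen.refl _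
    · intro h
      induction h with
      | rel x y h => obtain ⟨e, he, -⟩ := h; exact absurd ⟨e, rfl⟩ he
      | refl => rfl
      | symm _ _ _ ih => exact ih.symm
      | trans _ _ _ _ _ h1 h2 => exact h1.trans h2
  ends_onE e := rfl
  gauge _ := c
  lab_onE e := rfl
  lab_collapsed e he := absurd ⟨e, rfl⟩ he

end MarkedGraph

open Opposite Simplicial

/-! ### The simplicial closure of Outer space -/

/-- The vertices of the closed simplex of a marked graph are its edges, and its faces are the
nonempty sets of edges. A flag is an `n`-simplex (possibly degenerate) of the barycentric subdivision
of this closed simplex: a weakly increasing sequence of `n + 1` faces. -/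
structure FaceFlag (r : ℕ) (n : SimplexCategory) where
  graph : MarkedGraph r
  sets : Fin (n.len + 1) →o Finset (Fin graph.nE)
  nonempty : ∀ i, (sets i).Nonempty

namespace FaceFlag
variable {r : ℕ}

/-- Faces and degeneracies. -/
def pull {m n : SimplexCategory} (f : m ⟶ n) (x : FaceFlag r n) : FaceFlag r m where
  graph := x.graph
  sets := x.sets.comp f.toOrderHom
  nonempty _ := x.nonempty _

/-- Changing the marking. -/
def twist {n : SimplexCategory} (α : MulAut (FreeGroup (Fin r))) (x : FaceFlag r n) : FaceFlag r n where
  graph := x.graph.twist α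
  sets := x.sets
  nonempty := x.nonempty

/-- The gluing: the closed simplex of a marked graph `Γ'` obtained from `Γ` by collapsing a forest
is the face of the closed simplex of `Γ` spanned by the edges outside of the forest. -/
def Rel {n : SimplexCategory} (x y : FaceFlag r n) : Prop :=
  ∃ c : MarkedGraph.Collapse x.graph y.graph, ∀ i, x.sets i = (y.sets i).map c.onE

end FaceFlag

/-- The simplicial closure of Outer space in rank `r`, triangulated by its barycentric subdivision:
one closed simplex for each marked graph, including all of the faces which are missing in Outer space,
glued along forest collapses. -/
def closureSSet (r : ℕ) : SSet.{0} where
  obj n := Quot (FaceFlag.Rel (r := r) (n := n.unop))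
  map f := ↾(Quot.map (FaceFlag.pull f.unop) (by
    rintro x y ⟨c, hc⟩
    exact ⟨c, fun i => hc _⟩))
  map_id n := by
    ext ⟨x⟩; rfl
  map_comp f g := by
    ext ⟨x⟩; rfl

/-- The action of automorphisms of `F_r` by change of marking. -/
def autAction (r : ℕ) : MulAut (FreeGroup (Fin r)) →* End (closureSSet r) where
  toFun α :=
    { app := fun n => ↾(Quot.map (FaceFlag.twist α) (by
        rintro x y ⟨c, hc⟩
        exact ⟨c.twist α, hc⟩))
      naturality := by
        intro m n f
        ext ⟨x⟩; rfl }
  map_one' := by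
    refine NatTrans.ext (funext fun n => ?_)
    ext ⟨x⟩; rfl
  map_mul' α β := by
    refine NatTrans.ext (funext fun n => ?_)
    ext ⟨x⟩; rfl

/-- The simplicial closure of Outer space with the action of `Out(F_r)`. -/
def simplicialClosure (r : ℕ) : Action SSet.{0} (Out r) where
  V := closureSSet r
  ρ := QuotientGroup.lift (Inn r) (autAction r) (by
    rintro _ ⟨c, rfl⟩
    rw [MonoidHom.mem_ker]
    refine NatTrans.ext (funext fun n => ?_)
    ext ⟨x⟩
    exact Quot.sound ⟨MarkedGraph.Collapse.conj c x.graph, fun i => by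
      change x.sets i = (x.sets i).map (Function.Embedding.refl _)
      rw [Finset.map_refl]⟩)

/-- The subcomplex `A_r` of the simplices which are not in Outer space: a face of the closed simplex
of a marked graph is missing in Outer space if and only if the complementary edges, which are
collapsed to points, contain a cycle. A simplex of the subdivision lies in `A_r` if and only if
the largest face of the flag does. -/
def atInfinity (r : ℕ) : (simplicialClosure r).V.Subcomplex where
  obj n := {x | ∃ y : FaceFlag r n.unop, x = Quot.mk _ y ∧
    y.graph.HasCycle {e | e ∉ y.sets (Fin.last _)}}
  map := by
    rintro m n f _ ⟨y, rfl, v, p, h1, h2, h3, h4⟩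
    exact ⟨FaceFlag.pull f.unop y, rfl, v, p, h1, h2, h3, fun d hd h =>
      h4 d hd (y.sets.monotone (Fin.le_last _) h)⟩

/-! ### Relative homology, quotients, equivariant homology -/

/-- The simplicial vector space of chains on a simplicial set modulo a family of subspaces. -/
def quotChains (Y : SSet.{0}) (R : ∀ n, Submodule ℝ (Y.obj n →₀ ℝ))
    (hR : ∀ {m n : SimplexCategoryᵒᵖ} (f : m ⟶ n),
      R m ≤ (R n).comap (Finsupp.lmapDomain ℝ ℝ (Y.map f))) :
    SimplicialObject (ModuleCat.{0} ℝ) where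
  obj n := ModuleCat.of ℝ ((Y.obj n →₀ ℝ) ⧸ R n)
  map f := ModuleCat.ofHom (Submodule.mapQ _ _ (Finsupp.lmapDomain ℝ ℝ (Y.map f)) (hR f))
  map_id n := by
    ext x
    simp
  map_comp f g := by
    ext x
    simp

/-- Relative simplicial chains `C_*(Y, B; ℝ)`. -/
def relChains (Y : SSet.{0}) (B : Y.Subcomplex) : SimplicialObject (ModuleCat.{0} ℝ) :=
  quotChains Y (fun n => Submodule.span ℝ {x | ∃ b ∈ B.obj n, x = Finsupp.single b 1}) (by
    intro m n f
    rw [Submodule.span_le]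
    rintro _ ⟨b, hb, rfl⟩
    refine Submodule.subset_span ⟨Y.map f b, B.map f hb, ?_⟩
    simp)

/-- The map on relative chains induced by a map of pairs. -/
def relChainsMap {Y Y' : SSet.{0}} (B : Y.Subcomplex) (B' : Y'.Subcomplex) (f : Y ⟶ Y')
    (h : ∀ n, ∀ b ∈ B.obj n, f.app n b ∈ B'.obj n) : relChains Y B ⟶ relChains Y' B' where
  app n := ModuleCat.ofHom (Submodule.mapQ _ _ (Finsupp.lmapDomain ℝ ℝ (f.app n)) (by
    rw [Submodule.span_le]
    rintro _ ⟨b, hb, rfl⟩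
    refine Submodule.subset_span ⟨f.app n b, h n b hb, ?_⟩
    simp))
  naturality m n g := by
    refine ModuleCat.hom_ext (Submodule.linearMap_qext _ (Finsupp.lhom_ext' fun b =>
      LinearMap.ext_ring ?_))
    change Submodule.Quotient.mk (Finsupp.mapDomain (f.app n)
        (Finsupp.mapDomain (Y.map g) (Finsupp.single b 1))) =
      Submodule.Quotient.mk (Finsupp.mapDomain (Y'.map g)
        (Finsupp.mapDomain (f.app m) (Finsupp.single b 1)))
    simp only [Finsupp.mapDomain_single]
    rw [NatTrans.naturality_apply f g b]

/-- Homology of a simplicial vector space. -/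
abbrev simplicialHomology (M : SimplicialObject (ModuleCat.{0} ℝ)) (p : ℕ) : ModuleCat.{0} ℝ :=
  ((AlgebraicTopology.alternatingFaceMapComplex (ModuleCat.{0} ℝ)).obj M).homology p

section GroupAction

variable {G : Type} [Group G] (X : Action SSet.{0} G)

/-- The quotient of a simplicial set with `G`-action by a subgroup. -/
def orbitSSet (H : Subgroup G) : SSet.{0} where
  obj n := Quot (fun x y : X.V.obj n => ∃ g ∈ H, (X.ρ g).app n x = y)
  map f := ↾(Quot.map (X.V.map f) (by
    rintro x _ ⟨g, hg, rfl⟩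
    exact ⟨g, hg, NatTrans.naturality_apply (X.ρ g) f x⟩))
  map_id n := by
    ext ⟨x⟩
    exact congrArg (Quot.mk _) (by simp)
  map_comp f g := by
    ext ⟨x⟩
    exact congrArg (Quot.mk _) (by simp)

/-- The projection to the quotient. -/
def toOrbit (H : Subgroup G) : X.V ⟶ orbitSSet X H where
  app n := ↾(Quot.mk _)
  naturality m n f := by
    ext x; rfl

/-- The projection from the quotient by a subgroup to the quotient by a larger one. -/
def orbitMap {H K : Subgroup G} (h : H ≤ K) : orbitSSet X H ⟶ orbitSSet X K where
  app n := ↾(Quot.map id (by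
    rintro x y ⟨g, hg, hxy⟩
    exact ⟨g, h hg, hxy⟩))
  naturality m n f := by
    ext ⟨x⟩; rfl

/-- Relative chains `C_*(X/H, A/H; ℝ)`. -/
def orbitChains (A : X.V.Subcomplex) (H : Subgroup G) : SimplicialObject (ModuleCat.{0} ℝ) :=
  relChains (orbitSSet X H) (A.image (toOrbit X H))

/-- The map `C_*(X/H, A/H; ℝ) → C_*(X/K, A/K; ℝ)` induced by the projection, for `H ≤ K`. -/
def orbitChainsMap (A : X.V.Subcomplex) {H K : Subgroup G} (h : H ≤ K) :
    orbitChains X A H ⟶ orbitChains X A K :=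
  relChainsMap _ _ (orbitMap X h) (by
    rintro n _ ⟨a, ha, rfl⟩
    exact ⟨a, ha, rfl⟩)

/-- `EG × X`, where `EG` is the contractible free simplicial `G`-set with `n`-simplices
`(g_0, …, g_n)`. -/
def borelSSet : SSet.{0} where
  obj n := (Fin (n.unop.len + 1) → G) × X.V.obj n
  map f := ↾(fun x => (x.1 ∘ f.unop.toOrderHom, X.V.map f x.2))
  map_id n := by
    ext x <;> simp
  map_comp f g := by
    ext x <;> simp

/-- The diagonal action of `G` on `EG × X`. -/
def borelSMul (g : G) {n : SimplexCategoryᵒᵖ} (x : (borelSSet X).obj n) : (borelSSet X).obj n :=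
  (fun i => g * x.1 i, (X.ρ g).app n x.2)

/-- The defining relations of the chains of the Borel construction: `g • x = χ(g) x`, and simplices
over `A` are zero. -/
def borelRelators (A : X.V.Subcomplex) (χ : G →* ℤˣ) (n : SimplexCategoryᵒᵖ) :
    Set ((borelSSet X).obj n →₀ ℝ) :=
  {y | (∃ g x, y = Finsupp.single (borelSMul X g x) 1 - ((χ g : ℤ) : ℝ) • Finsupp.single x 1) ∨
    ∃ x, x.2 ∈ A.obj n ∧ y = Finsupp.single x 1}

/-- Chains of the pair of Borel constructions `(EG ×_G X, EG ×_G A)` with coefficients in the real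
line on which `G` acts through the character `χ`, that is, `C_*(EG × X, EG × A) ⊗_G ℝ_χ`. -/
def borelChains (A : X.V.Subcomplex) (χ : G →* ℤˣ) : SimplicialObject (ModuleCat.{0} ℝ) :=
  quotChains (borelSSet X) (fun n => Submodule.span ℝ (borelRelators X A χ n)) (by
    intro m n f
    rw [Submodule.span_le]
    rintro _ (⟨g, x, rfl⟩ | ⟨x, hx, rfl⟩)
    · have h : (borelSSet X).map f (borelSMul X g x) = borelSMul X g ((borelSSet X).map f x) := by
        have h₂ := NatTrans.naturality_apply (X.ρ g) f (x.2 : X.V.obj m)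
        exact Prod.ext rfl h₂.symm
      refine Submodule.subset_span (Or.inl ⟨g, (borelSSet X).map f x, ?_⟩)
      rw [map_sub, map_smul, Finsupp.lmapDomain_apply, Finsupp.lmapDomain_apply,
        Finsupp.mapDomain_single, Finsupp.mapDomain_single, h]
    · refine Submodule.subset_span (Or.inr ⟨(borelSSet X).map f x, A.map f hx, ?_⟩)
      rw [Finsupp.lmapDomain_apply, Finsupp.mapDomain_single])

/-- Relative homology `H_p(X/H, A/H; ℝ)` of the quotients by a subgroup. -/
abbrev orbitHomology (A : X.V.Subcomplex) (H : Subgroup G) (p : ℕ) : ModuleCat.{0} ℝ :=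
  simplicialHomology (orbitChains X A H) p

/-- The map `H_p(X/H, A/H; ℝ) → H_p(X/K, A/K; ℝ)` induced by the projection, for `H ≤ K`. -/
abbrev orbitHomologyMap (A : X.V.Subcomplex) {H K : Subgroup G} (h : H ≤ K) (p : ℕ) :
    orbitHomology X A H p ⟶ orbitHomology X A K p :=
  HomologicalComplex.homologyMap
    ((AlgebraicTopology.alternatingFaceMapComplex (ModuleCat.{0} ℝ)).map (orbitChainsMap X A h)) p

/-- Equivariant homology `H_p^G(X, A; ℝ_χ)`. -/
abbrev equivariantHomology (A : X.V.Subcomplex) (χ : G →* ℤˣ) (p : ℕ) : ModuleCat.{0} ℝ :=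
  simplicialHomology (borelChains X A χ) p

end GroupAction

/-! ### The terms of the long exact sequences -/

/-- `H_p^{Out(F_r)}(CX_r, A_r; ℝ̃)`, where `Out(F_r)` acts on `ℝ̃` through the determinant. -/
abbrev twistedOutHomology (r p : ℕ) : ModuleCat.{0} ℝ :=
  equivariantHomology (simplicialClosure r) (atInfinity r) (outDet r) p

/-- `H_p(CX_r / SOut_r, A_r / SOut_r)`. -/
abbrev modSOutHomology (r p : ℕ) : ModuleCat.{0} ℝ :=
  orbitHomology (simplicialClosure r) (atInfinity r) (SOut r) p

/-- `H_p(CX_r / Out(F_r), A_r / Out(F_r))`. -/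
abbrev modOutHomology (r p : ℕ) : ModuleCat.{0} ℝ :=
  orbitHomology (simplicialClosure r) (atInfinity r) ⊤ p

/-- The map induced by the projection `CX_r / SOut_r → CX_r / Out(F_r)`. -/
abbrev projection (r p : ℕ) : modSOutHomology r p →ₗ[ℝ] modOutHomology r p :=
  (orbitHomologyMap (simplicialClosure r) (atInfinity r) (le_top : SOut r ≤ ⊤) p).hom

/-- Graph homology of rank `r` in degree (number of vertices) `p + 2 - r`; it is zero if this number
is negative. Graphs of rank `r` with `p + 2 - r` vertices are those with `p + 1` edges. -/
def shiftedGraphHomology (r p : ℕ) : ModuleCat.{0} ℝ :=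
  if r ≤ p + 2 then (graphComplex r).homology (p + 2 - r) else ModuleCat.of ℝ PUnit

/-- Exactness of `⋯ → A_p → B_p → C_p → A_{p-1} → ⋯ → A_0 → B_0 → C_0 → 0`. -/
structure IsLongExact {A B C : ℕ → ModuleCat.{0} ℝ} (f : ∀ p, A p →ₗ[ℝ] B p)
    (g : ∀ p, B p →ₗ[ℝ] C p) (d : ∀ p, C (p + 1) →ₗ[ℝ] A p) : Prop where
  exact_middle : ∀ p, Function.Exact (f p) (g p)
  exact_right : ∀ p, Function.Exact (g (p + 1)) (d p)
  exact_left : ∀ p, Function.Exact (d p) (f p)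
  surjective_zero : Function.Surjective (g 0)

end OuterSpace

end

/-! Write X for the simplicial closure, A for its part at infinity, G for Out(F_r) and χ for the
determinant. The long exact sequences fall apart into split short ones, so all connecting maps can
be taken to be zero.

The splitting. If r > 0, some t in G has χ(t) = -1, and t induces an involution on the chains of
(X/ker χ, A/ker χ). Over ℝ these chains are the sum of its two eigenspaces: the +1 part is the
chains of (X/G, A/G), the -1 part is the twisted coinvariants C(X, A) ⊗_G ℝ_χ. This is
`orbitChains_split`. For r < 2 there are no marked graphs and all groups vanish.

From the Borel construction to coinvariants. The kernel of C(EG × X, EG × A) → C(X, A) is contracted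
by the contraction of EG. Simplices outside A have finite stabilizers (`finite_stabilizer`), because
a marking of a finite graph has only finitely many symmetries; over ℝ the contraction can therefore
be averaged to an equivariant one, and an equivariant contraction survives the passage to
coinvariants. Hence `nonempty_equivariantHomology_equiv`.

From coinvariants to graphs. An ordered tuple of edges of a marked graph, with a forest as
complement, determines a marked graph with numbered edges by contracting that forest. Such a graph
with vertex set V and edge set E has an isomorphism ℝ ⊕ ℝ^E → ℝ^V ⊕ ℝ^r, given by a base point, the
boundary of edges and their abelianized labels. Its determinant `gdet` changes sign under
transpositions of vertices, transpositions of edges and reversals of edges, and is multiplied by det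
α when α changes the marking. Therefore `gdet` times the oriented graph is independent of the
numbering of the vertices and of the directions of the edges, alternates in the edges and transforms
by χ: the determinant twist converts an ordering of the edges into an orientation in the sense of
the graph complex. Omitting the i-th edge from the tuple amounts to collapsing it, and expanding the
determinant along its column (`gdet_contract`) matches the signs of the two boundary operators.

The triangulation by flags of faces is compared with tuples of edges by two natural maps: a flag is
sent to the average over all choices of one edge from each face, and a tuple to its barycentric
subdivision. On alternating functions the average of the subdivision of an injective tuple is the
identity (`evalW_sd`); in the other order the composite is chain homotopic to the identity by coning
off towards the largest face of each flag (`tupleD_sdHomotopyFun`). Both maps and the homotopy are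
compatible with collapses and markings and respect A, so they descend to the coinvariants and give
`nonempty_outHomology_equiv`. The shift of degree is the Euler characteristic: a p-simplex has p + 1
edges, hence k = p + 2 - r vertices. -/

noncomputable section

open CategoryTheory

namespace OuterSpace

section

/-! ### Homology of complexes of vector spaces -/

section Homology

/-- The homology of a complex of vector spaces is cycles modulo boundaries. -/
def homologyEquivQuotient (K : ChainComplex (ModuleCat.{0} ℝ) ℕ) (p : ℕ) :
    K.homology p ≃ₗ[ℝ] LinearMap.ker (K.d p ((ComplexShape.down ℕ).next p)).hom ⧸
      LinearMap.range (K.sc p).moduleCatToCycles :=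
  (K.sc p).moduleCatHomologyIso.toLinearEquiv

theorem mem_range_moduleCatToCycles (K : ChainComplex (ModuleCat.{0} ℝ) ℕ) (p : ℕ)
    (z : LinearMap.ker (K.d p ((ComplexShape.down ℕ).next p)).hom) :
    z ∈ LinearMap.range (K.sc p).moduleCatToCycles ↔ ∃ x, (K.d (p + 1) p).hom x = z.1 := by
  have h : (ComplexShape.down ℕ).prev p = p + 1 := ChainComplex.prev ℕ p
  rw [← h]
  constructor
  · rintro ⟨x, rfl⟩
    exact ⟨x, rfl⟩
  · rintro ⟨x, hx⟩
    exact ⟨x, Subtype.ext hx⟩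

/-- A linear map which preserves cycles and boundaries and is bijective modulo boundaries induces
an isomorphism in homology. -/
theorem nonempty_homology_equiv {K L : ChainComplex (ModuleCat.{0} ℝ) ℕ} {p q : ℕ}
    (a : K.X p →ₗ[ℝ] L.X q)
    (hcyc : ∀ z, (K.d p ((ComplexShape.down ℕ).next p)).hom z = 0 →
      (L.d q ((ComplexShape.down ℕ).next q)).hom (a z) = 0)
    (hbd : ∀ x, ∃ y, (L.d (q + 1) q).hom y = a ((K.d (p + 1) p).hom x))
    (hinj : ∀ z, (K.d p ((ComplexShape.down ℕ).next p)).hom z = 0 →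
      ∀ y, (L.d (q + 1) q).hom y = a z → ∃ x, (K.d (p + 1) p).hom x = z)
    (hsurj : ∀ z', (L.d q ((ComplexShape.down ℕ).next q)).hom z' = 0 →
      ∃ z, (K.d p ((ComplexShape.down ℕ).next p)).hom z = 0 ∧
        ∃ y, (L.d (q + 1) q).hom y = z' - a z) :
    Nonempty (K.homology p ≃ₗ[ℝ] L.homology q) := by
  let a' : LinearMap.ker (K.d p ((ComplexShape.down ℕ).next p)).hom →ₗ[ℝ]
      LinearMap.ker (L.d q ((ComplexShape.down ℕ).next q)).hom :=
    a.restrict (fun z hz => hcyc z hz)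
  let b := Submodule.mapQ (LinearMap.range (K.sc p).moduleCatToCycles)
    (LinearMap.range (L.sc q).moduleCatToCycles) a' (by
      intro z hz
      obtain ⟨x, hx⟩ := (mem_range_moduleCatToCycles K p z).mp hz
      obtain ⟨y, hy⟩ := hbd x
      exact (mem_range_moduleCatToCycles L q _).mpr ⟨y, by rw [hy, hx]; rfl⟩)
  have hb : Function.Bijective b := by
    constructor
    · rw [injective_iff_map_eq_zero]
      intro z hz
      obtain ⟨z, rfl⟩ := Submodule.Quotient.mk_surjective _ z
      have h2 : a' z ∈ LinearMap.range (L.sc q).moduleCatToCycles :=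
        (Submodule.Quotient.mk_eq_zero _).mp hz
      obtain ⟨y, hy⟩ := (mem_range_moduleCatToCycles L q _).mp h2
      obtain ⟨x, hx⟩ := hinj z.1 z.2 y hy
      exact (Submodule.Quotient.mk_eq_zero _).mpr
        ((mem_range_moduleCatToCycles K p z).mpr ⟨x, hx⟩)
    · intro z
      obtain ⟨z, rfl⟩ := Submodule.Quotient.mk_surjective _ z
      obtain ⟨z', hz', y, hy⟩ := hsurj z.1 z.2
      refine ⟨Submodule.Quotient.mk ⟨z', hz'⟩, Eq.symm ((Submodule.Quotient.eq _).mpr ?_)⟩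
      exact (mem_range_moduleCatToCycles L q _).mpr ⟨y, hy⟩
  exact ⟨(homologyEquivQuotient K p).trans ((LinearEquiv.ofBijective b hb).trans
    (homologyEquivQuotient L q).symm)⟩

theorem subsingleton_homology {K : ChainComplex (ModuleCat.{0} ℝ) ℕ} {p : ℕ}
    (h : ∀ z, (K.d p ((ComplexShape.down ℕ).next p)).hom z = 0 → ∃ x, (K.d (p + 1) p).hom x = z) :
    Subsingleton (K.homology p) := by
  refine (homologyEquivQuotient K p).toEquiv.subsingleton_congr.mpr
    (subsingleton_of_forall_eq 0 fun z => ?_)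
  obtain ⟨z, rfl⟩ := Submodule.Quotient.mk_surjective _ z
  exact (Submodule.Quotient.mk_eq_zero _).mpr
    ((mem_range_moduleCatToCycles K p z).mpr (h z.1 z.2))

theorem d_next_zero (K : ChainComplex (ModuleCat.{0} ℝ) ℕ) :
    K.d 0 ((ComplexShape.down ℕ).next 0) = 0 :=
  K.shape _ _ (by simp)

/-- The successor index of the complex shape is `p` only propositionally; this lets cycle conditions
be used with the concrete differential. -/
theorem d_next_succ (K : ChainComplex (ModuleCat.{0} ℝ) ℕ) (p : ℕ) (z : K.X (p + 1)) :
    (K.d (p + 1) ((ComplexShape.down ℕ).next (p + 1))).hom z = 0 ↔ (K.d (p + 1) p).hom z = 0 := by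
  have h : (ComplexShape.down ℕ).next (p + 1) = p := ChainComplex.next_nat_succ p
  rw [h]

/-- The homology of a simplicial vector space as an additive functor. -/
def simplicialHomologyFunctor (p : ℕ) : SimplicialObject (ModuleCat.{0} ℝ) ⥤ ModuleCat.{0} ℝ :=
  AlgebraicTopology.alternatingFaceMapComplex (ModuleCat.{0} ℝ) ⋙
    HomologicalComplex.homologyFunctor _ _ p

instance (p : ℕ) : (simplicialHomologyFunctor p).Additive := by
  unfold simplicialHomologyFunctor
  infer_instance

end Homology

/-! ### Maps out of quotients of free simplicial vector spaces -/

/-- A natural family of functions which kills the relations induces a morphism. -/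
def quotChainsDesc {Y : SSet.{0}} {R : ∀ n, Submodule ℝ (Y.obj n →₀ ℝ)}
    {hR : ∀ {m n : SimplexCategoryᵒᵖ} (f : m ⟶ n),
      R m ≤ (R n).comap (Finsupp.lmapDomain ℝ ℝ (Y.map f))}
    (N : SimplicialObject (ModuleCat.{0} ℝ)) (F : ∀ n, Y.obj n → N.obj n)
    (hF : ∀ m n (f : m ⟶ n) (y : Y.obj m), F n (Y.map f y) = (N.map f).hom (F m y))
    (hker : ∀ n, R n ≤ LinearMap.ker (Finsupp.linearCombination ℝ (F n))) :
    quotChains Y R hR ⟶ N where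
  app n := ModuleCat.ofHom (Submodule.liftQ _ (Finsupp.linearCombination ℝ (F n)) (hker n))
  naturality m n f := by
    refine ModuleCat.hom_ext (Submodule.linearMap_qext _ (Finsupp.lhom_ext' fun b =>
      LinearMap.ext_ring ?_))
    change Finsupp.linearCombination ℝ (F n) (Finsupp.mapDomain (Y.map f) (Finsupp.single b 1)) =
      (N.map f).hom (Finsupp.linearCombination ℝ (F m) (Finsupp.single b 1))
    simp [hF]

/-- The class of a simplex. -/
def quotMk {Y : SSet.{0}} {R : ∀ n, Submodule ℝ (Y.obj n →₀ ℝ)}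
    {hR : ∀ {m n : SimplexCategoryᵒᵖ} (f : m ⟶ n),
      R m ≤ (R n).comap (Finsupp.lmapDomain ℝ ℝ (Y.map f))} {n : SimplexCategoryᵒᵖ} (y : Y.obj n) :
    (quotChains Y R hR).obj n :=
  Submodule.Quotient.mk (Finsupp.single y 1)

section quotMk

variable {Y : SSet.{0}} {R : ∀ n, Submodule ℝ (Y.obj n →₀ ℝ)}
    {hR : ∀ {m n : SimplexCategoryᵒᵖ} (f : m ⟶ n),
      R m ≤ (R n).comap (Finsupp.lmapDomain ℝ ℝ (Y.map f))}

theorem quotChains_hom_ext {n : SimplexCategoryᵒᵖ} {M : Type} [AddCommGroup M] [Module ℝ M]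
    {f g : (quotChains Y R hR).obj n →ₗ[ℝ] M}
    (h : ∀ y : Y.obj n, f (quotMk y) = g (quotMk y)) : f = g :=
  Submodule.linearMap_qext _ (Finsupp.lhom_ext' fun b => LinearMap.ext_ring (h b))

theorem quotChains_map_quotMk {m n : SimplexCategoryᵒᵖ} (f : m ⟶ n) (y : Y.obj m) :
    ((quotChains Y R hR).map f).hom (quotMk y) = quotMk (Y.map f y) := by
  change Submodule.Quotient.mk (Finsupp.mapDomain (Y.map f) (Finsupp.single y 1)) = _
  rw [Finsupp.mapDomain_single]
  rfl

theorem quotChainsDesc_quotMk (N : SimplicialObject (ModuleCat.{0} ℝ)) (F : ∀ n, Y.obj n → N.obj n)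
    (hF : ∀ m n (f : m ⟶ n) (y : Y.obj m), F n (Y.map f y) = (N.map f).hom (F m y))
    (hker : ∀ n, R n ≤ LinearMap.ker (Finsupp.linearCombination ℝ (F n)))
    {n : SimplexCategoryᵒᵖ} (y : Y.obj n) :
    ((quotChainsDesc (hR := hR) N F hF hker).app n).hom (quotMk y) = F n y := by
  change Finsupp.linearCombination ℝ (F n) (Finsupp.single y 1) = _
  simp

/-- A function on simplices which kills the relations induces a linear map. -/
def quotLift {n : SimplexCategoryᵒᵖ} {M : Type} [AddCommGroup M] [Module ℝ M] (F : Y.obj n → M)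
    (hker : R n ≤ LinearMap.ker (Finsupp.linearCombination ℝ F)) :
    (quotChains Y R hR).obj n →ₗ[ℝ] M :=
  Submodule.liftQ _ (Finsupp.linearCombination ℝ F) hker

theorem quotLift_quotMk {n : SimplexCategoryᵒᵖ} {M : Type} [AddCommGroup M] [Module ℝ M]
    (F : Y.obj n → M) (hker : R n ≤ LinearMap.ker (Finsupp.linearCombination ℝ F)) (y : Y.obj n) :
    quotLift (hR := hR) F hker (quotMk y) = F y := by
  change Finsupp.linearCombination ℝ F (Finsupp.single y 1) = _
  simp

end quotMk

end

section

/-! ### Twisted coinvariants -/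

section Coinvariants

variable {G : Type} [Group G] (X : Action SSet.{0} G) (A : X.V.Subcomplex) (χ : G →* ℤˣ)

/-- The relations `g • x = χ(g) x`, and simplices in `A` are zero. -/
def coinvRelators (n : SimplexCategoryᵒᵖ) : Set (X.V.obj n →₀ ℝ) :=
  {y | (∃ g x, y = Finsupp.single ((X.ρ g).app n x) 1 - ((χ g : ℤ) : ℝ) • Finsupp.single x 1) ∨
    ∃ x ∈ A.obj n, y = Finsupp.single x 1}

theorem coinvRelators_compat {m n : SimplexCategoryᵒᵖ} (f : m ⟶ n) :
    Submodule.span ℝ (coinvRelators X A χ m) ≤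
      (Submodule.span ℝ (coinvRelators X A χ n)).comap (Finsupp.lmapDomain ℝ ℝ (X.V.map f)) := by
  rw [Submodule.span_le]
  rintro _ (⟨g, x, rfl⟩ | ⟨x, hx, rfl⟩)
  · refine Submodule.subset_span (Or.inl ⟨g, X.V.map f x, ?_⟩)
    rw [map_sub, map_smul, Finsupp.lmapDomain_apply, Finsupp.lmapDomain_apply,
      Finsupp.mapDomain_single, Finsupp.mapDomain_single, NatTrans.naturality_apply (X.ρ g) f x]
  · refine Submodule.subset_span (Or.inr ⟨X.V.map f x, A.map f hx, ?_⟩)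
    rw [Finsupp.lmapDomain_apply, Finsupp.mapDomain_single]

theorem relators_compat {Y : SSet.{0}} (B : Y.Subcomplex) {m n : SimplexCategoryᵒᵖ} (f : m ⟶ n) :
    Submodule.span ℝ {x | ∃ b ∈ B.obj m, x = Finsupp.single b 1} ≤
      (Submodule.span ℝ {x | ∃ b ∈ B.obj n, x = Finsupp.single b 1}).comap
        (Finsupp.lmapDomain ℝ ℝ (Y.map f)) := by
  rw [Submodule.span_le]
  rintro _ ⟨b, hb, rfl⟩
  refine Submodule.subset_span ⟨Y.map f b, B.map f hb, ?_⟩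
  simp

/-- Twisted coinvariants of the relative chains: `C_*(X, A) ⊗_G ℝ_χ`. -/
def coinvChains : SimplicialObject (ModuleCat.{0} ℝ) :=
  quotChains X.V (fun n => Submodule.span ℝ (coinvRelators X A χ n)) (coinvRelators_compat X A χ)

variable {X A χ}

/-- The class of a simplex in the coinvariants. -/
def coinvMk {n : SimplexCategoryᵒᵖ} (x : X.V.obj n) : (coinvChains X A χ).obj n :=
  quotMk (hR := coinvRelators_compat X A χ) x

theorem coinvMk_smul {n : SimplexCategoryᵒᵖ} (g : G) (x : X.V.obj n) :
    (coinvMk ((X.ρ g).app n x) : (coinvChains X A χ).obj n) = ((χ g : ℤ) : ℝ) • coinvMk x :=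
  (Submodule.Quotient.eq (Submodule.span ℝ (coinvRelators X A χ n))).mpr
    (Submodule.subset_span (Or.inl ⟨g, x, rfl⟩))

theorem coinvMk_eq_zero {n : SimplexCategoryᵒᵖ} {x : X.V.obj n} (hx : x ∈ A.obj n) :
    (coinvMk x : (coinvChains X A χ).obj n) = 0 :=
  (Submodule.Quotient.mk_eq_zero (Submodule.span ℝ (coinvRelators X A χ n))).mpr
    (Submodule.subset_span (Or.inr ⟨x, hx, rfl⟩))

theorem coinvRelators_le_ker {n : SimplexCategoryᵒᵖ} {M : Type} [AddCommGroup M] [Module ℝ M]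
    {F : X.V.obj n → M} (h1 : ∀ g x, F ((X.ρ g).app n x) = ((χ g : ℤ) : ℝ) • F x)
    (h2 : ∀ x ∈ A.obj n, F x = 0) :
    Submodule.span ℝ (coinvRelators X A χ n) ≤ LinearMap.ker (Finsupp.linearCombination ℝ F) := by
  rw [Submodule.span_le]
  rintro _ (⟨g, x, rfl⟩ | ⟨x, hx, rfl⟩)
  · rw [SetLike.mem_coe, LinearMap.mem_ker, map_sub, map_smul]
    simp [h1]
  · rw [SetLike.mem_coe, LinearMap.mem_ker]
    simp [h2 x hx]

theorem relators_le_ker {Y : SSet.{0}} {B : Y.Subcomplex} {n : SimplexCategoryᵒᵖ} {M : Type}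
    [AddCommGroup M] [Module ℝ M] {F : Y.obj n → M} (h : ∀ x ∈ B.obj n, F x = 0) :
    Submodule.span ℝ {x | ∃ b ∈ B.obj n, x = Finsupp.single b 1} ≤
      LinearMap.ker (Finsupp.linearCombination ℝ F) := by
  rw [Submodule.span_le]
  rintro _ ⟨x, hx, rfl⟩
  rw [SetLike.mem_coe, LinearMap.mem_ker]
  simp [h x hx]

/-- The class of a simplex in the relative chains of an orbit space. -/
def orbitMk (H : Subgroup G) {n : SimplexCategoryᵒᵖ} (x : X.V.obj n) :
    (orbitChains X A H).obj n :=
  quotMk (hR := relators_compat (A.image (toOrbit X H))) (Quot.mk _ x)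

theorem orbitMk_smul {H : Subgroup G} {n : SimplexCategoryᵒᵖ} {g : G} (hg : g ∈ H)
    (x : X.V.obj n) :
    (orbitMk H ((X.ρ g).app n x) : (orbitChains X A H).obj n) = orbitMk H x :=
  congrArg (quotMk (hR := relators_compat (A.image (toOrbit X H)))) (Quot.sound ⟨g, hg, rfl⟩).symm

theorem orbitMk_eq_zero {H : Subgroup G} {n : SimplexCategoryᵒᵖ} {x : X.V.obj n}
    (hx : x ∈ A.obj n) : (orbitMk H x : (orbitChains X A H).obj n) = 0 :=
  (Submodule.Quotient.mk_eq_zero (Submodule.span ℝ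
    {y | ∃ b ∈ (A.image (toOrbit X H)).obj n, y = Finsupp.single b 1})).mpr
    (Submodule.subset_span ⟨_, ⟨x, hx, rfl⟩, rfl⟩)

theorem action_mul_apply {n : SimplexCategoryᵒᵖ} (g h : G) (x : X.V.obj n) :
    (X.ρ (g * h)).app n x = (X.ρ g).app n ((X.ρ h).app n x) := by
  rw [map_mul]; rfl

theorem action_one_apply {n : SimplexCategoryᵒᵖ} (x : X.V.obj n) :
    (X.ρ 1).app n x = x := by
  rw [map_one]; rfl

/-- Since g h⁻¹ lies in ker χ, the class of g x depends only on the sign χ(g). Each G-orbit thus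
contributes at most the two classes of x and t x. -/
theorem orbitMk_ker_congr {n : SimplexCategoryᵒᵖ} {g h : G} (hgh : χ g = χ h) (x : X.V.obj n) :
    (orbitMk χ.ker ((X.ρ g).app n x) : (orbitChains X A χ.ker).obj n) =
      orbitMk χ.ker ((X.ρ h).app n x) := by
  have h1 : g = (g * h⁻¹) * h := by group
  rw [h1, action_mul_apply]
  exact orbitMk_smul (by rw [MonoidHom.mem_ker, map_mul, map_inv, hgh, mul_inv_cancel]) _

theorem coinv_hom_ext {n : SimplexCategoryᵒᵖ} {M : Type} [AddCommGroup M] [Module ℝ M]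
    {f g : (coinvChains X A χ).obj n →ₗ[ℝ] M}
    (h : ∀ y : X.V.obj n, f (coinvMk y) = g (coinvMk y)) : f = g :=
  quotChains_hom_ext (hR := coinvRelators_compat X A χ) h

theorem orbit_hom_ext {H : Subgroup G} {n : SimplexCategoryᵒᵖ} {M : Type} [AddCommGroup M]
    [Module ℝ M] {f g : (orbitChains X A H).obj n →ₗ[ℝ] M}
    (h : ∀ y : X.V.obj n, f (orbitMk H y) = g (orbitMk H y)) : f = g :=
  quotChains_hom_ext (hR := relators_compat (A.image (toOrbit X H))) (by rintro ⟨y⟩; exact h y)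

theorem coinvChains_map {m n : SimplexCategoryᵒᵖ} (f : m ⟶ n) (x : X.V.obj m) :
    ((coinvChains X A χ).map f).hom (coinvMk x) = coinvMk (X.V.map f x) :=
  quotChains_map_quotMk (hR := coinvRelators_compat X A χ) f x

theorem orbitChains_map {H : Subgroup G} {m n : SimplexCategoryᵒᵖ} (f : m ⟶ n) (x : X.V.obj m) :
    ((orbitChains X A H).map f).hom (orbitMk H x) = orbitMk H (X.V.map f x) :=
  quotChains_map_quotMk (hR := relators_compat (A.image (toOrbit X H))) f _

variable (X A χ)

/-- Antisymmetrization: the inclusion of the `χ`-coinvariants into the chains of `X / ker χ`. -/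
def antisymmetrize (hA : ∀ (g : G) n, ∀ x ∈ A.obj n, (X.ρ g).app n x ∈ A.obj n)
    (t : G) (ht : χ t = -1) : coinvChains X A χ ⟶ orbitChains X A χ.ker :=
  quotChainsDesc (hR := coinvRelators_compat X A χ) _ (fun n x => orbitMk χ.ker x - orbitMk χ.ker ((X.ρ t).app n x))
    (by
      intro m n f x
      rw [map_sub, orbitChains_map, orbitChains_map, NatTrans.naturality_apply (X.ρ t) f x])
    (by
      intro n
      refine coinvRelators_le_ker (fun g x => ?_) (fun x hx => ?_)
      · rw [← action_mul_apply]
        -- If χ(g) = 1, both terms keep their classes; if χ(g) = -1, the classes of x and t x are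
        -- exchanged, which is the sign χ(g).
        rcases Int.units_eq_one_or (χ g) with h | h
        · rw [orbitMk_ker_congr (h := 1) (by rw [h, map_one]), action_one_apply,
            orbitMk_ker_congr (h := t) (by rw [map_mul, h, mul_one]), h]
          simp
        · rw [orbitMk_ker_congr (h := t) (by rw [h, ht]),
            orbitMk_ker_congr (g := t * g) (h := 1) (by rw [map_mul, h, ht]; simp),
            action_one_apply, h]
          simp
      · rw [orbitMk_eq_zero hx, orbitMk_eq_zero (hA t n x hx), sub_zero])

/-- The retraction of `antisymmetrize`. -/
def projectCoinv : orbitChains X A χ.ker ⟶ coinvChains X A χ :=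
  quotChainsDesc (hR := relators_compat (A.image (toOrbit X χ.ker))) _
    (fun n => Quot.lift (fun x => (2⁻¹ : ℝ) • (coinvMk x : (coinvChains X A χ).obj n)) (by
      rintro x _ ⟨g, hg, rfl⟩
      rw [coinvMk_smul, MonoidHom.mem_ker.mp hg]
      simp))
    (by
      rintro m n f ⟨x⟩
      change (2⁻¹ : ℝ) • coinvMk (X.V.map f x) = _
      rw [map_smul, coinvChains_map])
    (by
      intro n
      refine relators_le_ker ?_
      rintro _ ⟨x, hx, rfl⟩
      change (2⁻¹ : ℝ) • (coinvMk x : (coinvChains X A χ).obj n) = 0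
      rw [coinvMk_eq_zero hx, smul_zero])

/-- The section of the projection `X / ker χ → X / G` on chains. -/
def transfer (hA : ∀ (g : G) n, ∀ x ∈ A.obj n, (X.ρ g).app n x ∈ A.obj n)
    (t : G) (ht : χ t = -1) : orbitChains X A (⊤ : Subgroup G) ⟶ orbitChains X A χ.ker :=
  quotChainsDesc (hR := relators_compat (A.image (toOrbit X ⊤))) _
    (fun n => Quot.lift (fun x => (2⁻¹ : ℝ) • (orbitMk χ.ker x +
        orbitMk χ.ker ((X.ρ t).app n x) : (orbitChains X A χ.ker).obj n)) (by
      rintro x _ ⟨g, -, rfl⟩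
      rw [← action_mul_apply]
      rcases Int.units_eq_one_or (χ g) with h | h
      · rw [orbitMk_ker_congr (g := g) (h := 1) (by rw [h, map_one]), action_one_apply,
          orbitMk_ker_congr (g := t * g) (h := t) (by rw [map_mul, h, mul_one])]
      · rw [orbitMk_ker_congr (g := g) (h := t) (by rw [h, ht]),
          orbitMk_ker_congr (g := t * g) (h := 1) (by rw [map_mul, h, ht]; simp),
          action_one_apply, add_comm]))
    (by
      rintro m n f ⟨x⟩
      change (2⁻¹ : ℝ) • (orbitMk χ.ker (X.V.map f x) +
        orbitMk χ.ker ((X.ρ t).app n (X.V.map f x))) = _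
      rw [map_smul, map_add, orbitChains_map, orbitChains_map,
        NatTrans.naturality_apply (X.ρ t) f x])
    (by
      intro n
      refine relators_le_ker ?_
      rintro _ ⟨x, hx, rfl⟩
      change (2⁻¹ : ℝ) • (orbitMk χ.ker x + orbitMk χ.ker ((X.ρ t).app n x) :
        (orbitChains X A χ.ker).obj n) = 0
      rw [orbitMk_eq_zero hx, orbitMk_eq_zero (hA t n x hx), add_zero, smul_zero])

variable {X A χ}

theorem antisymmetrize_coinvMk (hA : ∀ (g : G) n, ∀ x ∈ A.obj n, (X.ρ g).app n x ∈ A.obj n)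
    (t : G) (ht : χ t = -1) {n : SimplexCategoryᵒᵖ} (x : X.V.obj n) :
    ((antisymmetrize X A χ hA t ht).app n).hom (coinvMk x) =
      orbitMk χ.ker x - orbitMk χ.ker ((X.ρ t).app n x) :=
  quotChainsDesc_quotMk (hR := coinvRelators_compat X A χ) _ _ _ _ x

theorem projectCoinv_orbitMk {n : SimplexCategoryᵒᵖ} (x : X.V.obj n) :
    ((projectCoinv X A χ).app n).hom (orbitMk χ.ker x) = (2⁻¹ : ℝ) • coinvMk x :=
  quotChainsDesc_quotMk (hR := relators_compat (A.image (toOrbit X χ.ker))) _ _ _ _ _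

theorem transfer_orbitMk (hA : ∀ (g : G) n, ∀ x ∈ A.obj n, (X.ρ g).app n x ∈ A.obj n)
    (t : G) (ht : χ t = -1) {n : SimplexCategoryᵒᵖ} (x : X.V.obj n) :
    ((transfer X A χ hA t ht).app n).hom (orbitMk ⊤ x) =
      (2⁻¹ : ℝ) • (orbitMk χ.ker x + orbitMk χ.ker ((X.ρ t).app n x)) :=
  quotChainsDesc_quotMk (hR := relators_compat (A.image (toOrbit X ⊤))) _ _ _ _ _

theorem orbitChainsMap_orbitMk {H K : Subgroup G} (h : H ≤ K) {n : SimplexCategoryᵒᵖ}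
    (x : X.V.obj n) :
    ((orbitChainsMap X A h).app n).hom (orbitMk H x) = orbitMk K x := by
  have h1 := Finsupp.mapDomain_single (f := (orbitMap X h).app n)
    (a := (Quot.mk _ x : (orbitSSet X H).obj n)) (b := (1 : ℝ))
  exact congrArg (Submodule.Quotient.mk (p := Submodule.span ℝ
    {y | ∃ b ∈ (A.image (toOrbit X K)).obj n, y = Finsupp.single b 1})) h1

/-- In the coinvariants t x = -x, so x - t x becomes 2x; this explains the factor 1/2 in
`projectCoinv`. -/
theorem antisymmetrize_projectCoinv (hA : ∀ (g : G) n, ∀ x ∈ A.obj n, (X.ρ g).app n x ∈ A.obj n)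
    (t : G) (ht : χ t = -1) : antisymmetrize X A χ hA t ht ≫ projectCoinv X A χ = 𝟙 _ := by
  refine NatTrans.ext (funext fun n => ModuleCat.hom_ext (coinv_hom_ext fun x => ?_))
  change ((projectCoinv X A χ).app n).hom (((antisymmetrize X A χ hA t ht).app n).hom _) = coinvMk x
  rw [antisymmetrize_coinvMk, map_sub, projectCoinv_orbitMk, projectCoinv_orbitMk, coinvMk_smul, ht,
    ← smul_sub]
  simp only [Units.val_neg, Units.val_one, Int.cast_neg, Int.cast_one, neg_smul, one_smul,
    sub_neg_eq_add, ← two_smul ℝ, smul_smul]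
  norm_num

theorem antisymmetrize_orbitChainsMap
    (hA : ∀ (g : G) n, ∀ x ∈ A.obj n, (X.ρ g).app n x ∈ A.obj n) (t : G) (ht : χ t = -1) :
    antisymmetrize X A χ hA t ht ≫ orbitChainsMap X A (le_top : χ.ker ≤ ⊤) = 0 := by
  refine NatTrans.ext (funext fun n => ModuleCat.hom_ext (coinv_hom_ext fun x => ?_))
  change ((orbitChainsMap X A le_top).app n).hom
    (((antisymmetrize X A χ hA t ht).app n).hom _) = 0
  rw [antisymmetrize_coinvMk, map_sub, orbitChainsMap_orbitMk, orbitChainsMap_orbitMk,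
    orbitMk_smul (Subgroup.mem_top t), sub_self]

theorem transfer_orbitChainsMap (hA : ∀ (g : G) n, ∀ x ∈ A.obj n, (X.ρ g).app n x ∈ A.obj n)
    (t : G) (ht : χ t = -1) :
    transfer X A χ hA t ht ≫ orbitChainsMap X A (le_top : χ.ker ≤ ⊤) = 𝟙 _ := by
  refine NatTrans.ext (funext fun n => ModuleCat.hom_ext (orbit_hom_ext fun x => ?_))
  change ((orbitChainsMap X A le_top).app n).hom (((transfer X A χ hA t ht).app n).hom _) =
    orbitMk ⊤ x
  rw [transfer_orbitMk, map_smul, map_add, orbitChainsMap_orbitMk, orbitChainsMap_orbitMk,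
    orbitMk_smul (Subgroup.mem_top t), ← two_smul ℝ, smul_smul]
  norm_num

/-- On a generator this is (x - t x)/2 + (x + t x)/2 = x, the decomposition into eigenvectors of the
involution t. -/
theorem orbitChains_split (hA : ∀ (g : G) n, ∀ x ∈ A.obj n, (X.ρ g).app n x ∈ A.obj n)
    (t : G) (ht : χ t = -1) :
    projectCoinv X A χ ≫ antisymmetrize X A χ hA t ht +
      orbitChainsMap X A (le_top : χ.ker ≤ ⊤) ≫ transfer X A χ hA t ht = 𝟙 _ := by
  refine NatTrans.ext (funext fun n => ModuleCat.hom_ext (orbit_hom_ext fun x => ?_))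
  rw [NatTrans.app_add, ModuleCat.hom_add, LinearMap.add_apply]
  rw [NatTrans.comp_app, NatTrans.comp_app, ModuleCat.hom_comp, ModuleCat.hom_comp,
    LinearMap.comp_apply, LinearMap.comp_apply, NatTrans.id_app, ModuleCat.hom_id,
    LinearMap.id_apply, orbitChainsMap_orbitMk, transfer_orbitMk, projectCoinv_orbitMk, map_smul,
    antisymmetrize_coinvMk, ← smul_add, sub_add_add_cancel, ← two_smul ℝ, smul_smul]
  norm_num

/-- If `χ` is nontrivial, then `H_*(X / ker χ, A / ker χ)` is the direct sum of
`H_*(X / G, A / G)` and the homology of the twisted coinvariants. -/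
theorem exists_split_homology (hA : ∀ (g : G) n, ∀ x ∈ A.obj n, (X.ρ g).app n x ∈ A.obj n)
    (t : G) (ht : χ t = -1) (p : ℕ) :
    ∃ i : simplicialHomology (coinvChains X A χ) p →ₗ[ℝ] orbitHomology X A χ.ker p,
      Function.Injective i ∧
      Function.Exact i (orbitHomologyMap X A (le_top : χ.ker ≤ ⊤) p).hom ∧
      Function.Surjective (orbitHomologyMap X A (le_top : χ.ker ≤ ⊤) p).hom := by
  let F := simplicialHomologyFunctor p
  let a := antisymmetrize X A χ hA t ht
  let g := orbitChainsMap X A (le_top : χ.ker ≤ ⊤)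
  let s := transfer X A χ hA t ht
  let q := projectCoinv X A χ
  -- Homology is an additive functor, so the four relations of the splitting persist in homology.
  have h1 : F.map a ≫ F.map q = 𝟙 _ := by
    rw [← F.map_comp, antisymmetrize_projectCoinv, F.map_id]
  have h2 : F.map a ≫ F.map g = 0 := by
    rw [← F.map_comp, antisymmetrize_orbitChainsMap, F.map_zero]
  have h3 : F.map s ≫ F.map g = 𝟙 _ := by
    rw [← F.map_comp, transfer_orbitChainsMap, F.map_id]
  have h4 : F.map q ≫ F.map a + F.map g ≫ F.map s = 𝟙 _ := by
    rw [← F.map_comp, ← F.map_comp, ← F.map_add, orbitChains_split, F.map_id]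
  have e1 : ∀ x, (F.map q).hom ((F.map a).hom x) = x := fun x =>
    congrArg (fun f => f.hom x) h1
  have e2 : ∀ x, (F.map g).hom ((F.map a).hom x) = 0 := fun x =>
    congrArg (fun f => f.hom x) h2
  have e3 : ∀ x, (F.map g).hom ((F.map s).hom x) = x := fun x =>
    congrArg (fun f => f.hom x) h3
  have e4 : ∀ x, (F.map a).hom ((F.map q).hom x) + (F.map s).hom ((F.map g).hom x) = x := fun x =>
    congrArg (fun f => f.hom x) h4
  refine ⟨(F.map a).hom, Function.LeftInverse.injective e1, fun y => ⟨fun hy => ?_, ?_⟩,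
    fun y => ⟨_, e3 y⟩⟩
  · have h5 := e4 y
    have h6 : (F.map g).hom y = 0 := hy
    rw [h6, map_zero, add_zero] at h5
    exact ⟨_, h5⟩
  · rintro ⟨x, rfl⟩
    exact e2 x

end Coinvariants

end

section

/-! ### Equivariant contractions -/

section EquivariantContraction

variable {G : Type} [Group G] {B : ℕ → Type} [∀ n, AddCommGroup (B n)] [∀ n, Module ℝ (B n)]
  (ρ : ∀ n, G → B n →ₗ[ℝ] B n) (d : ∀ n, B (n + 1) →ₗ[ℝ] B n) (K : ∀ n, Submodule ℝ (B n))

/-- `T` is equivariant and preserves the subspaces `K`. -/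
def IsEquivariant {m n : ℕ} (T : B m →ₗ[ℝ] B n) : Prop :=
  (∀ g y, T (ρ m g y) = ρ n g (T y)) ∧ ∀ y ∈ K m, T y ∈ K n

/-- Averaging a linear map by means of a partition of unity. -/
def averageMap {m n : ℕ} (P : B m →ₗ[ℝ] (G →₀ B m)) (T : B m →ₗ[ℝ] B n) : B m →ₗ[ℝ] B n :=
  Finsupp.lsum ℝ (fun g => ρ n g ∘ₗ T ∘ₗ ρ m g⁻¹) ∘ₗ P

variable {ρ d K}

theorem averageMap_apply {m n : ℕ} (P : B m →ₗ[ℝ] (G →₀ B m)) (T : B m →ₗ[ℝ] B n) (y : B m) :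
    averageMap ρ P T y = (P y).sum fun g v => ρ n g (T (ρ m g⁻¹ v)) := rfl

/-- Substituting h g for g in the sum of the g T g⁻¹ P_g moves h to the front, because `P` permutes
its components equivariantly. -/
theorem isEquivariant_averageMap {m n : ℕ}
    (hρ : ∀ n g h y, ρ n (g * h) y = ρ n g (ρ n h y)) (hρ1 : ∀ n y, ρ n 1 y = y)
    (hK : ∀ n g, ∀ y ∈ K n, ρ n g y ∈ K n) {P : B m →ₗ[ℝ] (G →₀ B m)}
    (hP : ∀ h g y, P (ρ m h y) (h * g) = ρ m h (P y g)) (hPK : ∀ y ∈ K m, ∀ g, P y g ∈ K m)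
    {T : B m →ₗ[ℝ] B n} (hT : ∀ y ∈ K m, T y ∈ K n) : IsEquivariant ρ K (averageMap ρ P T) := by
  refine ⟨fun h y => ?_, fun y hy => ?_⟩
  · rw [averageMap_apply, averageMap_apply, Finsupp.sum, Finsupp.sum, map_sum]
    refine (Finset.sum_bij (fun g _ => h * g) ?_ ?_ ?_ ?_).symm
    · intro g hg
      rw [Finsupp.mem_support_iff] at hg ⊢
      intro h0
      rw [hP] at h0
      apply hg
      have := congrArg (ρ m h⁻¹) h0
      rwa [← hρ, inv_mul_cancel, hρ1, map_zero] at this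
    · intro a _ b _ hab
      exact mul_left_cancel hab
    · intro g hg
      refine ⟨h⁻¹ * g, ?_, by group⟩
      rw [Finsupp.mem_support_iff] at hg ⊢
      intro h0
      apply hg
      have := hP h (h⁻¹ * g) y
      rw [h0, map_zero] at this
      rwa [mul_inv_cancel_left] at this
    · intro g _
      rw [hP, hρ, ← hρ m, mul_inv_rev, inv_mul_cancel_right]
  · rw [averageMap_apply]
    exact Submodule.sum_mem _ fun g _ => hK _ _ _ (hT _ (hK _ _ _ (hPK y hy g)))

/-- If a complex with an action of `G` has a (not necessarily equivariant) contraction and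
partitions of unity, then it has an equivariant contraction. -/
theorem exists_equivariant_contraction
    (hρ : ∀ n g h y, ρ n (g * h) y = ρ n g (ρ n h y)) (hρ1 : ∀ n y, ρ n 1 y = y)
    (hd : ∀ n y, d n (d (n + 1) y) = 0) (hdρ : ∀ n g y, d n (ρ (n + 1) g y) = ρ n g (d n y))
    (hK : ∀ n g, ∀ y ∈ K n, ρ n g y ∈ K n) (hdK : ∀ n, ∀ y ∈ K (n + 1), d n y ∈ K n)
    (H : ∀ n, B n →ₗ[ℝ] B (n + 1)) (hHK : ∀ n, ∀ y ∈ K n, H n y ∈ K (n + 1))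
    (hH0 : ∀ y ∈ K 0, d 0 (H 0 y) = y)
    (hH : ∀ n, ∀ y ∈ K (n + 1), d (n + 1) (H (n + 1) y) + H n (d n y) = y)
    (P : ∀ n, B n →ₗ[ℝ] (G →₀ B n)) (hPsum : ∀ n y, ((P n y).sum fun _ v => v) = y)
    (hP : ∀ n h g y, P n (ρ n h y) (h * g) = ρ n h (P n y g))
    (hPK : ∀ n, ∀ y ∈ K n, ∀ g, P n y g ∈ K n) :
    (∃ S : B 0 →ₗ[ℝ] B 1, IsEquivariant ρ K S ∧ ∀ y ∈ K 0, d 0 (S y) = y) ∧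
    ∀ n, ∃ (S : B n →ₗ[ℝ] B (n + 1)) (S' : B (n + 1) →ₗ[ℝ] B (n + 2)),
      IsEquivariant ρ K S ∧ IsEquivariant ρ K S' ∧
        ∀ y ∈ K (n + 1), d (n + 1) (S' y) + S (d n y) = y := by
  have h0 : ∃ S : B 0 →ₗ[ℝ] B 1, IsEquivariant ρ K S ∧ ∀ y ∈ K 0, d 0 (S y) = y := by
    refine ⟨averageMap ρ (P 0) (H 0), isEquivariant_averageMap hρ hρ1 hK (hP 0) (hPK 0) (hHK 0),
      fun y hy => ?_⟩
    rw [averageMap_apply, Finsupp.sum, map_sum]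
    conv_rhs => rw [← hPsum 0 y]
    refine Finset.sum_congr rfl fun g _ => ?_
    rw [hdρ, hH0 _ (hK _ _ _ (hPK 0 y hy g)), ← hρ, mul_inv_cancel, hρ1]
  -- Averaging `H` separately in each degree would destroy the homotopy relation. The map in the
  -- next degree is instead built from the equivariant map `S` already chosen.
  have step : ∀ n (S : B n →ₗ[ℝ] B (n + 1)), IsEquivariant ρ K S →
      (∀ y ∈ K (n + 1), d n (S (d n y)) = d n y) →
      ∃ S' : B (n + 1) →ₗ[ℝ] B (n + 2), IsEquivariant ρ K S' ∧
        ∀ y ∈ K (n + 1), d (n + 1) (S' y) + S (d n y) = y := by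
    intro n S hS hSd
    -- By `hSd`, the operator 1 - S d takes values in cycles of `K`, and there `H` is a right
    -- inverse of `d`. As 1 - S d is equivariant, averaging keeps this property.
    let T : B (n + 1) →ₗ[ℝ] B (n + 2) := H (n + 1) ∘ₗ (LinearMap.id - S ∘ₗ d n)
    have hz : ∀ y ∈ K (n + 1), y - S (d n y) ∈ K (n + 1) := fun y hy =>
      Submodule.sub_mem _ hy (hS.2 _ (hdK n y hy))
    refine ⟨averageMap ρ (P (n + 1)) T, isEquivariant_averageMap hρ hρ1 hK (hP _) (hPK _)
      (fun y hy => hHK _ _ (hz y hy)), fun y hy => ?_⟩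
    have key : ∀ v ∈ K (n + 1), d (n + 1) (T v) = v - S (d n v) := by
      intro v hv
      have h1 := hH n _ (hz v hv)
      have h2 : d n (v - S (d n v)) = 0 := by rw [map_sub, hSd v hv, sub_self]
      rw [h2, map_zero, add_zero] at h1
      exact h1
    have h3 : d (n + 1) (averageMap ρ (P (n + 1)) T y) =
        (P (n + 1) y).sum fun _ v => v - S (d n v) := by
      rw [averageMap_apply, Finsupp.sum, map_sum]
      refine Finset.sum_congr rfl fun g _ => ?_
      rw [hdρ, key _ (hK _ _ _ (hPK _ y hy g)), map_sub, hdρ, hS.1, ← hρ, ← hρ, mul_inv_cancel,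
        hρ1, hρ1]
    have h4 : ((P (n + 1) y).sum fun _ v => v - S (d n v)) = y - S (d n y) := by
      have h5 := hPsum (n + 1) y
      conv_rhs => rw [← h5]
      rw [Finsupp.sum, Finsupp.sum, Finset.sum_sub_distrib, map_sum, map_sum]
    rw [h3, h4, sub_add_cancel]
  -- The identity d S d = d on `K` is the invariant carried through the induction; it is exactly
  -- what `step` requires.
  have all : ∀ n, ∃ S : B n →ₗ[ℝ] B (n + 1), IsEquivariant ρ K S ∧
      ∀ y ∈ K (n + 1), d n (S (d n y)) = d n y := by
    intro n
    induction n with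
    | zero =>
      obtain ⟨S, hS, hSd⟩ := h0
      exact ⟨S, hS, fun y hy => hSd _ (hdK 0 y hy)⟩
    | succ n ih =>
      obtain ⟨S, hS, hSd⟩ := ih
      obtain ⟨S', hS', h⟩ := step n S hS hSd
      refine ⟨S', hS', fun y hy => ?_⟩
      have h1 := h _ (hdK _ y hy)
      rwa [hd, map_zero, add_zero] at h1
  refine ⟨h0, fun n => ?_⟩
  obtain ⟨S, hS, hSd⟩ := all n
  obtain ⟨S', hS', h⟩ := step n S hS hSd
  exact ⟨S, S', hS, hS', h⟩

end EquivariantContraction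

/-! ### Simplicial homotopies on relative chains -/

section RelChains

variable {Y Y' : SSet.{0}} {B : Y.Subcomplex} {B' : Y'.Subcomplex}

/-- The class of a simplex in the relative chains. -/
def relMk (B : Y.Subcomplex) {n : SimplexCategoryᵒᵖ} (y : Y.obj n) : (relChains Y B).obj n :=
  quotMk (hR := relators_compat B) y

theorem relMk_eq_zero {n : SimplexCategoryᵒᵖ} {y : Y.obj n} (hy : y ∈ B.obj n) :
    relMk B y = 0 :=
  (Submodule.Quotient.mk_eq_zero (Submodule.span ℝ
    {y | ∃ b ∈ B.obj n, y = Finsupp.single b 1})).mpr (Submodule.subset_span ⟨_, hy, rfl⟩)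

theorem relChains_hom_ext {n : SimplexCategoryᵒᵖ} {M : Type} [AddCommGroup M] [Module ℝ M]
    {f g : (relChains Y B).obj n →ₗ[ℝ] M} (h : ∀ y : Y.obj n, f (relMk B y) = g (relMk B y)) :
    f = g :=
  quotChains_hom_ext (hR := relators_compat B) h

/-- A function on simplices which vanishes on `B` induces a linear map on relative chains. -/
def relLift {n : SimplexCategoryᵒᵖ} {M : Type} [AddCommGroup M] [Module ℝ M] (F : Y.obj n → M)
    (hF : ∀ y ∈ B.obj n, F y = 0) : (relChains Y B).obj n →ₗ[ℝ] M :=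
  quotLift (hR := relators_compat B) F (relators_le_ker hF)

theorem relLift_relMk {n : SimplexCategoryᵒᵖ} {M : Type} [AddCommGroup M] [Module ℝ M]
    (F : Y.obj n → M) (hF : ∀ y ∈ B.obj n, F y = 0) (y : Y.obj n) :
    relLift F hF (relMk B y) = F y :=
  quotLift_quotMk (hR := relators_compat B) F (relators_le_ker hF) y

/-- `relLift` as a morphism. -/
def relHom {n : SimplexCategoryᵒᵖ} (N : ModuleCat.{0} ℝ) (F : Y.obj n → N)
    (hF : ∀ y ∈ B.obj n, F y = 0) : (relChains Y B).obj n ⟶ N :=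
  ModuleCat.ofHom (relLift F hF)

theorem relHom_relMk {n : SimplexCategoryᵒᵖ} (N : ModuleCat.{0} ℝ) (F : Y.obj n → N)
    (hF : ∀ y ∈ B.obj n, F y = 0) (y : Y.obj n) : (relHom N F hF).hom (relMk B y) = F y :=
  relLift_relMk F hF y

theorem relChains_map_relMk {m n : SimplexCategoryᵒᵖ} (f : m ⟶ n) (y : Y.obj m) :
    ((relChains Y B).map f).hom (relMk B y) = relMk B (Y.map f y) :=
  quotChains_map_quotMk (hR := relators_compat B) f y

theorem relChainsMap_relMk (f : Y ⟶ Y') (h : ∀ n, ∀ b ∈ B.obj n, f.app n b ∈ B'.obj n)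
    {n : SimplexCategoryᵒᵖ} (y : Y.obj n) :
    ((relChainsMap B B' f h).app n).hom (relMk B y) = relMk B' (f.app n y) := by
  have h1 := Finsupp.mapDomain_single (f := f.app n) (a := y) (b := (1 : ℝ))
  exact congrArg (Submodule.Quotient.mk (p := Submodule.span ℝ
    {y | ∃ b ∈ B'.obj n, y = Finsupp.single b 1})) h1

/-- A homotopy of maps of pairs induces a homotopy on relative chains. -/
def relChainsHomotopy {f g : Y ⟶ Y'} (hf : ∀ n, ∀ b ∈ B.obj n, f.app n b ∈ B'.obj n)
    (hg : ∀ n, ∀ b ∈ B.obj n, g.app n b ∈ B'.obj n) (H : SimplicialObject.Homotopy f g)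
    (hH : ∀ (n : ℕ) (i : Fin (n + 1)), ∀ b ∈ B.obj (Opposite.op (SimplexCategory.mk n)),
      H.h i b ∈ B'.obj (Opposite.op (SimplexCategory.mk (n + 1)))) :
    SimplicialObject.Homotopy (relChainsMap B B' f hf) (relChainsMap B B' g hg) where
  h {n} i := relHom _ (fun y => relMk B' (H.h i y)) fun b hb => relMk_eq_zero (hH n i b hb)
  h_zero_comp_δ_zero n := by
    refine ModuleCat.hom_ext (relChains_hom_ext fun y => ?_)
    rw [ModuleCat.hom_comp, LinearMap.comp_apply, relHom_relMk,
      relChainsMap_relMk, ← H.h_zero_comp_δ_zero]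
    exact relChains_map_relMk _ _
  h_last_comp_δ_last n := by
    refine ModuleCat.hom_ext (relChains_hom_ext fun y => ?_)
    rw [ModuleCat.hom_comp, LinearMap.comp_apply, relHom_relMk,
      relChainsMap_relMk, ← H.h_last_comp_δ_last]
    exact relChains_map_relMk _ _
  h_succ_comp_δ_castSucc_of_lt {n} i j hij := by
    refine ModuleCat.hom_ext (relChains_hom_ext fun y => ?_)
    rw [ModuleCat.hom_comp, LinearMap.comp_apply, ModuleCat.hom_comp, LinearMap.comp_apply,
      relHom_relMk]
    refine (relChains_map_relMk _ _).trans ?_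
    refine Eq.trans ?_ (congrArg _ (relChains_map_relMk _ y)).symm
    rw [relHom_relMk]
    exact congrArg (relMk B') (congrArg (fun f => f y) (H.h_succ_comp_δ_castSucc_of_lt i j hij))
  h_succ_comp_δ_castSucc_succ {n} j := by
    refine ModuleCat.hom_ext (relChains_hom_ext fun y => ?_)
    rw [ModuleCat.hom_comp, LinearMap.comp_apply, ModuleCat.hom_comp, LinearMap.comp_apply,
      relHom_relMk, relHom_relMk]
    refine (relChains_map_relMk _ _).trans (Eq.trans ?_ (relChains_map_relMk _ _).symm)
    exact congrArg (relMk B') (congrArg (fun f => f y) (H.h_succ_comp_δ_castSucc_succ j))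
  h_castSucc_comp_δ_succ_of_lt {n} i j hji := by
    refine ModuleCat.hom_ext (relChains_hom_ext fun y => ?_)
    rw [ModuleCat.hom_comp, LinearMap.comp_apply, ModuleCat.hom_comp, LinearMap.comp_apply,
      relHom_relMk]
    refine (relChains_map_relMk _ _).trans ?_
    refine Eq.trans ?_ (congrArg _ (relChains_map_relMk _ y)).symm
    rw [relHom_relMk]
    exact congrArg (relMk B') (congrArg (fun f => f y) (H.h_castSucc_comp_δ_succ_of_lt i j hji))
  h_comp_σ_castSucc_of_le {n} i j hij := by
    refine ModuleCat.hom_ext (relChains_hom_ext fun y => ?_)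
    rw [ModuleCat.hom_comp, LinearMap.comp_apply, ModuleCat.hom_comp, LinearMap.comp_apply,
      relHom_relMk]
    refine (relChains_map_relMk _ _).trans ?_
    refine Eq.trans ?_ (congrArg _ (relChains_map_relMk _ y)).symm
    rw [relHom_relMk]
    exact congrArg (relMk B') (congrArg (fun f => f y) (H.h_comp_σ_castSucc_of_le i j hij))
  h_comp_σ_succ_of_lt {n} i j hji := by
    refine ModuleCat.hom_ext (relChains_hom_ext fun y => ?_)
    rw [ModuleCat.hom_comp, LinearMap.comp_apply, ModuleCat.hom_comp, LinearMap.comp_apply,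
      relHom_relMk]
    refine (relChains_map_relMk _ _).trans ?_
    refine Eq.trans ?_ (congrArg _ (relChains_map_relMk _ y)).symm
    rw [relHom_relMk]
    exact congrArg (relMk B') (congrArg (fun f => f y) (H.h_comp_σ_succ_of_lt i j hji))

end RelChains

end

section

/-! ### The Borel construction and coinvariants -/

section Borel

theorem val_predAbove {n : ℕ} (p : Fin n) (i : Fin (n + 1)) :
    (p.predAbove i : ℕ) = if (p : ℕ) < i then (i : ℕ) - 1 else i := by
  unfold Fin.predAbove
  simp only [Fin.lt_def, Fin.val_castSucc]
  split_ifs <;> simp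

variable {G : Type} [Group G] (X : Action SSet.{0} G) (A : X.V.Subcomplex)

/-- The first `i + 1` entries of the tuple are replaced by `1`, after repeating the `i`-th entry. -/
def coneTuple {n : ℕ} (i : Fin (n + 1)) (g : Fin (n + 1) → G) (j : Fin (n + 2)) : G :=
  if (j : ℕ) ≤ i then 1 else g (i.predAbove j)

/-- The projection `EG × X → EG × X` to the vertex `1` of `EG`. -/
def borelConst : borelSSet X ⟶ borelSSet X where
  app n := ↾(fun x => (fun _ => 1, x.2))
  naturality m n f := by
    ext x; rfl

/-- The contraction of `EG` to the vertex `1`. -/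
def borelContraction : SimplicialObject.Homotopy (borelConst X) (𝟙 (borelSSet X)) where
  h {n} i := ↾(fun x => (coneTuple i x.1, (SimplicialObject.Homotopy.refl (𝟙 X.V)).h i x.2))
  h_zero_comp_δ_zero n := by
    ext ⟨g, x⟩
    refine Prod.ext ?_ ?_
    · funext j
      change coneTuple 0 g (Fin.succAbove 0 j) = g j
      simp [coneTuple]
    · exact congrArg (fun f => f x) ((SimplicialObject.Homotopy.refl (𝟙 X.V)).h_zero_comp_δ_zero n)
  h_last_comp_δ_last n := by
    ext ⟨g, x⟩
    refine Prod.ext ?_ ?_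
    · funext j
      change coneTuple (Fin.last n) g (Fin.succAbove (Fin.last (n + 1)) j) = 1
      have hj : (j : ℕ) < n + 1 := j.is_lt
      simp [coneTuple]
      omega
    · exact congrArg (fun f => f x) ((SimplicialObject.Homotopy.refl (𝟙 X.V)).h_last_comp_δ_last n)
  h_succ_comp_δ_castSucc_of_lt {n} i j hij := by
    ext ⟨g, x⟩
    refine Prod.ext ?_ ?_
    · funext l
      change coneTuple j.succ g (Fin.succAbove i.castSucc l) =
        coneTuple j (g ∘ Fin.succAbove i) l
      have hij' : (i : ℕ) ≤ j := hij
      unfold coneTuple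
      have e : ((j : ℕ) < l) → j.succ.predAbove (i.castSucc.succAbove l) =
          i.succAbove (j.predAbove l) := by
        intro h
        apply Fin.ext
        simp only [val_predAbove, OGraph.val_succAbove, Fin.val_succ, Fin.val_castSucc]
        split_ifs <;> omega
      simp only [OGraph.val_succAbove, Fin.val_succ, Fin.val_castSucc, Function.comp]
      split_ifs <;> first | rfl | omega | (rw [e (by omega)])
    · exact congrArg (fun f => f x)
        ((SimplicialObject.Homotopy.refl (𝟙 X.V)).h_succ_comp_δ_castSucc_of_lt i j hij)
  h_succ_comp_δ_castSucc_succ {n} j := by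
    ext ⟨g, x⟩
    refine Prod.ext ?_ ?_
    · funext l
      change coneTuple j.succ g (Fin.succAbove j.castSucc.succ l) =
        coneTuple j.castSucc g (Fin.succAbove j.castSucc.succ l)
      unfold coneTuple
      have e : ((j : ℕ) < l) → j.succ.predAbove (j.castSucc.succ.succAbove l) =
          j.castSucc.predAbove (j.castSucc.succ.succAbove l) := by
        intro h
        apply Fin.ext
        simp only [val_predAbove, OGraph.val_succAbove, Fin.val_succ, Fin.val_castSucc]
        split_ifs <;> omega
      simp only [OGraph.val_succAbove, Fin.val_succ, Fin.val_castSucc]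
      split_ifs <;> first | rfl | omega | (rw [e (by omega)])
    · exact congrArg (fun f => f x)
        ((SimplicialObject.Homotopy.refl (𝟙 X.V)).h_succ_comp_δ_castSucc_succ j)
  h_castSucc_comp_δ_succ_of_lt {n} i j hji := by
    ext ⟨g, x⟩
    refine Prod.ext ?_ ?_
    · funext l
      change coneTuple j.castSucc g (Fin.succAbove i.succ l) =
        coneTuple j (g ∘ Fin.succAbove i) l
      have hij' : (j : ℕ) < i := hji
      unfold coneTuple
      have e : ((j : ℕ) < l) → j.castSucc.predAbove (i.succ.succAbove l) =
          i.succAbove (j.predAbove l) := by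
        intro h
        apply Fin.ext
        simp only [val_predAbove, OGraph.val_succAbove, Fin.val_succ, Fin.val_castSucc]
        split_ifs <;> omega
      simp only [OGraph.val_succAbove, Fin.val_succ, Fin.val_castSucc, Function.comp]
      split_ifs <;> first | rfl | omega | (rw [e (by omega)])
    · exact congrArg (fun f => f x)
        ((SimplicialObject.Homotopy.refl (𝟙 X.V)).h_castSucc_comp_δ_succ_of_lt i j hji)
  h_comp_σ_castSucc_of_le {n} i j hij := by
    ext ⟨g, x⟩
    refine Prod.ext ?_ ?_
    · funext l
      change coneTuple j g (Fin.predAbove i.castSucc l) =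
        coneTuple j.succ (g ∘ Fin.predAbove i) l
      have hij' : (i : ℕ) ≤ j := hij
      unfold coneTuple
      have e : ((j : ℕ) + 1 < l) → j.predAbove (i.castSucc.predAbove l) =
          i.predAbove (j.succ.predAbove l) := by
        intro h
        apply Fin.ext
        simp only [val_predAbove, Fin.val_succ, Fin.val_castSucc]
        split_ifs <;> omega
      simp only [val_predAbove, Fin.val_succ, Fin.val_castSucc, Function.comp]
      split_ifs <;> first | rfl | omega | (rw [e (by omega)])
    · exact congrArg (fun f => f x)
        ((SimplicialObject.Homotopy.refl (𝟙 X.V)).h_comp_σ_castSucc_of_le i j hij)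
  h_comp_σ_succ_of_lt {n} i j hji := by
    ext ⟨g, x⟩
    refine Prod.ext ?_ ?_
    · funext l
      change coneTuple j g (Fin.predAbove i.succ l) =
        coneTuple j.castSucc (g ∘ Fin.predAbove i) l
      have hij' : (j : ℕ) ≤ i := hji
      unfold coneTuple
      have e : ((j : ℕ) < l) → j.predAbove (i.succ.predAbove l) =
          i.predAbove (j.castSucc.predAbove l) := by
        intro h
        apply Fin.ext
        simp only [val_predAbove, Fin.val_succ, Fin.val_castSucc]
        split_ifs <;> omega
      simp only [val_predAbove, Fin.val_succ, Fin.val_castSucc, Function.comp]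
      split_ifs <;> first | rfl | omega | (rw [e (by omega)])
    · exact congrArg (fun f => f x)
        ((SimplicialObject.Homotopy.refl (𝟙 X.V)).h_comp_σ_succ_of_lt i j hji)

/-- The boundary operator of the chain complex of a simplicial vector space. -/
def faceD (M : SimplicialObject (ModuleCat.{0} ℝ)) (n : ℕ) :
    M.obj (Opposite.op (SimplexCategory.mk (n + 1))) →ₗ[ℝ]
      M.obj (Opposite.op (SimplexCategory.mk n)) :=
  (((AlgebraicTopology.alternatingFaceMapComplex (ModuleCat.{0} ℝ)).obj M).d (n + 1) n).hom

theorem faceD_faceD (M : SimplicialObject (ModuleCat.{0} ℝ)) (n : ℕ)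
    (y : M.obj (Opposite.op (SimplexCategory.mk (n + 2)))) :
    faceD M n (faceD M (n + 1) y) = 0 :=
  congrArg (fun f => f.hom y)
    (((AlgebraicTopology.alternatingFaceMapComplex (ModuleCat.{0} ℝ)).obj M).d_comp_d
      (n + 2) (n + 1) n)

theorem faceD_eq_sum (M : SimplicialObject (ModuleCat.{0} ℝ)) (n : ℕ)
    (y : M.obj (Opposite.op (SimplexCategory.mk (n + 1)))) :
    faceD M n y = ∑ i : Fin (n + 2), ((-1 : ℝ) ^ (i : ℕ)) • (M.δ i).hom y := by
  unfold faceD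
  rw [AlgebraicTopology.alternatingFaceMapComplex_obj_d,
    AlgebraicTopology.AlternatingFaceMapComplex.objD, ModuleCat.hom_sum, LinearMap.sum_apply]
  refine Finset.sum_congr rfl fun i _ => ?_
  rw [ModuleCat.hom_zsmul, LinearMap.smul_apply, ← Int.cast_smul_eq_zsmul ℝ]
  push_cast
  rfl

theorem faceD_naturality {M N : SimplicialObject (ModuleCat.{0} ℝ)} (f : M ⟶ N) (n : ℕ)
    (y : M.obj (Opposite.op (SimplexCategory.mk (n + 1)))) :
    faceD N n ((f.app _).hom y) = (f.app _).hom (faceD M n y) :=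
  congrArg (fun f => f.hom y)
    (((AlgebraicTopology.alternatingFaceMapComplex (ModuleCat.{0} ℝ)).map f).comm (n + 1) n)

/-- The chain homotopy associated with a simplicial homotopy. -/
def homotopyMap {M N : SimplicialObject (ModuleCat.{0} ℝ)} {f g : M ⟶ N}
    (H : SimplicialObject.Homotopy f g) (n : ℕ) :
    M.obj (Opposite.op (SimplexCategory.mk n)) →ₗ[ℝ]
      N.obj (Opposite.op (SimplexCategory.mk (n + 1))) :=
  (H.toChainHomotopy.hom n (n + 1)).hom

theorem homotopy_zero {M N : SimplicialObject (ModuleCat.{0} ℝ)} {f g : M ⟶ N}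
    (H : SimplicialObject.Homotopy f g) (y : M.obj (Opposite.op (SimplexCategory.mk 0))) :
    (f.app _).hom y = faceD N 0 (homotopyMap H 0 y) + (g.app _).hom y := by
  have h := H.toChainHomotopy.comm 0
  rw [prevD_eq _ (j' := 1) (by simp), dNext_eq_zero _ _ (by simp), zero_add] at h
  exact congrArg (fun f => f.hom y) h

theorem homotopy_succ {M N : SimplicialObject (ModuleCat.{0} ℝ)} {f g : M ⟶ N}
    (H : SimplicialObject.Homotopy f g) (n : ℕ)
    (y : M.obj (Opposite.op (SimplexCategory.mk (n + 1)))) :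
    (f.app _).hom y = homotopyMap H n (faceD M n y) +
      faceD N (n + 1) (homotopyMap H (n + 1) y) + (g.app _).hom y := by
  have h := H.toChainHomotopy.comm (n + 1)
  rw [prevD_eq _ (j' := n + 2) (by simp), dNext_eq _ (i' := n) (by simp)] at h
  exact congrArg (fun f => f.hom y) h

/-- `EG × A`. -/
def borelSub : (borelSSet X).Subcomplex where
  obj n := {b | b.2 ∈ A.obj n}
  map f _ hb := A.map f hb

/-- The projection `EG × X → X`. -/
def borelProj : borelSSet X ⟶ X.V where
  app n := ↾(fun b => b.2)
  naturality m n f := by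
    ext x; rfl

/-- The action of `g` on `EG × X`. -/
def borelAct (g : G) : borelSSet X ⟶ borelSSet X where
  app n := ↾(borelSMul X g)
  naturality m n f := by
    ext x
    have h₂ := NatTrans.naturality_apply (X.ρ g) f (x.2 : X.V.obj m)
    exact Prod.ext rfl h₂

/-- The inclusion of `X` over the vertex `1` of `EG`. -/
def borelIncl : X.V ⟶ borelSSet X where
  app n := ↾(fun x => (fun _ => 1, x))
  naturality m n f := by
    ext x; rfl

theorem borelRelators_compat (χ : G →* ℤˣ) {m n : SimplexCategoryᵒᵖ} (f : m ⟶ n) :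
    Submodule.span ℝ (borelRelators X A χ m) ≤
      (Submodule.span ℝ (borelRelators X A χ n)).comap
        (Finsupp.lmapDomain ℝ ℝ ((borelSSet X).map f)) := by
  rw [Submodule.span_le]
  rintro _ (⟨g, x, rfl⟩ | ⟨x, hx, rfl⟩)
  · have h : (borelSSet X).map f (borelSMul X g x) = borelSMul X g ((borelSSet X).map f x) := by
      have h₂ := NatTrans.naturality_apply (X.ρ g) f (x.2 : X.V.obj m)
      exact Prod.ext rfl h₂.symm
    refine Submodule.subset_span (Or.inl ⟨g, (borelSSet X).map f x, ?_⟩)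
    rw [map_sub, map_smul, Finsupp.lmapDomain_apply, Finsupp.lmapDomain_apply,
      Finsupp.mapDomain_single, Finsupp.mapDomain_single, h]
  · refine Submodule.subset_span (Or.inr ⟨(borelSSet X).map f x, A.map f hx, ?_⟩)
    rw [Finsupp.lmapDomain_apply, Finsupp.mapDomain_single]

variable {X A} {χ : G →* ℤˣ}

/-- The class of a simplex in the chains of the Borel construction. -/
def borelMk {n : SimplexCategoryᵒᵖ} (b : (borelSSet X).obj n) : (borelChains X A χ).obj n :=
  quotMk (hR := borelRelators_compat X A χ) b

theorem borelMk_smul {n : SimplexCategoryᵒᵖ} (g : G) (b : (borelSSet X).obj n) :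
    (borelMk (borelSMul X g b) : (borelChains X A χ).obj n) = ((χ g : ℤ) : ℝ) • borelMk b :=
  (Submodule.Quotient.eq (Submodule.span ℝ (borelRelators X A χ n))).mpr
    (Submodule.subset_span (Or.inl ⟨g, b, rfl⟩))

theorem borelMk_eq_zero {n : SimplexCategoryᵒᵖ} {b : (borelSSet X).obj n} (hb : b.2 ∈ A.obj n) :
    (borelMk b : (borelChains X A χ).obj n) = 0 :=
  (Submodule.Quotient.mk_eq_zero (Submodule.span ℝ (borelRelators X A χ n))).mpr
    (Submodule.subset_span (Or.inr ⟨b, hb, rfl⟩))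

theorem borel_hom_ext {n : SimplexCategoryᵒᵖ} {M : Type} [AddCommGroup M] [Module ℝ M]
    {f g : (borelChains X A χ).obj n →ₗ[ℝ] M}
    (h : ∀ b : (borelSSet X).obj n, f (borelMk b) = g (borelMk b)) : f = g :=
  quotChains_hom_ext (hR := borelRelators_compat X A χ) h

theorem borelChains_map {m n : SimplexCategoryᵒᵖ} (f : m ⟶ n) (b : (borelSSet X).obj m) :
    ((borelChains X A χ).map f).hom (borelMk b) = borelMk ((borelSSet X).map f b) :=
  quotChains_map_quotMk (hR := borelRelators_compat X A χ) f b

theorem borelRelators_le_ker {n : SimplexCategoryᵒᵖ} {M : Type} [AddCommGroup M] [Module ℝ M]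
    {F : (borelSSet X).obj n → M} (h1 : ∀ g b, F (borelSMul X g b) = ((χ g : ℤ) : ℝ) • F b)
    (h2 : ∀ b, b.2 ∈ A.obj n → F b = 0) :
    Submodule.span ℝ (borelRelators X A χ n) ≤ LinearMap.ker (Finsupp.linearCombination ℝ F) := by
  rw [Submodule.span_le]
  rintro _ (⟨g, x, rfl⟩ | ⟨x, hx, rfl⟩)
  · rw [SetLike.mem_coe, LinearMap.mem_ker, map_sub, map_smul]
    simp [h1]
  · rw [SetLike.mem_coe, LinearMap.mem_ker]
    simp [h2 x hx]

/-- A function on simplices of `EG × X` which is compatible with the relations induces a linear map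
on the chains of the Borel construction. -/
def borelLift {n : SimplexCategoryᵒᵖ} {M : Type} [AddCommGroup M] [Module ℝ M]
    (F : (borelSSet X).obj n → M) (h1 : ∀ g b, F (borelSMul X g b) = ((χ g : ℤ) : ℝ) • F b)
    (h2 : ∀ b, b.2 ∈ A.obj n → F b = 0) : (borelChains X A χ).obj n →ₗ[ℝ] M :=
  quotLift (hR := borelRelators_compat X A χ) F (borelRelators_le_ker h1 h2)

theorem borelLift_borelMk {n : SimplexCategoryᵒᵖ} {M : Type} [AddCommGroup M] [Module ℝ M]
    (F : (borelSSet X).obj n → M) (h1 : ∀ g b, F (borelSMul X g b) = ((χ g : ℤ) : ℝ) • F b)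
    (h2 : ∀ b, b.2 ∈ A.obj n → F b = 0) (b : (borelSSet X).obj n) :
    borelLift (A := A) F h1 h2 (borelMk b) = F b :=
  quotLift_quotMk (hR := borelRelators_compat X A χ) F (borelRelators_le_ker h1 h2) b

/-- A function on simplices which is compatible with the relations induces a linear map
on the coinvariants. -/
def coinvLift {n : SimplexCategoryᵒᵖ} {M : Type} [AddCommGroup M] [Module ℝ M]
    (F : X.V.obj n → M) (h1 : ∀ g x, F ((X.ρ g).app n x) = ((χ g : ℤ) : ℝ) • F x)
    (h2 : ∀ x ∈ A.obj n, F x = 0) : (coinvChains X A χ).obj n →ₗ[ℝ] M :=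
  quotLift (hR := coinvRelators_compat X A χ) F (coinvRelators_le_ker h1 h2)

theorem coinvLift_coinvMk {n : SimplexCategoryᵒᵖ} {M : Type} [AddCommGroup M] [Module ℝ M]
    (F : X.V.obj n → M) (h1 : ∀ g x, F ((X.ρ g).app n x) = ((χ g : ℤ) : ℝ) • F x)
    (h2 : ∀ x ∈ A.obj n, F x = 0) (x : X.V.obj n) :
    coinvLift (A := A) F h1 h2 (coinvMk x) = F x :=
  quotLift_quotMk (hR := coinvRelators_compat X A χ) F (coinvRelators_le_ker h1 h2) x

variable (X A χ)

/-- The projection from the chains of `(EG × X, EG × A)` to the twisted coinvariants. -/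
def toBorel : relChains (borelSSet X) (borelSub X A) ⟶ borelChains X A χ :=
  quotChainsDesc (hR := relators_compat (borelSub X A)) _ (fun _ b => borelMk b)
    (fun _ _ f b => (borelChains_map f b).symm)
    (fun _ => relators_le_ker fun _ hb => borelMk_eq_zero hb)

/-- The projection from the Borel construction to the quotient. -/
def borelToCoinv : borelChains X A χ ⟶ coinvChains X A χ :=
  quotChainsDesc (hR := borelRelators_compat X A χ) _ (fun _ b => coinvMk b.2)
    (fun _ _ f b => (coinvChains_map f b.2).symm)
    (fun _ => borelRelators_le_ker (fun g b => coinvMk_smul g b.2) fun _ hb => coinvMk_eq_zero hb)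

variable {X A χ}

theorem toBorel_relMk {n : SimplexCategoryᵒᵖ} (b : (borelSSet X).obj n) :
    ((toBorel X A χ).app n).hom (relMk (borelSub X A) b) = borelMk b :=
  quotChainsDesc_quotMk (hR := relators_compat (borelSub X A)) _ _ _ _ b

theorem borelToCoinv_borelMk {n : SimplexCategoryᵒᵖ} (b : (borelSSet X).obj n) :
    ((borelToCoinv X A χ).app n).hom (borelMk b) = coinvMk b.2 :=
  quotChainsDesc_quotMk (hR := borelRelators_compat X A χ) _ _ _ _ b

theorem coinv_mem_of_forall {n : SimplexCategoryᵒᵖ} (S : Submodule ℝ ((coinvChains X A χ).obj n))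
    (h : ∀ x, coinvMk x ∈ S) (y : (coinvChains X A χ).obj n) : y ∈ S := by
  have h1 : S.mkQ = 0 := coinv_hom_ext fun b => by
    rw [Submodule.mkQ_apply, (Submodule.Quotient.mk_eq_zero S).mpr (h b)]
    rfl
  rw [← Submodule.Quotient.mk_eq_zero S, ← Submodule.mkQ_apply, h1]
  rfl

theorem borelToCoinv_surjective {n : SimplexCategoryᵒᵖ} (y : (coinvChains X A χ).obj n) :
    ∃ z, ((borelToCoinv X A χ).app n).hom z = y :=
  coinv_mem_of_forall (LinearMap.range ((borelToCoinv X A χ).app n).hom)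
    (fun x => ⟨_, borelToCoinv_borelMk (fun _ => 1, x)⟩) y

theorem action_injective {n : SimplexCategoryᵒᵖ} (g : G) {x y : X.V.obj n}
    (h : (X.ρ g).app n x = (X.ρ g).app n y) : x = y := by
  have h1 := congrArg ((X.ρ g⁻¹).app n) h
  rwa [← action_mul_apply, inv_mul_cancel, action_one_apply, ← action_mul_apply, inv_mul_cancel,
    action_one_apply] at h1

theorem borelProj_mem {n : SimplexCategoryᵒᵖ} {b : (borelSSet X).obj n}
    (hb : b ∈ (borelSub X A).obj n) : (borelProj X).app n b ∈ A.obj n := hb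

/-- The relative chains of `EG × X` which vanish under the projection to `X`. -/
def borelKer (X : Action SSet.{0} G) (A : X.V.Subcomplex) (n : ℕ) :
    Submodule ℝ ((relChains (borelSSet X) (borelSub X A)).obj
      (Opposite.op (SimplexCategory.mk n))) :=
  LinearMap.ker ((relChainsMap (borelSub X A) A (borelProj X) (fun _ _ => borelProj_mem)).app _).hom

/-- Right exactness of coinvariants: the kernel downstairs is the image of the kernel upstairs. -/
theorem exists_mem_borelKer {n : ℕ}
    {y : (borelChains X A χ).obj (Opposite.op (SimplexCategory.mk n))}
    (hy : ((borelToCoinv X A χ).app _).hom y = 0) :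
    ∃ z ∈ borelKer X A n, ((toBorel X A χ).app _).hom z = y := by
  let S := (borelKer X A n).map ((toBorel X A χ).app _).hom
  have hS : ∀ b b' : (borelSSet X).obj (Opposite.op (SimplexCategory.mk n)), b.2 = b'.2 →
      (borelMk b - borelMk b' : (borelChains X A χ).obj _) ∈ S := by
    intro b b' hb
    refine ⟨relMk _ b - relMk _ b', ?_, ?_⟩
    · rw [SetLike.mem_coe, borelKer, LinearMap.mem_ker, map_sub, relChainsMap_relMk,
        relChainsMap_relMk, sub_eq_zero]
      exact congrArg (relMk A) hb
    · rw [map_sub, toBorel_relMk, toBorel_relMk]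
  -- Modulo `S` only the X-component of a simplex matters, so x ↦ (1, …, 1; x) is compatible with
  -- the action. Composed with the projection it is the quotient map by `S`, which forces the kernel
  -- into `S`.
  let θ : (coinvChains X A χ).obj (Opposite.op (SimplexCategory.mk n)) →ₗ[ℝ] _ ⧸ S :=
    coinvLift (A := A) (χ := χ) (fun x => S.mkQ (borelMk ((borelIncl X).app _ x))) (by
      intro g x
      have h1 := borelMk_smul (A := A) (χ := χ) (n := Opposite.op (SimplexCategory.mk n)) g
        ((borelIncl X).app _ x)
      rw [← map_smul, ← h1]
      exact (Submodule.Quotient.eq S).mpr (hS _ _ rfl)) (by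
      intro x hx
      rw [borelMk_eq_zero (b := (borelIncl X).app _ x) hx, map_zero])
  have hθ : θ ∘ₗ ((borelToCoinv X A χ).app _).hom = S.mkQ := by
    refine borel_hom_ext fun b => ?_
    rw [LinearMap.comp_apply, borelToCoinv_borelMk, coinvLift_coinvMk]
    exact (Submodule.Quotient.eq S).mpr (hS _ _ rfl)
  have h2 : S.mkQ y = 0 := by
    rw [← hθ, LinearMap.comp_apply, hy, map_zero]
  exact (Submodule.Quotient.mk_eq_zero S).mp h2

/-- Partitions of unity on the simplices of `X` which are not in `A`. -/
theorem exists_weights (hA : ∀ (g : G) n, ∀ x ∈ A.obj n, (X.ρ g).app n x ∈ A.obj n)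
    (hfin : ∀ n, ∀ x : X.V.obj n, x ∉ A.obj n → {g | (X.ρ g).app n x = x}.Finite)
    (n : SimplexCategoryᵒᵖ) :
    ∃ μ : X.V.obj n → (G →₀ ℝ), (∀ x ∉ A.obj n, ((μ x).sum fun _ a => a) = 1) ∧
      ∀ h g x, μ ((X.ρ h).app n x) (h * g) = μ x g := by
  classical
  let s : Setoid (X.V.obj n) :=
    { r := fun x y => ∃ g, (X.ρ g).app n x = y
      iseqv := ⟨fun x => ⟨1, action_one_apply x⟩, by
        rintro x _ ⟨g, rfl⟩
        exact ⟨g⁻¹, by rw [← action_mul_apply, inv_mul_cancel, action_one_apply]⟩, by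
        rintro x _ _ ⟨g, rfl⟩ ⟨h, rfl⟩
        exact ⟨h * g, action_mul_apply _ _ _⟩⟩ }
  let rep : X.V.obj n → X.V.obj n := fun x => (Quotient.mk s x).out
  have hrep : ∀ x, ∃ g, (X.ρ g).app n (rep x) = x := fun x => Quotient.mk_out (s := s) x
  have hrep2 : ∀ h x, rep ((X.ρ h).app n x) = rep x := fun h x =>
    congrArg Quotient.out (Quotient.sound (s := s) (⟨h, rfl⟩ : ∃ g, (X.ρ g).app n x = _)).symm
  -- The elements carrying the chosen orbit representative to x: a coset of the stabilizer of the
  -- representative.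
  let T : X.V.obj n → Set G := fun x => {g | (X.ρ g).app n (rep x) = x}
  have hT : ∀ h x g, h * g ∈ T ((X.ρ h).app n x) ↔ g ∈ T x := by
    intro h x g
    change (X.ρ (h * g)).app n (rep ((X.ρ h).app n x)) = _ ↔ (X.ρ g).app n (rep x) = x
    rw [hrep2, action_mul_apply]
    constructor
    · intro e
      exact action_injective h e
    · intro e
      rw [e]
  have hTimg : ∀ h x, T ((X.ρ h).app n x) = (fun g => h * g) '' T x := by
    intro h x
    ext g
    rw [Set.mem_image]
    constructor
    · intro hg
      exact ⟨h⁻¹ * g, (hT h x _).mp (by rwa [mul_inv_cancel_left]), by group⟩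
    · rintro ⟨g, hg, rfl⟩
      exact (hT h x g).mpr hg
  -- Uniform weights on the coset. The value 0 for an infinite coset can only occur over simplices
  -- of `A`, where no normalization is claimed.
  let μ : X.V.obj n → (G →₀ ℝ) := fun x =>
    if hx : (T x).Finite then Finsupp.indicator hx.toFinset (fun _ _ => ((T x).ncard : ℝ)⁻¹) else 0
  refine ⟨μ, fun x hx => ?_, fun h g x => ?_⟩
  · obtain ⟨g₀, hg₀⟩ := hrep x
    have hxr : rep x ∉ A.obj n := fun h => hx (by rw [← hg₀]; exact hA _ _ _ h)
    have hf : (T x).Finite := by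
      refine Set.Finite.of_finite_image (f := fun g => g₀⁻¹ * g) ((hfin n _ hxr).subset ?_)
        (fun a _ b _ hab => mul_left_cancel hab)
      rintro _ ⟨g, hg, rfl⟩
      change (X.ρ (g₀⁻¹ * g)).app n (rep x) = rep x
      rw [action_mul_apply, (show (X.ρ g).app n (rep x) = x from hg)]
      conv_lhs => rw [← hg₀]
      rw [← action_mul_apply, inv_mul_cancel, action_one_apply]
    have hμ : μ x = Finsupp.indicator hf.toFinset (fun _ _ => ((T x).ncard : ℝ)⁻¹) := dif_pos hf
    rw [hμ, Finsupp.sum_of_support_subset (s := hf.toFinset) _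
      (Finsupp.support_indicator_subset _ _) _ (fun _ _ => rfl)]
    rw [Finset.sum_congr rfl (g := fun _ => ((T x).ncard : ℝ)⁻¹) (fun g hg => by
      rw [Finsupp.indicator_of_mem hg])]
    rw [Finset.sum_const, ← Set.ncard_eq_toFinset_card _ hf, nsmul_eq_mul]
    refine mul_inv_cancel₀ ?_
    have : 0 < (T x).ncard := (Set.ncard_pos hf).mpr ⟨g₀, hg₀⟩
    positivity
  · have hfiff : (T ((X.ρ h).app n x)).Finite ↔ (T x).Finite := by
      rw [hTimg]
      exact Set.finite_image_iff (mul_right_injective h).injOn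
    have hcard : (T ((X.ρ h).app n x)).ncard = (T x).ncard := by
      rw [hTimg]
      exact Set.ncard_image_of_injective _ (mul_right_injective h)
    by_cases hx : (T x).Finite
    · simp only [μ, hx, hfiff.mpr hx, dif_pos, Finsupp.indicator_apply, Set.Finite.mem_toFinset, hT,
        hcard]
    · simp only [μ, hx, mt hfiff.mp hx, dif_neg, not_false_eq_true, Finsupp.coe_zero,
        Pi.zero_apply]

theorem homotopyMap_apply {M N : SimplicialObject (ModuleCat.{0} ℝ)} {f g : M ⟶ N}
    (H : SimplicialObject.Homotopy f g) (n : ℕ)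
    (y : M.obj (Opposite.op (SimplexCategory.mk n))) :
    homotopyMap H n y = -∑ k : Fin (n + 1), ((-1 : ℤ) ^ (k : ℕ)) • (H.h k).hom y := by
  have h : H.toChainHomotopy.hom n (n + 1) = _ := SimplicialObject.Homotopy.ToChainHomotopy.hom_eq H n
  unfold homotopyMap
  rw [h, ModuleCat.hom_neg, LinearMap.neg_apply, ModuleCat.hom_sum, LinearMap.sum_apply]
  refine congrArg _ (Finset.sum_congr rfl fun i _ => ?_)
  rw [ModuleCat.hom_zsmul, LinearMap.smul_apply]

/-- If the stabilizers of the simplices which are not in `A` are finite, then the equivariant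
homology is the homology of the twisted coinvariants. -/
theorem nonempty_equivariantHomology_equiv
    (hA : ∀ (g : G) n, ∀ x ∈ A.obj n, (X.ρ g).app n x ∈ A.obj n)
    (hfin : ∀ n, ∀ x : X.V.obj n, x ∉ A.obj n → {g | (X.ρ g).app n x = x}.Finite) (p : ℕ) :
    Nonempty (equivariantHomology X A χ p ≃ₗ[ℝ] simplicialHomology (coinvChains X A χ) p) := by
  classical
  let C := relChains (borelSSet X) (borelSub X A)
  let B : ℕ → Type := fun n => C.obj (Opposite.op (SimplexCategory.mk n))
  have hact : ∀ (g : G) n, ∀ b ∈ (borelSub X A).obj n, (borelAct X g).app n b ∈ (borelSub X A).obj n :=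
    fun g n b hb => hA g n b.2 hb
  let ρm : G → (C ⟶ C) := fun g => relChainsMap _ _ (borelAct X g) (hact g)
  let ρ : ∀ n, G → B n →ₗ[ℝ] B n := fun n g => ((ρm g).app _).hom
  have hρmk : ∀ n g (b : (borelSSet X).obj (Opposite.op (SimplexCategory.mk n))),
      ρ n g (relMk (borelSub X A) b) = relMk (borelSub X A) ((borelAct X g).app _ b) :=
    fun n g b => relChainsMap_relMk _ _ b
  let d : ∀ n, B (n + 1) →ₗ[ℝ] B n := fun n => faceD C n
  let π : C ⟶ relChains X.V A :=
    relChainsMap (borelSub X A) A (borelProj X) (fun _ _ => borelProj_mem)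
  have hπmk : ∀ n (b : (borelSSet X).obj n),
      (π.app n).hom (relMk (borelSub X A) b) = relMk A ((borelProj X).app n b) :=
    fun n b => relChainsMap_relMk _ _ b
  have hρ : ∀ n g h y, ρ n (g * h) y = ρ n g (ρ n h y) := by
    intro n g h
    refine fun y => congrArg (fun f => f y) (?_ : ρ n (g * h) = ρ n g ∘ₗ ρ n h)
    refine relChains_hom_ext fun b => ?_
    rw [LinearMap.comp_apply, hρmk, hρmk, hρmk]
    refine congrArg (relMk _) (Prod.ext (funext fun i => mul_assoc _ _ _) ?_)
    exact action_mul_apply _ _ _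
  have hρ1 : ∀ n y, ρ n 1 y = y := by
    intro n
    refine fun y => congrArg (fun f => f y) (?_ : ρ n 1 = LinearMap.id)
    refine relChains_hom_ext fun b => ?_
    rw [hρmk]
    exact congrArg (relMk _) (Prod.ext (funext fun i => one_mul _) (action_one_apply _))
  have hπρ : ∀ n g y, (π.app _).hom (ρ n g y) =
      (((relChainsMap A A (X.ρ g) (hA g)).app _).hom ((π.app _).hom y)) := by
    intro n g
    refine fun y => congrArg (fun f => f y) (?_ : (π.app _).hom ∘ₗ ρ n g =
      ((relChainsMap A A (X.ρ g) (hA g)).app _).hom ∘ₗ (π.app _).hom)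
    refine relChains_hom_ext fun b => ?_
    rw [LinearMap.comp_apply, hρmk, hπmk, LinearMap.comp_apply, hπmk, relChainsMap_relMk]
    rfl
  have hK : ∀ n g, ∀ y ∈ borelKer X A n, ρ n g y ∈ borelKer X A n := by
    intro n g y hy
    have hy' : (π.app _).hom y = 0 := hy
    change (π.app _).hom (ρ n g y) = 0
    rw [hπρ, hy', map_zero]
  have hdK : ∀ n, ∀ y ∈ borelKer X A (n + 1), d n y ∈ borelKer X A n := by
    intro n y hy
    have hy' : (π.app _).hom y = 0 := hy
    have h := faceD_naturality π n y
    rw [hy', map_zero] at h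
    exact h.symm
  have hconst : ∀ n, ∀ b ∈ (borelSub X A).obj n, (borelConst X).app n b ∈ (borelSub X A).obj n :=
    fun n b hb => hb
  have hid : ∀ n, ∀ b ∈ (borelSub X A).obj n, (𝟙 (borelSSet X) : borelSSet X ⟶ _).app n b ∈
    (borelSub X A).obj n := fun n b hb => hb
  have hincl : ∀ n, ∀ x ∈ A.obj n, (borelIncl X).app n x ∈ (borelSub X A).obj n :=
    fun n x hx => hx
  have hidX : ∀ n, ∀ x ∈ A.obj n, (𝟙 X.V : X.V ⟶ _).app n x ∈ A.obj n := fun n b hb => hb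
  have hrefl : ∀ (n : ℕ) (i : Fin (n + 1)), ∀ b ∈ A.obj (Opposite.op (SimplexCategory.mk n)),
      (SimplicialObject.Homotopy.refl (𝟙 X.V)).h i b ∈
        A.obj (Opposite.op (SimplexCategory.mk (n + 1))) := fun n i b hb => A.map _ hb
  let Hh := relChainsHomotopy hconst hid (borelContraction X) (fun n i b hb => hrefl n i b.2 hb)
  let Hx := relChainsHomotopy hidX hidX (SimplicialObject.Homotopy.refl (𝟙 X.V)) hrefl
  -- The contraction of EG covers the constant homotopy of X, and therefore preserves the kernel of
  -- the projection.
  have hπH : ∀ n y, (π.app _).hom (homotopyMap Hh n y) = homotopyMap Hx n ((π.app _).hom y) := by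
    intro n y
    rw [homotopyMap_apply, homotopyMap_apply, map_neg, map_sum]
    refine congrArg _ (Finset.sum_congr rfl fun k _ => ?_)
    rw [map_zsmul]
    refine congrArg _ (congrArg (fun f => f y)
      (?_ : (π.app _).hom ∘ₗ (Hh.h k).hom = (Hx.h k).hom ∘ₗ (π.app _).hom))
    refine relChains_hom_ext fun b => ?_
    rw [LinearMap.comp_apply, LinearMap.comp_apply, hπmk]
    refine (congrArg (π.app _).hom (relHom_relMk _ _ _ _)).trans
      (Eq.trans ?_ (relHom_relMk _ _ _ _).symm)
    exact hπmk _ _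
  -- The map to the vertex 1 of EG factors through the projection to X, so it vanishes on the
  -- kernel. There the homotopy connects 0 with the identity.
  have hconst0 : ∀ n, ∀ y ∈ borelKer X A n,
      ((relChainsMap _ _ (borelConst X) hconst).app _).hom y = 0 := by
    intro n y hy
    have hy' : (π.app _).hom y = 0 := hy
    have h : ((relChainsMap _ _ (borelConst X) hconst).app (Opposite.op (SimplexCategory.mk n))).hom =
        ((relChainsMap A (borelSub X A) (borelIncl X) hincl).app _).hom ∘ₗ
          (π.app _).hom := by
      refine relChains_hom_ext fun b => ?_
      rw [LinearMap.comp_apply, hπmk, relChainsMap_relMk, relChainsMap_relMk]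
      rfl
    rw [h, LinearMap.comp_apply, hy', map_zero]
  have hid' : ∀ n (y : B n), ((relChainsMap _ _ (𝟙 (borelSSet X)) hid).app _).hom y = y := by
    intro n
    refine fun y => congrArg (fun f => f y) (?_ :
      ((relChainsMap _ _ (𝟙 (borelSSet X)) hid).app _).hom = LinearMap.id)
    refine relChains_hom_ext fun b => ?_
    rw [relChainsMap_relMk]
    rfl
  choose μ hμ1 hμ2 using exists_weights hA hfin
  -- A simplex is distributed over G with the weights of its X-component. This is well defined on
  -- relative chains since simplices over `A` are zero.
  let P : ∀ n, B n →ₗ[ℝ] (G →₀ B n) := fun n =>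
    relLift (fun b => Finsupp.mapRange.linearMap (LinearMap.toSpanSingleton ℝ (B n)
      (relMk (borelSub X A) b)) (μ _ b.2)) (by
      intro b hb
      rw [relMk_eq_zero hb, LinearMap.toSpanSingleton_zero]
      ext g
      simp)
  have hPmk' : ∀ n b, P n (relMk (borelSub X A) b) = Finsupp.mapRange.linearMap
      (LinearMap.toSpanSingleton ℝ (B n) (relMk (borelSub X A) b)) (μ _ b.2) :=
    fun n b => relLift_relMk _ _ b
  have hPmk : ∀ n b g, P n (relMk (borelSub X A) b) g = μ _ b.2 g • relMk (borelSub X A) b := by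
    intro n b g
    rw [hPmk']
    rfl
  have hPsum : ∀ n y, ((P n y).sum fun _ v => v) = y := by
    intro n
    refine fun y => congrArg (fun f => f y) (?_ :
      Finsupp.lsum ℝ (fun _ : G => (LinearMap.id : B n →ₗ[ℝ] B n)) ∘ₗ P n = LinearMap.id)
    refine relChains_hom_ext fun b => ?_
    by_cases hb : b.2 ∈ A.obj _
    · rw [relMk_eq_zero (B := borelSub X A) hb, map_zero, map_zero]
    · rw [LinearMap.comp_apply, hPmk', Finsupp.lsum_apply, Finsupp.mapRange.linearMap_apply,
        Finsupp.sum_mapRange_index (by intro; rfl)]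
      change ((μ _ b.2).sum fun _ c => c • relMk (borelSub X A) b) = relMk (borelSub X A) b
      rw [Finsupp.sum, ← Finset.sum_smul]
      have := hμ1 _ b.2 hb
      rw [Finsupp.sum] at this
      rw [this, one_smul]
  have hP : ∀ n h g y, P n (ρ n h y) (h * g) = ρ n h (P n y g) := by
    intro n h g
    refine fun y => congrArg (fun f => f y) (?_ :
      Finsupp.lapply (h * g) ∘ₗ P n ∘ₗ ρ n h = ρ n h ∘ₗ Finsupp.lapply g ∘ₗ P n)
    refine relChains_hom_ext fun b => ?_
    rw [LinearMap.comp_apply, LinearMap.comp_apply, LinearMap.comp_apply, LinearMap.comp_apply,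
      Finsupp.lapply_apply, Finsupp.lapply_apply, hρmk, hPmk, hPmk, map_smul, hρmk]
    exact congrArg (· • _) (hμ2 _ h g b.2)
  have hPK : ∀ n, ∀ y ∈ borelKer X A n, ∀ g, P n y g ∈ borelKer X A n := by
    intro n y hy g
    have hy' : (π.app _).hom y = 0 := hy
    let m : (relChains X.V A).obj (Opposite.op (SimplexCategory.mk n)) →ₗ[ℝ]
        (relChains X.V A).obj (Opposite.op (SimplexCategory.mk n)) :=
      relLift (fun x => μ _ x g • relMk A x) (fun x hx => by rw [relMk_eq_zero hx, smul_zero])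
    have hm : (π.app _).hom ∘ₗ Finsupp.lapply g ∘ₗ P n = m ∘ₗ (π.app _).hom := by
      refine relChains_hom_ext fun b => ?_
      rw [LinearMap.comp_apply, LinearMap.comp_apply, LinearMap.comp_apply,
        Finsupp.lapply_apply, hPmk, map_smul, hπmk, relLift_relMk]
      rfl
    have h := congrArg (fun f => f y) hm
    simp only [LinearMap.comp_apply, hy', map_zero] at h
    exact h
  obtain ⟨hS0, hS⟩ := exists_equivariant_contraction (ρ := ρ) (d := d) (K := borelKer X A) hρ hρ1
    (fun n y => faceD_faceD C n y) (fun n g y => faceD_naturality (ρm g) n y) hK hdK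
    -- The homotopy runs from the constant map to the identity, so 0 = dH + Hd + 1 on the kernel and
    -- -H is the contraction.
    (fun n => -homotopyMap Hh n)
    (fun n y hy => by
      have hy' : (π.app _).hom y = 0 := hy
      change (π.app _).hom (-homotopyMap Hh n y) = 0
      rw [map_neg, hπH, hy', map_zero, neg_zero])
    (fun y hy => by
      have h := homotopy_zero Hh y
      rw [hconst0 0 y hy, hid' 0 y] at h
      change faceD C 0 (-homotopyMap Hh 0 y) = y
      rw [map_neg, neg_eq_iff_add_eq_zero]
      exact h.symm)
    (fun n y hy => by
      have h := homotopy_succ Hh n y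
      rw [hconst0 (n + 1) y hy, hid' (n + 1) y] at h
      change faceD C (n + 1) (-homotopyMap Hh (n + 1) y) + -homotopyMap Hh n (faceD C n y) = y
      rw [map_neg, ← neg_add, neg_eq_iff_add_eq_zero, add_comm (faceD _ _ _)]
      exact h.symm) P hPsum hP hPK
  have hdesc : ∀ n (S : B n →ₗ[ℝ] B (n + 1)), IsEquivariant ρ (borelKer X A) S →
      ∃ S' : (borelChains X A χ).obj (Opposite.op (SimplexCategory.mk n)) →ₗ[ℝ]
          (borelChains X A χ).obj (Opposite.op (SimplexCategory.mk (n + 1))),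
        ∀ z, S' (((toBorel X A χ).app _).hom z) = ((toBorel X A χ).app _).hom (S z) := by
    intro n S hS
    have hρχ : ∀ m g z, ((toBorel X A χ).app _).hom (ρ m g z) =
        ((χ g : ℤ) : ℝ) • ((toBorel X A χ).app _).hom z := by
      intro m g
      refine fun y => congrArg (fun f => f y) (?_ : ((toBorel X A χ).app _).hom ∘ₗ ρ m g =
        ((χ g : ℤ) : ℝ) • ((toBorel X A χ).app _).hom)
      refine relChains_hom_ext fun b => ?_
      rw [LinearMap.comp_apply, LinearMap.smul_apply, hρmk, toBorel_relMk, toBorel_relMk]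
      exact borelMk_smul g b
    let S' : (borelChains X A χ).obj (Opposite.op (SimplexCategory.mk n)) →ₗ[ℝ]
        (borelChains X A χ).obj (Opposite.op (SimplexCategory.mk (n + 1))) :=
      borelLift (fun b => ((toBorel X A χ).app _).hom (S (relMk (borelSub X A) b)))
        (fun g b => by
          rw [← hρχ, ← hS.1, hρmk]
          rfl)
        (fun b hb => by rw [relMk_eq_zero (B := borelSub X A) hb, map_zero, map_zero])
    refine ⟨S', fun z => congrArg (fun f => f z) (?_ : S' ∘ₗ ((toBorel X A χ).app _).hom =
      ((toBorel X A χ).app _).hom ∘ₗ S)⟩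
    refine relChains_hom_ext fun b => ?_
    rw [LinearMap.comp_apply, LinearMap.comp_apply, toBorel_relMk, borelLift_borelMk]
  have hker : ∀ n, ∀ z ∈ borelKer X A n,
      ((borelToCoinv X A χ).app _).hom (((toBorel X A χ).app _).hom z) = 0 := by
    intro n z hz
    have hz' : (π.app _).hom z = 0 := hz
    let c : (relChains X.V A).obj (Opposite.op (SimplexCategory.mk n)) →ₗ[ℝ]
        (coinvChains X A χ).obj (Opposite.op (SimplexCategory.mk n)) :=
      relLift (fun x => coinvMk x) (fun x hx => coinvMk_eq_zero hx)
    have hc : ((borelToCoinv X A χ).app _).hom ∘ₗ ((toBorel X A χ).app _).hom =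
        c ∘ₗ (π.app _).hom := by
      refine relChains_hom_ext fun b => ?_
      rw [LinearMap.comp_apply, LinearMap.comp_apply, hπmk, toBorel_relMk, borelToCoinv_borelMk,
        relLift_relMk]
      rfl
    have h := congrArg (fun f => f z) hc
    simp only [LinearMap.comp_apply, hz', map_zero] at h
    exact h
  have acyclic0 : ∀ y : (borelChains X A χ).obj (Opposite.op (SimplexCategory.mk 0)),
      ((borelToCoinv X A χ).app _).hom y = 0 →
      ∃ x, ((borelToCoinv X A χ).app _).hom x = 0 ∧ faceD (borelChains X A χ) 0 x = y := by
    intro y hy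
    obtain ⟨z, hz, rfl⟩ := exists_mem_borelKer hy
    obtain ⟨S, hSe, hSd⟩ := hS0
    refine ⟨((toBorel X A χ).app _).hom (S z), hker 1 _ (hSe.2 z hz), ?_⟩
    rw [faceD_naturality]
    exact congrArg _ (hSd z hz)
  have acyclic : ∀ n, ∀ y : (borelChains X A χ).obj (Opposite.op (SimplexCategory.mk (n + 1))),
      ((borelToCoinv X A χ).app _).hom y = 0 → faceD (borelChains X A χ) n y = 0 →
      ∃ x, ((borelToCoinv X A χ).app _).hom x = 0 ∧ faceD (borelChains X A χ) (n + 1) x = y := by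
    intro n y hy hdy
    obtain ⟨z, hz, rfl⟩ := exists_mem_borelKer hy
    obtain ⟨S, S', hSe, hSe', hSd⟩ := hS n
    obtain ⟨S₂, hS₂⟩ := hdesc n S hSe
    refine ⟨((toBorel X A χ).app _).hom (S' z), hker _ _ (hSe'.2 z hz), ?_⟩
    -- The lift `z` of a cycle need not be a cycle. The error term S(dz) vanishes in the
    -- coinvariants because `S` is equivariant and descends, and dz maps to 0.
    have h1 := congrArg ((toBorel X A χ).app _).hom (hSd z hz)
    rw [map_add, ← hS₂] at h1
    have h2 : ((toBorel X A χ).app _).hom (d n z) = 0 := by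
      rw [faceD_naturality] at hdy
      exact hdy
    rw [h2, map_zero, add_zero] at h1
    rw [faceD_naturality]
    exact h1
  let Q := (AlgebraicTopology.alternatingFaceMapComplex (ModuleCat.{0} ℝ)).obj (borelChains X A χ)
  have acyc : ∀ n, ∀ y : Q.X n, ((borelToCoinv X A χ).app _).hom y = 0 →
      (Q.d n ((ComplexShape.down ℕ).next n)).hom y = 0 →
      ∃ x, ((borelToCoinv X A χ).app _).hom x = 0 ∧ faceD (borelChains X A χ) n x = y := by
    rintro (_ | n) y h1 h2
    · exact acyclic0 y h1
    · exact acyclic n y h1 ((d_next_succ Q n y).mp h2)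
  have hcyc : ∀ n, ∀ z : Q.X n, (Q.d n ((ComplexShape.down ℕ).next n)).hom z = 0 →
      ((((AlgebraicTopology.alternatingFaceMapComplex (ModuleCat.{0} ℝ)).obj
        (coinvChains X A χ)).d n ((ComplexShape.down ℕ).next n)).hom
          (((borelToCoinv X A χ).app _).hom z)) = 0 := by
    intro n z hz
    have h := congrArg (fun f => f.hom z) (((AlgebraicTopology.alternatingFaceMapComplex
      (ModuleCat.{0} ℝ)).map (borelToCoinv X A χ)).comm n ((ComplexShape.down ℕ).next n))
    exact h.trans ((congrArg ((borelToCoinv X A χ).app (Opposite.op (SimplexCategory.mk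
      ((ComplexShape.down ℕ).next n)))).hom hz).trans (map_zero _))
  refine nonempty_homology_equiv (K := Q)
    (L := (AlgebraicTopology.alternatingFaceMapComplex (ModuleCat.{0} ℝ)).obj (coinvChains X A χ))
    (p := p) (q := p) ((borelToCoinv X A χ).app _).hom (hcyc p) (fun x => ⟨((borelToCoinv X A χ).app _).hom x, ?_⟩) ?_ ?_
  · exact faceD_naturality _ _ _
  · intro (z : (borelChains X A χ).obj (Opposite.op (SimplexCategory.mk p))) hz y hy
    obtain ⟨y', rfl⟩ := borelToCoinv_surjective y
    -- Injectivity: after subtracting the boundary of a lift of `y`, the cycle lies in the acyclic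
    -- kernel.
    have h1 : ((borelToCoinv X A χ).app _).hom (z - faceD (borelChains X A χ) p y') = 0 := by
      rw [map_sub, ← faceD_naturality, sub_eq_zero]
      exact hy.symm
    have h2 : (Q.d p ((ComplexShape.down ℕ).next p)).hom
        (z - faceD (borelChains X A χ) p y') = 0 := by
      rw [map_sub, hz, zero_sub, neg_eq_zero]
      exact congrArg (fun f => f.hom y') (Q.d_comp_d (p + 1) p ((ComplexShape.down ℕ).next p))
    obtain ⟨x, -, hx⟩ := acyc p _ h1 h2
    refine ⟨x + y', ?_⟩
    change faceD (borelChains X A χ) p (x + y') = z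
    rw [map_add, hx, sub_add_cancel]
  · intro z' hz'
    obtain ⟨b, rfl⟩ := borelToCoinv_surjective z'
    -- Surjectivity: the boundary of a lift of a cycle lies in the kernel and bounds there, so the
    -- lift can be corrected. In degree 0 every chain is a cycle and no correction is needed.
    rcases p with _ | p
    · refine ⟨b, ?_, 0, ?_⟩
      · rw [d_next_zero]; rfl
      · rw [map_zero, sub_self]
    · have h1 : faceD (coinvChains X A χ) p (((borelToCoinv X A χ).app _).hom b) = 0 :=
        (d_next_succ _ p _).mp hz'
      rw [faceD_naturality] at h1
      have h2 : (Q.d p ((ComplexShape.down ℕ).next p)).hom (faceD (borelChains X A χ) p b) = 0 :=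
        congrArg (fun f => f.hom b) (Q.d_comp_d (p + 1) p ((ComplexShape.down ℕ).next p))
      obtain ⟨x, hx0, hx⟩ := acyc p _ h1 h2
      refine ⟨b - x, ?_, 0, ?_⟩
      · rw [d_next_succ]
        change faceD (borelChains X A χ) p (b - x) = 0
        rw [map_sub, hx, sub_self]
      · rw [map_zero, map_sub, hx0, sub_zero, sub_self]

end Borel

end

/-! ### Barycentric subdivision, averaging and the homotopy between them -/

section

/-! ### Chains on tuples -/

/-- Formal linear combinations of `(n + 1)`-tuples. -/
abbrev TupleChain (α : Type) (n : ℕ) : Type := (Fin (n + 1) → α) →₀ ℝ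

section Tuples

variable {α β : Type}

theorem tuple_hom_ext {n : ℕ} {M : Type} [AddCommGroup M] [Module ℝ M]
    {f g : TupleChain α n →ₗ[ℝ] M}
    (h : ∀ S, f (Finsupp.single S 1) = g (Finsupp.single S 1)) : f = g :=
  Finsupp.lhom_ext' fun S => LinearMap.ext_ring (h S)

/-- The alternating sum of the faces. -/
def tupleD (α : Type) (n : ℕ) : TupleChain α (n + 1) →ₗ[ℝ] TupleChain α n :=
  Finsupp.lift _ ℝ _ fun S => ∑ i : Fin (n + 2), (-1 : ℝ) ^ (i : ℕ) • Finsupp.single (S ∘ i.succAbove) 1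

theorem tupleD_single {n : ℕ} (S : Fin (n + 2) → α) :
    tupleD α n (Finsupp.single S 1) =
      ∑ i : Fin (n + 2), (-1 : ℝ) ^ (i : ℕ) • Finsupp.single (S ∘ i.succAbove) 1 := by
  simp [tupleD]

/-- The sum of the coefficients. -/
def tupleAug (α : Type) : TupleChain α 0 →ₗ[ℝ] ℝ := Finsupp.lift _ ℝ _ fun _ => 1

theorem tupleAug_single (S : Fin 1 → α) : tupleAug α (Finsupp.single S 1) = 1 := by
  simp [tupleAug]

/-- The cone with apex `t`. -/
def cone (t : α) (n : ℕ) : TupleChain α n →ₗ[ℝ] TupleChain α (n + 1) :=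
  (-1 : ℝ) ^ (n + 1) • Finsupp.lmapDomain ℝ ℝ fun S => Fin.snoc (α := fun _ => α) S t

theorem cone_single (t : α) {n : ℕ} (S : Fin (n + 1) → α) :
    cone t n (Finsupp.single S 1) =
      (-1 : ℝ) ^ (n + 1) • Finsupp.single (Fin.snoc (α := fun _ => α) S t) 1 := by
  rw [cone, LinearMap.smul_apply, Finsupp.lmapDomain_apply, Finsupp.mapDomain_single]

theorem snoc_comp_castSucc_succAbove {n : ℕ} (S : Fin (n + 2) → α) (t : α) (i : Fin (n + 2)) :
    Fin.snoc (α := fun _ => α) S t ∘ i.castSucc.succAbove =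
      Fin.snoc (α := fun _ => α) (S ∘ i.succAbove) t := by
  funext x
  refine Fin.lastCases ?_ (fun x => ?_) x
  · rw [Function.comp_apply, show i.castSucc.succAbove (Fin.last (n + 1)) = Fin.last (n + 2) from
      Fin.succAbove_ne_last_last (Fin.castSucc_lt_last i).ne, Fin.snoc_last, Fin.snoc_last]
  · rw [Function.comp_apply, Fin.castSucc_succAbove_castSucc, Fin.snoc_castSucc, Fin.snoc_castSucc]
    rfl

theorem snoc_comp_last_succAbove {n : ℕ} (S : Fin (n + 1) → α) (t : α) :
    Fin.snoc (α := fun _ => α) S t ∘ (Fin.last (n + 1)).succAbove = S := by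
  funext x
  rw [Function.comp_apply, Fin.succAbove_last, Fin.snoc_castSucc]

/-- The apex is appended at the end, so the face omitting it has sign (-1)^(n+2); the sign in `cone`
cancels this and leaves x with coefficient 1. -/
theorem tupleD_cone (t : α) {n : ℕ} (x : TupleChain α (n + 1)) :
    tupleD α (n + 1) (cone t (n + 1) x) = x - cone t n (tupleD α n x) := by
  suffices h : tupleD α (n + 1) ∘ₗ cone t (n + 1) = LinearMap.id - cone t n ∘ₗ tupleD α n from
    congrArg (fun f => f x) h
  refine tuple_hom_ext fun S => ?_
  rw [LinearMap.comp_apply, LinearMap.sub_apply, LinearMap.comp_apply, LinearMap.id_apply,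
    cone_single, map_smul, tupleD_single, tupleD_single, Fin.sum_univ_castSucc, map_sum]
  simp only [snoc_comp_castSucc_succAbove, snoc_comp_last_succAbove, map_smul, cone_single,
    Fin.val_castSucc, Fin.val_last]
  have hev : ((-1 : ℝ) ^ (n + 1 + 1)) * (-1) ^ (n + 2) = 1 := by
    rw [← mul_pow]; simp
  rw [smul_add, smul_smul, hev, one_smul, sub_eq_neg_add, ← Finset.sum_neg_distrib,
    Finset.smul_sum]
  congr 1
  refine Finset.sum_congr rfl fun i _ => ?_
  rw [smul_smul, smul_smul, ← neg_smul]
  congr 1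
  ring

theorem tupleD_cone_zero (t : α) (x : TupleChain α 0) :
    tupleD α 0 (cone t 0 x) = x - tupleAug α x • Finsupp.single (fun _ => t) 1 := by
  suffices h : tupleD α 0 ∘ₗ cone t 0 =
      LinearMap.id - (tupleAug α).smulRight (Finsupp.single (fun _ => t) 1) from
    congrArg (fun f => f x) h
  refine tuple_hom_ext fun S => ?_
  have h0 : Fin.snoc (α := fun _ => α) S t ∘ Fin.succAbove 0 = fun _ => t := by
    funext x; rw [Subsingleton.elim x 0]; rfl
  have h1 : Fin.snoc (α := fun _ => α) S t ∘ Fin.succAbove 1 = S := by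
    funext x; rw [Subsingleton.elim x 0]; rfl
  rw [LinearMap.comp_apply, LinearMap.sub_apply, LinearMap.smulRight_apply, LinearMap.id_apply,
    cone_single, map_smul, tupleD_single, tupleAug_single, Fin.sum_univ_two]
  rw [h0, h1]
  simp only [zero_add, pow_one, Fin.val_zero, pow_zero, one_smul, Fin.val_one, neg_smul, neg_add,
    neg_neg]
  abel

theorem tupleAug_tupleD (x : TupleChain α 1) : tupleAug α (tupleD α 0 x) = 0 := by
  suffices h : tupleAug α ∘ₗ tupleD α 0 = 0 from congrArg (fun f => f x) h
  refine tuple_hom_ext fun S => ?_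
  rw [LinearMap.comp_apply, tupleD_single, Fin.sum_univ_two, map_add, map_smul, map_smul,
    tupleAug_single, tupleAug_single]
  simp

/-- Every tuple is a cone over its initial segment, so identities for the boundary can be proved by
induction from the cone formula. -/
theorem single_eq_cone {n : ℕ} (S : Fin (n + 2) → α) :
    (Finsupp.single S 1 : TupleChain α (n + 1)) =
      cone (S (Fin.last _)) n ((-1 : ℝ) ^ (n + 1) • Finsupp.single (S ∘ Fin.castSucc) 1) := by
  have h : Fin.snoc (α := fun _ => α) (S ∘ Fin.castSucc) (S (Fin.last _)) = S :=
    Fin.snoc_init_self S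
  rw [map_smul, cone_single, h, smul_smul, ← pow_add, Even.neg_one_pow (by simp), one_smul]

/-- For a cone, d(x - cone(dx)) = dx - dx + cone(ddx), and the last term vanishes by induction; in
the lowest degree the augmentation of dx takes its place. -/
theorem tupleD_tupleD {n : ℕ} (x : TupleChain α (n + 2)) : tupleD α n (tupleD α (n + 1) x) = 0 := by
  suffices h : tupleD α n ∘ₗ tupleD α (n + 1) = 0 from congrArg (fun f => f x) h
  induction n with
  | zero =>
    refine tuple_hom_ext fun S => ?_
    rw [LinearMap.comp_apply, single_eq_cone, tupleD_cone, map_sub, tupleD_cone_zero,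
      tupleAug_tupleD]
    simp
  | succ n ih =>
    refine tuple_hom_ext fun S => ?_
    have h := fun x => congrArg (fun f => f x) (ih (x := 0))
    rw [LinearMap.comp_apply, single_eq_cone, tupleD_cone, map_sub, tupleD_cone]
    simp only [LinearMap.comp_apply, LinearMap.zero_apply] at h
    rw [h]
    simp

/-- Cycles moving j and σ(j) to the front turn σ into a permutation fixing 0. Its restriction to the
remaining places is σ', and the two cycles account for the signs. -/
theorem exists_perm_succAbove {k : ℕ} (σ : Equiv.Perm (Fin (k + 1))) (j : Fin (k + 1)) :
    ∃ σ' : Equiv.Perm (Fin k), (∀ x, σ (j.succAbove x) = (σ j).succAbove (σ' x)) ∧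
      ((Equiv.Perm.sign σ' : ℤ) : ℝ) * (-1) ^ (σ j : ℕ) =
        ((Equiv.Perm.sign σ : ℤ) : ℝ) * (-1) ^ (j : ℕ) := by
  let τ : Equiv.Perm (Fin (k + 1)) := j.cycleRange.symm.trans (σ.trans (σ j).cycleRange)
  obtain ⟨⟨q, σ'⟩, hq⟩ : ∃ q, Equiv.Perm.decomposeFin.symm q = τ :=
    ⟨_, Equiv.symm_apply_apply _ _⟩
  have hτ0 : τ 0 = 0 := by simp [τ]
  have hq0 : q = 0 := by
    rw [← hq] at hτ0; simpa using hτ0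
  subst hq0
  refine ⟨σ', fun x => ?_, ?_⟩
  · have h1 : τ x.succ = (σ' x).succ := by rw [← hq]; simp
    have h2 : (σ j).cycleRange (σ (j.succAbove x)) = (σ' x).succ := by
      rw [← h1]; simp [τ]
    rw [← Fin.cycleRange_symm_succ (σ j), ← h2, Equiv.symm_apply_apply]
  · have hs : Equiv.Perm.sign σ' = Equiv.Perm.sign τ := by
      rw [← hq]; simp
    have hs2 : Equiv.Perm.sign τ = (-1) ^ (σ j : ℕ) * Equiv.Perm.sign σ * (-1) ^ (j : ℕ) := by
      simp only [τ]
      rw [Equiv.Perm.sign_trans, Equiv.Perm.sign_trans, Equiv.Perm.sign_symm,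
        Fin.sign_cycleRange, Fin.sign_cycleRange]
    rw [hs, hs2]
    push_cast
    have : ((-1 : ℝ) ^ (σ j : ℕ)) * (-1) ^ (σ j : ℕ) = 1 := by
      rw [← mul_pow]; simp
    linear_combination ((Equiv.Perm.sign σ : ℤ) : ℝ) * (-1) ^ (j : ℕ) * this

/-- A function of tuples changes by the sign under permutations. -/
def IsAlternating {n : ℕ} {M : Type} [AddCommGroup M] [Module ℝ M] (w : (Fin n → α) → M) : Prop :=
  ∀ (f : Fin n → α) (σ : Equiv.Perm (Fin n)), w (f ∘ σ) = ((Equiv.Perm.sign σ : ℤ) : ℝ) • w f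

/-- Swapping two equal entries fixes the tuple and changes the sign, so twice the value is 0. -/
theorem IsAlternating.eq_zero {n : ℕ} {M : Type} [AddCommGroup M] [Module ℝ M]
    {w : (Fin n → α) → M} (hw : IsAlternating w) {f : Fin n → α} (hf : ¬ Function.Injective f) :
    w f = 0 := by
  obtain ⟨i, j, hij, hne⟩ : ∃ i j, f i = f j ∧ i ≠ j := by
    simpa [Function.Injective] using hf
  have h := hw f (Equiv.swap i j)
  have h2 : f ∘ Equiv.swap i j = f := by
    funext x
    rw [Function.comp_apply, Equiv.swap_apply_def]
    split_ifs with h1 h2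
    · rw [h1, hij]
    · rw [h2, hij]
    · rfl
  rw [h2, Equiv.Perm.sign_swap hne] at h
  have h3 : (2 : ℝ) • w f = 0 := by
    rw [two_smul]
    nth_rewrite 1 [h]
    simp
  exact (smul_eq_zero.mp h3).resolve_left two_ne_zero

/-- A permutation σ carries the i-th face to the σ(i)-th one up to the permutation of
`exists_perm_succAbove`, whose sign compensates the change of (-1)^i. -/
theorem IsAlternating.faceSum {n : ℕ} {M : Type} [AddCommGroup M] [Module ℝ M]
    {w : (Fin (n + 1) → α) → M} (hw : IsAlternating w) :
    IsAlternating fun f : Fin (n + 2) → α =>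
      ∑ i : Fin (n + 2), (-1 : ℝ) ^ (i : ℕ) • w (f ∘ i.succAbove) := by
  intro f σ
  have key : ∀ i : Fin (n + 2), (-1 : ℝ) ^ (i : ℕ) • w ((f ∘ σ) ∘ i.succAbove) =
      ((Equiv.Perm.sign σ : ℤ) : ℝ) • ((-1 : ℝ) ^ (σ i : ℕ) • w (f ∘ (σ i).succAbove)) := by
    intro i
    obtain ⟨σ', h1, h2⟩ := exists_perm_succAbove σ i
    have h3 : (f ∘ σ) ∘ i.succAbove = (f ∘ (σ i).succAbove) ∘ σ' := by
      funext x; exact congrArg f (h1 x)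
    rw [h3, hw, smul_smul, smul_smul]
    congr 1
    have e1 : ((-1 : ℝ) ^ (σ i : ℕ)) * (-1) ^ (σ i : ℕ) = 1 := by rw [← mul_pow]; simp
    have e2 : ((-1 : ℝ) ^ (i : ℕ)) * (-1) ^ (i : ℕ) = 1 := by rw [← mul_pow]; simp
    linear_combination (-1 : ℝ) ^ (i : ℕ) * (-1 : ℝ) ^ (σ i : ℕ) * h2 -
      (-1 : ℝ) ^ (i : ℕ) * ((Equiv.Perm.sign σ' : ℤ) : ℝ) * e1 +
      (-1 : ℝ) ^ (σ i : ℕ) * ((Equiv.Perm.sign σ : ℤ) : ℝ) * e2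
  change ∑ i : Fin (n + 2), (-1 : ℝ) ^ (i : ℕ) • w ((f ∘ σ) ∘ i.succAbove) = _
  rw [Finset.sum_congr rfl fun i _ => key i, ← Finset.smul_sum]
  congr 1
  exact Equiv.sum_comp σ fun i => (-1 : ℝ) ^ (i : ℕ) • w (f ∘ i.succAbove)

end Tuples

/-! ### Subdivision of ordered simplices -/

section Subdivision

set_option linter.unusedSectionVars false

variable {E E' : Type} [DecidableEq E] [DecidableEq E']

/-- The barycentric subdivision of the simplex with vertices `f 0, …, f n`. -/
def sd : (n : ℕ) → (Fin (n + 1) → E) → TupleChain (Finset E) n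
  | 0, f => Finsupp.single (fun _ => {f 0}) 1
  | n + 1, f => cone (Finset.univ.image f) n
      (∑ i : Fin (n + 2), (-1 : ℝ) ^ (i : ℕ) • sd n (f ∘ i.succAbove))

/-- The linear extension of the subdivision. -/
def sdL (n : ℕ) : TupleChain E n →ₗ[ℝ] TupleChain (Finset E) n := Finsupp.lift _ ℝ _ (sd n)

theorem sdL_single {n : ℕ} (f : Fin (n + 1) → E) : sdL n (Finsupp.single f 1) = sd n f := by
  simp [sdL]

theorem sd_succ {n : ℕ} (f : Fin (n + 2) → E) :
    sd (n + 1) f = cone (Finset.univ.image f) n (sdL n (tupleD E n (Finsupp.single f 1))) := by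
  rw [sd, tupleD_single, map_sum (sdL n)]
  simp only [map_smul, sdL_single]

theorem tupleAug_sd (f : Fin 1 → E) : tupleAug _ (sd 0 f) = 1 := by
  rw [sd, tupleAug_single]

theorem tupleAug_sdL (x : TupleChain E 0) : tupleAug _ (sdL 0 x) = tupleAug _ x := by
  suffices h : tupleAug _ ∘ₗ sdL 0 = tupleAug E from congrArg (fun f => f x) h
  refine tuple_hom_ext fun S => ?_
  rw [LinearMap.comp_apply, sdL_single, tupleAug_sd, tupleAug_single]

/-- Subdivision is the cone over the subdivided boundary, which is a cycle by induction; the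
boundary of a cone over a cycle is the cycle itself. -/
theorem tupleD_sdL {n : ℕ} (x : TupleChain E (n + 1)) :
    tupleD _ n (sdL (n + 1) x) = sdL n (tupleD E n x) := by
  suffices h : tupleD _ n ∘ₗ sdL (n + 1) = sdL n ∘ₗ tupleD E n from congrArg (fun f => f x) h
  induction n with
  | zero =>
    refine tuple_hom_ext fun f => ?_
    rw [LinearMap.comp_apply, LinearMap.comp_apply, sdL_single, sd_succ, tupleD_cone_zero,
      tupleAug_sdL, tupleAug_tupleD, zero_smul, sub_zero]
  | succ n ih =>
    refine tuple_hom_ext fun f => ?_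
    have h := fun x => congrArg (fun f => f x) (ih (x := 0))
    simp only [LinearMap.comp_apply] at h
    rw [LinearMap.comp_apply, LinearMap.comp_apply, sdL_single, sd_succ, tupleD_cone, h,
      tupleD_tupleD]
    simp

theorem tupleD_sd {n : ℕ} (f : Fin (n + 2) → E) :
    tupleD _ n (sd (n + 1) f) = ∑ i : Fin (n + 2), (-1 : ℝ) ^ (i : ℕ) • sd n (f ∘ i.succAbove) := by
  rw [← sdL_single, tupleD_sdL, tupleD_single, map_sum]
  simp only [map_smul, sdL_single]

/-- The apex, being the set of all vertices, does not depend on their order, and the face sum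
alternates. -/
theorem sd_alternating (n : ℕ) : IsAlternating (sd (E := E) n) := by
  induction n with
  | zero =>
    intro f σ
    have hσ : σ = 1 := Equiv.ext fun x => Subsingleton.elim (α := Fin 1) _ _
    subst hσ
    simp
  | succ n ih =>
    intro f σ
    have himg : Finset.univ.image (f ∘ σ) = Finset.univ.image f := by
      ext x
      simp only [Finset.mem_image, Finset.mem_univ, true_and, Function.comp_apply]
      exact ⟨fun ⟨a, h⟩ => ⟨σ a, h⟩, fun ⟨a, h⟩ => ⟨σ.symm a, by simpa using h⟩⟩
    rw [sd, sd, himg, ← map_smul]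
    exact congrArg _ (ih.faceSum f σ)

/-! ### Averages -/

section Average

variable {M N : Type} [AddCommGroup M] [Module ℝ M] [AddCommGroup N] [Module ℝ N]

/-- The average of a function over a product of finite sets. -/
def avg {n : ℕ} (S : Fin n → Finset E) (F : (Fin n → E) → M) : M :=
  (∏ i, ((S i).card : ℝ)⁻¹) • ∑ f ∈ Fintype.piFinset S, F f

theorem avg_map {n : ℕ} (S : Fin n → Finset E) (F : (Fin n → E) → M) (a : M →ₗ[ℝ] N) :
    a (avg S F) = avg S fun f => a (F f) := by
  simp [avg, map_sum]

theorem avg_congr {n : ℕ} (S : Fin n → Finset E) {F F' : (Fin n → E) → M}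
    (h : ∀ f, (∀ i, f i ∈ S i) → F f = F' f) : avg S F = avg S F' := by
  unfold avg
  rw [Finset.sum_congr rfl fun f hf => h f (Fintype.mem_piFinset.mp hf)]

theorem avg_smul {n : ℕ} (S : Fin n → Finset E) (F : (Fin n → E) → M) (c : ℝ) :
    avg S (fun f => c • F f) = c • avg S F := by
  rw [avg, ← Finset.smul_sum, smul_comm, avg]

theorem avg_sum {n : ℕ} {ι : Type} (s : Finset ι) (S : Fin n → Finset E)
    (F : ι → (Fin n → E) → M) : avg S (fun f => ∑ i ∈ s, F i f) = ∑ i ∈ s, avg S (F i) := by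
  simp only [avg]
  rw [Finset.sum_comm, Finset.smul_sum]

theorem avg_embedding {n : ℕ} (ι : E ↪ E') (S : Fin n → Finset E) (F : (Fin n → E') → M) :
    avg (fun i => (S i).map ι) F = avg S fun f => F (ι ∘ f) := by
  unfold avg
  simp only [Finset.card_map]
  congr 1
  symm
  refine Finset.sum_bij (fun f _ => ι ∘ f) ?_ ?_ ?_ ?_
  · intro f hf
    rw [Fintype.mem_piFinset] at hf ⊢
    exact fun i => Finset.mem_map_of_mem ι (hf i)
  · intro f _ g _ h
    funext i
    exact ι.injective (congrFun h i)
  · intro g hg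
    rw [Fintype.mem_piFinset] at hg
    choose f hf hfg using fun i => Finset.mem_map.mp (hg i)
    exact ⟨f, Fintype.mem_piFinset.mpr hf, funext hfg⟩
  · intro f _; rfl

theorem sum_piFinset_succ {n : ℕ} (p : Fin (n + 1)) (S : Fin (n + 1) → Finset E)
    (F : (Fin (n + 1) → E) → M) : ∑ f ∈ Fintype.piFinset S, F f =
      ∑ t ∈ S p, ∑ f ∈ Fintype.piFinset (S ∘ p.succAbove), F (p.insertNth t f) := by
  rw [← Finset.sum_product']
  refine Finset.sum_bij' (fun f _ => (f p, f ∘ p.succAbove))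
    (fun x _ => p.insertNth (α := fun _ => E) x.1 x.2) ?_ ?_ ?_ ?_ ?_
  · intro f hf
    rw [Fintype.mem_piFinset] at hf
    exact Finset.mem_product.mpr ⟨hf p, Fintype.mem_piFinset.mpr fun i => hf _⟩
  · rintro ⟨t, f⟩ h
    obtain ⟨h1, h2⟩ := Finset.mem_product.mp h
    rw [Fintype.mem_piFinset] at h2 ⊢
    intro i
    refine Fin.succAboveCases p ?_ (fun j => ?_) i
    · simpa using h1
    · simpa using h2 j
  · intro f _
    exact Fin.insertNth_self_removeNth p f
  · rintro ⟨t, f⟩ _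
    refine Prod.ext (by simp) (funext fun i => by simp)
  · intro f _
    exact congrArg F (Fin.insertNth_self_removeNth p f).symm

theorem avg_succ {n : ℕ} (p : Fin (n + 1)) (S : Fin (n + 1) → Finset E)
    (F : (Fin (n + 1) → E) → M) : avg S F =
      ((S p).card : ℝ)⁻¹ • ∑ t ∈ S p, avg (S ∘ p.succAbove) fun f => F (p.insertNth t f) := by
  simp only [avg]
  rw [sum_piFinset_succ p, Fin.prod_univ_succAbove _ p, mul_smul, ← Finset.smul_sum]
  rfl

/-- Averaging over a coordinate on which the function does not depend has no effect. The face must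
be nonempty: otherwise the left side is an empty sum. -/
theorem avg_face {n : ℕ} (p : Fin (n + 1)) (S : Fin (n + 1) → Finset E) (hS : (S p).Nonempty)
    (F : (Fin n → E) → M) : avg S (fun f => F (f ∘ p.succAbove)) = avg (S ∘ p.succAbove) F := by
  rw [avg_succ p]
  have h : ∀ t (f : Fin n → E), (p.insertNth (α := fun _ => E) t f) ∘ p.succAbove = f :=
    fun t f => funext fun i => by simp
  have h2 : ((S p).card : ℝ) ≠ 0 := by simpa using hS.ne_empty
  simp only [h, Finset.sum_const]
  rw [← Nat.cast_smul_eq_nsmul ℝ, smul_smul, inv_mul_cancel₀ h2, one_smul]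

/-- The linear extension of the average over the vertices of the faces. -/
def evalW {n : ℕ} (w : (Fin (n + 1) → E) → M) : TupleChain (Finset E) n →ₗ[ℝ] M :=
  Finsupp.lift _ ℝ _ fun S => avg S w

theorem evalW_single {n : ℕ} (w : (Fin (n + 1) → E) → M) (S : Fin (n + 1) → Finset E) :
    evalW w (Finsupp.single S 1) = avg S w := by
  simp [evalW]

theorem evalW_cone {n : ℕ} (w : (Fin (n + 2) → E) → M) (T : Finset E)
    (x : TupleChain (Finset E) n) : evalW w (cone T n x) =
      ((-1 : ℝ) ^ (n + 1) * (T.card : ℝ)⁻¹) •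
        ∑ t ∈ T, evalW (fun f => w (Fin.snoc (α := fun _ => E) f t)) x := by
  suffices h : evalW w ∘ₗ cone T n = ((-1 : ℝ) ^ (n + 1) * (T.card : ℝ)⁻¹) •
      ∑ t ∈ T, evalW (fun f => w (Fin.snoc (α := fun _ => E) f t)) by
    have := congrArg (fun f => f x) h
    simpa only [LinearMap.smul_apply, LinearMap.sum_apply, LinearMap.comp_apply] using this
  refine tuple_hom_ext fun S => ?_
  rw [LinearMap.comp_apply, LinearMap.smul_apply, LinearMap.sum_apply, cone_single, map_smul,
    evalW_single, avg_succ (Fin.last _), mul_smul, snoc_comp_last_succAbove, Fin.snoc_last]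
  simp only [evalW_single, Fin.insertNth_last']

theorem snoc_comp_perm_alternating {n : ℕ} {w : (Fin (n + 1) → E) → M} (hw : IsAlternating w)
    (t : E) : IsAlternating fun f => w (Fin.snoc (α := fun _ => E) f t) := by
  intro f σ
  obtain ⟨τ, hτ1, hτ2, hτ3⟩ : ∃ τ : Equiv.Perm (Fin (n + 1)), (∀ x : Fin n, τ x.castSucc = (σ x).castSucc) ∧
      τ (Fin.last _) = Fin.last _ ∧ Equiv.Perm.sign τ = Equiv.Perm.sign σ := by
    refine ⟨finSuccEquivLast.symm.permCongr (Equiv.optionCongr σ), ?_, ?_, ?_⟩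
    · intro x; simp [Equiv.permCongr_apply]
    · simp [Equiv.permCongr_apply]
    · rw [Equiv.Perm.sign_permCongr, Equiv.optionCongr_sign]
  have h : Fin.snoc (α := fun _ => E) (f ∘ σ) t = Fin.snoc (α := fun _ => E) f t ∘ τ := by
    funext x
    refine Fin.lastCases ?_ (fun x => ?_) x
    · rw [Function.comp_apply, hτ2, Fin.snoc_last, Fin.snoc_last]
    · rw [Function.comp_apply, hτ1, Fin.snoc_castSucc, Fin.snoc_castSucc]; rfl
  change w (Fin.snoc (α := fun _ => E) (f ∘ σ) t) = _
  rw [h, hw, hτ3]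

/-- Moving the i-th entry to the end takes n - i transpositions, and n - i has the parity of n + i.
-/
theorem alternating_snoc_removeNth {n : ℕ} {w : (Fin (n + 1) → E) → M} (hw : IsAlternating w)
    (f : Fin (n + 1) → E) (i : Fin (n + 1)) :
    w (Fin.snoc (α := fun _ => E) (f ∘ i.succAbove) (f i)) = (-1 : ℝ) ^ (n + i : ℕ) • w f := by
  let τ : Equiv.Perm (Fin (n + 1)) := (Fin.last n).cycleRange.trans i.cycleRange.symm
  have h : Fin.snoc (α := fun _ => E) (f ∘ i.succAbove) (f i) = f ∘ τ := by
    funext x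
    refine Fin.lastCases ?_ (fun x => ?_) x
    · simp [τ]
    · have h1 : (Fin.last n).cycleRange x.castSucc = x.succ := by
        have := Fin.cycleRange_succAbove (Fin.last n) x
        rwa [Fin.succAbove_last] at this
      simp only [Fin.snoc_castSucc, Function.comp_apply, τ, Equiv.trans_apply, h1,
        Fin.cycleRange_symm_succ]
  rw [h, hw]
  congr 1
  simp only [τ]
  rw [Equiv.Perm.sign_trans, Equiv.Perm.sign_symm, Fin.sign_cycleRange, Fin.sign_cycleRange,
    ← pow_add]
  simp [add_comm]

/-- The subdivision is a cone with apex the full vertex set, so averaging inserts each vertex t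
behind each face. By induction the i-th face gives w of that face followed by t, which vanishes by
alternation unless t is the omitted vertex. The n + 2 faces then contribute w(f)/(n + 2) each. -/
theorem evalW_sd {n : ℕ} {w : (Fin (n + 1) → E) → M} (hw : IsAlternating w)
    {f : Fin (n + 1) → E} (hf : Function.Injective f) : evalW w (sd n f) = w f := by
  induction n with
  | zero =>
    rw [sd, evalW_single, avg]
    have h : Fintype.piFinset (fun _ : Fin 1 => ({f 0} : Finset E)) = {f} := by
      ext g
      rw [Fintype.mem_piFinset, Finset.mem_singleton, funext_iff]
      simp
    rw [h]
    simp
  | succ n ih =>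
    have hcard : ((Finset.univ.image f).card : ℝ) = n + 2 := by
      rw [Finset.card_image_of_injective _ hf]; simp; ring
    have key : ∀ i : Fin (n + 2), ∑ t ∈ Finset.univ.image f,
        evalW (fun g => w (Fin.snoc (α := fun _ => E) g t)) (sd n (f ∘ i.succAbove)) =
          (-1 : ℝ) ^ (n + 1 + i : ℕ) • w f := by
      intro i
      -- Only the omitted vertex completes the i-th face to an injective tuple.
      rw [Finset.sum_eq_single (f i)]
      · rw [ih (snoc_comp_perm_alternating hw _) (hf.comp Fin.succAbove_right_injective),
          alternating_snoc_removeNth hw]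
      · intro t ht hne
        obtain ⟨j, -, rfl⟩ := Finset.mem_image.mp ht
        rw [ih (snoc_comp_perm_alternating hw _) (hf.comp Fin.succAbove_right_injective)]
        apply hw.eq_zero
        intro hinj
        obtain ⟨x, hx⟩ := Fin.exists_succAbove_eq (x := j) (y := i) (fun h => hne (by rw [h]))
        have := @hinj x.castSucc (Fin.last _) (by
          rw [Fin.snoc_castSucc, Fin.snoc_last, Function.comp_apply, hx])
        exact (Fin.castSucc_lt_last x).ne this
      · intro h
        exact absurd (Finset.mem_image_of_mem f (Finset.mem_univ i)) h
    rw [sd, evalW_cone]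
    simp only [map_sum, map_smul]
    rw [Finset.sum_comm]
    simp only [← Finset.smul_sum, key]
    have h2 : ∀ i : Fin (n + 2), (-1 : ℝ) ^ (i : ℕ) • (-1 : ℝ) ^ (n + 1 + i : ℕ) • w f =
        (-1 : ℝ) ^ (n + 1) • w f := by
      intro i
      rw [smul_smul, ← pow_add]
      congr 1
      rw [show (i : ℕ) + (n + 1 + i) = n + 1 + 2 * i by ring, pow_add, pow_mul]
      simp
    simp only [h2, Finset.sum_const, Finset.card_univ, Fintype.card_fin, hcard]
    rw [← Nat.cast_smul_eq_nsmul ℝ, smul_smul, smul_smul]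
    have h3 : ((-1 : ℝ) ^ (n + 1)) * (-1) ^ (n + 1) = 1 := by rw [← mul_pow]; simp
    have h4 : ((n : ℝ) + 2) ≠ 0 := by positivity
    convert one_smul ℝ (w f) using 2
    push_cast
    field_simp
    linear_combination h3

end Average

/-! ### The homotopy between a chain and its averaged subdivision -/

/-- Replace each face by the average of its vertices and subdivide. -/
def avgSd (n : ℕ) : TupleChain (Finset E) n →ₗ[ℝ] TupleChain (Finset E) n := evalW (sd n)

/-- The homotopy on generators. -/
def sdHomotopyFun : (n : ℕ) → (Fin (n + 1) → Finset E) → TupleChain (Finset E) (n + 1)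
  | 0, S => cone (S (Fin.last _)) 0 (Finsupp.single S 1 - avgSd 0 (Finsupp.single S 1))
  | n + 1, S => cone (S (Fin.last _)) (n + 1) (Finsupp.single S 1 - avgSd (n + 1) (Finsupp.single S 1) -
      ∑ i : Fin (n + 2), (-1 : ℝ) ^ (i : ℕ) • sdHomotopyFun n (S ∘ i.succAbove))

/-- The homotopy. -/
def sdHomotopy (n : ℕ) : TupleChain (Finset E) n →ₗ[ℝ] TupleChain (Finset E) (n + 1) :=
  Finsupp.lift _ ℝ _ (sdHomotopyFun n)

theorem sdHomotopy_single {n : ℕ} (S : Fin (n + 1) → Finset E) :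
    sdHomotopy n (Finsupp.single S 1) = sdHomotopyFun n S := by
  simp [sdHomotopy]

theorem sdHomotopyFun_succ {n : ℕ} (S : Fin (n + 2) → Finset E) :
    sdHomotopyFun (n + 1) S = cone (S (Fin.last _)) (n + 1) (Finsupp.single S 1 -
      avgSd (n + 1) (Finsupp.single S 1) - sdHomotopy n (tupleD _ n (Finsupp.single S 1))) := by
  rw [sdHomotopyFun, tupleD_single, map_sum]
  simp only [map_smul, sdHomotopy_single]

/-- Chains on flags of nonempty subsets of `T`. -/
def flagChains (T : Finset E) (n : ℕ) : Submodule ℝ (TupleChain (Finset E) n) :=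
  Submodule.span ℝ {x | ∃ S : Fin (n + 1) → Finset E, Monotone S ∧ (∀ i, (S i).Nonempty) ∧
    S (Fin.last _) ⊆ T ∧ x = Finsupp.single S 1}

theorem single_mem_flagChains {T : Finset E} {n : ℕ} {S : Fin (n + 1) → Finset E} (h1 : Monotone S)
    (h2 : ∀ i, (S i).Nonempty) (h3 : S (Fin.last _) ⊆ T) :
    (Finsupp.single S 1 : TupleChain (Finset E) n) ∈ flagChains T n :=
  Submodule.subset_span ⟨S, h1, h2, h3, rfl⟩

theorem flagChains_mono {T T' : Finset E} (h : T ⊆ T') (n : ℕ) :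
    flagChains T n ≤ flagChains T' n := by
  refine Submodule.span_mono ?_
  rintro _ ⟨S, h1, h2, h3, rfl⟩
  exact ⟨S, h1, h2, h3.trans h, rfl⟩

theorem tupleD_mem_flagChains {T : Finset E} {n : ℕ} {x : TupleChain (Finset E) (n + 1)}
    (hx : x ∈ flagChains T (n + 1)) : tupleD _ n x ∈ flagChains T n := by
  suffices h : flagChains T (n + 1) ≤ (flagChains T n).comap (tupleD _ n) from h hx
  rw [flagChains, Submodule.span_le]
  rintro _ ⟨S, h1, h2, h3, rfl⟩
  rw [SetLike.mem_coe, Submodule.mem_comap, tupleD_single]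
  refine Submodule.sum_mem _ fun i _ => Submodule.smul_mem _ _ (single_mem_flagChains
    (h1.comp (Fin.strictMono_succAbove i).monotone) (fun j => h2 _) ?_)
  exact (h1 (Fin.le_last _)).trans h3

theorem cone_mem_flagChains {T : Finset E} (hT : T.Nonempty) {n : ℕ} {x : TupleChain (Finset E) n}
    (hx : x ∈ flagChains T n) : cone T n x ∈ flagChains T (n + 1) := by
  suffices h : flagChains T n ≤ (flagChains T (n + 1)).comap (cone T n) from h hx
  rw [flagChains, Submodule.span_le]
  rintro _ ⟨S, h1, h2, h3, rfl⟩
  rw [SetLike.mem_coe, Submodule.mem_comap, cone_single]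
  refine Submodule.smul_mem _ _ (single_mem_flagChains ?_ ?_ ?_)
  · intro i j hij
    refine Fin.lastCases (fun hij => ?_) (fun j hij => ?_) j hij
    · refine Fin.lastCases (by rfl) (fun i => ?_) i
      rw [Fin.snoc_castSucc, Fin.snoc_last]
      exact (h1 (Fin.le_last _)).trans h3
    · obtain ⟨i, rfl⟩ : ∃ i', i = Fin.castSucc i' := by
        refine Fin.exists_castSucc_eq.mpr ?_ |>.imp fun _ h => h.symm
        rintro rfl
        exact absurd hij (not_le.mpr (Fin.castSucc_lt_last j))
      rw [Fin.snoc_castSucc, Fin.snoc_castSucc]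
      exact h1 hij
  · intro i
    refine Fin.lastCases ?_ (fun i => ?_) i
    · rw [Fin.snoc_last]; exact hT
    · rw [Fin.snoc_castSucc]; exact h2 i
  · rw [Fin.snoc_last]

/-- Carrier of the subdivision. The carriers serve twice: chains carried by a face at infinity
vanish in the quotient, and the class `toOut` is only meaningful on genuine flags. -/
theorem sd_mem_flagChains {n : ℕ} (f : Fin (n + 1) → E) :
    sd n f ∈ flagChains (Finset.univ.image f) n := by
  induction n with
  | zero =>
    rw [sd]
    refine single_mem_flagChains monotone_const (fun _ => Finset.singleton_nonempty _) ?_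
    rw [Finset.singleton_subset_iff]
    exact Finset.mem_image_of_mem f (Finset.mem_univ 0)
  | succ n ih =>
    rw [sd]
    refine cone_mem_flagChains ⟨f 0, Finset.mem_image_of_mem f (Finset.mem_univ 0)⟩
      (Submodule.sum_mem _ fun i _ => Submodule.smul_mem _ _ (flagChains_mono ?_ n (ih _)))
    intro x hx
    obtain ⟨j, -, rfl⟩ := Finset.mem_image.mp hx
    exact Finset.mem_image_of_mem f (Finset.mem_univ _)

theorem avg_mem {n : ℕ} {M : Type} [AddCommGroup M] [Module ℝ M] (P : Submodule ℝ M)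
    {S : Fin n → Finset E} {F : (Fin n → E) → M} (h : ∀ f, (∀ i, f i ∈ S i) → F f ∈ P) :
    avg S F ∈ P :=
  Submodule.smul_mem _ _ (Submodule.sum_mem _ fun f hf => h f (Fintype.mem_piFinset.mp hf))

theorem avgSd_single_mem {n : ℕ} {S : Fin (n + 1) → Finset E} (h1 : Monotone S) :
    avgSd n (Finsupp.single S 1) ∈ flagChains (S (Fin.last _)) n := by
  rw [avgSd, evalW_single]
  refine avg_mem _ fun f hf => flagChains_mono ?_ n (sd_mem_flagChains f)
  intro x hx
  obtain ⟨j, -, rfl⟩ := Finset.mem_image.mp hx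
  exact h1 (Fin.le_last j) (hf j)

/-- All terms are carried by the largest face, so coning with this face as apex again produces
flags. -/
theorem sdHomotopyFun_mem {n : ℕ} {S : Fin (n + 1) → Finset E} (h1 : Monotone S)
    (h2 : ∀ i, (S i).Nonempty) : sdHomotopyFun n S ∈ flagChains (S (Fin.last _)) (n + 1) := by
  induction n with
  | zero =>
    rw [sdHomotopyFun]
    exact cone_mem_flagChains (h2 _) (sub_mem (single_mem_flagChains h1 h2 subset_rfl)
      (avgSd_single_mem h1))
  | succ n ih =>
    rw [sdHomotopyFun]
    have key : ∀ i : Fin (n + 2),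
        sdHomotopyFun n (S ∘ i.succAbove) ∈ flagChains (S (Fin.last _)) (n + 1) := fun i =>
      flagChains_mono (T := S (i.succAbove (Fin.last n))) (h1 (Fin.le_last _)) (n + 1)
        (ih (S := S ∘ i.succAbove) (h1.comp (Fin.strictMono_succAbove i).monotone) fun j => h2 _)
    exact cone_mem_flagChains (h2 _) (sub_mem (sub_mem (single_mem_flagChains h1 h2 subset_rfl)
      (avgSd_single_mem h1)) (Submodule.sum_mem _ fun i _ => Submodule.smul_mem _ _ (key i)))

theorem flagChains_induction {n : ℕ} {T : Finset E} {M : Type} [AddCommGroup M] [Module ℝ M]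
    {f g : TupleChain (Finset E) n →ₗ[ℝ] M}
    (h : ∀ S, Monotone S → (∀ i, (S i).Nonempty) → f (Finsupp.single S 1) = g (Finsupp.single S 1))
    {x : TupleChain (Finset E) n} (hx : x ∈ flagChains T n) : f x = g x := by
  suffices hh : flagChains T n ≤ LinearMap.eqLocus f g from hh hx
  rw [flagChains, Submodule.span_le]
  rintro _ ⟨S, h1, h2, -, rfl⟩
  exact h S h1 h2

/-- Subdivision commutes with the boundary, and averaging with passing to faces by `avg_face`. -/
theorem tupleD_avgSd {n : ℕ} {S : Fin (n + 2) → Finset E} (h2 : ∀ i, (S i).Nonempty) :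
    tupleD _ n (avgSd (n + 1) (Finsupp.single S 1)) = avgSd n (tupleD _ n (Finsupp.single S 1)) := by
  rw [avgSd, avgSd, evalW_single, avg_map]
  simp only [tupleD_sd]
  rw [avg_sum, tupleD_single, map_sum]
  refine Finset.sum_congr rfl fun i _ => ?_
  rw [avg_smul, map_smul, evalW_single, avg_face i S (h2 i)]

theorem tupleAug_avgSd {S : Fin 1 → Finset E} (h2 : ∀ i, (S i).Nonempty) :
    tupleAug _ (avgSd 0 (Finsupp.single S 1)) = 1 := by
  rw [avgSd, evalW_single, avg_map]
  simp only [tupleAug_sd]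
  have h := avg_face (n := 0) (M := ℝ) 0 S (h2 0) (fun _ => (1 : ℝ))
  refine h.trans ?_
  simp [avg]

theorem tupleD_sdHomotopyFun_zero {S : Fin 1 → Finset E} (h2 : ∀ i, (S i).Nonempty) :
    tupleD _ 0 (sdHomotopyFun 0 S) = Finsupp.single S 1 - avgSd 0 (Finsupp.single S 1) := by
  rw [sdHomotopyFun, tupleD_cone_zero, map_sub, tupleAug_single, tupleAug_avgSd h2, sub_self,
    zero_smul, sub_zero]

/-- Acyclic carriers made explicit: the chain that the homotopy has to bound is a cycle on flags
below the largest face, and these flags form a cone with that face as apex. -/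
theorem tupleD_sdHomotopyFun {n : ℕ} {S : Fin (n + 2) → Finset E} (h1 : Monotone S)
    (h2 : ∀ i, (S i).Nonempty) : tupleD _ (n + 1) (sdHomotopyFun (n + 1) S) +
      sdHomotopy n (tupleD _ n (Finsupp.single S 1)) =
        Finsupp.single S 1 - avgSd (n + 1) (Finsupp.single S 1) := by
  have hmem : tupleD _ n (Finsupp.single S 1) ∈ flagChains (S (Fin.last _)) n :=
    tupleD_mem_flagChains (single_mem_flagChains h1 h2 subset_rfl)
  -- The chain to be coned off is a cycle, by the homotopy formula one degree lower applied to the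
  -- faces of the flag.
  have key : tupleD _ n (Finsupp.single S 1 -
      avgSd (n + 1) (Finsupp.single S 1) - sdHomotopy n (tupleD _ n (Finsupp.single S 1))) = 0 := by
    rw [map_sub, map_sub, tupleD_avgSd h2]
    cases n with
    | zero =>
      have := flagChains_induction (f := tupleD _ 0 ∘ₗ sdHomotopy 0)
        (g := LinearMap.id - avgSd 0) (fun S _ h2 => by
          rw [LinearMap.comp_apply, sdHomotopy_single, tupleD_sdHomotopyFun_zero h2]; rfl) hmem
      rw [LinearMap.comp_apply] at this
      rw [this]
      simp
    | succ n =>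
      have := flagChains_induction (f := tupleD _ (n + 1) ∘ₗ sdHomotopy (n + 1) +
        sdHomotopy n ∘ₗ tupleD _ n)
        (g := LinearMap.id - avgSd (n + 1)) (fun S h1 h2 => by
          rw [LinearMap.add_apply, LinearMap.comp_apply, LinearMap.comp_apply, sdHomotopy_single,
            tupleD_sdHomotopyFun h1 h2]; rfl) hmem
      rw [LinearMap.add_apply, LinearMap.comp_apply, LinearMap.comp_apply, tupleD_tupleD, map_zero,
        add_zero] at this
      rw [this]
      simp
  rw [sdHomotopyFun_succ, tupleD_cone, key]
  simp

/-! ### Naturality -/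

/-- The image of a chain under an embedding of the vertices. -/
def mapFaces (ι : E ↪ E') (n : ℕ) : TupleChain (Finset E) n →ₗ[ℝ] TupleChain (Finset E') n :=
  Finsupp.lmapDomain ℝ ℝ fun S i => (S i).map ι

theorem mapFaces_single (ι : E ↪ E') {n : ℕ} (S : Fin (n + 1) → Finset E) :
    mapFaces ι n (Finsupp.single S 1) = Finsupp.single (fun i => (S i).map ι) 1 := by
  rw [mapFaces, Finsupp.lmapDomain_apply, Finsupp.mapDomain_single]

theorem mapFaces_cone (ι : E ↪ E') (T : Finset E) {n : ℕ} (x : TupleChain (Finset E) n) :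
    mapFaces ι (n + 1) (cone T n x) = cone (T.map ι) n (mapFaces ι n x) := by
  suffices h : mapFaces ι (n + 1) ∘ₗ cone T n = cone (T.map ι) n ∘ₗ mapFaces ι n from
    congrArg (fun f => f x) h
  refine tuple_hom_ext fun S => ?_
  rw [LinearMap.comp_apply, LinearMap.comp_apply, cone_single, map_smul, mapFaces_single,
    mapFaces_single, cone_single]
  congr 2
  funext i
  refine Fin.lastCases ?_ (fun i => ?_) i
  · rw [Fin.snoc_last, Fin.snoc_last]
  · rw [Fin.snoc_castSucc, Fin.snoc_castSucc]

theorem mapFaces_sd (ι : E ↪ E') {n : ℕ} (f : Fin (n + 1) → E) :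
    mapFaces ι n (sd n f) = sd n (ι ∘ f) := by
  induction n with
  | zero => rw [sd, sd, mapFaces_single]; rfl
  | succ n ih =>
    have h : Finset.univ.image (ι ∘ f) = (Finset.univ.image f).map ι := by
      rw [Finset.map_eq_image, Finset.image_image]
    rw [sd, sd, mapFaces_cone, h, map_sum]
    simp only [map_smul, ih]
    rfl

theorem mapFaces_avgSd (ι : E ↪ E') {n : ℕ} (S : Fin (n + 1) → Finset E) :
    mapFaces ι n (avgSd n (Finsupp.single S 1)) =
      avgSd n (Finsupp.single (fun i => (S i).map ι) 1) := by
  rw [avgSd, avgSd, evalW_single, evalW_single, avg_embedding, avg_map]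
  simp only [mapFaces_sd]

/-- The construction only uses the largest face as apex and involves no choices, so it commutes with
embeddings of vertices; this makes the homotopy compatible with forest collapses. -/
theorem mapFaces_sdHomotopyFun (ι : E ↪ E') {n : ℕ} (S : Fin (n + 1) → Finset E) :
    mapFaces ι (n + 1) (sdHomotopyFun n S) = sdHomotopyFun n fun i => (S i).map ι := by
  induction n with
  | zero =>
    rw [sdHomotopyFun, sdHomotopyFun, mapFaces_cone, map_sub, mapFaces_avgSd, mapFaces_single]
  | succ n ih =>
    rw [sdHomotopyFun, sdHomotopyFun, mapFaces_cone, map_sub (mapFaces ι (n + 1)),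
      map_sub (mapFaces ι (n + 1)), mapFaces_avgSd, mapFaces_single, map_sum (mapFaces ι (n + 1))]
    simp only [map_smul, ih]
    rfl

end Subdivision

end

/-! ### Paths as elements of the free group on the edges, and markings -/

section

/-! ### Homotopy classes of edge paths -/

/-- `EPath ends F u x v` says that the element `x` of the free group on the edges is represented by a
path from `u` to `v` along edges in `F`. -/
inductive EPath {E V : Type} (ends : E → V × V) (F : Set E) : V → FreeGroup E → V → Prop
  | one (u : V) : EPath ends F u 1 u
  | edge (e : E) (he : e ∈ F) : EPath ends F (ends e).1 (FreeGroup.of e) (ends e).2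
  | inv {u v : V} {x : FreeGroup E} : EPath ends F u x v → EPath ends F v x⁻¹ u
  | mul {u v w : V} {x y : FreeGroup E} : EPath ends F u x v → EPath ends F v y w →
      EPath ends F u (x * y) w

section Paths

variable {E V : Type} {ends : E → V × V} {F : Set E}

theorem EPath.mono {F' : Set E} (h : F ⊆ F') {u v : V} {x : FreeGroup E} (hx : EPath ends F u x v) :
    EPath ends F' u x v := by
  induction hx with
  | one u => exact .one u
  | edge e he => exact .edge e (h he)
  | inv _ ih => exact ih.inv
  | mul _ _ ih1 ih2 => exact ih1.mul ih2

/-- Two labellings which differ by a gauge transformation. -/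
theorem EPath.hom_eq {G : Type} [Group G] (φ ψ : FreeGroup E →* G) (γ : V → G)
    (h : ∀ e ∈ F, γ (ends e).1 * φ (FreeGroup.of e) * (γ (ends e).2)⁻¹ = ψ (FreeGroup.of e))
    {u v : V} {x : FreeGroup E} (hx : EPath ends F u x v) : γ u * φ x * (γ v)⁻¹ = ψ x := by
  induction hx with
  | one u => simp
  | edge e he => exact h e he
  | inv _ ih => rw [map_inv, map_inv, ← ih]; group
  | mul _ _ ih1 ih2 => rw [map_mul, map_mul, ← ih1, ← ih2]; group

theorem ePath_of_eqvGen {u v : V}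
    (h : Relation.EqvGen (fun x y => ∃ e, e ∈ F ∧ ends e = (x, y)) u v) :
    ∃ x, EPath ends F u x v := by
  induction h with
  | rel x y h =>
    obtain ⟨e, he, h⟩ := h
    have := EPath.edge (ends := ends) e he
    rw [h] at this
    exact ⟨_, this⟩
  | refl x => exact ⟨1, .one x⟩
  | symm _ _ _ ih => obtain ⟨x, hx⟩ := ih; exact ⟨_, hx.inv⟩
  | trans _ _ _ _ _ ih1 ih2 =>
    obtain ⟨x, hx⟩ := ih1
    obtain ⟨y, hy⟩ := ih2
    exact ⟨_, hx.mul hy⟩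

theorem EPath.eqvGen {u v : V} {x : FreeGroup E} (h : EPath ends F u x v) :
    Relation.EqvGen (fun x y => ∃ e, e ∈ F ∧ ends e = (x, y)) u v := by
  induction h with
  | one u => exact .refl _
  | edge e he => exact .rel _ _ ⟨e, he, rfl⟩
  | inv _ ih => exact ih.symm
  | mul _ _ ih1 ih2 => exact ih1.trans _ _ _ ih2

theorem eqvGen_iff_ePath {u v : V} :
    Relation.EqvGen (fun x y => ∃ e, e ∈ F ∧ ends e = (x, y)) u v ↔ ∃ x, EPath ends F u x v :=
  ⟨ePath_of_eqvGen, fun ⟨_, h⟩ => h.eqvGen⟩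

end Paths

section Walks

variable {nV nE : ℕ} {ends : Fin nE → Fin nV × Fin nV} {F : Set (Fin nE)}

theorem IsWalk.append {u v w : Fin nV} {p q : List (Fin nE × Bool)} (h1 : IsWalk ends u p v)
    (h2 : IsWalk ends v q w) : IsWalk ends u (p ++ q) w := by
  induction p generalizing u with
  | nil => cases h1; exact h2
  | cons d p ih =>
    obtain ⟨e, _ | _⟩ := d
    · exact ⟨h1.1, ih h1.2⟩
    · exact ⟨h1.1, ih h1.2⟩

theorem IsWalk.split {u w : Fin nV} {p q : List (Fin nE × Bool)} (h : IsWalk ends u (p ++ q) w) :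
    ∃ v, IsWalk ends u p v ∧ IsWalk ends v q w := by
  induction p generalizing u with
  | nil => exact ⟨u, rfl, h⟩
  | cons d p ih =>
    obtain ⟨e, _ | _⟩ := d
    · obtain ⟨v, h1, h2⟩ := ih h.2
      exact ⟨v, ⟨h.1, h1⟩, h2⟩
    · obtain ⟨v, h1, h2⟩ := ih h.2
      exact ⟨v, ⟨h.1, h1⟩, h2⟩

theorem IsWalk.invRev {u v : Fin nV} {p : List (Fin nE × Bool)} (h : IsWalk ends u p v) :
    IsWalk ends v (FreeGroup.invRev p) u := by
  induction p generalizing u with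
  | nil => cases h; exact rfl
  | cons d p ih =>
    have hs : FreeGroup.invRev (d :: p) = FreeGroup.invRev p ++ [(d.1, !d.2)] := by
      simp [FreeGroup.invRev]
    rw [hs]
    obtain ⟨e, _ | _⟩ := d
    · exact (ih h.2).append ⟨rfl, h.1⟩
    · exact (ih h.2).append ⟨rfl, h.1⟩

/-- A cancelled pair of letters traverses an edge and comes straight back, so its removal leaves a
walk with the same end points. -/
theorem IsWalk.reduce {u v : Fin nV} {p : List (Fin nE × Bool)} (h : IsWalk ends u p v) :
    IsWalk ends u (FreeGroup.reduce p) v := by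
  have key : ∀ p q, FreeGroup.Red.Step p q → IsWalk ends u p v → IsWalk ends u q v := by
    rintro _ _ ⟨⟩ h
    rename_i L₁ L₂ e b
    obtain ⟨w, h1, h2⟩ := h.split
    cases b
    · obtain ⟨h3, h4, h5⟩ := h2
      rw [h3] at h5
      exact h1.append h5
    · obtain ⟨h3, h4, h5⟩ := h2
      rw [h3] at h5
      exact h1.append h5
  have key2 : ∀ q, FreeGroup.Red p q → IsWalk ends u q v := by
    intro q hq
    induction hq with
    | refl => exact h
    | tail _ hs ih => exact key _ _ hs ih
  exact key2 _ FreeGroup.reduce.red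

theorem mem_reduce {p : List (Fin nE × Bool)} {d : Fin nE × Bool} (h : d ∈ FreeGroup.reduce p) :
    d ∈ p :=
  (FreeGroup.Red.sublist FreeGroup.reduce.red).subset h

theorem ePath_mk_of_isWalk {u v : Fin nV} {p : List (Fin nE × Bool)} (h : IsWalk ends u p v)
    (hF : ∀ d ∈ p, d.1 ∈ F) : EPath ends F u (FreeGroup.mk p) v := by
  induction p generalizing u with
  | nil => cases h; exact .one _
  | cons d p ih =>
    have hs : FreeGroup.mk (d :: p) = FreeGroup.mk [d] * FreeGroup.mk p := by
      rw [FreeGroup.mul_mk]; rfl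
    rw [hs]
    have hd := hF d (by simp)
    have hp : ∀ d ∈ p, d.1 ∈ F := fun d' h' => hF d' (by simp [h'])
    obtain ⟨e, _ | _⟩ := d
    · refine EPath.mul (v := (ends e).1) ?_ (ih h.2 hp)
      have := (EPath.edge (ends := ends) (F := F) e hd).inv
      rw [h.1] at this
      exact this
    · refine EPath.mul (v := (ends e).2) ?_ (ih h.2 hp)
      have := EPath.edge (ends := ends) (F := F) e hd
      rw [h.1] at this
      exact this

theorem ePath_iff_isWalk {u v : Fin nV} {x : FreeGroup (Fin nE)} :
    EPath ends F u x v ↔ IsWalk ends u x.toWord v ∧ ∀ d ∈ x.toWord, d.1 ∈ F := by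
  constructor
  · intro h
    induction h with
    | one u => simp [IsWalk]
    | edge e he => simp [IsWalk, FreeGroup.toWord_of, he]
    | inv _ ih =>
      rw [FreeGroup.toWord_inv]
      refine ⟨ih.1.invRev, fun d hd => ?_⟩
      obtain ⟨d', hd', rfl⟩ : ∃ d' : Fin nE × Bool, d' ∈ _ ∧ (d'.1, !d'.2) = d := by
        rw [FreeGroup.invRev, List.mem_reverse] at hd
        exact List.mem_map.mp hd
      exact ih.2 d' hd'
    | mul _ _ ih1 ih2 =>
      rw [FreeGroup.toWord_mul]
      refine ⟨(ih1.1.append ih2.1).reduce, fun d hd => ?_⟩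
      rcases List.mem_append.mp (mem_reduce hd) with h | h
      · exact ih1.2 d h
      · exact ih2.2 d h
  · rintro ⟨h1, h2⟩
    have := ePath_mk_of_isWalk h1 h2
    rwa [FreeGroup.mk_toWord] at this

end Walks

/-! ### Markings -/

/-- Every element of the group is the label of exactly one closed path at every vertex. -/
def IsMarked {E V G : Type} [Group G] (ends : E → V × V) (lab : E → G) : Prop :=
  ∀ (v : V) (w : G), ∃! x : FreeGroup E, EPath ends Set.univ v x v ∧ FreeGroup.lift lab x = w

/-- Any two vertices are joined by a path. -/
def PathConnected {E V : Type} (ends : E → V × V) : Prop :=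
  ∀ u v, ∃ x, EPath ends Set.univ u x v

/-- Reduced words are the normal forms of free group elements. From here on, closed paths are group
elements and no reductions need to be performed. -/
theorem isMarked_iff {r nV nE : ℕ} (ends : Fin nE → Fin nV × Fin nV)
    (lab : Fin nE → FreeGroup (Fin r)) :
    (∀ (v : Fin nV) (w : FreeGroup (Fin r)), ∃! p : List (Fin nE × Bool),
      FreeGroup.IsReduced p ∧ IsWalk ends v p v ∧ FreeGroup.lift lab (FreeGroup.mk p) = w) ↔
    IsMarked ends lab := by
  refine forall_congr' fun v => forall_congr' fun w => ?_
  constructor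
  · rintro ⟨p, ⟨h1, h2, h3⟩, h4⟩
    refine ⟨FreeGroup.mk p, ⟨ePath_mk_of_isWalk h2 (fun _ _ => trivial), h3⟩, ?_⟩
    rintro y ⟨hy1, hy2⟩
    rw [← h4 y.toWord ⟨FreeGroup.isReduced_toWord, (ePath_iff_isWalk.mp hy1).1, by
      rw [FreeGroup.mk_toWord]; exact hy2⟩, FreeGroup.mk_toWord]
  · rintro ⟨x, ⟨h1, h2⟩, h3⟩
    refine ⟨x.toWord, ⟨FreeGroup.isReduced_toWord, (ePath_iff_isWalk.mp h1).1, by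
      rw [FreeGroup.mk_toWord]; exact h2⟩, ?_⟩
    rintro p ⟨hp1, hp2, hp3⟩
    rw [← h3 (FreeGroup.mk p) ⟨ePath_mk_of_isWalk hp2 (fun _ _ => trivial), hp3⟩,
      FreeGroup.toWord_mk, hp1.reduce_eq]

theorem pathConnected_iff {k m : ℕ} (ends : Fin m → Fin k × Fin k) :
    OGraph.Connected (Finset.univ.val.map ends) ↔ 0 < k ∧ PathConnected ends := by
  have h : (fun i j => (i, j) ∈ Multiset.map ends Finset.univ.val) =
      fun x y => ∃ e, e ∈ (Set.univ : Set (Fin m)) ∧ ends e = (x, y) := by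
    funext x y
    simp
  unfold OGraph.Connected PathConnected
  rw [h]
  simp only [eqvGen_iff_ePath]

theorem MarkedGraph.isMarked {r : ℕ} (Γ : MarkedGraph r) : IsMarked Γ.ends Γ.lab :=
  (isMarked_iff _ _).mp Γ.marking

theorem MarkedGraph.pathConnected {r : ℕ} (Γ : MarkedGraph r) : PathConnected Γ.ends :=
  ((pathConnected_iff _).mp Γ.connected).2

theorem MarkedGraph.nV_pos {r : ℕ} (Γ : MarkedGraph r) : 0 < Γ.nV := Γ.connected.1

theorem MarkedGraph.hasCycle_iff {r : ℕ} (Γ : MarkedGraph r) (T : Set (Fin Γ.nE)) :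
    Γ.HasCycle T ↔ ∃ v x, x ≠ 1 ∧ EPath Γ.ends T v x v := by
  constructor
  · rintro ⟨v, p, h1, h2, h3, h4⟩
    refine ⟨v, FreeGroup.mk p, fun h => h1 ?_, ePath_mk_of_isWalk h3 h4⟩
    rw [← h2.reduce_eq, ← FreeGroup.toWord_mk, h, FreeGroup.toWord_one]
  · rintro ⟨v, x, h1, h2⟩
    obtain ⟨h3, h4⟩ := ePath_iff_isWalk.mp h2
    exact ⟨v, x.toWord, fun h => h1 (FreeGroup.toWord_eq_nil_iff.mp h),
      FreeGroup.isReduced_toWord, h3, h4⟩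

section Marked

variable {E V G : Type} [Group G] {ends : E → V × V} {lab : E → G}

/-- The closed path x y⁻¹ has trivial label, hence is trivial by uniqueness. -/
theorem IsMarked.eq_of_lab_eq (hm : IsMarked ends lab) {u v : V} {x y : FreeGroup E}
    (hx : EPath ends Set.univ u x v) (hy : EPath ends Set.univ u y v)
    (h : FreeGroup.lift lab x = FreeGroup.lift lab y) : x = y := by
  have h1 := (hm u 1).unique ⟨hx.mul hy.inv, by rw [map_mul, map_inv, h, mul_inv_cancel]⟩
    ⟨.one u, map_one _⟩
  exact mul_inv_eq_one.mp h1

theorem IsMarked.exists_path (hm : IsMarked ends lab) (hc : PathConnected ends) (u v : V) (w : G) :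
    ∃ x, EPath ends Set.univ u x v ∧ FreeGroup.lift lab x = w := by
  obtain ⟨y, hy⟩ := hc u v
  obtain ⟨z, ⟨hz, hz2⟩, -⟩ := hm u (w * (FreeGroup.lift lab y)⁻¹)
  exact ⟨z * y, hz.mul hy, by rw [map_mul, hz2]; group⟩

/-- The paths with trivial label from a base point. -/
def treePath (hm : IsMarked ends lab) (hc : PathConnected ends) (u v : V) : FreeGroup E :=
  (hm.exists_path hc u v 1).choose

theorem ePath_treePath (hm : IsMarked ends lab) (hc : PathConnected ends) (u v : V) :
    EPath ends Set.univ u (treePath hm hc u v) v :=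
  (hm.exists_path hc u v 1).choose_spec.1

theorem lab_treePath (hm : IsMarked ends lab) (hc : PathConnected ends) (u v : V) :
    FreeGroup.lift lab (treePath hm hc u v) = 1 :=
  (hm.exists_path hc u v 1).choose_spec.2

theorem treePath_self (hm : IsMarked ends lab) (hc : PathConnected ends) (u : V) :
    treePath hm hc u u = 1 :=
  hm.eq_of_lab_eq (ePath_treePath hm hc u u) (.one u) (by rw [lab_treePath, map_one])

/-- The isomorphism from the group of labels to the closed paths at `v`. -/
def closedPath (hm : IsMarked ends lab) (v : V) : G →* FreeGroup E where
  toFun w := (hm v w).choose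
  map_one' := ((hm v 1).choose_spec.2 1 ⟨.one v, map_one _⟩).symm
  map_mul' a b := ((hm v (a * b)).choose_spec.2 _ ⟨(hm v a).choose_spec.1.1.mul
    (hm v b).choose_spec.1.1, by
      rw [map_mul, (hm v a).choose_spec.1.2, (hm v b).choose_spec.1.2]⟩).symm

theorem ePath_closedPath (hm : IsMarked ends lab) (v : V) (w : G) :
    EPath ends Set.univ v (closedPath hm v w) v := (hm v w).choose_spec.1.1

theorem lab_closedPath (hm : IsMarked ends lab) (v : V) (w : G) :
    FreeGroup.lift lab (closedPath hm v w) = w := (hm v w).choose_spec.1.2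

theorem closedPath_lab (hm : IsMarked ends lab) {v : V} {x : FreeGroup E}
    (hx : EPath ends Set.univ v x v) : closedPath hm v (FreeGroup.lift lab x) = x :=
  hm.eq_of_lab_eq (ePath_closedPath hm v _) hx (lab_closedPath hm v _)

/-- The paths with trivial label play the role of paths in a maximal tree; the edge closed up by
them is the closed path having the label of the edge. -/
theorem treePath_edge (hm : IsMarked ends lab) (hc : PathConnected ends) (v : V) (e : E) :
    treePath hm hc v (ends e).1 * FreeGroup.of e * (treePath hm hc v (ends e).2)⁻¹ =
      closedPath hm v (lab e) := by
  rw [← closedPath_lab hm (((ePath_treePath hm hc v (ends e).1).mul (.edge e trivial)).mul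
    (ePath_treePath hm hc v (ends e).2).inv)]
  simp [lab_treePath]

/-- Two markings of the same graph differ by an automorphism and a gauge transformation. -/
theorem exists_aut_of_isMarked {lab' : E → G} (hm : IsMarked ends lab) (hm' : IsMarked ends lab')
    (hc : PathConnected ends) (v : V) : ∃ (α : MulAut G) (g : V → G),
      ∀ e, lab' e = g (ends e).1 * α (lab e) * (g (ends e).2)⁻¹ := by
  -- The automorphism lifts an element to the closed path with this label under `lab` and reads off
  -- its label under `lab'`; the gauge corrects for the paths to the base point.
  refine ⟨MulEquiv.ofBijective ((FreeGroup.lift lab').comp (closedPath hm v)) ⟨?_, ?_⟩,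
    fun u => (FreeGroup.lift lab' (treePath hm hc v u))⁻¹, fun e => ?_⟩
  · intro a b h
    have h2 := hm'.eq_of_lab_eq (ePath_closedPath hm v a) (ePath_closedPath hm v b) h
    rw [← lab_closedPath hm v a, h2, lab_closedPath]
  · intro w
    refine ⟨FreeGroup.lift lab (closedPath hm' v w), ?_⟩
    rw [MonoidHom.comp_apply, closedPath_lab hm (ePath_closedPath hm' v w), lab_closedPath]
  · change _ = _ * FreeGroup.lift lab' (closedPath hm v (lab e)) * _
    rw [← treePath_edge hm hc v e]
    simp
    group

theorem IsMarked.gauge (hm : IsMarked ends lab) (g : V → G) :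
    IsMarked ends fun e => (g (ends e).1)⁻¹ * lab e * g (ends e).2 := by
  have key : ∀ {u v x}, EPath ends Set.univ u x v →
      FreeGroup.lift (fun e => (g (ends e).1)⁻¹ * lab e * g (ends e).2) x =
        (g u)⁻¹ * FreeGroup.lift lab x * g v := by
    intro u v x hx
    have := hx.hom_eq (FreeGroup.lift lab)
      (FreeGroup.lift (fun e => (g (ends e).1)⁻¹ * lab e * g (ends e).2)) (fun v => (g v)⁻¹)
      (fun e _ => by simp)
    rw [← this, inv_inv]
  intro v w
  obtain ⟨x, ⟨h1, h2⟩, h3⟩ := hm v (g v * w * (g v)⁻¹)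
  refine ⟨x, ⟨h1, by rw [key h1, h2]; group⟩, ?_⟩
  rintro y ⟨hy1, hy2⟩
  refine h3 y ⟨hy1, ?_⟩
  rw [← hy2, key hy1]
  group

end Marked

/-! ### Abelianized paths -/

/-- The abelianization of a free group, with real coefficients. -/
def abHom (B : Type) : FreeGroup B →* Multiplicative (B →₀ ℝ) :=
  FreeGroup.lift fun b => Multiplicative.ofAdd (Finsupp.single b 1)

/-- The exponent sums of a word. -/
def ab {B : Type} (x : FreeGroup B) : B →₀ ℝ := Multiplicative.toAdd (abHom B x)

section Abelianization

variable {B : Type}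

theorem ab_one : ab (1 : FreeGroup B) = 0 := by rw [ab, map_one]; rfl

theorem ab_mul (x y : FreeGroup B) : ab (x * y) = ab x + ab y := by rw [ab, map_mul]; rfl

theorem ab_inv (x : FreeGroup B) : ab x⁻¹ = - ab x := by rw [ab, map_inv]; rfl

theorem ab_of (b : B) : ab (FreeGroup.of b) = Finsupp.single b 1 := by
  rw [ab, abHom, FreeGroup.lift_apply_of]; rfl

variable {E V : Type} {ends : E → V × V} {lab : E → FreeGroup B}

/-- The boundary of a path together with its abelianized label; the base point is `none`. -/
def cycleMap (ends : E → V × V) (lab : E → FreeGroup B) (v₀ : V) :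
    (Option E →₀ ℝ) →ₗ[ℝ] (V ⊕ B →₀ ℝ) :=
  Finsupp.lift _ ℝ _ fun o => o.elim (Finsupp.single (Sum.inl v₀) 1) fun e =>
    Finsupp.single (Sum.inl (ends e).2) 1 - Finsupp.single (Sum.inl (ends e).1) 1 +
      Finsupp.lmapDomain ℝ ℝ Sum.inr (ab (lab e))

theorem cycleMap_none (v₀ : V) : cycleMap ends lab v₀ (Finsupp.single none 1) =
    Finsupp.single (Sum.inl v₀) 1 := by
  simp [cycleMap]

theorem cycleMap_some (v₀ : V) (e : E) : cycleMap ends lab v₀ (Finsupp.single (some e) 1) =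
    Finsupp.single (Sum.inl (ends e).2) 1 - Finsupp.single (Sum.inl (ends e).1) 1 +
      Finsupp.lmapDomain ℝ ℝ Sum.inr (ab (lab e)) := by
  simp only [cycleMap, Finsupp.lift_apply, zero_smul, Finsupp.sum_single_index, one_smul,
    Option.elim_some]

/-- Boundaries telescope and abelianized labels add up along a path. This evaluates `cycleMap` on
the paths that define its inverse. -/
theorem cycleMap_path (v₀ : V) {u v : V} {x : FreeGroup E} (hx : EPath ends Set.univ u x v) :
    cycleMap ends lab v₀ (Finsupp.lmapDomain ℝ ℝ some (ab x)) =
      Finsupp.single (Sum.inl v) 1 - Finsupp.single (Sum.inl u) 1 +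
        Finsupp.lmapDomain ℝ ℝ Sum.inr (ab (FreeGroup.lift lab x)) := by
  induction hx with
  | one u => rw [map_one, ab_one, ab_one]; simp
  | edge e he =>
    rw [ab_of, Finsupp.lmapDomain_apply, Finsupp.mapDomain_single, cycleMap_some,
      FreeGroup.lift_apply_of]
  | inv _ ih => rw [map_inv, ab_inv, ab_inv, map_neg, map_neg, map_neg, ih]; abel
  | mul _ _ ih1 ih2 => rw [map_mul, ab_mul, ab_mul, map_add, map_add, map_add, ih1, ih2]; abel

/-- The inverse of `cycleMap` for a marked graph. -/
def cycleMapInv (hm : IsMarked ends lab) (hc : PathConnected ends) (v₀ : V) :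
    (V ⊕ B →₀ ℝ) →ₗ[ℝ] (Option E →₀ ℝ) :=
  Finsupp.lift _ ℝ _ (Sum.elim
    (fun v => Finsupp.single none 1 + Finsupp.lmapDomain ℝ ℝ some (ab (treePath hm hc v₀ v)))
    (fun b => Finsupp.lmapDomain ℝ ℝ some (ab (closedPath hm v₀ (FreeGroup.of b)))))

theorem cycleMapInv_inl (hm : IsMarked ends lab) (hc : PathConnected ends) (v₀ v : V) :
    cycleMapInv hm hc v₀ (Finsupp.single (Sum.inl v) 1) =
      Finsupp.single none 1 + Finsupp.lmapDomain ℝ ℝ some (ab (treePath hm hc v₀ v)) := by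
  simp only [cycleMapInv, Finsupp.lift_apply, zero_smul, Finsupp.sum_single_index, one_smul,
    Sum.elim_inl]

theorem cycleMapInv_inr (hm : IsMarked ends lab) (hc : PathConnected ends) (v₀ : V) (b : B) :
    cycleMapInv hm hc v₀ (Finsupp.single (Sum.inr b) 1) =
      Finsupp.lmapDomain ℝ ℝ some (ab (closedPath hm v₀ (FreeGroup.of b))) := by
  simp only [cycleMapInv, Finsupp.lift_apply, zero_smul, Finsupp.sum_single_index, one_smul,
    Sum.elim_inr]

theorem cycleMapInv_ab (hm : IsMarked ends lab) (hc : PathConnected ends) (v₀ : V)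
    (w : FreeGroup B) : cycleMapInv hm hc v₀ (Finsupp.lmapDomain ℝ ℝ Sum.inr (ab w)) =
      Finsupp.lmapDomain ℝ ℝ some (ab (closedPath hm v₀ w)) := by
  induction w using FreeGroup.induction_on with
  | C1 => rw [map_one, ab_one, ab_one]; simp
  | of b => rw [ab_of, Finsupp.lmapDomain_apply, Finsupp.mapDomain_single, cycleMapInv_inr]
  | inv_of b ih => rw [map_inv, ab_inv, ab_inv, map_neg, map_neg, map_neg, ih]
  | mul x y hx hy => rw [map_mul, ab_mul, ab_mul, map_add, map_add, map_add, hx, hy]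

/-- Paths in a marked graph up to homology. -/
def cycleEquiv (hm : IsMarked ends lab) (hc : PathConnected ends) (v₀ : V) :
    (Option E →₀ ℝ) ≃ₗ[ℝ] (V ⊕ B →₀ ℝ) :=
  LinearEquiv.ofLinearMap (cycleMap ends lab v₀) (cycleMapInv hm hc v₀)
    (by
      refine Finsupp.lhom_ext' fun s => LinearMap.ext_ring ?_
      change cycleMap ends lab v₀ (cycleMapInv hm hc v₀ (Finsupp.single s 1)) = Finsupp.single s 1
      obtain v | b := s
      · rw [cycleMapInv_inl, map_add, cycleMap_path v₀ (ePath_treePath hm hc v₀ v), cycleMap_none,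
          lab_treePath, ab_one, map_zero]
        abel
      · rw [cycleMapInv_inr, cycleMap_path v₀ (ePath_closedPath hm v₀ _), lab_closedPath, ab_of,
          Finsupp.lmapDomain_apply, Finsupp.mapDomain_single]
        abel)
    (by
      refine Finsupp.lhom_ext' fun o => LinearMap.ext_ring ?_
      change cycleMapInv hm hc v₀ (cycleMap ends lab v₀ (Finsupp.single o 1)) = Finsupp.single o 1
      obtain _ | e := o
      · rw [cycleMap_none, cycleMapInv_inl, treePath_self, ab_one, map_zero, add_zero]
      · rw [cycleMap_some, map_add, map_sub, cycleMapInv_inl, cycleMapInv_inl, cycleMapInv_ab,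
          ← treePath_edge hm hc v₀ e, ab_mul, ab_mul, ab_inv, map_add, map_add, map_neg, ab_of,
          Finsupp.lmapDomain_apply (R := ℝ) (M := ℝ) _ (Finsupp.single e 1),
          Finsupp.mapDomain_single]
        abel)

theorem cycleEquiv_apply (hm : IsMarked ends lab) (hc : PathConnected ends) (v₀ : V)
    (x : Option E →₀ ℝ) : cycleEquiv hm hc v₀ x = cycleMap ends lab v₀ x := rfl

theorem finite_of_isMarked [Finite E] (hm : IsMarked ends lab) (hc : PathConnected ends) (v₀ : V) :
    Finite B := by
  have := Module.Finite.equiv (cycleEquiv hm hc v₀)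
  have h : Finite (V ⊕ B) := Module.Finite.finite_basis (Finsupp.basisSingleOne (R := ℝ))
  exact Finite.of_injective _ (Sum.inr_injective (α := V) (β := B))

/-- The Euler characteristic, obtained by comparing the dimensions of the two sides of `cycleEquiv`.
-/
theorem card_of_isMarked [Fintype E] [Fintype V] [Fintype B] (hm : IsMarked ends lab)
    (hc : PathConnected ends) (v₀ : V) :
    Fintype.card V + Fintype.card B = Fintype.card E + 1 := by
  have := (cycleEquiv hm hc v₀).finrank_eq
  simpa using this.symm

end Abelianization

/-! ### Existence of markings -/

/-- The closed paths at `v₀` form a subgroup of the free group on the edges, which is free by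
Nielsen–Schreier. An edge is labelled by the closed path obtained by joining its ends to `v₀`. -/
theorem exists_isMarked {E V : Type} {ends : E → V × V} (hc : PathConnected ends) (v₀ : V) :
    ∃ (B : Type) (lab : E → FreeGroup B), IsMarked ends lab := by
  let P : Subgroup (FreeGroup E) :=
    { carrier := {x | EPath ends Set.univ v₀ x v₀}
      mul_mem' := fun h1 h2 => h1.mul h2
      one_mem' := .one v₀
      inv_mem' := fun h => h.inv }
  let θ : P ≃* FreeGroup (IsFreeGroup.Generators P) := IsFreeGroup.toFreeGroup P
  let ι : FreeGroup (IsFreeGroup.Generators P) →* FreeGroup E := P.subtype.comp θ.symm.toMonoidHom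
  have hι : Function.Injective ι := P.subtype_injective.comp θ.symm.injective
  have hιP : ∀ w, EPath ends Set.univ v₀ (ι w) v₀ := fun w => (θ.symm w).2
  have hιsurj : ∀ x, EPath ends Set.univ v₀ x v₀ → ∃ w, ι w = x := fun x hx =>
    ⟨θ ⟨x, hx⟩, by simp [ι]⟩
  choose γ hγ using hc v₀
  choose lab hlab using fun e => hιsurj _ (((hγ (ends e).1).mul (.edge e trivial)).mul
    (hγ (ends e).2).inv)
  refine ⟨_, lab, fun v w => ?_⟩
  have key : ∀ {u v x}, EPath ends Set.univ u x v → γ u * x * (γ v)⁻¹ = ι (FreeGroup.lift lab x) :=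
    fun hx => hx.hom_eq (MonoidHom.id _) (ι.comp (FreeGroup.lift lab)) γ (fun e _ => by
      simp [hlab])
  have hx : EPath ends Set.univ v ((γ v)⁻¹ * ι w * γ v) v := ((hγ v).inv.mul (hιP w)).mul (hγ v)
  refine ⟨_, ⟨hx, ?_⟩, ?_⟩
  · apply hι
    rw [← key hx]
    group
  · rintro y ⟨hy1, hy2⟩
    rw [← hy2, ← key hy1]
    group

theorem IsMarked.congr {E V B B' : Type} {ends : E → V × V} {lab : E → FreeGroup B}
    (hm : IsMarked ends lab) (θ : FreeGroup B ≃* FreeGroup B') :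
    IsMarked ends fun e => θ (lab e) := by
  have h : ∀ x, FreeGroup.lift (fun e => θ (lab e)) x = θ (FreeGroup.lift lab x) := by
    intro x
    have : FreeGroup.lift (fun e => θ (lab e)) = θ.toMonoidHom.comp (FreeGroup.lift lab) := by
      ext; simp
    rw [this]; rfl
  intro v w
  simpa only [h, MulEquiv.eq_symm_apply] using hm v (θ.symm w)

/-- The rank of the free group of closed paths is determined by the numbers of vertices and edges,
so its basis can be indexed by `Fin r`. -/
theorem exists_isMarked_fin {r k m : ℕ} {ends : Fin m → Fin k × Fin k} (hk : 0 < k)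
    (hc : PathConnected ends) (h : k + r = m + 1) :
    ∃ lab : Fin m → FreeGroup (Fin r), IsMarked ends lab := by
  obtain ⟨B, lab, hm⟩ := exists_isMarked hc ⟨0, hk⟩
  have := finite_of_isMarked hm hc ⟨0, hk⟩
  have := Fintype.ofFinite B
  have hcard := card_of_isMarked hm hc ⟨0, hk⟩
  simp only [Fintype.card_fin] at hcard
  have hB : Fintype.card B = Fintype.card (Fin r) := by rw [Fintype.card_fin]; omega
  exact ⟨_, hm.congr (FreeGroup.freeGroupCongr (Fintype.equivOfCardEq hB))⟩

end

/-! ### Orientations of marked graphs by determinants -/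

section

/-! ### The determinant of an automorphism -/

/-- The action of an automorphism on the abelianization, as a real matrix. -/
def autMatrix {r : ℕ} (α : MulAut (FreeGroup (Fin r))) : Matrix (Fin r) (Fin r) ℝ :=
  Matrix.of fun b' b => ab (α (FreeGroup.of b)) b'

theorem autMatrix_mulVec {r : ℕ} (α : MulAut (FreeGroup (Fin r))) (x : FreeGroup (Fin r)) :
    (autMatrix α).mulVec (ab x) = ab (α x) := by
  induction x using FreeGroup.induction_on with
  | C1 => rw [map_one, ab_one, Finsupp.coe_zero, Matrix.mulVec_zero]
  | of b =>
    funext b'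
    simp [ab_of, autMatrix, Matrix.mulVec, dotProduct, Finsupp.single_apply]
  | inv_of b ih => rw [map_inv, ab_inv, ab_inv, Finsupp.coe_neg, Finsupp.coe_neg, Matrix.mulVec_neg, ih]
  | mul x y hx hy =>
    rw [map_mul, ab_mul, ab_mul, Finsupp.coe_add, Finsupp.coe_add, Matrix.mulVec_add, hx, hy]

theorem toFinsupp_class {r : ℕ} (x : FreeGroup (Fin r)) (i : Fin r) :
    ((FreeAbelianGroup.toFinsupp (Additive.ofMul (Abelianization.of x) : FreeAbelianGroup (Fin r)) i : ℤ) : ℝ) =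
      ab x i := by
  induction x using FreeGroup.induction_on with
  | C1 =>
    rw [map_one, ofMul_one, ab_one]
    have h := map_zero (FreeAbelianGroup.toFinsupp (X := Fin r))
    refine (congrArg (fun z : Fin r →₀ ℤ => ((z i : ℤ) : ℝ)) h).trans ?_
    simp
  | of b =>
    rw [ab_of]
    have := FreeAbelianGroup.toFinsupp_of b
    refine (congrArg (fun z : Fin r →₀ ℤ => ((z i : ℤ) : ℝ)) this).trans ?_
    simp [Finsupp.single_apply]
  | inv_of b ih =>
    rw [map_inv, ofMul_inv, ab_inv, Finsupp.neg_apply, ← ih]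
    have h := map_neg (FreeAbelianGroup.toFinsupp (X := Fin r))
      (Additive.ofMul (Abelianization.of (FreeGroup.of b)) : FreeAbelianGroup (Fin r))
    refine (congrArg (fun z : Fin r →₀ ℤ => ((z i : ℤ) : ℝ)) h).trans ?_
    simp only [Finsupp.neg_apply, Int.cast_neg]
    rfl
  | mul x y hx hy =>
    rw [map_mul, ofMul_mul, ab_mul, Finsupp.add_apply, ← hx, ← hy]
    have h := map_add (FreeAbelianGroup.toFinsupp (X := Fin r))
      (Additive.ofMul (Abelianization.of x) : FreeAbelianGroup (Fin r))
      (Additive.ofMul (Abelianization.of y) : FreeAbelianGroup (Fin r))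
    refine (congrArg (fun z : Fin r →₀ ℤ => ((z i : ℤ) : ℝ)) h).trans ?_
    simp only [Finsupp.add_apply, Int.cast_add]
    rfl

/-- The matrix of exponent sums is the integral matrix of the induced map on the abelianization, in
the standard basis, with its entries read in ℝ. -/
theorem det_autMatrix {r : ℕ} (α : MulAut (FreeGroup (Fin r))) :
    (autMatrix α).det = ((autDet r α : ℤ) : ℝ) := by
  let b : Module.Basis (Fin r) ℤ (Additive (Abelianization (FreeGroup (Fin r)))) :=
    FreeAbelianGroup.basis (Fin r)
  let f : Additive (Abelianization (FreeGroup (Fin r))) ≃ₗ[ℤ]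
      Additive (Abelianization (FreeGroup (Fin r))) := (MulEquiv.toAdditive (MulEquiv.abelianizationCongr α)).toIntLinearEquiv
  have h1 : ((autDet r α : ℤˣ) : ℤ) = (LinearMap.toMatrix b b f.toLinearMap).det := by
    rw [LinearMap.det_toMatrix]; exact LinearEquiv.coe_det f
  have h2 : autMatrix α = (LinearMap.toMatrix b b f.toLinearMap).map (Int.cast : ℤ → ℝ) := by
    ext i j
    rw [Matrix.map_apply, LinearMap.toMatrix_apply, autMatrix, Matrix.of_apply, ← toFinsupp_class]
    have hb : b j = Additive.ofMul (Abelianization.of (FreeGroup.of j)) := by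
      change (FreeAbelianGroup.equivFinsupp (Fin r)).symm (Finsupp.single j 1) = FreeAbelianGroup.of j
      rw [AddEquiv.symm_apply_eq]
      exact (FreeAbelianGroup.toFinsupp_of j).symm
    rw [hb]
    rfl
  rw [h1, h2, Int.cast_det]

/-! ### The orientation determinant -/

section Gdet

variable {r k m : ℕ}

/-- The column of an edge: its boundary and its abelianized label. -/
def edgeCol (p : Fin k × Fin k) (w : FreeGroup (Fin r)) : Fin k ⊕ Fin r → ℝ :=
  Sum.elim (Pi.single p.2 1 - Pi.single p.1 1) (ab w)

/-- The columns of all edges, preceded by a column `x`. -/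
def colMatrix (ends : Fin m → Fin k × Fin k) (lab : Fin m → FreeGroup (Fin r))
    (x : Fin k ⊕ Fin r → ℝ) : Matrix (Fin k ⊕ Fin r) (Fin (m + 1)) ℝ :=
  Matrix.of fun a b => Fin.cons (α := fun _ => Fin k ⊕ Fin r → ℝ) x
    (fun i => edgeCol (ends i) (lab i)) b a

theorem colMatrix_zero (ends : Fin m → Fin k × Fin k) (lab : Fin m → FreeGroup (Fin r))
    (x : Fin k ⊕ Fin r → ℝ) (a : Fin k ⊕ Fin r) : colMatrix ends lab x a 0 = x a := rfl

theorem colMatrix_succ (ends : Fin m → Fin k × Fin k) (lab : Fin m → FreeGroup (Fin r))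
    (x : Fin k ⊕ Fin r → ℝ) (a : Fin k ⊕ Fin r) (i : Fin m) :
    colMatrix ends lab x a i.succ = edgeCol (ends i) (lab i) a := rfl

/-- The numbering of the rows. -/
def rowEquiv (h : k + r = m + 1) : Fin k ⊕ Fin r ≃ Fin (m + 1) :=
  finSumFinEquiv.trans (finCongr h)

theorem val_rowEquiv_inl (h : k + r = m + 1) (v : Fin k) : (rowEquiv h (Sum.inl v) : ℕ) = v := by
  simp [rowEquiv]

theorem val_rowEquiv_inr (h : k + r = m + 1) (b : Fin r) : (rowEquiv h (Sum.inr b) : ℕ) = k + b := by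
  simp [rowEquiv]

/-- The determinant with an arbitrary first column. -/
def colDet (h : k + r = m + 1) (ends : Fin m → Fin k × Fin k) (lab : Fin m → FreeGroup (Fin r))
    (x : Fin k ⊕ Fin r → ℝ) : ℝ :=
  ((colMatrix ends lab x).submatrix id (rowEquiv h)).det

theorem colDet_eq_fin (h : k + r = m + 1) (ends : Fin m → Fin k × Fin k)
    (lab : Fin m → FreeGroup (Fin r)) (x : Fin k ⊕ Fin r → ℝ) :
    colDet h ends lab x = ((colMatrix ends lab x).submatrix (rowEquiv h).symm id).det := by
  rw [colDet, ← Matrix.det_submatrix_equiv_self (rowEquiv h).symm, Matrix.submatrix_submatrix]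
  simp

/-- Multiplicativity of the determinant; each transformation rule for `gdet` under a change of the
rows comes from a suitable matrix `B`. -/
theorem colDet_of_mul (h : k + r = m + 1) {ends ends' : Fin m → Fin k × Fin k}
    {lab lab' : Fin m → FreeGroup (Fin r)} {x x' : Fin k ⊕ Fin r → ℝ}
    (B : Matrix (Fin k ⊕ Fin r) (Fin k ⊕ Fin r) ℝ) (hx : B.mulVec x = x')
    (he : ∀ i, B.mulVec (edgeCol (ends i) (lab i)) = edgeCol (ends' i) (lab' i)) :
    colDet h ends' lab' x' = B.det * colDet h ends lab x := by
  have hB : colMatrix ends' lab' x' = B * colMatrix ends lab x := by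
    ext a b
    refine Fin.cases ?_ (fun i => ?_) b
    · rw [colMatrix_zero, ← hx]; rfl
    · rw [colMatrix_succ, ← he]; rfl
  rw [colDet, colDet, ← Matrix.det_mul, hB]
  rfl

theorem sum_edgeCol_inl (p : Fin k × Fin k) (w : FreeGroup (Fin r)) :
    ∑ v, edgeCol p w (Sum.inl v) = 0 := by
  simp [edgeCol, Finset.sum_sub_distrib]

/-- Edge columns have vertex sum 0. The rank-one perturbation of the identity by (x' - x) times the
vertex-sum functional fixes them, sends x to x' and has determinant 1 because x and x' have equal
vertex sums. -/
theorem colDet_eq (h : k + r = m + 1) (ends : Fin m → Fin k × Fin k)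
    (lab : Fin m → FreeGroup (Fin r)) {x x' : Fin k ⊕ Fin r → ℝ} (hx : ∑ v, x (Sum.inl v) = 1)
    (hx' : ∑ v, x' (Sum.inl v) = 1) : colDet h ends lab x' = colDet h ends lab x := by
  let o : Fin k ⊕ Fin r → ℝ := Sum.elim 1 0
  have ho : ∀ y : Fin k ⊕ Fin r → ℝ, o ⬝ᵥ y = ∑ v, y (Sum.inl v) := by
    intro y
    simp [dotProduct, o, Fintype.sum_sum_type]
  have hB : ∀ y, (1 + Matrix.replicateCol Unit (x' - x) * Matrix.replicateRow Unit o).mulVec y =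
      y + (o ⬝ᵥ y) • (x' - x) := by
    intro y
    rw [Matrix.add_mulVec, Matrix.one_mulVec, ← Matrix.mulVec_mulVec]
    congr 1
    ext a
    simp [Matrix.mulVec, dotProduct, mul_comm]
  rw [colDet_of_mul h (1 + Matrix.replicateCol Unit (x' - x) * Matrix.replicateRow Unit o)
    (ends := ends) (lab := lab) (x := x), Matrix.det_one_add_replicateCol_mul_replicateRow, ho]
  · simp [hx, hx', Finset.sum_sub_distrib]
  · rw [hB, ho, hx]; simp
  · intro i
    rw [hB, ho, sum_edgeCol_inl]; simp

/-- The determinant of the boundaries and labels of all edges. -/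
def gdet (h : k + r = m + 1) (ends : Fin m → Fin k × Fin k) (lab : Fin m → FreeGroup (Fin r)) : ℝ :=
  colDet h ends lab (Sum.elim (fun _ => (k : ℝ)⁻¹) 0)

theorem gdet_eq_colDet (h : k + r = m + 1) (hk : 0 < k) (ends : Fin m → Fin k × Fin k)
    (lab : Fin m → FreeGroup (Fin r)) {x : Fin k ⊕ Fin r → ℝ} (hx : ∑ v, x (Sum.inl v) = 1) :
    gdet h ends lab = colDet h ends lab x := by
  refine colDet_eq h ends lab hx ?_
  have : (k : ℝ) ≠ 0 := by exact_mod_cast hk.ne'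
  simp [this]

/-- The first column of `gdet` is constant on the vertices, hence unaffected by the permutation;
only the rows are permuted. -/
theorem gdet_relabel (h : k + r = m + 1) (ends : Fin m → Fin k × Fin k)
    (lab : Fin m → FreeGroup (Fin r)) (σ : Equiv.Perm (Fin k)) :
    gdet h (fun i => Prod.map σ σ (ends i)) lab =
      ((Equiv.Perm.sign σ : ℤ) : ℝ) * gdet h ends lab := by
  have hM : colMatrix (fun i => Prod.map σ σ (ends i)) lab (Sum.elim (fun _ => (k : ℝ)⁻¹) 0) =
      (colMatrix ends lab (Sum.elim (fun _ => (k : ℝ)⁻¹) 0)).submatrix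
        (Equiv.sumCongr σ.symm (Equiv.refl (Fin r))) id := by
    ext a b
    refine Fin.cases ?_ (fun i => ?_) b
    · rw [colMatrix_zero, Matrix.submatrix_apply, id, colMatrix_zero]
      rcases a with v | b <;> rfl
    · rw [colMatrix_succ, Matrix.submatrix_apply, id, colMatrix_succ]
      rcases a with v | b
      · simp [edgeCol, Pi.single_apply, Equiv.symm_apply_eq]
      · rfl
  have hdet := Matrix.det_permute (Equiv.Perm.sumCongr σ⁻¹ (1 : Equiv.Perm (Fin r)))
    ((colMatrix ends lab (Sum.elim (fun _ => (k : ℝ)⁻¹) 0)).submatrix id (rowEquiv h))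
  rw [Equiv.Perm.sign_sumCongr, Equiv.Perm.sign_inv, Equiv.Perm.sign_one, mul_one] at hdet
  rw [gdet, colDet, hM, gdet, colDet, ← hdet]
  rfl

/-- A gauge transformation adds to each edge label the difference of the abelianized gauge at its
ends: a unipotent row operation. It disturbs the first column only in the label rows, which is
harmless by `colDet_eq`. -/
theorem gdet_gauge (h : k + r = m + 1) (ends : Fin m → Fin k × Fin k)
    (lab : Fin m → FreeGroup (Fin r)) (g : Fin k → FreeGroup (Fin r)) :
    gdet h ends (fun i => (g (ends i).1)⁻¹ * lab i * g (ends i).2) = gdet h ends lab := by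
  -- Without vertices there are no edges, so both labellings agree; otherwise k can be inverted in
  -- the first column.
  rcases Nat.eq_zero_or_pos k with hk | hk
  · subst hk
    have : IsEmpty (Fin m) := ⟨fun i => (ends i).1.elim0⟩
    congr 1
    funext i
    exact this.elim i
  let C : Matrix (Fin r) (Fin k) ℝ := Matrix.of fun b v => ab (g v) b
  have hk' : (k : ℝ) ≠ 0 := by exact_mod_cast hk.ne'
  have hB : ∀ y, (Matrix.fromBlocks 1 0 C 1 : Matrix (Fin k ⊕ Fin r) (Fin k ⊕ Fin r) ℝ).mulVec y =
      Sum.elim (y ∘ Sum.inl) (C.mulVec (y ∘ Sum.inl) + y ∘ Sum.inr) := by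
    intro y
    rw [Matrix.fromBlocks_mulVec]
    simp
  rw [gdet_eq_colDet h hk _ _ (x := (Matrix.fromBlocks 1 0 C (1 : Matrix (Fin r) (Fin r) ℝ)).mulVec
      (Sum.elim (fun _ => (k : ℝ)⁻¹) 0)), gdet,
    colDet_of_mul h (Matrix.fromBlocks 1 0 C 1) (ends := ends) (lab := lab)
      (x := Sum.elim (fun _ => (k : ℝ)⁻¹) 0) rfl]
  · rw [Matrix.det_fromBlocks_zero₁₂]; simp
  · intro i
    rw [hB]
    funext a
    rcases a with v | b
    · rfl
    · simp only [Sum.elim_inr, edgeCol, Pi.add_apply, Function.comp_apply, ab_mul, ab_inv,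
        Finsupp.add_apply, Finsupp.neg_apply]
      have : (Sum.elim (Pi.single (ends i).2 1 - Pi.single (ends i).1 1) (⇑(ab (lab i))) :
          Fin k ⊕ Fin r → ℝ) ∘ Sum.inl = Pi.single (ends i).2 1 - Pi.single (ends i).1 1 := rfl
      rw [this, Matrix.mulVec_sub, Matrix.mulVec_single_one, Matrix.mulVec_single_one]
      simp [C]
      ring
  · rw [hB]
    simp [hk']

theorem gdet_twist (h : k + r = m + 1) (ends : Fin m → Fin k × Fin k)
    (lab : Fin m → FreeGroup (Fin r)) (α : MulAut (FreeGroup (Fin r))) :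
    gdet h ends (fun i => α (lab i)) = ((autDet r α : ℤ) : ℝ) * gdet h ends lab := by
  have hB : ∀ y, (Matrix.fromBlocks 1 0 0 (autMatrix α) :
      Matrix (Fin k ⊕ Fin r) (Fin k ⊕ Fin r) ℝ).mulVec y =
      Sum.elim (y ∘ Sum.inl) ((autMatrix α).mulVec (y ∘ Sum.inr)) := by
    intro y
    rw [Matrix.fromBlocks_mulVec]
    simp
  rw [gdet, gdet, colDet_of_mul h (Matrix.fromBlocks 1 0 0 (autMatrix α)) (ends := ends)
    (lab := lab) (x := Sum.elim (fun _ => (k : ℝ)⁻¹) 0)]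
  · rw [Matrix.det_fromBlocks_zero₁₂, det_autMatrix]; simp
  · rw [hB]
    funext a
    rcases a with v | b
    · rfl
    · have : (Sum.elim (fun _ => (k : ℝ)⁻¹) 0 : Fin k ⊕ Fin r → ℝ) ∘ Sum.inr = 0 := rfl
      rw [this]; simp
  · intro i
    rw [hB]
    funext a
    rcases a with v | b
    · rfl
    · exact congrFun (autMatrix_mulVec α (lab i)) b

theorem gdet_perm (h : k + r = m + 1) (ends : Fin m → Fin k × Fin k)
    (lab : Fin m → FreeGroup (Fin r)) (σ : Equiv.Perm (Fin m)) :
    gdet h (ends ∘ σ) (lab ∘ σ) = ((Equiv.Perm.sign σ : ℤ) : ℝ) * gdet h ends lab := by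
  have hdet := Matrix.det_permute' (Equiv.Perm.decomposeFin.symm (0, σ))
    ((colMatrix ends lab (Sum.elim (fun _ => (k : ℝ)⁻¹) 0)).submatrix (rowEquiv h).symm id)
  rw [gdet, colDet_eq_fin, gdet, colDet_eq_fin]
  have hs : Equiv.Perm.sign (Equiv.Perm.decomposeFin.symm ((0 : Fin (m + 1)), σ)) =
      Equiv.Perm.sign σ := by simp
  rw [hs] at hdet
  rw [← hdet]
  congr 1
  ext a b
  refine Fin.cases ?_ (fun i => ?_) b
  · simp [colMatrix_zero]
  · simp [colMatrix_succ]

/-- Reverse an edge if the flag is set. -/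
def flipEnds (b : Bool) (p : Fin k × Fin k) : Fin k × Fin k := if b then p.swap else p

/-- Invert the label of an edge if the flag is set. -/
def flipLab (b : Bool) (w : FreeGroup (Fin r)) : FreeGroup (Fin r) := if b then w⁻¹ else w

/-- The sign of a reversal. -/
def flipSign (b : Bool) : ℝ := if b then -1 else 1

theorem flipSign_mul_self (b : Bool) : flipSign b * flipSign b = 1 := by cases b <;> simp [flipSign]

theorem edgeCol_flip (b : Bool) (p : Fin k × Fin k) (w : FreeGroup (Fin r)) :
    edgeCol (flipEnds b p) (flipLab b w) = flipSign b • edgeCol p w := by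
  cases b
  · simp [flipEnds, flipLab, flipSign]
  · funext a
    rcases a with v | b <;> simp [flipEnds, flipLab, flipSign, edgeCol, ab_inv]

theorem gdet_flip (h : k + r = m + 1) (ends : Fin m → Fin k × Fin k)
    (lab : Fin m → FreeGroup (Fin r)) (fl : Fin m → Bool) :
    gdet h (fun i => flipEnds (fl i) (ends i)) (fun i => flipLab (fl i) (lab i)) =
      (∏ i, flipSign (fl i)) * gdet h ends lab := by
  have hdet := Matrix.det_mul_row (Fin.cons (α := fun _ => ℝ) 1 fun i => flipSign (fl i))
    ((colMatrix ends lab (Sum.elim (fun _ => (k : ℝ)⁻¹) 0)).submatrix (rowEquiv h).symm id)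
  rw [gdet, colDet_eq_fin, gdet, colDet_eq_fin]
  rw [Fin.prod_univ_succ] at hdet
  simp only [Fin.cons_zero, Fin.cons_succ, one_mul] at hdet
  rw [← hdet]
  congr 1
  ext a b
  refine Fin.cases ?_ (fun i => ?_) b
  · simp [colMatrix_zero]
  · simp [colMatrix_succ, edgeCol_flip]

/-- With a base vertex as first column, the matrix represents `cycleMap`, which is injective for a
marked graph. -/
theorem gdet_ne_zero (h : k + r = m + 1) (hk : 0 < k) {ends : Fin m → Fin k × Fin k}
    {lab : Fin m → FreeGroup (Fin r)} (hm : IsMarked ends lab) (hc : PathConnected ends) :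
    gdet h ends lab ≠ 0 := by
  let v₀ : Fin k := ⟨0, hk⟩
  rw [gdet_eq_colDet h hk ends lab (x := Pi.single (Sum.inl v₀) 1) (by
    simp [Pi.single_apply]), colDet_eq_fin]
  intro h0
  obtain ⟨y, hy0, hy⟩ := Matrix.exists_mulVec_eq_zero_iff.mpr h0
  let z : Option (Fin m) →₀ ℝ := Finsupp.equivFunOnFinite.symm fun o => o.elim (y 0) fun i => y i.succ
  have hz : cycleMap ends lab v₀ z = 0 := by
    ext a
    have h1 := congrFun hy (rowEquiv h a)
    simp only [Matrix.mulVec, dotProduct, Matrix.submatrix_apply, Equiv.symm_apply_apply, id,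
      Pi.zero_apply, Fin.sum_univ_succ, colMatrix_zero, colMatrix_succ] at h1
    rw [cycleMap, Finsupp.lift_apply, Finsupp.sum_fintype _ _ (by simp), Fintype.sum_option]
    simp only [Finsupp.coe_add, Finsupp.coe_finsetSum, Pi.add_apply, Finset.sum_apply,
      Finsupp.coe_smul, Pi.smul_apply, smul_eq_mul, Option.elim_none, Option.elim_some,
      Finsupp.coe_zero, Pi.zero_apply]
    rw [← h1]
    congr 1
    · change y 0 * _ = _
      rw [mul_comm]
      simp [Finsupp.single_apply, Pi.single_apply, eq_comm]
    · refine Finset.sum_congr rfl fun i _ => ?_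
      change y i.succ * _ = _
      rw [mul_comm]
      congr 1
      rcases a with v | b
      · have : (Finsupp.lmapDomain ℝ ℝ (Sum.inr : Fin r → Fin k ⊕ Fin r)) (ab (lab i)) (Sum.inl v) = 0 := by
          rw [Finsupp.lmapDomain_apply, Finsupp.mapDomain_of_notMem_range]
          simp
        rw [this]
        simp [edgeCol, Finsupp.single_apply, Pi.single_apply, eq_comm]
      · have : (Finsupp.lmapDomain ℝ ℝ (Sum.inr : Fin r → Fin k ⊕ Fin r)) (ab (lab i)) (Sum.inr b) =
            ab (lab i) b := by
          rw [Finsupp.lmapDomain_apply, Finsupp.mapDomain_apply Sum.inr_injective]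
        rw [this]
        simp [edgeCol]
  have hz0 : z = 0 := (cycleEquiv hm hc v₀).injective (by rw [cycleEquiv_apply, hz, map_zero])
  apply hy0
  funext i
  refine Fin.cases ?_ (fun i => ?_) i
  · exact congrArg (fun f : Option (Fin m) →₀ ℝ => f none) hz0
  · exact congrArg (fun f : Option (Fin m) →₀ ℝ => f (some i)) hz0

theorem rowEquiv_symm_succAbove (h : k + 1 + r = m + 1 + 1) (h' : k + r = m + 1) (j : Fin (k + 1))
    (a : Fin (m + 1)) : (rowEquiv h).symm ((rowEquiv h (Sum.inl j)).succAbove a) =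
      Sum.map j.succAbove id ((rowEquiv h').symm a) := by
  obtain ⟨s, rfl⟩ := (rowEquiv h').surjective a
  rw [Equiv.symm_apply_apply, Equiv.symm_apply_eq]
  apply Fin.ext
  rw [OGraph.val_succAbove, val_rowEquiv_inl]
  rcases s with v | b
  · rw [val_rowEquiv_inl, Sum.map_inl, val_rowEquiv_inl, OGraph.val_succAbove]
  · rw [val_rowEquiv_inr, Sum.map_inr, val_rowEquiv_inr]
    have := j.2
    split_ifs
    · omega
    · simp; omega

/-- Contracting an edge with trivial label. -/
theorem gdet_contract (h : k + 1 + r = m + 1 + 1) (h' : k + r = m + 1)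
    (ends : Fin (m + 1) → Fin (k + 1) × Fin (k + 1)) (lab : Fin (m + 1) → FreeGroup (Fin r))
    (i : Fin (m + 1)) (a b : Fin (k + 1)) (hab : ends i = (a, b)) (hi : a ≠ b) (hlab : lab i = 1) :
    gdet h ends lab = (-1 : ℝ) ^ ((i : ℕ) + (b : ℕ) + 1) *
      gdet h' (fun j => Prod.map (OGraph.contract a b hi) (OGraph.contract a b hi)
        (ends (i.succAbove j))) (fun j => lab (i.succAbove j)) := by
  have hk : 0 < k := (OGraph.contract a b hi a).pos
  let x : Fin (k + 1) ⊕ Fin r → ℝ := Sum.elim (fun v => ((k + 1 : ℕ) : ℝ)⁻¹) 0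
  -- Add the row of the head b to the row of the tail a. The column of the edge with trivial label
  -- becomes the unit vector at b, and the remaining rows see both vertices as one.
  let B : Matrix (Fin (k + 1) ⊕ Fin r) (Fin (k + 1) ⊕ Fin r) ℝ :=
    1 + Matrix.replicateCol Unit (Pi.single (Sum.inl a) (1 : ℝ)) *
      Matrix.replicateRow Unit (Pi.single (Sum.inl b) (1 : ℝ))
  have hBdet : B.det = 1 := by
    rw [Matrix.det_one_add_replicateCol_mul_replicateRow]
    simp [hi.symm]
  let T (y : Fin (k + 1) ⊕ Fin r → ℝ) : Fin (k + 1) ⊕ Fin r → ℝ :=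
    y + y (Sum.inl b) • (Pi.single (Sum.inl a) (1 : ℝ) : Fin (k + 1) ⊕ Fin r → ℝ)
  have hB : ∀ y, B.mulVec y = T y := by
    intro y
    rw [Matrix.add_mulVec, Matrix.one_mulVec, ← Matrix.mulVec_mulVec]
    congr 1
    ext s
    simp [Matrix.mulVec, dotProduct, mul_comm, Pi.single_apply]
  let N : Matrix (Fin (m + 2)) (Fin (m + 2)) ℝ :=
    (B * colMatrix ends lab x).submatrix (rowEquiv h).symm id
  have hN : gdet h ends lab = N.det := by
    have : N = (B.submatrix (rowEquiv h).symm (rowEquiv h).symm) *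
        ((colMatrix ends lab x).submatrix (rowEquiv h).symm id) := by
      rw [Matrix.submatrix_mul_equiv]
    rw [this, Matrix.det_mul, Matrix.det_submatrix_equiv_self, hBdet, one_mul, gdet, colDet_eq_fin]
  have hcol0 : ∀ s, N s 0 = T x ((rowEquiv h).symm s) := by
    intro s
    exact congrFun (hB x) _
  have hcol : ∀ s j, N s (Fin.succ j) = T (edgeCol (ends j) (lab j)) ((rowEquiv h).symm s) := by
    intro s j
    exact congrFun (hB (edgeCol (ends j) (lab j))) _
  have hcoli : ∀ s, N s i.succ = if s = rowEquiv h (Sum.inl b) then 1 else 0 := by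
    intro s
    obtain ⟨s, rfl⟩ := (rowEquiv h).surjective s
    rw [hcol, Equiv.symm_apply_apply, hlab, hab]
    simp only [(rowEquiv h).injective.eq_iff]
    rcases s with v | c
    · simp only [T, edgeCol, ab_one, Pi.add_apply, Pi.smul_apply, Sum.elim_inl, Pi.sub_apply, Pi.single_eq_same, Sum.inl.injEq, Pi.single_eq_of_ne hi.symm, Pi.single_apply,
        smul_eq_mul]
      by_cases h1 : v = b <;> by_cases h2 : v = a <;> simp [h1, h2, hi, hi.symm]
    · simp [T, edgeCol, ab_one]
  -- Laplace expansion along this column, which has number i + 1 because the first column precedes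
  -- the edges; hence the exponent i + b + 1.
  rw [hN, Matrix.det_succ_column N i.succ, Finset.sum_eq_single (rowEquiv h (Sum.inl b))]
  · rw [hcoli, if_pos rfl, mul_one, val_rowEquiv_inl, Fin.val_succ]
    congr 1
    · congr 1; ring
    · rw [gdet_eq_colDet h' hk _ _ (x := fun s => T x
        (Sum.map b.succAbove id s)), colDet_eq_fin]
      · congr 1
        ext s t
        refine Fin.cases ?_ (fun j => ?_) t
        · rw [Matrix.submatrix_apply, Fin.succ_succAbove_zero, hcol0, rowEquiv_symm_succAbove h h']
          rfl
        · rw [Matrix.submatrix_apply, Fin.succ_succAbove_succ, hcol, rowEquiv_symm_succAbove h h',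
            Matrix.submatrix_apply, id, colMatrix_succ]
          rcases (rowEquiv h').symm s with v | c
          · have key : ∀ w : Fin (k + 1), (Pi.single (OGraph.contract a b hi w) 1 : Fin k → ℝ) v =
                (Pi.single w 1 : Fin (k + 1) → ℝ) (b.succAbove v) +
                  (Pi.single w 1 : Fin (k + 1) → ℝ) b *
                    (Pi.single a 1 : Fin (k + 1) → ℝ) (b.succAbove v) := by
              intro w
              have h1 : v = OGraph.contract a b hi w ↔ b.succAbove v = if w = b then a else w := by
                rw [← OGraph.succAbove_contract a b hi w,
                  (Fin.succAbove_right_injective (p := b)).eq_iff]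
              simp only [Pi.single_apply, h1]
              have h2 : b.succAbove v ≠ b := Fin.succAbove_ne b v
              by_cases hw : w = b
              · subst hw
                simp [h2]
              · simp [hw, Ne.symm hw]
            have hs : (Pi.single (Sum.inl a) (1 : ℝ) : Fin (k + 1) ⊕ Fin r → ℝ)
                (Sum.inl (b.succAbove v)) = (Pi.single a 1 : Fin (k + 1) → ℝ) (b.succAbove v) := by
              simp [Pi.single_apply]
            simp only [T, edgeCol, Prod.map_fst, Prod.map_snd, Sum.elim_inl, Pi.sub_apply, Sum.map_inl,
              Pi.add_apply, Pi.smul_apply, smul_eq_mul, key, hs]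
            ring
          · simp [T, edgeCol]
      -- The minor has a different first column from `gdet` of the contracted graph. Its vertex sum
      -- is 1: the row operation adds the entry at b, and deleting row b removes the same amount.
      · have hx1 : ∑ v : Fin (k + 1), T x (Sum.inl v) =
            1 + x (Sum.inl b) := by
          have hk1 : ((k : ℝ) + 1) ≠ 0 := by positivity
          simp only [T, Pi.add_apply, Finset.sum_add_distrib, Pi.smul_apply, smul_eq_mul,
            ← Finset.mul_sum]
          congr 1
          · simp only [x, Sum.elim_inl, Finset.sum_const, Finset.card_univ, Fintype.card_fin,
              nsmul_eq_mul]
            push_cast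
            field_simp
          · simp [Pi.single_apply]
        rw [Fin.sum_univ_succAbove _ b] at hx1
        have hb1 : T x (Sum.inl b) = x (Sum.inl b) := by
          simp [T, hi.symm]
        rw [hb1] at hx1
        simp only [Sum.map_inl]
        linarith
  · intro s _ hs
    rw [hcoli, if_neg hs]
    simp
  · simp

/-! ### Oriented graphs -/

/-- The oriented graph with orientation determined by the numbering of the edges and the marking. -/
def orientedClass (h : k + r = m + 1) (ends : Fin m → Fin k × Fin k)
    (lab : Fin m → FreeGroup (Fin r)) : OGraph.Chain k :=
  gdet h ends lab • OGraph.cls (Finset.univ.val.map ends)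

theorem sign_mul_self {n : ℕ} (σ : Equiv.Perm (Fin n)) :
    ((Equiv.Perm.sign σ : ℤ) : ℝ) * ((Equiv.Perm.sign σ : ℤ) : ℝ) = 1 := by
  rw [← Int.cast_mul, ← Units.val_mul, Int.units_mul_self]; simp

theorem map_comp_perm {α : Type} (f : Fin m → α) (σ : Equiv.Perm (Fin m)) :
    (Finset.univ.val.map (f ∘ σ) : Multiset α) = Finset.univ.val.map f := by
  rw [← Multiset.map_map]
  congr 1
  exact congrArg Finset.val (Finset.map_univ_equiv σ)

/-- The sign of the permutation enters both through the determinant and through the orientation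
relation, hence cancels. -/
theorem orientedClass_relabel (h : k + r = m + 1) (ends : Fin m → Fin k × Fin k)
    (lab : Fin m → FreeGroup (Fin r)) (σ : Equiv.Perm (Fin k)) :
    orientedClass h (fun i => Prod.map σ σ (ends i)) lab = orientedClass h ends lab := by
  have : (Finset.univ.val.map fun i => Prod.map σ σ (ends i)) =
      OGraph.relabel σ (Finset.univ.val.map ends) := by
    rw [OGraph.relabel, Multiset.map_map]; rfl
  rw [orientedClass, gdet_relabel, this, OGraph.cls_perm, smul_smul, orientedClass]
  congr 1
  linear_combination gdet h ends lab * sign_mul_self σ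

theorem orientedClass_gauge (h : k + r = m + 1) (ends : Fin m → Fin k × Fin k)
    (lab : Fin m → FreeGroup (Fin r)) (g : Fin k → FreeGroup (Fin r)) :
    orientedClass h ends (fun i => (g (ends i).1)⁻¹ * lab i * g (ends i).2) =
      orientedClass h ends lab := by
  rw [orientedClass, gdet_gauge, orientedClass]

/-- The underlying oriented graph ignores the marking; only the determinant responds, by the
character det. -/
theorem orientedClass_twist (h : k + r = m + 1) (ends : Fin m → Fin k × Fin k)
    (lab : Fin m → FreeGroup (Fin r)) (α : MulAut (FreeGroup (Fin r))) :
    orientedClass h ends (fun i => α (lab i)) =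
      ((autDet r α : ℤ) : ℝ) • orientedClass h ends lab := by
  rw [orientedClass, gdet_twist, orientedClass, smul_smul]

theorem orientedClass_perm (h : k + r = m + 1) (ends : Fin m → Fin k × Fin k)
    (lab : Fin m → FreeGroup (Fin r)) (σ : Equiv.Perm (Fin m)) :
    orientedClass h (ends ∘ σ) (lab ∘ σ) =
      ((Equiv.Perm.sign σ : ℤ) : ℝ) • orientedClass h ends lab := by
  rw [orientedClass, gdet_perm, map_comp_perm, orientedClass, smul_smul]

theorem cls_flip_multiset {ι : Type} (ends : ι → Fin k × Fin k) (fl : ι → Bool) (t : Multiset ι) :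
    ∀ s : OGraph k, OGraph.cls (s + t.map fun i => flipEnds (fl i) (ends i)) =
      (t.map fun i => flipSign (fl i)).prod • OGraph.cls (s + t.map ends) := by
  induction t using Multiset.induction_on with
  | empty => intro s; simp
  | cons a t ih =>
    intro s
    rw [Multiset.map_cons, Multiset.map_cons, Multiset.map_cons, Multiset.prod_cons,
      Multiset.add_cons, Multiset.add_cons, ← Multiset.cons_add, ih, Multiset.cons_add, mul_comm,
      mul_smul]
    congr 1
    cases fl a
    · simp [flipEnds, flipSign]
    · simp only [flipEnds, flipSign, if_true]
      rw [neg_smul, one_smul]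
      exact OGraph.cls_flip _ _ _

theorem cls_flip_univ (ends : Fin m → Fin k × Fin k) (fl : Fin m → Bool) :
    OGraph.cls (Finset.univ.val.map fun i => flipEnds (fl i) (ends i)) =
      (∏ i, flipSign (fl i)) • OGraph.cls (Finset.univ.val.map ends) := by
  have := cls_flip_multiset ends fl Finset.univ.val 0
  rwa [zero_add, zero_add] at this

theorem orientedClass_flip (h : k + r = m + 1) (ends : Fin m → Fin k × Fin k)
    (lab : Fin m → FreeGroup (Fin r)) (fl : Fin m → Bool) :
    orientedClass h (fun i => flipEnds (fl i) (ends i)) (fun i => flipLab (fl i) (lab i)) =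
      orientedClass h ends lab := by
  rw [orientedClass, gdet_flip, cls_flip_univ, smul_smul, orientedClass]
  congr 1
  have : (∏ i, flipSign (fl i)) * (∏ i, flipSign (fl i)) = 1 := by
    rw [← Finset.prod_mul_distrib]
    exact Finset.prod_eq_one fun i _ => flipSign_mul_self _
  linear_combination gdet h ends lab * this

theorem map_univ_succAbove {α : Type} (f : Fin (m + 1) → α) (i : Fin (m + 1)) :
    (Finset.univ.val.map f : Multiset α) = f i ::ₘ Finset.univ.val.map fun j => f (i.succAbove j) := by
  rw [Fin.univ_succAbove _ i, Finset.cons_val, Multiset.map_cons, Finset.map_val, Multiset.map_map]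
  rfl

theorem boundary_cls_univ (ends : Fin (m + 1) → Fin (k + 1) × Fin (k + 1)) :
    OGraph.boundary k (OGraph.cls (Finset.univ.val.map ends)) =
      ∑ i, OGraph.collapse (Finset.univ.val.map fun j => ends (i.succAbove j)) (ends i) := by
  rw [OGraph.boundary_cls, OGraph.boundaryTerm, Multiset.map_map]
  refine congrArg Multiset.sum (Multiset.map_congr rfl fun i _ => ?_)
  rw [Function.comp_apply, map_univ_succAbove ends i, Multiset.erase_cons_head]

/-- The boundary of an oriented graph, where the label of each edge which is not a loop can be made
trivial by a gauge transformation. -/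
theorem boundary_orientedClass (h : k + 1 + r = m + 1 + 1) (h' : k + r = m + 1)
    (ends : Fin (m + 1) → Fin (k + 1) × Fin (k + 1)) (lab : Fin (m + 1) → FreeGroup (Fin r))
    (W : Fin (m + 1) → OGraph.Chain k) (hloop : ∀ i, (ends i).1 = (ends i).2 → W i = 0)
    (hW : ∀ i (hi : (ends i).1 ≠ (ends i).2), ∃ g : Fin (k + 1) → FreeGroup (Fin r),
      (g (ends i).1)⁻¹ * lab i * g (ends i).2 = 1 ∧
      W i = orientedClass h' (fun j => Prod.map (OGraph.contract (ends i).1 (ends i).2 hi)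
        (OGraph.contract (ends i).1 (ends i).2 hi) (ends (i.succAbove j)))
        (fun j => (g (ends (i.succAbove j)).1)⁻¹ * lab (i.succAbove j) *
          g (ends (i.succAbove j)).2)) :
    OGraph.boundary k (orientedClass h ends lab) = ∑ i : Fin (m + 1), (-1 : ℝ) ^ (i : ℕ) • W i := by
  rw [orientedClass, map_smul, boundary_cls_univ, Finset.smul_sum]
  refine Finset.sum_congr rfl fun i _ => ?_
  by_cases hi : (ends i).1 = (ends i).2
  · rw [hloop i hi, OGraph.collapse, dif_neg (by simpa using hi)]
    simp
  -- After the gauge transformation the contracted edge has trivial label. The sign (-1)^(head + 1)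
  -- of `collapse` cancels against that of `gdet_contract`, leaving (-1)^i.
  · obtain ⟨g, hg1, hg2⟩ := hW i hi
    rw [hg2, OGraph.collapse, dif_pos hi, ← gdet_gauge h ends lab g,
      gdet_contract h h' ends _ i _ _ rfl hi hg1, orientedClass, smul_smul, smul_smul]
    have hs : OGraph.relabel (OGraph.contract (ends i).1 (ends i).2 hi)
        (Finset.univ.val.map fun j => ends (i.succAbove j)) = Finset.univ.val.map fun j =>
          Prod.map (OGraph.contract (ends i).1 (ends i).2 hi)
            (OGraph.contract (ends i).1 (ends i).2 hi) (ends (i.succAbove j)) := by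
      rw [OGraph.relabel, Multiset.map_map]; rfl
    rw [hs]
    congr 1
    have e1 : ((-1 : ℝ) ^ ((ends i).2 : ℕ)) * (-1) ^ ((ends i).2 : ℕ) = 1 := by
      rw [← mul_pow]; simp
    rw [pow_add, pow_add, pow_add]
    linear_combination (-1 : ℝ) ^ (i : ℕ) * gdet h' (fun j => Prod.map
      (OGraph.contract (ends i).1 (ends i).2 hi)
        (OGraph.contract (ends i).1 (ends i).2 hi) (ends (i.succAbove j)))
        (fun j => (g (ends (i.succAbove j)).1)⁻¹ * lab (i.succAbove j) *
          g (ends (i.succAbove j)).2) * e1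

end Gdet

end

/-! ### Forest contractions of labelled graphs -/

section

/-! ### Contracting the complement of a set of edges -/

section Contraction

variable {V E K M G : Type} [Group G]

/-- The graph with vertex set `K` and edge set `M` is the result of contracting the edges outside of
the range of `e`, and the gauge transformation `g` makes the labels of these edges trivial. -/
structure IsContraction (ends : E → V × V) (lab : E → G) (e : M → E) (q : V → K) (g : V → G) :
    Prop where
  inj : Function.Injective e
  surj : Function.Surjective q
  eq_iff : ∀ u v, q u = q v ↔ ∃ x, EPath ends (Set.range e)ᶜ u x v
  lab_eq : ∀ a, a ∉ Set.range e → lab a = g (ends a).1 * (g (ends a).2)⁻¹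

/-- The end points of the edges in the contracted graph. -/
def contrEnds (ends : E → V × V) (e : M → E) (q : V → K) (i : M) : K × K :=
  Prod.map q q (ends (e i))

/-- The labels in the contracted graph. -/
def contrLab (ends : E → V × V) (lab : E → G) (e : M → E) (g : V → G) (i : M) : G :=
  (g (ends (e i)).1)⁻¹ * lab (e i) * g (ends (e i)).2

open Classical in
/-- The effect of the contraction on paths. -/
def contrProj (e : M → E) : FreeGroup E →* FreeGroup M :=
  FreeGroup.lift fun a => if h : ∃ i, e i = a then FreeGroup.of h.choose else 1

theorem contrProj_of {e : M → E} (he : Function.Injective e) (i : M) :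
    contrProj e (FreeGroup.of (e i)) = FreeGroup.of i := by
  have h : ∃ j, e j = e i := ⟨i, rfl⟩
  rw [contrProj, FreeGroup.lift_apply_of, dif_pos h]
  exact congrArg _ (he h.choose_spec)

theorem contrProj_of_notMem {e : M → E} {a : E} (ha : a ∉ Set.range e) :
    contrProj e (FreeGroup.of a) = 1 := by
  have h : ¬ ∃ i, e i = a := ha
  rw [contrProj, FreeGroup.lift_apply_of, dif_neg h]

variable {ends : E → V × V} {lab : E → G} {e : M → E} {q : V → K} {g : V → G}

namespace IsContraction

theorem q_eq (hC : IsContraction ends lab e q g) {a : E} (ha : a ∉ Set.range e) :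
    q (ends a).1 = q (ends a).2 :=
  (hC.eq_iff _ _).mpr ⟨_, .edge a ha⟩

/-- Contracted edges become constant paths, since both ends have the same image. -/
theorem proj_path (hC : IsContraction ends lab e q g) {F : Set E} {u v : V} {x : FreeGroup E}
    (hx : EPath ends F u x v) :
    EPath (contrEnds ends e q) (e ⁻¹' F) (q u) (contrProj e x) (q v) := by
  induction hx with
  | one u => rw [map_one]; exact .one _
  | edge a ha =>
    by_cases h : a ∈ Set.range e
    · obtain ⟨i, rfl⟩ := h
      rw [contrProj_of hC.inj]
      exact EPath.edge (ends := contrEnds ends e q) i ha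
    · rw [contrProj_of_notMem h, hC.q_eq h]
      exact .one _
  | inv _ ih => rw [map_inv]; exact ih.inv
  | mul _ _ ih1 ih2 => rw [map_mul]; exact ih1.mul ih2

theorem proj_eq_one {u v : V} {x : FreeGroup E}
    (hx : EPath ends (Set.range e)ᶜ u x v) : contrProj e x = 1 := by
  have := hx.hom_eq (contrProj e) 1 (fun _ => 1) (fun a ha => by simp [contrProj_of_notMem ha])
  simpa using this

/-- Consecutive edges of the path need not meet upstairs, but their ends lie in the same contracted
component; the inserted connecting paths project to 1. -/
theorem lift_path (hC : IsContraction ends lab e q g) {F' : Set M} {a b : K} {x' : FreeGroup M}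
    (hx : EPath (contrEnds ends e q) F' a x' b) : ∀ u v, q u = a → q v = b →
      ∃ x, EPath ends (e '' F' ∪ (Set.range e)ᶜ) u x v ∧ contrProj e x = x' := by
  have hcomp : ∀ u v, q u = q v →
      ∃ x, EPath ends (e '' F' ∪ (Set.range e)ᶜ) u x v ∧ contrProj e x = 1 := by
    intro u v h
    obtain ⟨x, hx⟩ := (hC.eq_iff u v).mp h
    exact ⟨x, hx.mono Set.subset_union_right, proj_eq_one hx⟩
  induction hx with
  | one c =>
    intro u v hu hv
    exact hcomp u v (hu.trans hv.symm)
  | edge i hi =>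
    intro u v hu hv
    obtain ⟨x, hx1, hx2⟩ := hcomp u (ends (e i)).1 hu
    obtain ⟨y, hy1, hy2⟩ := hcomp (ends (e i)).2 v hv.symm
    refine ⟨x * FreeGroup.of (e i) * y, (hx1.mul (.edge (e i) (Or.inl ⟨i, hi, rfl⟩))).mul hy1, ?_⟩
    rw [map_mul, map_mul, hx2, hy2, contrProj_of hC.inj]
    simp
  | inv _ ih =>
    intro u v hu hv
    obtain ⟨x, hx1, hx2⟩ := ih v u hv hu
    exact ⟨x⁻¹, hx1.inv, by rw [map_inv, hx2]⟩
  | @mul _ c _ _ _ _ _ ih1 ih2 =>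
    intro u v hu hv
    obtain ⟨w, rfl⟩ := hC.surj c
    obtain ⟨x, hx1, hx2⟩ := ih1 u w hu rfl
    obtain ⟨y, hy1, hy2⟩ := ih2 w v rfl hv
    exact ⟨x * y, hx1.mul hy1, by rw [map_mul, hx2, hy2]⟩

theorem lab_proj (hC : IsContraction ends lab e q g) {u v : V} {x : FreeGroup E} {F : Set E}
    (hx : EPath ends F u x v) : (g u)⁻¹ * FreeGroup.lift lab x * g v =
      FreeGroup.lift (contrLab ends lab e g) (contrProj e x) := by
  have := hx.hom_eq (FreeGroup.lift lab) ((FreeGroup.lift (contrLab ends lab e g)).comp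
    (contrProj e)) (fun v => (g v)⁻¹) (fun a _ => by
      by_cases h : a ∈ Set.range e
      · obtain ⟨i, rfl⟩ := h
        rw [MonoidHom.comp_apply, contrProj_of hC.inj]
        simp [contrLab]
      · rw [MonoidHom.comp_apply, contrProj_of_notMem h]
        simp [hC.lab_eq a h])
  simpa using this

theorem lab_inv_mul (hC : IsContraction ends lab e q g) {u v : V} {x : FreeGroup E}
    (hx : EPath ends (Set.range e)ᶜ u x v) : FreeGroup.lift lab x = g u * (g v)⁻¹ := by
  have := hC.lab_proj hx
  rw [proj_eq_one hx, map_one] at this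
  have h2 : FreeGroup.lift lab x = g u * ((g u)⁻¹ * FreeGroup.lift lab x * g v) * (g v)⁻¹ := by group
  rw [h2, this, mul_one]

/-- A closed path of contracted edges has trivial label by the gauge condition, so the marking
forces it to be trivial. The complement is automatically a forest. -/
theorem eq_one_of_closed (hC : IsContraction ends lab e q g) (hm : IsMarked ends lab) {u : V}
    {x : FreeGroup E} (hx : EPath ends (Set.range e)ᶜ u x u) : x = 1 := by
  refine hm.eq_of_lab_eq (hx.mono (Set.subset_univ _)) (.one u) ?_
  rw [hC.lab_inv_mul hx, map_one, mul_inv_cancel]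

/-- Paths lift to the original graph and their labels change only by the gauge at the ends, so
existence and uniqueness carry over. -/
theorem isMarked (hC : IsContraction ends lab e q g) (hm : IsMarked ends lab) :
    IsMarked (contrEnds ends e q) (contrLab ends lab e g) := by
  intro a w
  obtain ⟨v, rfl⟩ := hC.surj a
  obtain ⟨x, ⟨hx1, hx2⟩, -⟩ := hm v (g v * w * (g v)⁻¹)
  refine ⟨contrProj e x, ⟨hC.proj_path hx1, ?_⟩, ?_⟩
  · rw [← hC.lab_proj hx1, hx2]; group
  · rintro y ⟨hy1, hy2⟩
    obtain ⟨z, hz1, rfl⟩ := hC.lift_path hy1 v v rfl rfl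
    congr 1
    refine hm.eq_of_lab_eq (hz1.mono (Set.subset_univ _)) hx1 ?_
    rw [hx2, ← hy2, ← hC.lab_proj hz1]
    group

theorem pathConnected (hC : IsContraction ends lab e q g) (hc : PathConnected ends) :
    PathConnected (contrEnds ends e q) := by
  intro a b
  obtain ⟨u, rfl⟩ := hC.surj a
  obtain ⟨v, rfl⟩ := hC.surj b
  obtain ⟨x, hx⟩ := hc u v
  exact ⟨_, hC.proj_path hx⟩

theorem equiv {K' : Type} (hC : IsContraction ends lab e q g) (θ : K ≃ K') :
    IsContraction ends lab e (θ ∘ q) g where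
  inj := hC.inj
  surj := θ.surjective.comp hC.surj
  eq_iff u v := by
    rw [Function.comp_apply, Function.comp_apply, θ.injective.eq_iff, hC.eq_iff]
  lab_eq := hC.lab_eq

theorem of_range_eq {e' : M → E} (hC : IsContraction ends lab e q g) (he : Function.Injective e')
    (h : Set.range e' = Set.range e) : IsContraction ends lab e' q g where
  inj := he
  surj := hC.surj
  eq_iff := by rw [h]; exact hC.eq_iff
  lab_eq := by rw [h]; exact hC.lab_eq

/-- Both gauges compute the label of the same contracted path, so their quotient is constant on each
component and descends to the contracted graph. -/
theorem gauge_eq {g' : V → G} {K' : Type} {q' : V → K'} (hC : IsContraction ends lab e q g)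
    (hC' : IsContraction ends lab e q' g') {u v : V} (h : q u = q v) :
    (g u)⁻¹ * g' u = (g v)⁻¹ * g' v := by
  obtain ⟨x, hx⟩ := (hC.eq_iff u v).mp h
  have h1 := hC.lab_inv_mul hx
  have h2 := hC'.lab_inv_mul hx
  rw [h1] at h2
  have h3 : (g u)⁻¹ * g' u = (g v)⁻¹ * (g u * (g v)⁻¹)⁻¹ * g' u := by group
  rw [h3, h2]
  group

/-- Contractions are unique up to renaming of the vertices and gauge transformations. -/
theorem unique {q' : V → K} {g' : V → G} (hC : IsContraction ends lab e q g)
    (hC' : IsContraction ends lab e q' g') : ∃ (σ : Equiv.Perm K) (h : K → G),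
      (∀ v, q' v = σ (q v)) ∧ ∀ v, g' v = g v * h (q v) := by
  let s : K → V := Function.surjInv hC.surj
  have hs : ∀ a, q (s a) = a := Function.surjInv_eq hC.surj
  have hqq : ∀ u v, q u = q v ↔ q' u = q' v := fun u v => by rw [hC.eq_iff, hC'.eq_iff]
  refine ⟨Equiv.ofBijective (fun a => q' (s a)) ⟨?_, ?_⟩, fun a => (g (s a))⁻¹ * g' (s a), ?_, ?_⟩
  · intro a b h
    rw [← hs a, ← hs b]
    exact (hqq _ _).mpr h
  · intro b
    obtain ⟨v, rfl⟩ := hC'.surj b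
    exact ⟨q v, (hqq _ _).mp (hs _)⟩
  · intro v
    exact (hqq _ _).mp (hs _).symm
  · intro v
    change g' v = g v * ((g (s (q v)))⁻¹ * g' (s (q v)))
    rw [gauge_eq hC hC' (hs (q v)), mul_inv_cancel_left]

end IsContraction

/-- The vertices are the components of the complement, and the gauge at v is the label of a path to
a representative. In a forest this path is unique, which gives the condition on labels. -/
theorem exists_isContraction (he : Function.Injective e)
    (hno : ∀ u x, EPath ends (Set.range e)ᶜ u x u → x = 1) :
    ∃ (K' : Type) (q : V → K') (g : V → G), IsContraction ends lab e q g := by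
  let s : Setoid V :=
    { r := fun u v => ∃ x, EPath ends (Set.range e)ᶜ u x v
      iseqv := ⟨fun u => ⟨1, .one u⟩, fun ⟨_, h⟩ => ⟨_, h.inv⟩,
        fun ⟨_, h1⟩ ⟨_, h2⟩ => ⟨_, h1.mul h2⟩⟩ }
  have hrep : ∀ v, ∃ x, EPath ends (Set.range e)ᶜ v x (Quotient.mk s v).out :=
    fun v => Quotient.exact (Quotient.out_eq (Quotient.mk s v)).symm
  choose β hβ using hrep
  refine ⟨Quotient s, Quotient.mk s, fun v => FreeGroup.lift lab (β v), he, Quotient.mk_surjective,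
    fun u v => Quotient.eq, fun a ha => ?_⟩
  have hq : Quotient.mk s (ends a).1 = Quotient.mk s (ends a).2 := Quotient.sound ⟨_, .edge a ha⟩
  have h1 := hβ (ends a).1
  rw [hq] at h1
  have := hno _ _ (((EPath.edge (ends := ends) a ha).mul (hβ (ends a).2)).mul h1.inv)
  have h2 := congrArg (FreeGroup.lift lab) (mul_inv_eq_one.mp this)
  rw [map_mul, FreeGroup.lift_apply_of] at h2
  rw [← h2]
  group

/-! ### Edges in the components of a forest -/

/-- After the gauge transformation the forest edges have trivial labels. The injective map
`cycleEquiv` therefore sends the span of the base point and these edges into the span of the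
vertices of the component; compare dimensions. -/
theorem IsContraction.card_forest_lt {B : Type} [Fintype E] [Fintype V] [DecidableEq K]
    {lab : E → FreeGroup B} {g : V → FreeGroup B}
    (hC : IsContraction ends lab e q g) (hm : IsMarked ends lab) (hc : PathConnected ends) (w : K)
    (F : Finset E) (hF : ∀ a ∈ F, a ∉ Set.range e ∧ q (ends a).1 = w) :
    F.card + 1 ≤ (Finset.univ.filter fun v => q v = w).card := by
  classical
  obtain ⟨v₀, rfl⟩ := hC.surj w
  let L := cycleEquiv (hm.gauge g) hc v₀
  let S : Finset (Option E) := Finset.insertNone F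
  let T : Finset (V ⊕ B) := (Finset.univ.filter fun v => q v = q v₀).map Function.Embedding.inl
  have hmap : ∀ x ∈ Finsupp.supported ℝ ℝ (S : Set (Option E)),
      L x ∈ Finsupp.supported ℝ ℝ (T : Set (V ⊕ B)) := by
    have hle : Finsupp.supported ℝ ℝ (S : Set (Option E)) ≤
        (Finsupp.supported ℝ ℝ (T : Set (V ⊕ B))).comap L.toLinearMap := by
      rw [Finsupp.supported_eq_span_single, Submodule.span_le]
      rintro _ ⟨o, ho, rfl⟩
      have hmem : ∀ v, q v = q v₀ → (Finsupp.single (Sum.inl v) 1 : V ⊕ B →₀ ℝ) ∈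
          Finsupp.supported ℝ ℝ (T : Set (V ⊕ B)) := fun v hv =>
        Finsupp.single_mem_supported ℝ 1 (by simp [T, hv])
      change cycleMap _ _ v₀ (Finsupp.single o 1) ∈ Finsupp.supported ℝ ℝ (T : Set (V ⊕ B))
      obtain _ | a := o
      · rw [cycleMap_none]
        exact hmem v₀ rfl
      · have ha : a ∈ F := by simpa [S] using ho
        obtain ⟨h1, h2⟩ := hF a ha
        have h3 : ab ((g (ends a).1)⁻¹ * lab a * g (ends a).2) = 0 := by
          rw [hC.lab_eq a h1, ← ab_one]; congr 1; group
        rw [cycleMap_some, h3, map_zero, add_zero]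
        exact sub_mem (hmem _ ((hC.q_eq h1).symm.trans h2)) (hmem _ h2)
    exact fun x hx => hle hx
  have hfin : ∀ (X : Type) (S : Finset X),
      Module.finrank ℝ (Finsupp.supported ℝ ℝ (S : Set X)) = S.card := by
    intro X S
    rw [(Finsupp.supportedEquivFinsupp (R := ℝ) (M := ℝ) (S : Set X)).finrank_eq]
    simp
  have hfd : FiniteDimensional ℝ (Finsupp.supported ℝ ℝ (T : Set (V ⊕ B))) :=
    Module.Finite.equiv (Finsupp.supportedEquivFinsupp (R := ℝ) (M := ℝ) (T : Set (V ⊕ B))).symm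
  have := LinearMap.finrank_le_finrank_of_injective
    (f := (L.toLinearMap.restrict hmap)) (fun x y h => Subtype.ext (L.injective
      (congrArg Subtype.val h)))
  rw [hfin, hfin] at this
  simpa [S, T] using this

end Contraction

end

/-! ### Contractions, collapses and the oriented graph of a tuple of edges -/

section

/-! ### Contractions of marked graphs -/

namespace MarkedGraph

variable {r : ℕ}

/-- Contractions of a marked graph. -/
abbrev IsContr {m k : ℕ} (Γ : MarkedGraph r) (e : Fin m → Fin Γ.nE) (q : Fin Γ.nV → Fin k)
    (g : Fin Γ.nV → FreeGroup (Fin r)) : Prop :=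
  IsContraction Γ.ends Γ.lab e q g

theorem IsContr.card {m k : ℕ} {Γ : MarkedGraph r} {e : Fin m → Fin Γ.nE} {q : Fin Γ.nV → Fin k}
    {g : Fin Γ.nV → FreeGroup (Fin r)} (hC : Γ.IsContr e q g) : k + r = m + 1 := by
  have := card_of_isMarked (hC.isMarked Γ.isMarked) (hC.pathConnected Γ.pathConnected)
    (q ⟨0, Γ.nV_pos⟩)
  simpa using this

theorem IsContr.not_hasCycle {m k : ℕ} {Γ : MarkedGraph r} {e : Fin m → Fin Γ.nE}
    {q : Fin Γ.nV → Fin k} {g : Fin Γ.nV → FreeGroup (Fin r)} (hC : Γ.IsContr e q g) :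
    ¬ Γ.HasCycle (Set.range e)ᶜ := by
  rw [hasCycle_iff]
  rintro ⟨v, x, h1, h2⟩
  exact h1 (hC.eq_one_of_closed Γ.isMarked h2)

theorem exists_nat_isContr {m : ℕ} (Γ : MarkedGraph r) {e : Fin m → Fin Γ.nE}
    (he : Function.Injective e) (hno : ¬ Γ.HasCycle (Set.range e)ᶜ) :
    ∃ (k : ℕ) (q : Fin Γ.nV → Fin k) (g : Fin Γ.nV → FreeGroup (Fin r)), Γ.IsContr e q g := by
  rw [hasCycle_iff] at hno
  push Not at hno
  obtain ⟨K, q, g, hC⟩ := exists_isContraction (lab := Γ.lab) he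
    fun u x hx => by_contra fun h => hno u x h hx
  have : Finite K := Finite.of_surjective q hC.surj
  have := Fintype.ofFinite K
  exact ⟨_, _, g, hC.equiv (Fintype.equivFin K)⟩

theorem exists_isContr {m : ℕ} (Γ : MarkedGraph r) {e : Fin m → Fin Γ.nE}
    (he : Function.Injective e) (hno : ¬ Γ.HasCycle (Set.range e)ᶜ) {k : ℕ} (hk : k + r = m + 1) :
    ∃ (q : Fin Γ.nV → Fin k) (g : Fin Γ.nV → FreeGroup (Fin r)), Γ.IsContr e q g := by
  obtain ⟨k', q, g, hC⟩ := Γ.exists_nat_isContr he hno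
  obtain rfl : k' = k := by
    have := hC.card
    omega
  exact ⟨q, g, hC⟩

theorem countP_univ_map {m : ℕ} {α : Type} (f : Fin m → α) (p : α → Prop) [DecidablePred p] :
    (Finset.univ.val.map f).countP p = (Finset.univ.filter fun i => p (f i)).card := by
  rw [Multiset.countP_map]
  rfl

theorem valence_univ_map {m k : ℕ} (ends : Fin m → Fin k × Fin k) (v : Fin k) :
    OGraph.valence (Finset.univ.val.map ends) v =
      (Finset.univ.filter fun i => (ends i).1 = v).card +
        (Finset.univ.filter fun i => (ends i).2 = v).card := by
  rw [OGraph.valence, countP_univ_map, countP_univ_map]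

/-- A component with c vertices has at least 3c half-edges, and at most c - 1 forest edges use up
two each. At least c + 2 ≥ 3 half-edges remain. -/
theorem IsContr.three_le_valence {m k : ℕ} {Γ : MarkedGraph r} {e : Fin m → Fin Γ.nE}
    {q : Fin Γ.nV → Fin k} {g : Fin Γ.nV → FreeGroup (Fin r)} (hC : Γ.IsContr e q g) (w : Fin k) :
    3 ≤ OGraph.valence (Finset.univ.val.map (contrEnds Γ.ends e q)) w := by
  classical
  let C := Finset.univ.filter fun v => q v = w
  let F := Finset.univ.filter fun a => a ∉ Set.range e ∧ q (Γ.ends a).1 = w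
  have hF : F.card + 1 ≤ C.card := by
    convert hC.card_forest_lt Γ.isMarked Γ.pathConnected w F (fun a ha => by
      simpa [F] using ha)
  have hsum : 3 * C.card ≤ (Finset.univ.filter fun a => q (Γ.ends a).1 = w).card +
      (Finset.univ.filter fun a => q (Γ.ends a).2 = w).card := by
    have h1 : ∀ p : Fin Γ.nE → Fin Γ.nV, (Finset.univ.filter fun a => q (p a) = w).card =
        ∑ v ∈ C, (Finset.univ.filter fun a => p a = v).card := by
      intro p
      rw [Finset.card_eq_sum_card_fiberwise (f := p) (t := C) (fun a ha => by simpa [C] using ha)]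
      refine Finset.sum_congr rfl fun v hv => congrArg _ ?_
      ext a
      simp only [Finset.mem_filter, Finset.mem_univ, true_and, C] at hv ⊢
      exact ⟨fun h => h.2, fun h => ⟨by rw [h, hv], h⟩⟩
    rw [h1, h1, ← Finset.sum_add_distrib, mul_comm, ← smul_eq_mul, ← Finset.sum_const]
    refine Finset.sum_le_sum fun v _ => ?_
    rw [← valence_univ_map]
    exact Γ.three_le_valence v
  have hsplit : ∀ p : Fin Γ.nE → Fin Γ.nV, (∀ a, a ∉ Set.range e → q (p a) = q (Γ.ends a).1) →
      (Finset.univ.filter fun a => q (p a) = w).card =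
        (Finset.univ.filter fun i => q (p (e i)) = w).card + F.card := by
    intro p hp
    rw [← Finset.card_map (⟨e, hC.inj⟩ : Fin m ↪ Fin Γ.nE), ← Finset.card_union_of_disjoint]
    · congr 1
      ext a
      simp only [Finset.mem_filter, Finset.mem_univ, true_and, Finset.mem_union, Finset.mem_map, F,
        Function.Embedding.coeFn_mk]
      constructor
      · intro h
        by_cases ha : a ∈ Set.range e
        · obtain ⟨i, rfl⟩ := ha
          exact Or.inl ⟨i, h, rfl⟩
        · exact Or.inr ⟨ha, by rw [← hp a ha, h]⟩
      · rintro (⟨i, h, rfl⟩ | ⟨ha, h⟩)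
        · exact h
        · rw [hp a ha, h]
    · rw [Finset.disjoint_left]
      intro a ha hb
      obtain ⟨i, -, rfl⟩ := Finset.mem_map.mp ha
      exact (Finset.mem_filter.mp hb).2.1 ⟨i, rfl⟩
  rw [valence_univ_map]
  have e1 := hsplit (fun a => (Γ.ends a).1) (fun a _ => rfl)
  have e2 := hsplit (fun a => (Γ.ends a).2) (fun a ha => (hC.q_eq ha).symm)
  have e3 : (Finset.univ.filter fun i => (contrEnds Γ.ends e q i).1 = w).card =
    (Finset.univ.filter fun i => q (Γ.ends (e i)).1 = w).card := rfl
  have e4 : (Finset.univ.filter fun i => (contrEnds Γ.ends e q i).2 = w).card =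
    (Finset.univ.filter fun i => q (Γ.ends (e i)).2 = w).card := rfl
  rw [e3, e4]
  omega

/-- The contracted graph. -/
def contrGraph {m k : ℕ} {Γ : MarkedGraph r} {e : Fin m → Fin Γ.nE} {q : Fin Γ.nV → Fin k}
    {g : Fin Γ.nV → FreeGroup (Fin r)} (hC : Γ.IsContr e q g) : MarkedGraph r where
  nV := k
  nE := m
  ends := contrEnds Γ.ends e q
  lab := contrLab Γ.ends Γ.lab e g
  connected := (pathConnected_iff _).mpr ⟨(q ⟨0, Γ.nV_pos⟩).pos, hC.pathConnected Γ.pathConnected⟩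
  three_le_valence := hC.three_le_valence
  marking := (isMarked_iff _ _).mpr (hC.isMarked Γ.isMarked)

theorem eqvGen_notMem_iff (Γ : MarkedGraph r) {m : ℕ} (e : Fin m → Fin Γ.nE) (u v : Fin Γ.nV) :
    Relation.EqvGen (fun x y => ∃ a, a ∉ Set.range e ∧ Γ.ends a = (x, y)) u v ↔
      ∃ x, EPath Γ.ends (Set.range e)ᶜ u x v :=
  eqvGen_iff_ePath (F := (Set.range e)ᶜ)

/-- The collapse to the contracted graph. -/
def contrCollapse {m k : ℕ} {Γ : MarkedGraph r} {e : Fin m → Fin Γ.nE} {q : Fin Γ.nV → Fin k}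
    {g : Fin Γ.nV → FreeGroup (Fin r)} (hC : Γ.IsContr e q g) : Collapse Γ (contrGraph hC) where
  onV := q
  onE := ⟨e, hC.inj⟩
  flip _ := false
  onV_surjective := hC.surj
  forest := hC.not_hasCycle
  onV_eq_iff u v := (hC.eq_iff u v).trans (eqvGen_notMem_iff Γ e u v).symm
  ends_onE _ := rfl
  gauge := g
  lab_onE i := by
    change Γ.lab (e i) = g (Γ.ends (e i)).1 * ((g (Γ.ends (e i)).1)⁻¹ * Γ.lab (e i) *
      g (Γ.ends (e i)).2) * (g (Γ.ends (e i)).2)⁻¹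
    group
  lab_collapsed := hC.lab_eq

/-! ### Contractions and collapses -/

theorem Collapse.map_ends {Γ Γ' : MarkedGraph r} (c : Collapse Γ Γ') (a : Fin Γ'.nE) :
    Prod.map c.onV c.onV (Γ.ends (c.onE a)) = flipEnds (c.flip a) (Γ'.ends a) := by
  rw [c.ends_onE]; rfl

theorem Collapse.lab_map {Γ Γ' : MarkedGraph r} (c : Collapse Γ Γ') (a : Fin Γ'.nE) :
    Γ.lab (c.onE a) = c.gauge (Γ.ends (c.onE a)).1 * flipLab (c.flip a) (Γ'.lab a) *
      (c.gauge (Γ.ends (c.onE a)).2)⁻¹ := by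
  rw [c.lab_onE]; rfl

theorem Collapse.isContr {Γ Γ' : MarkedGraph r} (c : Collapse Γ Γ') :
    Γ.IsContr c.onE c.onV c.gauge where
  inj := c.onE.injective
  surj := c.onV_surjective
  eq_iff u v := (c.onV_eq_iff u v).trans (eqvGen_notMem_iff Γ c.onE u v)
  lab_eq := c.lab_collapsed

theorem ePath_of_flip {E V : Type} {ends ends' : E → V × V}
    (h : ∀ a, ends' a = ends a ∨ ends' a = (ends a).swap) {F : Set E} {u v : V} {x : FreeGroup E}
    (hx : EPath ends F u x v) : ∃ y, EPath ends' F u y v := by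
  induction hx with
  | one u => exact ⟨1, .one u⟩
  | edge a ha =>
    have h1 := EPath.edge (ends := ends') a ha
    rcases h a with h2 | h2
    · rw [h2] at h1; exact ⟨_, h1⟩
    · rw [h2] at h1; exact ⟨_, h1.inv⟩
  | inv _ ih => obtain ⟨y, hy⟩ := ih; exact ⟨_, hy.inv⟩
  | mul _ _ ih1 ih2 =>
    obtain ⟨y, hy⟩ := ih1
    obtain ⟨z, hz⟩ := ih2
    exact ⟨_, hy.mul hz⟩

theorem flipEnds_cases {k : ℕ} (b : Bool) (p : Fin k × Fin k) :
    flipEnds b p = p ∨ flipEnds b p = p.swap := by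
  cases b <;> simp [flipEnds]

/-- Contracting in two stages identifies the same vertices as contracting at once; reversing edges
changes the word of a path but not its end points. -/
theorem Collapse.ePath_iff {Γ Γ' : MarkedGraph r} (c : Collapse Γ Γ') {m : ℕ}
    (e : Fin m → Fin Γ'.nE) (u v : Fin Γ.nV) :
    (∃ x, EPath Γ.ends (Set.range (c.onE ∘ e))ᶜ u x v) ↔
      ∃ x, EPath Γ'.ends (Set.range e)ᶜ (c.onV u) x (c.onV v) := by
  have hends : ∀ a, contrEnds Γ.ends c.onE c.onV a = flipEnds (c.flip a) (Γ'.ends a) := c.map_ends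
  constructor
  · rintro ⟨x, hx⟩
    have h1 := (c.isContr.proj_path hx).mono (F' := (Set.range e)ᶜ) (by
      rintro a ha ⟨i, rfl⟩
      exact ha ⟨i, rfl⟩)
    refine ePath_of_flip (fun a => ?_) h1
    rw [hends]
    rcases flipEnds_cases (c.flip a) (Γ'.ends a) with h | h
    · rw [h]; exact Or.inl rfl
    · rw [h]; exact Or.inr (Prod.swap_swap _).symm
  · rintro ⟨x, hx⟩
    obtain ⟨y, hy⟩ := ePath_of_flip (ends' := contrEnds Γ.ends c.onE c.onV) (fun a => by
      rw [hends]; exact flipEnds_cases _ _) hx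
    obtain ⟨z, hz, -⟩ := c.isContr.lift_path hy u v rfl rfl
    refine ⟨z, hz.mono ?_⟩
    rintro _ (⟨a, ha, rfl⟩ | ha) ⟨i, hi⟩
    · exact ha ⟨i, c.onE.injective hi⟩
    · exact ha ⟨e i, hi⟩

theorem Collapse.contrEnds_comp {Γ Γ' : MarkedGraph r} (c : Collapse Γ Γ') {m k : ℕ}
    (e : Fin m → Fin Γ'.nE) (q : Fin Γ'.nV → Fin k) (i : Fin m) :
    contrEnds Γ.ends (c.onE ∘ e) (q ∘ c.onV) i =
      flipEnds (c.flip (e i)) (contrEnds Γ'.ends e q i) := by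
  have h : contrEnds Γ.ends (c.onE ∘ e) (q ∘ c.onV) i =
      Prod.map q q (Prod.map c.onV c.onV (Γ.ends (c.onE (e i)))) := rfl
  rw [h, c.map_ends]
  cases c.flip (e i) <;> rfl

theorem Collapse.contrLab_comp {Γ Γ' : MarkedGraph r} (c : Collapse Γ Γ') {m : ℕ}
    (e : Fin m → Fin Γ'.nE) (g : Fin Γ'.nV → FreeGroup (Fin r)) (i : Fin m) :
    contrLab Γ.ends Γ.lab (c.onE ∘ e) (fun v => c.gauge v * g (c.onV v)) i =
      flipLab (c.flip (e i)) (contrLab Γ'.ends Γ'.lab e g i) := by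
  have h1 := congrArg Prod.fst (c.map_ends (e i))
  have h2 := congrArg Prod.snd (c.map_ends (e i))
  simp only [Prod.map_fst, Prod.map_snd] at h1 h2
  simp only [contrLab, Function.comp_apply]
  rw [c.lab_map, h1, h2]
  cases c.flip (e i)
  · simp only [flipEnds, flipLab, Bool.false_eq_true, if_false]
    group
  · simp only [flipEnds, flipLab, if_true, Prod.fst_swap, Prod.snd_swap]
    group

theorem Collapse.isContr_comp {Γ Γ' : MarkedGraph r} (c : Collapse Γ Γ') {m k : ℕ}
    {e : Fin m → Fin Γ'.nE} {q : Fin Γ'.nV → Fin k} {g : Fin Γ'.nV → FreeGroup (Fin r)}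
    (hC : Γ'.IsContr e q g) :
    Γ.IsContr (c.onE ∘ e) (q ∘ c.onV) fun v => c.gauge v * g (c.onV v) where
  inj := c.onE.injective.comp hC.inj
  surj := hC.surj.comp c.onV_surjective
  eq_iff u v := by
    rw [c.ePath_iff]
    exact hC.eq_iff _ _
  lab_eq a ha := by
    by_cases h : a ∈ Set.range c.onE
    · obtain ⟨b, rfl⟩ := h
      have hb : b ∉ Set.range e := by
        rintro ⟨i, rfl⟩
        exact ha ⟨i, rfl⟩
      have h1 := congrArg Prod.fst (c.map_ends b)
      have h2 := congrArg Prod.snd (c.map_ends b)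
      simp only [Prod.map_fst, Prod.map_snd] at h1 h2
      rw [c.lab_map, h1, h2, hC.lab_eq b hb]
      cases c.flip b
      · simp only [flipEnds, flipLab, Bool.false_eq_true, if_false]
        group
      · simp only [flipEnds, flipLab, if_true, Prod.fst_swap, Prod.snd_swap]
        group
    · have h1 := c.isContr.q_eq h
      rw [c.lab_collapsed a h, h1]
      group

/-- Converse of `Collapse.isContr_comp`: the vertex map is constant on the fibres of the collapse,
and the two gauges differ there by a constant, so both descend. -/
theorem Collapse.exists_isContr {Γ Γ' : MarkedGraph r} (c : Collapse Γ Γ') {m k : ℕ}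
    {e : Fin m → Fin Γ'.nE} {q : Fin Γ.nV → Fin k} {g : Fin Γ.nV → FreeGroup (Fin r)}
    (hC : Γ.IsContr (c.onE ∘ e) q g) : ∃ (q' : Fin Γ'.nV → Fin k)
      (g' : Fin Γ'.nV → FreeGroup (Fin r)), Γ'.IsContr e q' g' ∧ q = q' ∘ c.onV ∧
        g = fun v => c.gauge v * g' (c.onV v) := by
  let s := Function.surjInv c.onV_surjective
  have hs : ∀ a, c.onV (s a) = a := Function.surjInv_eq c.onV_surjective
  have hpath : ∀ {u v x}, EPath Γ.ends (Set.range c.onE)ᶜ u x v →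
      EPath Γ.ends (Set.range (c.onE ∘ e))ᶜ u x v := fun hx => hx.mono (by
    rintro a ha ⟨i, rfl⟩
    exact ha ⟨e i, rfl⟩)
  have hq : ∀ u v, c.onV u = c.onV v → q u = q v := by
    intro u v h
    obtain ⟨x, hx⟩ := (c.isContr.eq_iff u v).mp h
    exact (hC.eq_iff u v).mpr ⟨x, hpath hx⟩
  have hg : ∀ u v, c.onV u = c.onV v → (c.gauge u)⁻¹ * g u = (c.gauge v)⁻¹ * g v := by
    intro u v h
    obtain ⟨x, hx⟩ := (c.isContr.eq_iff u v).mp h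
    have h1 := c.isContr.lab_inv_mul hx
    have h2 := hC.lab_inv_mul (hpath hx)
    rw [h1] at h2
    have h3 : (c.gauge u)⁻¹ * g u = (c.gauge v)⁻¹ * (c.gauge u * (c.gauge v)⁻¹)⁻¹ * g u := by group
    rw [h3, h2]
    group
  -- The descended gauge is read off at a section of the vertex map.
  have hg2 : ∀ v, g v = c.gauge v * ((c.gauge (s (c.onV v)))⁻¹ * g (s (c.onV v))) := fun v => by
    rw [hg _ _ (hs (c.onV v)), mul_inv_cancel_left]
  refine ⟨q ∘ s, fun a => (c.gauge (s a))⁻¹ * g (s a), ⟨?_, ?_, ?_, ?_⟩, ?_, funext hg2⟩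
  · exact Function.Injective.of_comp hC.inj
  · intro b
    obtain ⟨v, rfl⟩ := hC.surj b
    exact ⟨c.onV v, hq _ _ (hs _)⟩
  · intro a b
    have := c.ePath_iff e (s a) (s b)
    rw [hs, hs] at this
    rw [← this]
    exact hC.eq_iff _ _
  · intro b hb
    have hb' : c.onE b ∉ Set.range (c.onE ∘ e) := by
      rintro ⟨i, hi⟩
      exact hb ⟨i, c.onE.injective hi⟩
    have h0 := hC.lab_eq _ hb'
    have h1 := congrArg Prod.fst (c.map_ends b)
    have h2 := congrArg Prod.snd (c.map_ends b)
    simp only [Prod.map_fst, Prod.map_snd] at h1 h2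
    rw [c.lab_map, hg2 (Γ.ends (c.onE b)).1, hg2 (Γ.ends (c.onE b)).2, h1, h2] at h0
    have h3 : ∀ x y z a b' : FreeGroup (Fin r), x * y * z⁻¹ = x * a * (z * b')⁻¹ →
        y = a * b'⁻¹ := by
      intro x y z a b' h
      have : y = x⁻¹ * (x * y * z⁻¹) * z := by group
      rw [this, h]
      group
    have h4 := h3 _ _ _ _ _ h0
    revert h4
    cases c.flip b
    · exact fun h => h
    · simp only [flipEnds, flipLab, if_true, Prod.fst_swap, Prod.snd_swap]
      intro h
      rw [← inv_inv (Γ'.lab b), h]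
      group
  · funext v
    exact hq _ _ (hs _).symm

theorem IsContr.twist {Γ : MarkedGraph r} {m k : ℕ} {e : Fin m → Fin Γ.nE} {q : Fin Γ.nV → Fin k}
    {g : Fin Γ.nV → FreeGroup (Fin r)} (α : MulAut (FreeGroup (Fin r))) (hC : Γ.IsContr e q g) :
    (Γ.twist α).IsContr e q fun v => α (g v) where
  inj := hC.inj
  surj := hC.surj
  eq_iff := hC.eq_iff
  lab_eq a ha := by
    change α (Γ.lab a) = _
    rw [hC.lab_eq a ha, map_mul, map_inv]
    rfl

theorem IsContr.of_twist {Γ : MarkedGraph r} {m k : ℕ} {e : Fin m → Fin Γ.nE}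
    {q : Fin Γ.nV → Fin k} {g : Fin Γ.nV → FreeGroup (Fin r)} (α : MulAut (FreeGroup (Fin r)))
    (hC : (Γ.twist α).IsContr e q g) : Γ.IsContr e q fun v => α.symm (g v) where
  inj := hC.inj
  surj := hC.surj
  eq_iff := hC.eq_iff
  lab_eq a ha := by
    have h := congrArg α.symm (show α (Γ.lab a) = _ from hC.lab_eq a ha)
    rw [MulEquiv.symm_apply_apply, map_mul, map_inv] at h
    exact h

/-! ### The oriented graph of a tuple of edges -/

open Classical in
/-- Contract all edges outside of the tuple `e`; the result is oriented by the order of the edges and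
the marking. It is zero if the contraction is not possible. -/
def orientedContr {m k : ℕ} (h : k + r = m + 1) (Γ : MarkedGraph r) (e : Fin m → Fin Γ.nE) :
    OGraph.Chain k :=
  if H : ∃ p : (Fin Γ.nV → Fin k) × (Fin Γ.nV → FreeGroup (Fin r)), Γ.IsContr e p.1 p.2 then
    orientedClass h (contrEnds Γ.ends e H.choose.1) (contrLab Γ.ends Γ.lab e H.choose.2) else 0

/-- The choice of contraction is irrelevant: contractions differ by renaming vertices and a gauge
transformation, and `orientedClass` is invariant under both. -/
theorem orientedContr_eq {m k : ℕ} (h : k + r = m + 1) {Γ : MarkedGraph r} {e : Fin m → Fin Γ.nE}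
    {q : Fin Γ.nV → Fin k} {g : Fin Γ.nV → FreeGroup (Fin r)} (hC : Γ.IsContr e q g) :
    orientedContr h Γ e = orientedClass h (contrEnds Γ.ends e q) (contrLab Γ.ends Γ.lab e g) := by
  have H : ∃ p : (Fin Γ.nV → Fin k) × (Fin Γ.nV → FreeGroup (Fin r)), Γ.IsContr e p.1 p.2 :=
    ⟨(q, g), hC⟩
  rw [orientedContr, dif_pos H]
  obtain ⟨σ, c, h1, h2⟩ := hC.unique H.choose_spec
  have e1 : contrEnds Γ.ends e H.choose.1 = fun i => Prod.map σ σ (contrEnds Γ.ends e q i) := by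
    funext i
    simp only [contrEnds, Prod.map, h1]
  have e2 : contrLab Γ.ends Γ.lab e H.choose.2 = fun i => (c (contrEnds Γ.ends e q i).1)⁻¹ *
      contrLab Γ.ends Γ.lab e g i * c (contrEnds Γ.ends e q i).2 := by
    funext i
    simp only [contrLab, h2, contrEnds, Prod.map]
    group
  rw [e1, orientedClass_relabel, e2, orientedClass_gauge]

theorem orientedContr_eq_zero {m k : ℕ} (h : k + r = m + 1) {Γ : MarkedGraph r}
    {e : Fin m → Fin Γ.nE} (hC : ∀ (q : Fin Γ.nV → Fin k) g, ¬ Γ.IsContr e q g) :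
    orientedContr h Γ e = 0 := by
  rw [orientedContr, dif_neg]
  rintro ⟨p, hp⟩
  exact hC _ _ hp

theorem orientedContr_of_hasCycle {m k : ℕ} (h : k + r = m + 1) {Γ : MarkedGraph r}
    {e : Fin m → Fin Γ.nE} (hc : Γ.HasCycle (Set.range e)ᶜ) : orientedContr h Γ e = 0 :=
  orientedContr_eq_zero h fun _ _ hC => hC.not_hasCycle hc

/-- Reordering the tuple keeps its range and hence the contraction; only the numbering of the edges
changes. -/
theorem orientedContr_alternating {m k : ℕ} (h : k + r = m + 1) (Γ : MarkedGraph r) :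
    IsAlternating fun e : Fin m → Fin Γ.nE => orientedContr h Γ e := by
  intro e σ
  have hr : Set.range (e ∘ σ) = Set.range e := σ.surjective.range_comp e
  change orientedContr h Γ (e ∘ σ) = _ • orientedContr h Γ e
  by_cases H : ∃ (q : Fin Γ.nV → Fin k) (g : Fin Γ.nV → FreeGroup (Fin r)), Γ.IsContr e q g
  · obtain ⟨q, g, hC⟩ := H
    have hC' : Γ.IsContr (e ∘ σ) q g := hC.of_range_eq (hC.inj.comp σ.injective) hr
    rw [orientedContr_eq h hC, orientedContr_eq h hC']
    exact orientedClass_perm h (contrEnds Γ.ends e q) (contrLab Γ.ends Γ.lab e g) σ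
  · push Not at H
    rw [orientedContr_eq_zero h H, smul_zero, orientedContr_eq_zero h]
    intro q g hC
    refine H q g (hC.of_range_eq ?_ hr.symm)
    have := hC.inj.comp σ.symm.injective
    rwa [Function.comp_assoc, Equiv.self_comp_symm] at this

theorem orientedContr_twist {m k : ℕ} (h : k + r = m + 1) (Γ : MarkedGraph r)
    (α : MulAut (FreeGroup (Fin r))) (e : Fin m → Fin Γ.nE) :
    orientedContr h (Γ.twist α) e = ((autDet r α : ℤ) : ℝ) • orientedContr h Γ e := by
  by_cases H : ∃ (q : Fin Γ.nV → Fin k) (g : Fin Γ.nV → FreeGroup (Fin r)), Γ.IsContr e q g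
  · obtain ⟨q, g, hC⟩ := H
    rw [orientedContr_eq h hC, ← orientedClass_twist]
    refine (orientedContr_eq h (hC.twist α)).trans (congrArg _ ?_)
    funext i
    simp only [contrLab, map_mul, map_inv]
    rfl
  · push Not at H
    rw [orientedContr_eq_zero h H, smul_zero]
    exact orientedContr_eq_zero h fun q g hC => H q _ (IsContr.of_twist α hC)

/-- The contracted graphs agree up to reversal of edges, to which `orientedClass` is insensitive.
Hence the value is compatible with the gluing of closed simplices. -/
theorem orientedContr_collapse {m k : ℕ} (h : k + r = m + 1) {Γ Γ' : MarkedGraph r}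
    (c : Collapse Γ Γ') (e : Fin m → Fin Γ'.nE) :
    orientedContr h Γ (c.onE ∘ e) = orientedContr h Γ' e := by
  by_cases H : ∃ (q : Fin Γ'.nV → Fin k) (g : Fin Γ'.nV → FreeGroup (Fin r)), Γ'.IsContr e q g
  · obtain ⟨q, g, hC⟩ := H
    rw [orientedContr_eq h hC, orientedContr_eq h (c.isContr_comp hC),
      ← orientedClass_flip h (contrEnds Γ'.ends e q) _ fun i => c.flip (e i)]
    congr 1
    · funext i; exact c.contrEnds_comp e q i
    · funext i; exact c.contrLab_comp e g i
  · push Not at H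
    rw [orientedContr_eq_zero h H, orientedContr_eq_zero h]
    intro q g hC
    obtain ⟨q', g', hC', -⟩ := c.exists_isContr hC
    exact H q' g' hC'

theorem contract_eq_iff {k : ℕ} {a b : Fin (k + 1)} (hab : a ≠ b) (x y : Fin (k + 1)) :
    OGraph.contract a b hab x = OGraph.contract a b hab y ↔
      (if x = b then a else x) = if y = b then a else y := by
  rw [← (Fin.succAbove_right_injective (p := b)).eq_iff, OGraph.succAbove_contract,
    OGraph.succAbove_contract]

theorem range_comp_succAbove {m : ℕ} {α : Type} {e : Fin (m + 1) → α} (he : Function.Injective e)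
    (i : Fin (m + 1)) (a : α) :
    a ∉ Set.range (e ∘ i.succAbove) ↔ a ∉ Set.range e ∨ a = e i := by
  constructor
  · intro h
    by_contra hn
    push Not at hn
    obtain ⟨⟨j, rfl⟩, hne⟩ := hn
    obtain ⟨l, rfl⟩ := Fin.exists_succAbove_eq (x := j) (y := i) (fun h => hne (by rw [h]))
    exact h ⟨l, rfl⟩
  · rintro (h | rfl) ⟨j, hj⟩
    · exact h ⟨_, hj⟩
    · exact Fin.succAbove_ne i j (he hj)

/-- Contracting one more edge. -/
theorem IsContr.contract {Γ : MarkedGraph r} {m k : ℕ} {e : Fin (m + 1) → Fin Γ.nE}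
    {q : Fin Γ.nV → Fin (k + 1)} {g : Fin Γ.nV → FreeGroup (Fin r)} (hC : Γ.IsContr e q g)
    (i : Fin (m + 1)) {a b : Fin (k + 1)} (hi : contrEnds Γ.ends e q i = (a, b)) (hab : a ≠ b)
    {c : Fin (k + 1) → FreeGroup (Fin r)}
    (hc : (c a)⁻¹ * contrLab Γ.ends Γ.lab e g i * c b = 1) :
    Γ.IsContr (e ∘ i.succAbove) (fun v => OGraph.contract a b hab (q v))
      fun v => g v * c (q v) where
  inj := hC.inj.comp Fin.succAbove_right_injective
  surj := by
    intro y
    obtain ⟨v, hv⟩ := hC.surj (b.succAbove y)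
    refine ⟨v, Fin.succAbove_right_injective (p := b) ?_⟩
    change b.succAbove (OGraph.contract a b hab (q v)) = _
    rw [OGraph.succAbove_contract, hv, if_neg (Fin.succAbove_ne b y)]
  eq_iff u v := by
    have hmono : ∀ {u v x}, EPath Γ.ends (Set.range e)ᶜ u x v →
        EPath Γ.ends (Set.range (e ∘ i.succAbove))ᶜ u x v := fun hx => hx.mono fun y hy =>
      (range_comp_succAbove hC.inj i y).mpr (Or.inl hy)
    have hei : EPath Γ.ends (Set.range (e ∘ i.succAbove))ᶜ (Γ.ends (e i)).1 (FreeGroup.of (e i))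
        (Γ.ends (e i)).2 := .edge _ ((range_comp_succAbove hC.inj i _).mpr (Or.inr rfl))
    have h1 : q (Γ.ends (e i)).1 = a := congrArg Prod.fst hi
    have h2 : q (Γ.ends (e i)).2 = b := congrArg Prod.snd hi
    constructor
    · intro h
      rw [contract_eq_iff] at h
      have hto : ∀ u, ∃ v x, EPath Γ.ends (Set.range (e ∘ i.succAbove))ᶜ u x v ∧
          q v = if q u = b then a else q u := by
        intro u
        by_cases hu : q u = b
        · obtain ⟨x, hx⟩ := (hC.eq_iff u (Γ.ends (e i)).2).mp (hu.trans h2.symm)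
          exact ⟨_, _, (hmono hx).mul hei.inv, by rw [if_pos hu, h1]⟩
        · exact ⟨u, 1, .one u, by rw [if_neg hu]⟩
      obtain ⟨u', x, hx, hu'⟩ := hto u
      obtain ⟨v', y, hy, hv'⟩ := hto v
      obtain ⟨z, hz⟩ := (hC.eq_iff u' v').mp (by rw [hu', hv', h])
      exact ⟨_, (hx.mul (hmono hz)).mul hy.inv⟩
    · rintro ⟨x, hx⟩
      induction hx with
      | one u => rfl
      | edge y hy =>
        rcases (range_comp_succAbove hC.inj i y).mp hy with hy | rfl
        · rw [hC.q_eq hy]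
        · rw [h1, h2, contract_eq_iff, if_neg hab, if_pos rfl]
      | inv _ ih => exact ih.symm
      | mul _ _ ih1 ih2 => exact ih1.trans ih2
  lab_eq y hy := by
    rcases (range_comp_succAbove hC.inj i y).mp hy with hy | rfl
    · rw [hC.lab_eq y hy, hC.q_eq hy]
      group
    · have h1 : q (Γ.ends (e i)).1 = a := congrArg Prod.fst hi
      have h2 : q (Γ.ends (e i)).2 = b := congrArg Prod.snd hi
      rw [h1, h2]
      unfold contrLab at hc
      have h3 : Γ.lab (e i) = g (Γ.ends (e i)).1 * c a * ((c a)⁻¹ * ((g (Γ.ends (e i)).1)⁻¹ *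
        Γ.lab (e i) * g (Γ.ends (e i)).2) * c b) * (g (Γ.ends (e i)).2 * c b)⁻¹ := by group
      rw [h3, hc]
      group

/-- Omitting an edge from the tuple contracts it in addition, which is a term of the boundary.
Tuples with repetitions vanish by alternation, and tuples whose complement contains a cycle keep one
after an omission. -/
theorem boundary_orientedContr {m k : ℕ} (h : k + 1 + r = m + 2 + 1) (h' : k + r = m + 1 + 1)
    (Γ : MarkedGraph r) (e : Fin (m + 2) → Fin Γ.nE) :
    OGraph.boundary k (orientedContr h Γ e) =
      ∑ i : Fin (m + 2), (-1 : ℝ) ^ (i : ℕ) • orientedContr h' Γ (e ∘ i.succAbove) := by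
  by_cases he : Function.Injective e
  swap
  · have h1 := (orientedContr_alternating h Γ).eq_zero he
    have h2 := (orientedContr_alternating h' Γ).faceSum.eq_zero he
    rw [h1, map_zero]
    exact h2.symm
  by_cases hcyc : Γ.HasCycle (Set.range e)ᶜ
  · rw [orientedContr_of_hasCycle h hcyc, map_zero]
    symm
    refine Finset.sum_eq_zero fun i _ => ?_
    rw [orientedContr_of_hasCycle h', smul_zero]
    obtain ⟨v, p, h1, h2, h3, h4⟩ := hcyc
    refine ⟨v, p, h1, h2, h3, fun d hd => ?_⟩
    rintro ⟨j, hj⟩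
    exact h4 d hd ⟨_, hj⟩
  obtain ⟨q, g, hC⟩ := Γ.exists_isContr he hcyc h
  rw [orientedContr_eq h hC]
  refine boundary_orientedClass (m := m + 1) h h' _ _ _ (fun i hi => ?_) (fun i hi => ?_)
  -- A loop closes up to a cycle through contracted edges, so no further contraction exists.
  -- Otherwise the edge would equal a path of contracted edges, which projects to 1, while the edge
  -- projects to a generator.
  · apply orientedContr_eq_zero
    intro q' g' hC'
    obtain ⟨x, hx⟩ := (hC.eq_iff _ _).mp hi
    have hmono : (Set.range e)ᶜ ⊆ (Set.range (e ∘ i.succAbove))ᶜ := fun y hy =>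
      (range_comp_succAbove hC.inj i y).mpr (Or.inl hy)
    have h1 := hC'.eq_one_of_closed Γ.isMarked ((hx.mono hmono).mul
      (EPath.edge (e i) ((range_comp_succAbove hC.inj i _).mpr (Or.inr rfl))).inv)
    rw [mul_inv_eq_one] at h1
    have h2 := IsContraction.proj_eq_one hx
    rw [h1, contrProj_of hC.inj] at h2
    exact FreeGroup.of_ne_one i h2
  -- Moving the gauge at the head alone makes the label of a non-loop trivial.
  · let c : Fin (k + 1) → FreeGroup (Fin r) := fun v =>
      if v = (contrEnds Γ.ends e q i).2 then (contrLab Γ.ends Γ.lab e g i)⁻¹ else 1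
    have hc : (c (contrEnds Γ.ends e q i).1)⁻¹ * contrLab Γ.ends Γ.lab e g i *
        c (contrEnds Γ.ends e q i).2 = 1 := by
      simp [c, hi]
    refine ⟨c, hc, ?_⟩
    rw [orientedContr_eq h' (hC.contract i rfl hi hc)]
    congr 1
    funext j
    simp only [contrLab, contrEnds, Function.comp_apply, Prod.map]
    group

theorem orientedContr_mem_reduced {m k : ℕ} (h : k + r = m + 1) (Γ : MarkedGraph r)
    (e : Fin m → Fin Γ.nE) : orientedContr h Γ e ∈ OGraph.reduced r k := by
  by_cases H : ∃ (q : Fin Γ.nV → Fin k) (g : Fin Γ.nV → FreeGroup (Fin r)), Γ.IsContr e q g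
  · obtain ⟨q, g, hC⟩ := H
    rw [orientedContr_eq h hC]
    refine Submodule.smul_mem _ _ (Submodule.subset_span ⟨_, ⟨(contrGraph hC).connected,
      (contrGraph hC).three_le_valence, ?_⟩, rfl⟩)
    have hcard : Multiset.card (Finset.univ.val.map (contrEnds Γ.ends e q)) = m := by simp
    change (k : ℤ) - (Multiset.card (Finset.univ.val.map (contrEnds Γ.ends e q)) : ℤ) = _
    rw [hcard]
    omega
  · push Not at H
    rw [orientedContr_eq_zero h H]
    exact zero_mem _

end MarkedGraph

end

/-! ### Coinvariants of flags and the averaging map to graphs -/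

section

open Opposite Simplicial

/-! ### Chains on flags of faces -/

/-- The twisted coinvariants of the chains of the simplicial closure of Outer space. -/
abbrev outChains (r : ℕ) : SimplicialObject (ModuleCat.{0} ℝ) :=
  coinvChains (simplicialClosure r) (atInfinity r) (outDet r)

/-- Twisted coinvariants in degree `n`. -/
abbrev OutChain (r n : ℕ) : Type := (outChains r).obj (op ⦋n⦌)

namespace MarkedGraph

variable {r : ℕ}

/-- The simplex of a flag. -/
def flagSimplex (Γ : MarkedGraph r) {n : ℕ} (S : Fin (n + 1) → Finset (Fin Γ.nE)) (h1 : Monotone S)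
    (h2 : ∀ i, (S i).Nonempty) : (simplicialClosure r).V.obj (op ⦋n⦌) :=
  Quot.mk _ (⟨Γ, ⟨S, h1⟩, h2⟩ : FaceFlag r ⦋n⦌)

/-- The class of a flag. -/
def flagClass (Γ : MarkedGraph r) {n : ℕ} (S : Fin (n + 1) → Finset (Fin Γ.nE)) (h1 : Monotone S)
    (h2 : ∀ i, (S i).Nonempty) : OutChain r n :=
  coinvMk (Γ.flagSimplex S h1 h2)

theorem flagClass_collapse {Γ Γ' : MarkedGraph r} (c : Collapse Γ Γ') {n : ℕ}
    (S : Fin (n + 1) → Finset (Fin Γ'.nE)) (h1 : Monotone S) (h2 : ∀ i, (S i).Nonempty)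
    (h1' : Monotone fun i => (S i).map c.onE) (h2' : ∀ i, ((S i).map c.onE).Nonempty) :
    Γ.flagClass (fun i => (S i).map c.onE) h1' h2' = Γ'.flagClass S h1 h2 :=
  congrArg _ (Quot.sound ⟨c, fun _ => rfl⟩)

theorem flagClass_twist (Γ : MarkedGraph r) (α : MulAut (FreeGroup (Fin r))) {n : ℕ}
    (S : Fin (n + 1) → Finset (Fin Γ.nE)) (h1 : Monotone S) (h2 : ∀ i, (S i).Nonempty) :
    (Γ.twist α).flagClass S h1 h2 = ((autDet r α : ℤ) : ℝ) • Γ.flagClass S h1 h2 :=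
  coinvMk_smul (X := simplicialClosure r) (A := atInfinity r) (χ := outDet r)
    (QuotientGroup.mk α : Out r) (Γ.flagSimplex S h1 h2)

theorem flagClass_eq_zero (Γ : MarkedGraph r) {n : ℕ}
    (S : Fin (n + 1) → Finset (Fin Γ.nE)) (h1 : Monotone S) (h2 : ∀ i, (S i).Nonempty)
    (h : Γ.HasCycle {e | e ∉ S (Fin.last n)}) : Γ.flagClass S h1 h2 = 0 :=
  coinvMk_eq_zero ⟨_, rfl, h⟩

theorem faceD_flagClass (Γ : MarkedGraph r) {n : ℕ}
    (S : Fin (n + 2) → Finset (Fin Γ.nE)) (h1 : Monotone S) (h2 : ∀ i, (S i).Nonempty) :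
    faceD (outChains r) n (Γ.flagClass S h1 h2) = ∑ i : Fin (n + 2), (-1 : ℝ) ^ (i : ℕ) •
      Γ.flagClass (S ∘ i.succAbove) (h1.comp (Fin.strictMono_succAbove i).monotone)
        fun _ => h2 _ := by
  rw [faceD_eq_sum]
  refine Finset.sum_congr rfl fun i _ => congrArg _ ?_
  exact coinvChains_map (X := simplicialClosure r) (SimplexCategory.δ i).op _

open Classical in
/-- The class of a chain on flags of faces of the closed simplex of `Γ`. -/
def toOut (Γ : MarkedGraph r) (n : ℕ) : TupleChain (Finset (Fin Γ.nE)) n →ₗ[ℝ] OutChain r n :=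
  Finsupp.lift _ ℝ _ fun S =>
    if h : Monotone S ∧ ∀ i, (S i).Nonempty then Γ.flagClass S h.1 h.2 else 0

theorem toOut_single (Γ : MarkedGraph r) {n : ℕ} {S : Fin (n + 1) → Finset (Fin Γ.nE)}
    (h1 : Monotone S) (h2 : ∀ i, (S i).Nonempty) :
    Γ.toOut n (Finsupp.single S 1) = Γ.flagClass S h1 h2 := by
  simp [toOut, h1, h2]

theorem HasCycle.mono {Γ : MarkedGraph r} {T T' : Set (Fin Γ.nE)} (h : Γ.HasCycle T) (hT : T ⊆ T') :
    Γ.HasCycle T' := by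
  obtain ⟨v, p, h1, h2, h3, h4⟩ := h
  exact ⟨v, p, h1, h2, h3, fun d hd => hT (h4 d hd)⟩

/-- If a cycle avoids the carrier T, it avoids the largest face of every flag in T, so all these
flags lie at infinity. -/
theorem toOut_eq_zero (Γ : MarkedGraph r) {n : ℕ} {T : Finset (Fin Γ.nE)}
    (hT : Γ.HasCycle {e | e ∉ T}) {x : TupleChain (Finset (Fin Γ.nE)) n}
    (hx : x ∈ flagChains T n) : Γ.toOut n x = 0 := by
  suffices h : flagChains T n ≤ LinearMap.ker (Γ.toOut n) from h hx
  rw [flagChains, Submodule.span_le]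
  rintro _ ⟨S, h1, h2, h3, rfl⟩
  rw [SetLike.mem_coe, LinearMap.mem_ker, toOut_single Γ h1 h2]
  exact flagClass_eq_zero _ _ _ _ (hT.mono fun e he h => he (h3 h))

theorem toOut_collapse {Γ Γ' : MarkedGraph r} (c : Collapse Γ Γ') {n : ℕ} {T : Finset (Fin Γ'.nE)}
    {x : TupleChain (Finset (Fin Γ'.nE)) n} (hx : x ∈ flagChains T n) :
    Γ.toOut n (mapFaces c.onE n x) = Γ'.toOut n x := by
  refine flagChains_induction (f := Γ.toOut n ∘ₗ mapFaces c.onE n) (fun S h1 h2 => ?_) hx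
  have h1' : Monotone fun i => (S i).map c.onE := fun i j hij => Finset.map_subset_map.mpr (h1 hij)
  have h2' : ∀ i, ((S i).map c.onE).Nonempty := fun i => (h2 i).map
  rw [LinearMap.comp_apply, mapFaces_single, toOut_single Γ h1' h2', toOut_single Γ' h1 h2,
    flagClass_collapse]

theorem toOut_twist (Γ : MarkedGraph r) (α : MulAut (FreeGroup (Fin r))) {n : ℕ}
    {T : Finset (Fin Γ.nE)} {x : TupleChain (Finset (Fin Γ.nE)) n} (hx : x ∈ flagChains T n) :
    (Γ.twist α).toOut n x = ((autDet r α : ℤ) : ℝ) • Γ.toOut n x := by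
  refine flagChains_induction (f := (Γ.twist α).toOut n)
    (g := ((autDet r α : ℤ) : ℝ) • Γ.toOut n) (fun S h1 h2 => ?_) hx
  exact (toOut_single (Γ.twist α) h1 h2).trans ((Γ.flagClass_twist α S h1 h2).trans
    (congrArg _ (toOut_single Γ h1 h2).symm))

theorem faceD_toOut (Γ : MarkedGraph r) {n : ℕ}
    {T : Finset (Fin Γ.nE)} {x : TupleChain (Finset (Fin Γ.nE)) (n + 1)}
    (hx : x ∈ flagChains T (n + 1)) :
    faceD (outChains r) n (Γ.toOut (n + 1) x) = Γ.toOut n (tupleD _ n x) := by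
  refine flagChains_induction (f := faceD (outChains r) n ∘ₗ Γ.toOut (n + 1))
    (g := Γ.toOut n ∘ₗ tupleD _ n) (fun S h1 h2 => ?_) hx
  rw [LinearMap.comp_apply, LinearMap.comp_apply, toOut_single Γ h1 h2, faceD_flagClass,
    tupleD_single, map_sum]
  refine Finset.sum_congr rfl fun i _ => ?_
  rw [map_smul]
  exact congrArg _ (toOut_single Γ (S := S ∘ i.succAbove) _ _).symm

end MarkedGraph

variable {r : ℕ}

theorem outChain_hom_ext {n : ℕ} {M : Type} [AddCommGroup M] [Module ℝ M]
    {f g : OutChain r n →ₗ[ℝ] M}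
    (h : ∀ (Γ : MarkedGraph r) (S : Fin (n + 1) → Finset (Fin Γ.nE)) (h1 : Monotone S)
      (h2 : ∀ i, (S i).Nonempty), f (Γ.flagClass S h1 h2) = g (Γ.flagClass S h1 h2)) : f = g := by
  refine coinv_hom_ext (X := simplicialClosure r) ?_
  rintro ⟨Γ, S, h2⟩
  exact h Γ S S.monotone h2

/-- A function on flags which is compatible with collapses, changes of the marking and which vanishes
at infinity induces a linear map on the twisted coinvariants. -/
theorem exists_outLift {n : ℕ} {M : Type} [AddCommGroup M] [Module ℝ M]
    (F : ∀ Γ : MarkedGraph r, (Fin (n + 1) → Finset (Fin Γ.nE)) → M)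
    (h1 : ∀ (Γ Γ' : MarkedGraph r) (c : MarkedGraph.Collapse Γ Γ') S, Monotone S →
      (∀ i, (S i).Nonempty) → F Γ (fun i => (S i).map c.onE) = F Γ' S)
    (h2 : ∀ (Γ : MarkedGraph r) (α : MulAut (FreeGroup (Fin r)))
      (S : Fin (n + 1) → Finset (Fin Γ.nE)), Monotone S → (∀ i, (S i).Nonempty) →
      F (Γ.twist α) S = ((autDet r α : ℤ) : ℝ) • F Γ S)
    (h3 : ∀ (Γ : MarkedGraph r) S, Monotone S → (∀ i, (S i).Nonempty) →
      Γ.HasCycle {e | e ∉ S (Fin.last n)} → F Γ S = 0) :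
    ∃ f : OutChain r n →ₗ[ℝ] M, ∀ (Γ : MarkedGraph r) (S : Fin (n + 1) → Finset (Fin Γ.nE))
      (h1 : Monotone S) (h2 : ∀ i, (S i).Nonempty), f (Γ.flagClass S h1 h2) = F Γ S := by
  let F' : (simplicialClosure r).V.obj (op ⦋n⦌) → M :=
    Quot.lift (fun x : FaceFlag r ⦋n⦌ => F x.graph x.sets) (by
      rintro x y ⟨c, hc⟩
      have : (x.sets : Fin (n + 1) → Finset (Fin x.graph.nE)) = fun i => (y.sets i).map c.onE :=
        funext hc
      change F x.graph x.sets = _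
      rw [this]
      exact h1 _ _ c _ y.sets.monotone y.nonempty)
  have hF1 : ∀ (g : Out r) x, F' (((simplicialClosure r).ρ g).app (op ⦋n⦌) x) =
      ((outDet r g : ℤ) : ℝ) • F' x := by
    intro g
    obtain ⟨α, rfl⟩ := QuotientGroup.mk_surjective g
    rintro ⟨x⟩
    exact h2 x.graph α x.sets x.sets.monotone x.nonempty
  have hF2 : ∀ x ∈ (atInfinity r).obj (op ⦋n⦌), F' x = 0 := by
    rintro _ ⟨y, rfl, hy⟩
    exact h3 y.graph y.sets y.sets.monotone y.nonempty hy
  exact ⟨coinvLift (X := simplicialClosure r) F' hF1 hF2, fun Γ S _ _ =>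
    coinvLift_coinvMk (X := simplicialClosure r) F' hF1 hF2 _⟩

/-- Naturality under embeddings gives compatibility with collapses, and the carrier estimate gives
vanishing at infinity. -/
theorem exists_sdHomotopy (r n : ℕ) : ∃ f : OutChain r n →ₗ[ℝ] OutChain r (n + 1),
    ∀ (Γ : MarkedGraph r) (S : Fin (n + 1) → Finset (Fin Γ.nE))
      (h1 : Monotone S) (h2 : ∀ i, (S i).Nonempty),
      f (Γ.flagClass S h1 h2) = Γ.toOut (n + 1) (sdHomotopyFun n S) := by
  refine exists_outLift (fun Γ S => Γ.toOut (n + 1) (sdHomotopyFun n S)) ?_ ?_ ?_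
  · intro Γ Γ' c S h1 h2
    rw [← mapFaces_sdHomotopyFun]
    exact MarkedGraph.toOut_collapse c (sdHomotopyFun_mem h1 h2)
  · intro Γ α S h1 h2
    exact Γ.toOut_twist α (sdHomotopyFun_mem h1 h2)
  · intro Γ S h1 h2 h
    exact Γ.toOut_eq_zero h (sdHomotopyFun_mem h1 h2)

/-- The homotopy on the twisted coinvariants. -/
def outHomotopy (r n : ℕ) : OutChain r n →ₗ[ℝ] OutChain r (n + 1) := (exists_sdHomotopy r n).choose

theorem outHomotopy_flagClass {n : ℕ} (Γ : MarkedGraph r) (S : Fin (n + 1) → Finset (Fin Γ.nE))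
    (h1 : Monotone S) (h2 : ∀ i, (S i).Nonempty) :
    outHomotopy r n (Γ.flagClass S h1 h2) = Γ.toOut (n + 1) (sdHomotopyFun n S) :=
  (exists_sdHomotopy r n).choose_spec Γ S h1 h2

theorem outHomotopy_toOut {n : ℕ} (Γ : MarkedGraph r) {T : Finset (Fin Γ.nE)}
    {x : TupleChain (Finset (Fin Γ.nE)) n} (hx : x ∈ flagChains T n) :
    outHomotopy r n (Γ.toOut n x) = Γ.toOut (n + 1) (sdHomotopy n x) := by
  refine flagChains_induction (f := outHomotopy r n ∘ₗ Γ.toOut n)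
    (g := Γ.toOut (n + 1) ∘ₗ sdHomotopy n) (fun S h1 h2 => ?_) hx
  rw [LinearMap.comp_apply, LinearMap.comp_apply, Γ.toOut_single h1 h2, outHomotopy_flagClass,
    sdHomotopy_single]

theorem outHomotopy_zero (Γ : MarkedGraph r) (S : Fin 1 → Finset (Fin Γ.nE))
    (h1 : Monotone S) (h2 : ∀ i, (S i).Nonempty) :
    faceD (outChains r) 0 (outHomotopy r 0 (Γ.flagClass S h1 h2)) =
      Γ.flagClass S h1 h2 - Γ.toOut 0 (avgSd 0 (Finsupp.single S 1)) := by
  rw [outHomotopy_flagClass, Γ.faceD_toOut (sdHomotopyFun_mem h1 h2), tupleD_sdHomotopyFun_zero h2,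
    map_sub, Γ.toOut_single h1 h2]

theorem outHomotopy_succ {n : ℕ} (Γ : MarkedGraph r) (S : Fin (n + 2) → Finset (Fin Γ.nE))
    (h1 : Monotone S) (h2 : ∀ i, (S i).Nonempty) :
    faceD (outChains r) (n + 1) (outHomotopy r (n + 1) (Γ.flagClass S h1 h2)) +
      outHomotopy r n (faceD (outChains r) n (Γ.flagClass S h1 h2)) =
      Γ.flagClass S h1 h2 - Γ.toOut (n + 1) (avgSd (n + 1) (Finsupp.single S 1)) := by
  have hS : (Finsupp.single S 1 : TupleChain _ (n + 1)) ∈ flagChains (S (Fin.last _)) (n + 1) :=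
    single_mem_flagChains h1 h2 subset_rfl
  rw [outHomotopy_flagClass, Γ.faceD_toOut (sdHomotopyFun_mem h1 h2), ← Γ.toOut_single h1 h2,
    Γ.faceD_toOut hS, outHomotopy_toOut Γ (tupleD_mem_flagChains hS), ← map_add,
    tupleD_sdHomotopyFun h1 h2, map_sub]

/-! ### From flags to graphs -/

/-- At infinity every tuple chosen from the faces of the flag avoids the same cycle, so every term
of the average is zero. -/
theorem exists_outToGraph {n k : ℕ} (h : k + r = n + 1 + 1) :
    ∃ f : OutChain r n →ₗ[ℝ] OGraph.Chain k,
    ∀ (Γ : MarkedGraph r) (S : Fin (n + 1) → Finset (Fin Γ.nE))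
      (h1 : Monotone S) (h2 : ∀ i, (S i).Nonempty),
      f (Γ.flagClass S h1 h2) = avg S (Γ.orientedContr h) := by
  refine exists_outLift (fun Γ S => avg S (Γ.orientedContr h)) ?_ ?_ ?_
  · intro Γ Γ' c S h1 h2
    rw [avg_embedding]
    simp only [MarkedGraph.orientedContr_collapse]
  · intro Γ α S h1 h2
    rw [← avg_smul]
    exact avg_congr S fun f _ => MarkedGraph.orientedContr_twist h Γ α f
  · intro Γ S h1 h2 hcyc
    refine (avg_congr S (F' := fun _ => 0) fun f hf =>
      MarkedGraph.orientedContr_of_hasCycle h (hcyc.mono ?_)).trans (by simp [avg])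
    rintro e he ⟨i, rfl⟩
    exact he (h1 (Fin.le_last i) (hf i))

/-- The map from the twisted coinvariants to graphs. -/
def outToGraph {n k : ℕ} (h : k + r = n + 1 + 1) : OutChain r n →ₗ[ℝ] OGraph.Chain k :=
  (exists_outToGraph h).choose

theorem outToGraph_flagClass {n k : ℕ} (h : k + r = n + 1 + 1) (Γ : MarkedGraph r)
    (S : Fin (n + 1) → Finset (Fin Γ.nE)) (h1 : Monotone S) (h2 : ∀ i, (S i).Nonempty) :
    outToGraph h (Γ.flagClass S h1 h2) = avg S (Γ.orientedContr h) :=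
  (exists_outToGraph h).choose_spec Γ S h1 h2

theorem outToGraph_toOut {n k : ℕ} (h : k + r = n + 1 + 1) (Γ : MarkedGraph r)
    {T : Finset (Fin Γ.nE)} {x : TupleChain (Finset (Fin Γ.nE)) n} (hx : x ∈ flagChains T n) :
    outToGraph h (Γ.toOut n x) = evalW (Γ.orientedContr h) x := by
  refine flagChains_induction (f := outToGraph h ∘ₗ Γ.toOut n) (fun S h1 h2 => ?_) hx
  rw [LinearMap.comp_apply, Γ.toOut_single h1 h2, outToGraph_flagClass, evalW_single]

theorem outToGraph_mem_reduced {n k : ℕ} (h : k + r = n + 1 + 1) (x : OutChain r n) :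
    outToGraph h x ∈ OGraph.reduced r k := by
  rw [← Submodule.Quotient.mk_eq_zero, ← Submodule.mkQ_apply, ← LinearMap.comp_apply]
  suffices hh : (OGraph.reduced r k).mkQ ∘ₗ outToGraph h = 0 by rw [hh]; rfl
  refine outChain_hom_ext fun Γ S h1 h2 => ?_
  rw [LinearMap.comp_apply, outToGraph_flagClass, LinearMap.zero_apply, Submodule.mkQ_apply,
    Submodule.Quotient.mk_eq_zero]
  exact avg_mem _ fun f _ => Γ.orientedContr_mem_reduced h f

/-- The boundary formula holds for each tuple, and averages are compatible with faces. -/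
theorem boundary_outToGraph {n k : ℕ} (h : k + 1 + r = n + 2 + 1) (h' : k + r = n + 1 + 1)
    (x : OutChain r (n + 1)) :
    OGraph.boundary k (outToGraph h x) = outToGraph h' (faceD (outChains r) n x) := by
  suffices hh : OGraph.boundary k ∘ₗ outToGraph h = outToGraph h' ∘ₗ faceD (outChains r) n from
    congrArg (fun f => f x) hh
  refine outChain_hom_ext fun Γ S h1 h2 => ?_
  rw [LinearMap.comp_apply, LinearMap.comp_apply, outToGraph_flagClass, MarkedGraph.faceD_flagClass,
    map_sum, avg_map]
  simp only [MarkedGraph.boundary_orientedContr h h']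
  rw [avg_sum]
  refine Finset.sum_congr rfl fun i _ => ?_
  rw [avg_smul, map_smul, outToGraph_flagClass, avg_face i S (h2 i)]

end

section

open Opposite Simplicial

/-! ### From graphs to flags -/

variable {r : ℕ}

/-- The data `ends` and `lab` define a marked graph. -/
structure IsMarkedGraph {k m : ℕ} (ends : Fin m → Fin k × Fin k) (lab : Fin m → FreeGroup (Fin r)) :
    Prop where
  connected : OGraph.Connected (Finset.univ.val.map ends)
  three_le_valence : ∀ v, 3 ≤ OGraph.valence (Finset.univ.val.map ends) v
  isMarked : IsMarked ends lab

namespace IsMarkedGraph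

variable {k m : ℕ} {ends : Fin m → Fin k × Fin k} {lab : Fin m → FreeGroup (Fin r)}

/-- The marked graph. -/
def graph (hG : IsMarkedGraph ends lab) : MarkedGraph r where
  nV := k
  nE := m
  ends := ends
  lab := lab
  connected := hG.connected
  three_le_valence := hG.three_le_valence
  marking := (isMarked_iff _ _).mpr hG.isMarked

theorem pathConnected (hG : IsMarkedGraph ends lab) : PathConnected ends :=
  ((pathConnected_iff ends).mp hG.connected).2

theorem pos (hG : IsMarkedGraph ends lab) : 0 < k := hG.connected.1

theorem euler (hG : IsMarkedGraph ends lab) : k + r = m + 1 := by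
  simpa using card_of_isMarked hG.isMarked hG.pathConnected ⟨0, hG.pos⟩

theorem gdet_ne_zero (hG : IsMarkedGraph ends lab) (h : k + r = m + 1) : gdet h ends lab ≠ 0 :=
  OuterSpace.gdet_ne_zero h hG.pos hG.isMarked hG.pathConnected

theorem admissible (hG : IsMarkedGraph ends lab) :
    OGraph.Admissible r (Finset.univ.val.map ends) where
  connected := hG.connected
  three_le_valence := hG.three_le_valence
  euler := by
    have h1 : Multiset.card (Finset.univ.val.map ends) = m := by simp
    have h2 := hG.euler
    rw [h1]
    omega

theorem of_isContr {Γ : MarkedGraph r} {e : Fin m → Fin Γ.nE} {q : Fin Γ.nV → Fin k}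
    {g : Fin Γ.nV → FreeGroup (Fin r)} (hC : Γ.IsContr e q g) :
    IsMarkedGraph (contrEnds Γ.ends e q) (contrLab Γ.ends Γ.lab e g) where
  connected := (MarkedGraph.contrGraph hC).connected
  three_le_valence := hC.three_le_valence
  isMarked := hC.isMarked Γ.isMarked

theorem isContr_of_perm (hG : IsMarkedGraph ends lab) (σ : Equiv.Perm (Fin k))
    (τ : Equiv.Perm (Fin m)) : hG.graph.IsContr τ σ fun _ => 1 where
  inj := τ.injective
  surj := σ.surjective
  eq_iff u v := by
    refine (σ.injective.eq_iff (a := u) (b := v)).trans ?_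
    constructor
    · rintro rfl
      exact ⟨1, .one _⟩
    · rintro ⟨x, hx⟩
      induction hx with
      | one u => rfl
      | edge a ha => exact absurd (τ.surjective a) ha
      | inv _ ih => exact ih.symm
      | mul _ _ ih1 ih2 => exact ih1.trans ih2
  lab_eq a ha := absurd (τ.surjective a) ha

/-- Renaming the vertices and the edges. -/
theorem perm (hG : IsMarkedGraph ends lab) (σ : Equiv.Perm (Fin k)) (τ : Equiv.Perm (Fin m)) :
    IsMarkedGraph (fun i => Prod.map σ σ (ends (τ i))) (lab ∘ τ) := by
  have h := of_isContr (hG.isContr_of_perm σ τ)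
  have h2 : contrLab hG.graph.ends hG.graph.lab τ (fun _ => 1) = lab ∘ τ := by
    funext i
    simp [contrLab, graph]
  rw [h2] at h
  exact h

/-- The involution θ of the free group inverts the reversed edges; it carries paths to paths and
preserves labels. -/
theorem isMarked_flip (hm : IsMarked ends lab) (fl : Fin m → Bool) :
    IsMarked (fun i => flipEnds (fl i) (ends i)) fun i => flipLab (fl i) (lab i) := by
  let θ : FreeGroup (Fin m) →* FreeGroup (Fin m) :=
    FreeGroup.lift fun i => flipLab (fl i) (FreeGroup.of i)
  have hθ : ∀ x, θ (θ x) = x := by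
    intro x
    have : θ.comp θ = MonoidHom.id _ := by
      ext i
      simp only [MonoidHom.comp_apply, θ, FreeGroup.lift_apply_of, MonoidHom.id_apply]
      cases h : fl i <;> simp [flipLab, h]
    exact congrArg (fun f => f x) this
  have hlab : ∀ x, FreeGroup.lift (fun i => flipLab (fl i) (lab i)) (θ x) =
      FreeGroup.lift lab x := by
    intro x
    have : (FreeGroup.lift fun i => flipLab (fl i) (lab i)).comp θ = FreeGroup.lift lab := by
      ext i
      simp only [MonoidHom.comp_apply, θ, FreeGroup.lift_apply_of]
      cases h : fl i <;> simp [flipLab, h]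
    exact congrArg (fun f => f x) this
  have hpath : ∀ {ends : Fin m → Fin k × Fin k} {u v x}, EPath ends Set.univ u x v →
      EPath (fun i => flipEnds (fl i) (ends i)) Set.univ u (θ x) v := by
    intro ends u v x hx
    induction hx with
    | one u => rw [map_one]; exact .one u
    | edge a ha =>
      have h1 := EPath.edge (ends := fun i => flipEnds (fl i) (ends i)) a ha
      simp only [θ, FreeGroup.lift_apply_of]
      cases h : fl a with
      | false =>
        rw [h] at h1
        exact h1
      | true =>
        rw [h] at h1
        exact h1.inv
    | inv _ ih => rw [map_inv]; exact ih.inv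
    | mul _ _ ih1 ih2 => rw [map_mul]; exact ih1.mul ih2
  have hends : (fun i => flipEnds (fl i) (flipEnds (fl i) (ends i))) = ends := by
    funext i
    cases h : fl i <;> simp [flipEnds]
  intro v w
  obtain ⟨x, ⟨h1, h2⟩, h3⟩ := hm v w
  refine ⟨θ x, ⟨hpath h1, (hlab x).trans h2⟩, fun y hy => ?_⟩
  have h4 := hpath hy.1
  rw [hends] at h4
  rw [← h3 (θ y) ⟨h4, by rw [← hlab, hθ]; exact hy.2⟩, hθ]

theorem card_filter_eq_sum {α : Type} [DecidableEq α] (f : Fin m → α) (v : α) :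
    (Finset.univ.filter fun i => f i = v).card = ∑ i, if f i = v then 1 else 0 := by
  rw [Finset.card_filter]

/-- Reversing edges. -/
theorem flip (hG : IsMarkedGraph ends lab) (fl : Fin m → Bool) :
    IsMarkedGraph (fun i => flipEnds (fl i) (ends i)) fun i => flipLab (fl i) (lab i) where
  connected := by
    rw [pathConnected_iff]
    refine ⟨hG.pos, fun u v => ?_⟩
    obtain ⟨x, hx⟩ := hG.pathConnected u v
    exact MarkedGraph.ePath_of_flip (fun a => MarkedGraph.flipEnds_cases _ _) hx
  three_le_valence v := by
    refine (hG.three_le_valence v).trans_eq ?_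
    rw [MarkedGraph.valence_univ_map, MarkedGraph.valence_univ_map, card_filter_eq_sum,
      card_filter_eq_sum, card_filter_eq_sum, card_filter_eq_sum, ← Finset.sum_add_distrib,
      ← Finset.sum_add_distrib]
    refine Finset.sum_congr rfl fun i _ => ?_
    cases h : fl i
    · simp [flipEnds]
    · simp [flipEnds, add_comm]
  isMarked := isMarked_flip hG.isMarked fl

end IsMarkedGraph

/-- An isomorphism of marked graphs. -/
def MarkedGraph.Collapse.ofEquiv {Γ Γ' : MarkedGraph r} (σ : Fin Γ.nV ≃ Fin Γ'.nV)
    (τ : Fin Γ'.nE ≃ Fin Γ.nE) (fl : Fin Γ'.nE → Bool) (g : Fin Γ.nV → FreeGroup (Fin r))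
    (h1 : ∀ e, Prod.map σ σ (Γ.ends (τ e)) = flipEnds (fl e) (Γ'.ends e))
    (h2 : ∀ e, Γ.lab (τ e) = g (Γ.ends (τ e)).1 * flipLab (fl e) (Γ'.lab e) *
      (g (Γ.ends (τ e)).2)⁻¹) : MarkedGraph.Collapse Γ Γ' where
  onV := σ
  onE := τ.toEmbedding
  flip := fl
  onV_surjective := σ.surjective
  forest := by
    rintro ⟨v, p, hp, -, -, h⟩
    obtain ⟨d, l, rfl⟩ := List.exists_cons_of_ne_nil hp
    exact h d (by simp) (τ.surjective d.1)
  onV_eq_iff u v := by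
    constructor
    · intro h
      rw [σ.injective h]
      exact Relation.EqvGen.refl _
    · intro h
      induction h with
      | rel x y h => obtain ⟨e, he, -⟩ := h; exact absurd (τ.surjective e) he
      | refl => rfl
      | symm _ _ _ ih => exact ih.symm
      | trans _ _ _ _ _ h1 h2 => exact h1.trans h2
  ends_onE := h1
  gauge := g
  lab_onE := h2
  lab_collapsed e he := absurd (τ.surjective e) he

theorem toOut_sd_collapse {Γ Γ' : MarkedGraph r} (c : MarkedGraph.Collapse Γ Γ') {n : ℕ}
    (f : Fin (n + 1) → Fin Γ'.nE) : Γ.toOut n (sd n (c.onE ∘ f)) = Γ'.toOut n (sd n f) := by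
  rw [← mapFaces_sd]
  exact MarkedGraph.toOut_collapse c (sd_mem_flagChains f)

namespace IsMarkedGraph

variable {k n : ℕ} {ends ends' : Fin (n + 1) → Fin k × Fin k}
  {lab lab' : Fin (n + 1) → FreeGroup (Fin r)}

/-- The normalized chain of a marked graph. It does not depend on the marking. -/
def chain (h : k + r = n + 1 + 1) (hG : IsMarkedGraph ends lab) : OutChain r n :=
  (gdet h ends lab)⁻¹ • hG.graph.toOut n (sd n id)

/-- Two markings differ by an automorphism α and a gauge transformation. Both `gdet` and the class
in the coinvariants are multiplied by det α, so the quotient is unchanged. -/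
theorem chain_marking (h : k + r = n + 1 + 1) (hG : IsMarkedGraph ends lab)
    (hG' : IsMarkedGraph ends lab') : hG'.chain h = hG.chain h := by
  obtain ⟨α, g, hα⟩ := exists_aut_of_isMarked hG.isMarked hG'.isMarked hG.pathConnected
    ⟨0, hG.pos⟩
  have h1 : gdet h ends lab' = ((autDet r α : ℤ) : ℝ) * gdet h ends lab := by
    rw [← gdet_twist, ← gdet_gauge h ends lab' g]
    congr 1
    funext i
    rw [hα]
    group
  have h2 : hG'.graph.toOut n (sd n id) =
      ((autDet r α : ℤ) : ℝ) • hG.graph.toOut n (sd n id) := by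
    have e1 := toOut_sd_collapse (MarkedGraph.Collapse.ofEquiv (Γ := hG'.graph)
      (Γ' := hG.graph.twist α) (Equiv.refl (Fin k)) (Equiv.refl (Fin (n + 1))) (fun _ => false) g
      (fun e => rfl) hα) (id : Fin (n + 1) → Fin (n + 1))
    exact e1.trans (hG.graph.toOut_twist α (sd_mem_flagChains _))
  have h3 : ((autDet r α : ℤ) : ℝ) * ((autDet r α : ℤ) : ℝ) = 1 := by
    rw [← Int.cast_mul, ← Units.val_mul, Int.units_mul_self]; simp
  have h4 : ((autDet r α : ℤ) : ℝ)⁻¹ = ((autDet r α : ℤ) : ℝ) :=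
    inv_eq_of_mul_eq_one_right h3
  rw [chain, h2, h1, smul_smul, chain, mul_inv, h4]
  congr 1
  linear_combination (gdet h ends lab)⁻¹ * h3

/-- The sign of the edge permutation appears in `gdet` and in the subdivision and cancels; the sign
of the vertex permutation survives, as the orientation relation demands. -/
theorem chain_perm (h : k + r = n + 1 + 1) (hG : IsMarkedGraph ends lab)
    (σ : Equiv.Perm (Fin k)) (τ : Equiv.Perm (Fin (n + 1))) :
    (hG.perm σ τ).chain h = ((Equiv.Perm.sign σ : ℤ) : ℝ) • hG.chain h := by
  have h1 : gdet h (fun i => Prod.map σ σ (ends (τ i))) (lab ∘ τ) =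
      ((Equiv.Perm.sign σ : ℤ) : ℝ) * (((Equiv.Perm.sign τ : ℤ) : ℝ) * gdet h ends lab) := by
    rw [← gdet_perm, ← gdet_relabel]
    rfl
  have h2 : (hG.perm σ τ).graph.toOut n (sd n id) =
      ((Equiv.Perm.sign τ : ℤ) : ℝ) • hG.graph.toOut n (sd n id) := by
    have e1 := toOut_sd_collapse (MarkedGraph.Collapse.ofEquiv (Γ := hG.graph)
      (Γ' := (hG.perm σ τ).graph) σ τ (fun _ => false) (fun _ => 1)
      (fun e => rfl) (fun e => (show lab (τ e) = 1 * lab (τ e) * 1⁻¹ by simp))) (id : Fin (n + 1) → Fin (n + 1))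
    have e2 := congrArg (hG.graph.toOut n) (sd_alternating (E := Fin (n + 1)) n id τ)
    exact e1.symm.trans (e2.trans (map_smul (hG.graph.toOut n) _ _))
  have h3 := sign_mul_self σ
  have h4 := sign_mul_self τ
  have h3' := inv_eq_of_mul_eq_one_right h3
  have h4' := inv_eq_of_mul_eq_one_right h4
  rw [chain, h2, h1, smul_smul, chain, smul_smul, mul_inv, mul_inv, h3', h4']
  congr 1
  linear_combination ((Equiv.Perm.sign σ : ℤ) : ℝ) * (gdet h ends lab)⁻¹ * h4

theorem chain_flip (h : k + r = n + 1 + 1) (hG : IsMarkedGraph ends lab) (fl : Fin (n + 1) → Bool) :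
    (hG.flip fl).chain h = (∏ i, flipSign (fl i)) • hG.chain h := by
  have h2 : (hG.flip fl).graph.toOut n (sd n id) = hG.graph.toOut n (sd n id) := by
    have e1 := toOut_sd_collapse (MarkedGraph.Collapse.ofEquiv (Γ := (hG.flip fl).graph)
      (Γ' := hG.graph) (Equiv.refl (Fin k)) (Equiv.refl (Fin (n + 1))) fl (fun _ => 1)
      (fun e => rfl)
      (fun e => (show flipLab (fl e) (lab e) = 1 * flipLab (fl e) (lab e) * 1⁻¹ by simp))) (id : Fin (n + 1) → Fin (n + 1))
    exact e1
  have h3 : (∏ i, flipSign (fl i)) * (∏ i, flipSign (fl i)) = 1 := by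
    rw [← Finset.prod_mul_distrib]
    exact Finset.prod_eq_one fun i _ => flipSign_mul_self _
  have h3' := inv_eq_of_mul_eq_one_right h3
  rw [chain, h2, gdet_flip, mul_inv, h3', chain, smul_smul]

end IsMarkedGraph

/-- `y` is the normalized chain of some marked graph with underlying oriented graph `s`. -/
def Represents {k n : ℕ} (h : k + r = n + 1 + 1) (s : OGraph k) (y : OutChain r n) : Prop :=
  ∃ (ends : Fin (n + 1) → Fin k × Fin k) (lab : Fin (n + 1) → FreeGroup (Fin r))
    (hG : IsMarkedGraph ends lab), Finset.univ.val.map ends = s ∧ y = hG.chain h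

/-- Equal multisets of values mean fibres of equal size, and bijections between the fibres assemble
to a permutation. -/
theorem exists_perm_of_map_eq {α : Type} {m : ℕ} {f g : Fin m → α}
    (h : Finset.univ.val.map f = Finset.univ.val.map g) : ∃ τ : Equiv.Perm (Fin m), g = f ∘ τ := by
  classical
  have h1 : ∀ a, Fintype.card {i // g i = a} = Fintype.card {i // f i = a} := by
    intro a
    have h2 := congrArg (Multiset.countP (· = a)) h
    rw [MarkedGraph.countP_univ_map, MarkedGraph.countP_univ_map] at h2
    rw [Fintype.card_subtype, Fintype.card_subtype, h2]
  let τ : Fin m ≃ Fin m := Equiv.ofFiberEquiv fun a => Fintype.equivOfCardEq (h1 a)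
  exact ⟨τ, funext fun i => (Equiv.ofFiberEquiv_map (fun a => Fintype.equivOfCardEq (h1 a)) i).symm⟩

namespace Represents

variable {k n : ℕ} {h : k + r = n + 1 + 1} {s : OGraph k} {y y' : OutChain r n}

/-- Two numberings of the edges differ by a permutation, and the marking is irrelevant by
`chain_marking`. -/
theorem unique (hy : Represents h s y) (hy' : Represents h s y') : y = y' := by
  obtain ⟨ends, lab, hG, h1, rfl⟩ := hy
  obtain ⟨ends', lab', hG', h1', rfl⟩ := hy'
  obtain ⟨τ, rfl⟩ := exists_perm_of_map_eq (h1.trans h1'.symm)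
  have h2 := hG.chain_perm h (Equiv.refl _) τ
  rw [show ((Equiv.Perm.sign (Equiv.refl (Fin k)) : ℤ) : ℝ) = 1 by simp, one_smul] at h2
  exact h2.symm.trans (hG'.chain_marking h (hG.perm (Equiv.refl _) τ))

theorem relabel (hy : Represents h s y) (σ : Equiv.Perm (Fin k)) :
    Represents h (s.relabel σ) (((Equiv.Perm.sign σ : ℤ) : ℝ) • y) := by
  obtain ⟨ends, lab, hG, rfl, rfl⟩ := hy
  refine ⟨_, _, hG.perm σ (Equiv.refl _), ?_, (hG.chain_perm h σ (Equiv.refl _)).symm⟩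
  rw [OGraph.relabel, Multiset.map_map]
  rfl

theorem flip {i j : Fin k} (hy : Represents h ((i, j) ::ₘ s) y) :
    Represents h ((j, i) ::ₘ s) (-y) := by
  obtain ⟨ends, lab, hG, h1, rfl⟩ := hy
  obtain ⟨t, -, ht⟩ := Multiset.mem_map.mp (h1 ▸ Multiset.mem_cons_self (i, j) s)
  refine ⟨_, _, hG.flip fun a => decide (a = t), ?_, ?_⟩
  · rw [map_univ_succAbove _ t, ht] at h1
    have h2 := (Multiset.cons_inj_right _).mp h1
    rw [map_univ_succAbove _ t, ← h2]
    simp [flipEnds, ht, Fin.succAbove_ne]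
  · rw [hG.chain_flip, Fin.prod_univ_succAbove _ t]
    simp [flipSign, Fin.succAbove_ne]

end Represents

/-- Numbering the edges and choosing a marking is possible because an admissible graph is connected
with Euler characteristic 1 - r. -/
theorem exists_represents {k n : ℕ} (h : k + r = n + 1 + 1) {s : OGraph k} (hs : s.Admissible r) :
    ∃ y : OutChain r n, Represents h s y := by
  have hcard : Multiset.card s = n + 1 := by
    have := hs.euler
    omega
  obtain ⟨l, rfl⟩ : ∃ l : List (Fin k × Fin k), (l : Multiset _) = s := Quot.exists_rep s
  rw [Multiset.coe_card] at hcard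
  let ends : Fin (n + 1) → Fin k × Fin k := fun i => l.get (i.cast hcard.symm)
  have hends : Finset.univ.val.map ends = (l : Multiset (Fin k × Fin k)) := by
    rw [Fin.univ_val_map]
    rw [← List.ofFn_congr hcard l.get, List.ofFn_get]
  have hc : OGraph.Connected (Finset.univ.val.map ends) := hends ▸ hs.connected
  obtain ⟨lab, hm⟩ := exists_isMarked_fin hc.1 ((pathConnected_iff ends).mp hc).2 h
  exact ⟨_, ends, lab, ⟨hc, hends ▸ hs.three_le_valence, hm⟩, hends, rfl⟩

open Classical in
/-- The chain of an oriented graph. -/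
def graphChain {k n : ℕ} (h : k + r = n + 1 + 1) (s : OGraph k) : OutChain r n :=
  if H : ∃ y : OutChain r n, Represents h s y then H.choose else 0

theorem Represents.eq_graphChain {k n : ℕ} {h : k + r = n + 1 + 1} {s : OGraph k}
    {y : OutChain r n} (hy : Represents h s y) : graphChain h s = y := by
  have H : ∃ y : OutChain r n, Represents h s y := ⟨y, hy⟩
  rw [graphChain, dif_pos H]
  exact H.choose_spec.unique hy

theorem graphChain_eq_zero {k n : ℕ} {h : k + r = n + 1 + 1} {s : OGraph k}
    (hs : ∀ y : OutChain r n, ¬ Represents h s y) : graphChain h s = 0 := by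
  rw [graphChain, dif_neg]
  rintro ⟨y, hy⟩
  exact hs y hy

theorem graphChain_relabel {k n : ℕ} (h : k + r = n + 1 + 1) (s : OGraph k)
    (σ : Equiv.Perm (Fin k)) :
    graphChain h (s.relabel σ) = ((Equiv.Perm.sign σ : ℤ) : ℝ) • graphChain h s := by
  by_cases H : ∃ y : OutChain r n, Represents h s y
  · obtain ⟨y, hy⟩ := H
    rw [hy.eq_graphChain, (hy.relabel σ).eq_graphChain]
  · push Not at H
    rw [graphChain_eq_zero H, smul_zero, graphChain_eq_zero]
    intro y hy
    have h1 := hy.relabel σ.symm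
    rw [OGraph.relabel_relabel, Equiv.symm_comp_self] at h1
    have h2 : OGraph.relabel id s = s := by simp [OGraph.relabel]
    rw [h2] at h1
    exact H _ h1

theorem graphChain_flip {k n : ℕ} (h : k + r = n + 1 + 1) (s : OGraph k) (i j : Fin k) :
    graphChain h ((j, i) ::ₘ s) = - graphChain h ((i, j) ::ₘ s) := by
  by_cases H : ∃ y : OutChain r n, Represents h ((i, j) ::ₘ s) y
  · obtain ⟨y, hy⟩ := H
    rw [hy.eq_graphChain, hy.flip.eq_graphChain]
  · push Not at H
    rw [graphChain_eq_zero H, neg_zero, graphChain_eq_zero]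
    intro y hy
    exact H _ hy.flip

/-- The map from graphs to the twisted coinvariants. -/
def graphToOut {k n : ℕ} (h : k + r = n + 1 + 1) : OGraph.Chain k →ₗ[ℝ] OutChain r n :=
  Submodule.liftQ _ (Finsupp.lift (OutChain r n) ℝ (OGraph k) (graphChain h)) (by
    rw [Submodule.span_le]
    rintro x (⟨s, σ⟩ | ⟨s, i, j⟩)
    · rw [SetLike.mem_coe, LinearMap.mem_ker, map_sub, map_smul]
      simp [graphChain_relabel]
    · rw [SetLike.mem_coe, LinearMap.mem_ker, map_add]
      simp [graphChain_flip h s i j])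

theorem graphToOut_cls {k n : ℕ} (h : k + r = n + 1 + 1) (s : OGraph k) :
    graphToOut h (OGraph.cls s) = graphChain h s := by
  simp [graphToOut, OGraph.cls]

theorem graphToOut_orientedClass {k n : ℕ} (h : k + r = n + 1 + 1)
    {ends : Fin (n + 1) → Fin k × Fin k} {lab : Fin (n + 1) → FreeGroup (Fin r)}
    (hG : IsMarkedGraph ends lab) :
    graphToOut h (orientedClass h ends lab) = hG.graph.toOut n (sd n id) := by
  have h1 : Represents h (Finset.univ.val.map ends) (hG.chain h) := ⟨ends, lab, hG, rfl, rfl⟩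
  rw [orientedClass, map_smul, graphToOut_cls, h1.eq_graphChain, IsMarkedGraph.chain, smul_smul,
    mul_inv_cancel₀ (hG.gdet_ne_zero h), one_smul]

theorem toOut_sd_of_hasCycle {Γ : MarkedGraph r} {n : ℕ} {f : Fin (n + 1) → Fin Γ.nE}
    (hf : Γ.HasCycle (Set.range f)ᶜ) : Γ.toOut n (sd n f) = 0 := by
  refine Γ.toOut_eq_zero (hf.mono fun e he h => ?_) (sd_mem_flagChains f)
  obtain ⟨i, -, hi⟩ := Finset.mem_image.mp h
  exact he ⟨i, hi⟩

theorem toOut_sd_of_not_injective {Γ : MarkedGraph r} {n : ℕ} {f : Fin (n + 1) → Fin Γ.nE}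
    (hf : ¬ Function.Injective f) : Γ.toOut n (sd n f) = 0 := by
  rw [(sd_alternating n).eq_zero hf, map_zero]

/-- The closed simplex of the contracted graph is the face spanned by the tuple, so the two
subdivisions represent the same chain. In the degenerate cases both sides vanish. -/
theorem graphToOut_orientedContr {k n : ℕ} (h : k + r = n + 1 + 1) (Γ : MarkedGraph r)
    (f : Fin (n + 1) → Fin Γ.nE) : graphToOut h (Γ.orientedContr h f) = Γ.toOut n (sd n f) := by
  by_cases hf : Function.Injective f
  swap
  · rw [(Γ.orientedContr_alternating h).eq_zero hf, map_zero, toOut_sd_of_not_injective hf]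
  by_cases hcyc : Γ.HasCycle (Set.range f)ᶜ
  · rw [MarkedGraph.orientedContr_of_hasCycle h hcyc, map_zero, toOut_sd_of_hasCycle hcyc]
  obtain ⟨q, g, hC⟩ := Γ.exists_isContr hf hcyc h
  rw [MarkedGraph.orientedContr_eq h hC,
    graphToOut_orientedClass h (IsMarkedGraph.of_isContr hC)]
  exact (toOut_sd_collapse (MarkedGraph.contrCollapse hC) (id : Fin (n + 1) → Fin (n + 1))).symm

/-- This composite replaces a flag by the averaged subdivision, to which `outHomotopy` connects the
identity. -/
theorem graphToOut_outToGraph {k n : ℕ} (h : k + r = n + 1 + 1) (Γ : MarkedGraph r)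
    (S : Fin (n + 1) → Finset (Fin Γ.nE)) (h1 : Monotone S) (h2 : ∀ i, (S i).Nonempty) :
    graphToOut h (outToGraph h (Γ.flagClass S h1 h2)) =
      Γ.toOut n (avgSd n (Finsupp.single S 1)) := by
  rw [outToGraph_flagClass, avg_map, avgSd, evalW_single, avg_map]
  exact avg_congr S fun f _ => graphToOut_orientedContr h Γ f

/-- The normalizing determinants cancel, and averaging undoes the subdivision of the tuple of all
edges because the oriented contraction alternates. -/
theorem outToGraph_graphToOut {k n : ℕ} (h : k + r = n + 1 + 1) {x : OGraph.Chain k}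
    (hx : x ∈ OGraph.reduced r k) : outToGraph h (graphToOut h x) = x := by
  suffices hh : OGraph.reduced r k ≤
      LinearMap.eqLocus (outToGraph h ∘ₗ graphToOut h) LinearMap.id from hh hx
  rw [OGraph.reduced, Submodule.span_le]
  rintro _ ⟨s, hs, rfl⟩
  change outToGraph h (graphToOut h (OGraph.cls s)) = OGraph.cls s
  obtain ⟨y, ends, lab, hG, rfl, -⟩ := exists_represents h hs
  have hd := hG.gdet_ne_zero h
  have h1 : OGraph.cls (Finset.univ.val.map ends) = (gdet h ends lab)⁻¹ • orientedClass h ends lab := by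
    rw [orientedClass, smul_smul, inv_mul_cancel₀ hd, one_smul]
  have hC := hG.isContr_of_perm (Equiv.refl _) (Equiv.refl _)
  have h2 : hG.graph.orientedContr h (id : Fin (n + 1) → Fin (n + 1)) = orientedClass h ends lab := by
    refine (MarkedGraph.orientedContr_eq h hC).trans (congrArg _ ?_)
    funext i
    simp [contrLab, IsMarkedGraph.graph]
  rw [h1, map_smul, map_smul, graphToOut_orientedClass h hG]
  refine congrArg _ ((outToGraph_toOut h hG.graph (sd_mem_flagChains _)).trans
    ((evalW_sd (hG.graph.orientedContr_alternating h) Function.injective_id).trans h2))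

end

section

open Opposite Simplicial

/-! ### Comparison of the homology of the twisted coinvariants with graph homology -/

variable {r : ℕ}

theorem OGraph.sum_countP {k : ℕ} (f : Fin k × Fin k → Fin k) (s : OGraph k) :
    ∑ v, s.countP (fun e => f e = v) = Multiset.card s := by
  induction s using Multiset.induction_on with
  | empty => simp
  | cons a s ih => simp [Multiset.countP_cons, Finset.sum_add_distrib, ih]

/-- Counting half-edges gives 3k ≤ 2(k + r - 1), that is k ≤ 2r - 2, and k is at least 1. -/
theorem OGraph.Admissible.two_le {k : ℕ} {s : OGraph k} (hs : s.Admissible r) : 2 ≤ r := by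
  have h1 : ∑ v : Fin k, s.valence v = 2 * Multiset.card s := by
    unfold OGraph.valence
    rw [Finset.sum_add_distrib, OGraph.sum_countP, OGraph.sum_countP]
    ring
  have h2 : k * 3 ≤ ∑ v : Fin k, s.valence v := by
    have := Finset.card_nsmul_le_sum (Finset.univ : Finset (Fin k)) (fun v => s.valence v) 3
      fun v _ => hs.three_le_valence v
    simpa using this
  have h3 := hs.euler
  have h4 := hs.connected.1
  omega

theorem MarkedGraph.two_le (Γ : MarkedGraph r) : 2 ≤ r :=
  (IsMarkedGraph.admissible (ends := Γ.ends) (lab := Γ.lab)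
    ⟨Γ.connected, Γ.three_le_valence, Γ.isMarked⟩).two_le

theorem subsingleton_outChain (hr : r < 2) (n : ℕ) : Subsingleton (OutChain r n) := by
  have h : (LinearMap.id : OutChain r n →ₗ[ℝ] OutChain r n) = 0 :=
    outChain_hom_ext fun Γ _ _ _ => absurd Γ.two_le (by omega)
  exact ⟨fun x y => (congrArg (fun f => f x) h).trans (congrArg (fun f => f y) h).symm⟩

theorem subsingleton_reduced {k : ℕ} (h : ∀ s : OGraph k, ¬ s.Admissible r) :
    Subsingleton (OGraph.reduced r k) := by
  rw [Submodule.subsingleton_iff_eq_bot, OGraph.reduced, Submodule.span_eq_bot]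
  rintro _ ⟨s, hs, -⟩
  exact absurd hs (h s)

theorem subsingleton_graphHomology {k : ℕ} (h : ∀ s : OGraph k, ¬ s.Admissible r) :
    Subsingleton ((graphComplex r).homology k) := by
  have := subsingleton_reduced h
  refine subsingleton_homology fun z _ => ⟨0, ?_⟩
  exact Subsingleton.elim (α := OGraph.reduced r k) _ _

/-- Contracting the complement of n + 1 edges would leave n + 2 - r ≤ 0 vertices, so no such tuple
has a forest as complement. -/
theorem toOut_sd_eq_zero {n : ℕ} (hn : n + 2 ≤ r) (Γ : MarkedGraph r) (f : Fin (n + 1) → Fin Γ.nE) :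
    Γ.toOut n (sd n f) = 0 := by
  by_cases hf : Function.Injective f
  swap
  · exact toOut_sd_of_not_injective hf
  by_cases hcyc : Γ.HasCycle (Set.range f)ᶜ
  · exact toOut_sd_of_hasCycle hcyc
  exfalso
  obtain ⟨k, q, g, hC⟩ := Γ.exists_nat_isContr hf hcyc
  have := hC.card
  have := (q ⟨0, Γ.nV_pos⟩).pos
  omega

theorem toOut_avgSd_eq_zero {n : ℕ} (hn : n + 2 ≤ r) (Γ : MarkedGraph r)
    (S : Fin (n + 1) → Finset (Fin Γ.nE)) : Γ.toOut n (avgSd n (Finsupp.single S 1)) = 0 := by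
  rw [avgSd, evalW_single, avg_map]
  simp only [toOut_sd_eq_zero hn]
  simp [avg]

/-- In this range the averaged subdivision is zero, and the homotopy contracts the identity. -/
theorem exists_faceD_eq_of_le {n : ℕ} (hn : n + 2 ≤ r) {z : OutChain r n}
    (hz : (((AlgebraicTopology.alternatingFaceMapComplex (ModuleCat.{0} ℝ)).obj (outChains r)).d n
      ((ComplexShape.down ℕ).next n)).hom z = 0) : ∃ x, faceD (outChains r) n x = z := by
  cases n with
  | zero =>
    have h : faceD (outChains r) 0 ∘ₗ outHomotopy r 0 = LinearMap.id :=
      outChain_hom_ext fun Γ S h1 h2 => by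
        rw [LinearMap.comp_apply, outHomotopy_zero, toOut_avgSd_eq_zero hn, sub_zero]
        rfl
    exact ⟨_, congrArg (fun f => f z) h⟩
  | succ n =>
    have h : faceD (outChains r) (n + 1) ∘ₗ outHomotopy r (n + 1) +
        outHomotopy r n ∘ₗ faceD (outChains r) n = LinearMap.id :=
      outChain_hom_ext fun Γ S h1 h2 => by
        rw [LinearMap.add_apply, LinearMap.comp_apply, LinearMap.comp_apply, outHomotopy_succ,
          toOut_avgSd_eq_zero hn, sub_zero]
        rfl
    have h2 := congrArg (fun f => f z) h
    have h3 : faceD (outChains r) n z = 0 := (d_next_succ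
      ((AlgebraicTopology.alternatingFaceMapComplex (ModuleCat.{0} ℝ)).obj (outChains r)) n z).mp hz
    simp only [LinearMap.add_apply, LinearMap.comp_apply, h3, map_zero, add_zero] at h2
    exact ⟨_, h2⟩

section Comparison

variable {n k : ℕ}

theorem outHomotopy_eq (h : k + r = n + 2 + 1) (x : OutChain r (n + 1)) :
    faceD (outChains r) (n + 1) (outHomotopy r (n + 1) x) +
      outHomotopy r n (faceD (outChains r) n x) = x - graphToOut h (outToGraph h x) := by
  suffices hh : faceD (outChains r) (n + 1) ∘ₗ outHomotopy r (n + 1) +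
      outHomotopy r n ∘ₗ faceD (outChains r) n =
      LinearMap.id - graphToOut h ∘ₗ outToGraph h from congrArg (fun f => f x) hh
  refine outChain_hom_ext fun Γ S h1 h2 => ?_
  rw [LinearMap.add_apply, LinearMap.comp_apply, LinearMap.comp_apply, outHomotopy_succ,
    LinearMap.sub_apply, LinearMap.comp_apply, graphToOut_outToGraph]
  rfl

theorem outHomotopy_zero_eq (h : k + r = 0 + 1 + 1) (x : OutChain r 0) :
    faceD (outChains r) 0 (outHomotopy r 0 x) = x - graphToOut h (outToGraph h x) := by
  suffices hh : faceD (outChains r) 0 ∘ₗ outHomotopy r 0 =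
      LinearMap.id - graphToOut h ∘ₗ outToGraph h from congrArg (fun f => f x) hh
  refine outChain_hom_ext fun Γ S h1 h2 => ?_
  rw [LinearMap.comp_apply, outHomotopy_zero, LinearMap.sub_apply, LinearMap.comp_apply,
    graphToOut_outToGraph]
  rfl

/-- A map that is homotopic to the identity commutes with the boundary: apply d to the homotopy
formula. No computation with signs is needed. -/
theorem faceD_graphToOut_outToGraph (h : k + 1 + r = n + 2 + 1) (h' : k + r = n + 1 + 1)
    (x : OutChain r (n + 1)) : faceD (outChains r) n (graphToOut h (outToGraph h x)) =
      graphToOut h' (outToGraph h' (faceD (outChains r) n x)) := by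
  have h1 := congrArg (faceD (outChains r) n) (outHomotopy_eq h x)
  rw [map_add, faceD_faceD, zero_add, map_sub] at h1
  have h2 : faceD (outChains r) n (outHomotopy r n (faceD (outChains r) n x)) =
      faceD (outChains r) n x - graphToOut h' (outToGraph h' (faceD (outChains r) n x)) := by
    cases n with
    | zero => exact outHomotopy_zero_eq h' _
    | succ n =>
      have h3 := outHomotopy_eq h' (faceD (outChains r) (n + 1) x)
      rw [faceD_faceD, map_zero, add_zero] at h3
      exact h3
  rw [h2] at h1
  exact (sub_right_injective h1).symm

/-- Every reduced chain is in the image of `outToGraph`, so the chain map property of the composite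
passes to `graphToOut`. -/
theorem faceD_graphToOut (h : k + 1 + r = n + 2 + 1) (h' : k + r = n + 1 + 1)
    {x : OGraph.Chain (k + 1)} (hx : x ∈ OGraph.reduced r (k + 1)) :
    faceD (outChains r) n (graphToOut h x) = graphToOut h' (OGraph.boundary k x) := by
  have h1 := faceD_graphToOut_outToGraph h h' (graphToOut h x)
  rwa [← boundary_outToGraph h h', outToGraph_graphToOut h hx] at h1

theorem nonempty_outHomology_equiv_of_eq (h : k + r = n + 1 + 1) :
    Nonempty (simplicialHomology (outChains r) (n + 1) ≃ₗ[ℝ] (graphComplex r).homology (k + 1)) := by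
  have h0 : k + 1 + r = n + 2 + 1 := by omega
  have h2 : k + 2 + r = n + 3 + 1 := by omega
  have hd : ∀ j (x : OGraph.reduced r (j + 1)), (((graphComplex r).d (j + 1) j).hom x).1 =
      OGraph.boundary j x.1 := by
    intro j x
    have : (graphComplex r).d (j + 1) j = ModuleCat.ofHom
      ((OGraph.boundary j).restrict (OGraph.boundary_mem_reduced r j)) :=
      ChainComplex.of_d (fun k => ModuleCat.of ℝ (OGraph.reduced r k)) (fun k => ModuleCat.ofHom
        ((OGraph.boundary k).restrict (OGraph.boundary_mem_reduced r k))) j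
    rw [this]
    rfl
  let K := (AlgebraicTopology.alternatingFaceMapComplex (ModuleCat.{0} ℝ)).obj (outChains r)
  let a : K.X (n + 1) →ₗ[ℝ] (graphComplex r).X (k + 1) :=
    (outToGraph h0).codRestrict (OGraph.reduced r (k + 1)) (outToGraph_mem_reduced h0)
  refine nonempty_homology_equiv (K := K) (L := graphComplex r) (p := n + 1) (q := k + 1) a
    (fun z hz => ?_) (fun x => ?_) (fun z hz y hy => ?_) (fun z hz => ?_)
  · rw [d_next_succ] at hz ⊢
    refine Subtype.ext ((hd k (a z)).trans ((boundary_outToGraph h0 h z).trans ?_))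
    refine (congrArg (outToGraph h) hz).trans ?_
    rw [map_zero]
    rfl
  · refine ⟨(outToGraph h2).codRestrict (OGraph.reduced r (k + 2)) (outToGraph_mem_reduced h2) x,
      Subtype.ext ((hd (k + 1) _).trans (boundary_outToGraph h2 h0 x))⟩
  · rw [d_next_succ] at hz
    have hz' : faceD (outChains r) n z = 0 := hz
    have h3 := outHomotopy_eq h0 z
    have h4 : OGraph.boundary (k + 1) y.1 = outToGraph h0 z :=
      (hd (k + 1) y).symm.trans (congrArg Subtype.val hy)
    have h5 := faceD_graphToOut h2 h0 y.2
    -- The cycle differs from its image under the composite by a boundary. If that image comes from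
    -- a graph boundary ∂y, it is the boundary of `graphToOut` applied to y.
    rw [hz', map_zero, add_zero, ← h4, ← h5] at h3
    refine ⟨outHomotopy r (n + 1) z + graphToOut h2 y.1, ?_⟩
    change faceD (outChains r) (n + 1) _ = z
    rw [map_add, h3, sub_add_cancel]
  · rw [d_next_succ] at hz
    refine ⟨graphToOut h0 z.1, ?_, 0, ?_⟩
    · rw [d_next_succ]
      refine (faceD_graphToOut h0 h z.2).trans ?_
      rw [← hd k z, hz]
      exact map_zero _
    · rw [map_zero, eq_comm, sub_eq_zero]
      exact Subtype.ext (outToGraph_graphToOut h0 z.2).symm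

end Comparison

theorem subsingleton_outHomology {n : ℕ} (hn : n + 2 ≤ r) :
    Subsingleton (simplicialHomology (outChains r) n) :=
  subsingleton_homology fun _ hz => exists_faceD_eq_of_le hn hz

theorem nonempty_outHomology_equiv (r p : ℕ) :
    Nonempty (simplicialHomology (outChains r) p ≃ₗ[ℝ] shiftedGraphHomology r p) := by
  have key : ∀ {M N : ModuleCat.{0} ℝ}, Subsingleton M → Subsingleton N → Nonempty (M ≃ₗ[ℝ] N) :=
    fun _ _ => ⟨LinearEquiv.ofSubsingleton _ _⟩
  by_cases hp : r ≤ p + 2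
  swap
  · rw [shiftedGraphHomology, if_neg hp]
    exact key (subsingleton_outHomology (by omega)) (inferInstanceAs (Subsingleton PUnit))
  rw [shiftedGraphHomology, if_pos hp]
  suffices h : ∀ k, k + r = p + 2 → Nonempty (simplicialHomology (outChains r) p ≃ₗ[ℝ]
      (graphComplex r).homology k) from h _ (by omega)
  intro k hk
  rcases Nat.lt_or_ge r 2 with hr | hr
  · have := subsingleton_outChain hr p
    exact key (subsingleton_homology fun z _ => ⟨0, Subsingleton.elim (α := OutChain r p) _ _⟩)
      (subsingleton_graphHomology fun s hs => absurd hs.two_le (by omega))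
  -- For k = 0 one has p + 2 = r, where both sides vanish. For positive k, the bound r ≥ 2 forces p
  -- ≥ 1, so degree 0 never occurs in the comparison.
  cases k with
  | zero =>
    exact key (subsingleton_outHomology (by omega))
      (subsingleton_graphHomology fun s hs => absurd hs.connected.1 (lt_irrefl 0))
  | succ k =>
    obtain ⟨n, rfl⟩ : ∃ n, p = n + 1 := ⟨p - 1, by omega⟩
    exact nonempty_outHomology_equiv_of_eq (by omega)

end

/-! ### Finite stabilizers and the splitting for Out(F_r) -/

section

/-! ### Stabilizers -/

variable {r : ℕ}

theorem flipLab_flipLab (a b : Bool) (w : FreeGroup (Fin r)) :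
    flipLab a (flipLab b w) = flipLab (a ^^ b) w := by
  cases a <;> cases b <;> simp [flipLab]

namespace FaceFlag

/-- The graph obtained by contracting the edges outside of the largest face of the flag has
the labels `L`, up to the directions of the edges. -/
def Realizes {n : SimplexCategory} {m k : ℕ} (L : Fin m → FreeGroup (Fin r)) (y : FaceFlag r n) :
    Prop :=
  ∃ (e : Fin m → Fin y.graph.nE) (q : Fin y.graph.nV → Fin k)
    (g : Fin y.graph.nV → FreeGroup (Fin r)) (fl : Fin m → Bool),
    y.graph.IsContr e q g ∧ Set.range e = y.sets (Fin.last _) ∧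
      ∀ i, contrLab y.graph.ends y.graph.lab e g i = flipLab (fl i) (L i)

/-- Contractions pass through collapses in both directions and only edge directions change, so this
is a property of the simplex and not of the flag representing it. -/
theorem Rel.realizes_iff {n : SimplexCategory} {m k : ℕ} {L : Fin m → FreeGroup (Fin r)}
    {x y : FaceFlag r n} (h : Rel x y) : x.Realizes (k := k) L ↔ y.Realizes (k := k) L := by
  obtain ⟨c, hc⟩ := h
  constructor
  · rintro ⟨e, q, g, fl, hC, he, hL⟩
    rw [hc, Finset.coe_map] at he
    have h1 : ∀ i, ∃ a, c.onE a = e i := fun i => by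
      obtain ⟨a, -, ha⟩ := he ▸ Set.mem_range_self i
      exact ⟨a, ha⟩
    choose e' he' using h1
    obtain rfl : c.onE ∘ e' = e := funext he'
    obtain ⟨q', g', hC', -, rfl⟩ := c.exists_isContr hC
    refine ⟨e', q', g', fun i => c.flip (e' i) ^^ fl i, hC', ?_, fun i => ?_⟩
    · rw [Set.range_comp] at he
      exact c.onE.injective.image_injective he
    · rw [← flipLab_flipLab, ← hL, c.contrLab_comp, flipLab_flipLab]
      simp [flipLab]
  · rintro ⟨e, q, g, fl, hC, he, hL⟩
    refine ⟨_, _, _, fun i => c.flip (e i) ^^ fl i, c.isContr_comp hC, ?_, fun i => ?_⟩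
    · rw [hc, Finset.coe_map, ← he, Set.range_comp]
    · rw [c.contrLab_comp, hL, flipLab_flipLab]

theorem realizes_of_mk_eq {n : SimplexCategory} {m k : ℕ} {L : Fin m → FreeGroup (Fin r)}
    {x y : FaceFlag r n} (h : Quot.mk Rel x = Quot.mk Rel y) (hy : y.Realizes (k := k) L) :
    x.Realizes (k := k) L := by
  have h1 : ∀ a b : FaceFlag r n, Rel a b → a.Realizes (k := k) L = b.Realizes (k := k) L :=
    fun a b hab => propext hab.realizes_iff
  have h2 := congrArg (Quot.lift (fun a => a.Realizes (k := k) L) h1) h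
  exact h2.mpr hy

end FaceFlag

/-- Two automorphisms which agree on labels up to a gauge transformation have the same class
in `Out(F_r)`. -/
theorem MarkedGraph.mk_eq_mk_of_gauge (Γ : MarkedGraph r) {α β : MulAut (FreeGroup (Fin r))}
    (γ : Fin Γ.nV → FreeGroup (Fin r))
    (h : ∀ a, β (Γ.lab a) = γ (Γ.ends a).1 * α (Γ.lab a) * (γ (Γ.ends a).2)⁻¹) :
    (QuotientGroup.mk α : Out r) = QuotientGroup.mk β := by
  let v : Fin Γ.nV := ⟨0, Γ.nV_pos⟩
  have h1 : β = MulAut.conj (γ v) * α := by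
    ext w
    have h2 := (ePath_closedPath Γ.isMarked v w).hom_eq
      ((α : FreeGroup (Fin r) →* FreeGroup (Fin r)).comp (FreeGroup.lift Γ.lab))
      ((β : FreeGroup (Fin r) →* FreeGroup (Fin r)).comp (FreeGroup.lift Γ.lab)) γ
      (fun a _ => by simpa using (h a).symm)
    simp only [MonoidHom.comp_apply, lab_closedPath] at h2
    simpa using h2.symm
  have h2 : (QuotientGroup.mk (MulAut.conj (γ v)) : Out r) = 1 :=
    (QuotientGroup.eq_one_iff _).mpr ⟨γ v, rfl⟩
  rw [h1, QuotientGroup.mk_mul, h2, one_mul]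

/-- Contract the complement of the largest face. An automorphism fixing the simplex realizes the
same labels on the twisted graph after renumbering and reversing edges, and this finite datum
determines its outer class. -/
theorem finite_stabilizer (n : SimplexCategoryᵒᵖ) (x : (simplicialClosure r).V.obj n)
    (hx : x ∉ (atInfinity r).obj n) :
    {g : Out r | ((simplicialClosure r).ρ g).app n x = x}.Finite := by
  obtain ⟨y, rfl⟩ : ∃ y : FaceFlag r n.unop, Quot.mk _ y = x := Quot.exists_rep x
  obtain ⟨Γ, S, hS⟩ := y
  let T := S (Fin.last _)
  let m := T.card
  let e₀ : Fin m → Fin Γ.nE := fun i => (T.equivFin.symm i).1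
  have he₀ : Function.Injective e₀ := Subtype.val_injective.comp T.equivFin.symm.injective
  have hr₀ : Set.range e₀ = T := by
    ext a
    constructor
    · rintro ⟨i, rfl⟩
      exact (T.equivFin.symm i).2
    · intro ha
      exact ⟨T.equivFin ⟨a, ha⟩, by simp [e₀]⟩
  have hcyc : ¬ Γ.HasCycle (Set.range e₀)ᶜ := by
    intro h
    rw [hr₀] at h
    exact hx ⟨⟨Γ, S, hS⟩, rfl, h⟩
  obtain ⟨k, q₀, g₀, hC₀⟩ := Γ.exists_nat_isContr he₀ hcyc
  let L := contrLab Γ.ends Γ.lab e₀ g₀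
  have hreal : (⟨Γ, S, hS⟩ : FaceFlag r n.unop).Realizes (k := k) L :=
    ⟨e₀, q₀, g₀, fun _ => false, hC₀, hr₀, fun i => rfl⟩
  have hstab : ∀ g : {g : Out r | ((simplicialClosure r).ρ g).app n (Quot.mk _ ⟨Γ, S, hS⟩) =
      Quot.mk _ ⟨Γ, S, hS⟩}, ∃ (α : MulAut (FreeGroup (Fin r))) (e : Fin m → Fin Γ.nE)
        (γ : Fin Γ.nV → FreeGroup (Fin r)) (fl : Fin m → Bool), g.1 = QuotientGroup.mk α ∧
        Function.Injective e ∧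
        (∀ a, a ∉ Set.range e → α (Γ.lab a) = γ (Γ.ends a).1 * (γ (Γ.ends a).2)⁻¹) ∧
        ∀ i, (γ (Γ.ends (e i)).1)⁻¹ * α (Γ.lab (e i)) * γ (Γ.ends (e i)).2 =
          flipLab (fl i) (L i) := by
    rintro ⟨g, hg⟩
    obtain ⟨α, rfl⟩ := QuotientGroup.mk_surjective g
    obtain ⟨e, q, γ, fl, hC, -, hL⟩ := FaceFlag.realizes_of_mk_eq
      (x := FaceFlag.twist α ⟨Γ, S, hS⟩) hg hreal
    exact ⟨α, e, γ, fl, rfl, hC.inj, hC.lab_eq, hL⟩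
  choose α e γ fl h1 h2 h3 h4 using hstab
  rw [← Set.finite_coe_iff]
  -- For equal numberings and reversals, the two automorphisms agree on all edge labels up to a
  -- gauge transformation.
  refine Finite.of_injective (fun g => (e g, fl g)) fun g g' hgg => ?_
  obtain ⟨he, hfl⟩ := Prod.mk.inj hgg
  refine Subtype.ext ?_
  rw [h1, h1]
  refine Γ.mk_eq_mk_of_gauge (fun v => γ g' v * (γ g v)⁻¹) fun a => ?_
  by_cases ha : a ∈ Set.range (e g)
  · obtain ⟨i, rfl⟩ := ha
    have h5 := h4 g i
    have h6 := h4 g' i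
    rw [← he, ← hfl, ← h5] at h6
    have h7 : ∀ x y z u w s : FreeGroup (Fin r), x⁻¹ * y * z = u⁻¹ * w * s →
        y = x * u⁻¹ * w * (z * s⁻¹)⁻¹ := by
      intro x y z u w s h
      have : y = x * (x⁻¹ * y * z) * z⁻¹ := by group
      rw [this, h]
      group
    exact h7 _ _ _ _ _ _ h6
  · rw [h3 g a ha, h3 g' a (he ▸ ha)]
    group

theorem action_mem_atInfinity (g : Out r) (n : SimplexCategoryᵒᵖ)
    (x : (simplicialClosure r).V.obj n) (hx : x ∈ (atInfinity r).obj n) :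
    ((simplicialClosure r).ρ g).app n x ∈ (atInfinity r).obj n := by
  obtain ⟨y, rfl, hy⟩ := hx
  obtain ⟨α, rfl⟩ := QuotientGroup.mk_surjective g
  exact ⟨y.twist α, rfl, hy⟩

/-! ### Assembling the exact sequences -/

/-- The automorphism which inverts the first generator. -/
theorem exists_outDet_eq_neg_one (hr : 0 < r) : ∃ t : Out r, outDet r t = -1 := by
  let i₀ : Fin r := ⟨0, hr⟩
  let f : FreeGroup (Fin r) →* FreeGroup (Fin r) :=
    FreeGroup.lift fun i => flipLab (decide (i = i₀)) (FreeGroup.of i)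
  have hf : f.comp f = MonoidHom.id _ := by
    ext i
    simp only [MonoidHom.comp_apply, f, FreeGroup.lift_apply_of, MonoidHom.id_apply]
    by_cases h : i = i₀ <;> simp [flipLab, h]
  let α : MulAut (FreeGroup (Fin r)) := MonoidHom.toMulEquiv f f hf hf
  refine ⟨QuotientGroup.mk α, ?_⟩
  change autDet r α = -1
  have h1 := det_autMatrix α
  have h2 : autMatrix α = Matrix.diagonal fun i => if i = i₀ then (-1 : ℝ) else 1 := by
    ext i j
    have hα : α (FreeGroup.of j) = flipLab (decide (j = i₀)) (FreeGroup.of j) :=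
      FreeGroup.lift_apply_of
    rw [autMatrix, Matrix.of_apply, hα, Matrix.diagonal_apply]
    by_cases hj : j = i₀
    · subst hj
      by_cases hi : i = i₀
      · simp [flipLab, ab_inv, ab_of, hi]
      · simp [flipLab, ab_inv, ab_of, hi]
    · by_cases hi : i = j
      · simp [flipLab, ab_of, hi, hj]
      · simp [flipLab, ab_of, hi, hj]
  rw [h2, Matrix.det_diagonal, Finset.prod_ite_eq' Finset.univ i₀ fun _ => (-1 : ℝ)] at h1
  simp only [Finset.mem_univ, if_true] at h1
  refine Units.ext ?_
  have h3 : ((autDet r α : ℤˣ) : ℤ) = -1 := by exact_mod_cast h1.symm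
  exact h3

theorem subsingleton_orbitHomology (hr : r < 2) (H : Subgroup (Out r)) (p : ℕ) :
    Subsingleton (orbitHomology (simplicialClosure r) (atInfinity r) H p) := by
  have h : (LinearMap.id : (orbitChains (simplicialClosure r) (atInfinity r) H).obj
      (Opposite.op (SimplexCategory.mk p)) →ₗ[ℝ] _) = 0 :=
    orbit_hom_ext (X := simplicialClosure r) fun y => by
      obtain ⟨y, rfl⟩ := Quot.exists_rep y
      exact absurd y.graph.two_le (by omega)
  exact subsingleton_homology fun z _ => ⟨0, (map_zero _).trans (congrArg (fun f => f z) h).symm⟩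

theorem exists_split_out (r p : ℕ) :
    ∃ i : simplicialHomology (outChains r) p →ₗ[ℝ] modSOutHomology r p,
      Function.Injective i ∧ Function.Exact i (projection r p) ∧
      Function.Surjective (projection r p) := by
  -- For r = 0 there is no element of determinant -1 to split with, but there are no marked graphs
  -- either.
  rcases Nat.eq_zero_or_pos r with hr | hr
  · have hr2 : r < 2 := by omega
    have h1 := subsingleton_outChain hr2 p
    have h2 := subsingleton_orbitHomology hr2 (SOut r) p
    have h3 := subsingleton_orbitHomology hr2 ⊤ p
    have h4 : Subsingleton (simplicialHomology (outChains r) p) :=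
      subsingleton_homology fun z _ => ⟨0, Subsingleton.elim (α := OutChain r p) _ _⟩
    exact ⟨0, Function.injective_of_subsingleton _,
      fun y => ⟨fun _ => ⟨0, Subsingleton.elim _ _⟩, fun _ => Subsingleton.elim _ _⟩,
      fun y => ⟨0, Subsingleton.elim _ _⟩⟩
  · obtain ⟨t, ht⟩ := exists_outDet_eq_neg_one hr
    exact exists_split_homology action_mem_atInfinity t ht p

/-- A family of short exact sequences is a long exact sequence with zero connecting maps. -/
theorem isLongExact_of_split {A B C : ℕ → ModuleCat.{0} ℝ} {f : ∀ p, A p →ₗ[ℝ] B p}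
    {g : ∀ p, B p →ₗ[ℝ] C p} (h1 : ∀ p, Function.Injective (f p))
    (h2 : ∀ p, Function.Exact (f p) (g p)) (h3 : ∀ p, Function.Surjective (g p)) :
    IsLongExact f g fun _ => 0 where
  exact_middle := h2
  exact_right p y := ⟨fun _ => h3 (p + 1) y, fun _ => rfl⟩
  exact_left p y := by
    constructor
    · intro hy
      exact ⟨0, (h1 p (hy.trans (map_zero _).symm)).symm⟩
    · rintro ⟨z, rfl⟩
      exact map_zero _
  surjective_zero := h3 0

end

end OuterSpace

end

theorem mainTheorem7 (r : ℕ) :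
    ∃ (i : ∀ p, OuterSpace.twistedOutHomology r p →ₗ[ℝ] OuterSpace.modSOutHomology r p)
      (δ : ∀ p, OuterSpace.modOutHomology r (p + 1) →ₗ[ℝ] OuterSpace.twistedOutHomology r p)
      (Φ : ∀ p, OuterSpace.twistedOutHomology r p ≃ₗ[ℝ] OuterSpace.shiftedGraphHomology r p),
      OuterSpace.IsLongExact i (OuterSpace.projection r) δ ∧
      OuterSpace.IsLongExact (fun p => i p ∘ₗ (Φ p).symm.toLinearMap) (OuterSpace.projection r)
        (fun p => (Φ p).toLinearMap ∘ₗ δ p) := by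
  have hB : ∀ p, Nonempty (OuterSpace.twistedOutHomology r p ≃ₗ[ℝ]
      OuterSpace.simplicialHomology (OuterSpace.outChains r) p) :=
    OuterSpace.nonempty_equivariantHomology_equiv OuterSpace.action_mem_atInfinity
      OuterSpace.finite_stabilizer
  choose j h1 h2 h3 using OuterSpace.exists_split_out r
  let β := fun p => (hB p).some
  let Φ := fun p => (β p).trans (OuterSpace.nonempty_outHomology_equiv r p).some
  have hinj : ∀ p, Function.Injective (j p ∘ₗ (β p).toLinearMap) := fun p =>
    (h1 p).comp (β p).injective
  have hexact : ∀ p, Function.Exact (j p ∘ₗ (β p).toLinearMap) (OuterSpace.projection r p) := by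
    intro p y
    rw [h2 p y]
    exact ⟨fun ⟨x, hx⟩ => ⟨(β p).symm x, (congrArg (j p) ((β p).apply_symm_apply x)).trans hx⟩,
      fun ⟨x, hx⟩ => ⟨β p x, hx⟩⟩
  -- The projections are surjective in homology, so the connecting maps are zero in both sequences;
  -- the second is the first transported along `Φ`.
  refine ⟨fun p => j p ∘ₗ (β p).toLinearMap, fun _ => 0, Φ,
    OuterSpace.isLongExact_of_split hinj hexact h3, ?_⟩
  have h0 : (fun p => (Φ p).toLinearMap ∘ₗ
      (0 : OuterSpace.modOutHomology r (p + 1) →ₗ[ℝ] OuterSpace.twistedOutHomology r p)) =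
      fun _ => 0 :=
    funext fun p => LinearMap.comp_zero _
  rw [h0]
  refine OuterSpace.isLongExact_of_split (fun p => (hinj p).comp (Φ p).symm.injective)
    (fun p y => ?_) h3
  rw [hexact p y]
  exact ⟨fun ⟨x, hx⟩ => ⟨Φ p x,
      (congrArg (j p ∘ₗ (β p).toLinearMap) ((Φ p).symm_apply_apply x)).trans hx⟩,
    fun ⟨x, hx⟩ => ⟨(Φ p).symm x, hx⟩⟩
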